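/- **Setting.** Consider four points $z_i=(x_i^\mu,\theta_i^\alpha,\bar\theta_i^{\dot\alpha})$, $i=1,\dots,4$, of $\mathcal N=1$, $d=4$ superspace with metric $\mathrm{diag}(1,-1,-1,-1)$. A superfunction is a smooth function of the $x_i\in\mathbb R^4$ with values in the complex Grassmann algebra on the 16 odd coordinates. Put $x_{i\pm}^\mu=x_i^\mu\mp i\theta_i\sigma^\mu\bar\theta_i$, $\theta_{ij}=\theta_i-\theta_j$, $\bar\theta_{ij}=\bar\theta_i-\bar\theta_j$, $$x_{\bar ij}^\mu=x_{i-}^\mu-x_{j+}^\mu-2i\,\theta_j\sigma^\mu\bar\theta_i,\quad \mathrm x_{\bar ij}=x_{\bar ij}^\mu\sigma_\mu,\quad \tilde{\mathrm x}_{\bar ij}=x_{\bar ij}^\mu\tilde\sigma_\mu,\quad \mathrm x_{\bar ij}^{-1}=\tilde{\mathrm x}_{\bar ij}/x_{\bar ij}^2,\quad \tilde{\mathrm x}_{\bar ij}^{-1}=\mathrm x_{\bar ij}/x_{\bar ij}^2 .$$ A superfunction on an open set is a *superconformal invariant* if it is annihilated there by all generators (translations, Lorentz transformations, dilation, $U(1)$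 R-symmetry, special conformal transformations, $Q,\bar Q,S,\bar S$) of the $\mathcal N=1$ superconformal algebra. A configuration $(x_1,\dots,x_4)$ is *nondegenerate* if $(x_i-x_j)^2\ne0$ for $i\ne j$, and *regular* if moreover $a^2+b^2+c^2-2ab-2bc-2ca\neq0$, where $a=(x_1-x_2)^2(x_3-x_4)^2$, $b=(x_1-x_3)^2(x_2-x_4)^2$, $c=(x_1-x_4)^2(x_2-x_3)^2$. Define $$J_1=\frac{x_{\bar23}^2x_{\bar31}^2x_{\bar12}^2}{x_{\bar21}^2x_{\bar13}^2x_{\bar32}^2},\quad X_{1(i-1)+}^2=\frac{x_{\bar i4}^2}{x_{\bar i1}^2x_{\bar14}^2},\quad X_{1(i-1)-}^2=\frac{x_{\bar4i}^2}{x_{\bar41}^2x_{\bar1i}^2},\quad J_{1(i-1)}=\frac{X_{1(i-1)+}^2}{X_{1(i-1)-}^2}\quad(i=2,3),$$ $$\mathcal I_1=\frac{x_{\bar14}^2x_{\bar32}^2}{x_{\bar12}^2x_{\bar34}^2},\; \mathcal I_2=\frac{x_{\bar14}^2x_{\bar23}^2}{x_{\bar13}^2x_{\bar24}^2},\; \mathcal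 I_3=\frac{x_{\bar32}^2x_{\bar41}^2}{x_{\bar31}^2x_{\bar42}^2},\; \mathcal I_4=\frac{x_{\bar24}^2x_{\bar31}^2}{x_{\bar21}^2x_{\bar34}^2},\; \mathcal I_5=\frac{x_{\bar23}^2x_{\bar41}^2}{x_{\bar21}^2x_{\bar43}^2},\; \mathcal I_6=\frac{x_{\bar13}^2x_{\bar42}^2}{x_{\bar12}^2x_{\bar43}^2},$$ $\tilde{\mathrm X}_{1(1)+}=-\mathrm x_{\bar14}^{-1}\mathrm x_{\bar24}\mathrm x_{\bar21}^{-1}$, $\tilde{\mathrm X}_{1(2)-}=\mathrm x_{\bar13}^{-1}\mathrm x_{\bar43}\mathrm x_{\bar41}^{-1}$ with corresponding four-vectors $X^\mu=\frac12\mathrm{tr}(\sigma^\mu\tilde{\mathrm X})$, $R=\sqrt{X_{1(1)+}^2X_{1(1)-}^2}$ (the root whose body, i.e. value at $\theta=\bar\theta=0$, is the common body of $X_{1(1)\pm}^2$), $\hat X=X/R^{1/2}$, $$\tilde\Theta_{1(i-1)}=i\big(\tilde{\mathrm x}_{\bar41}^{-1}\bar\theta_{41}-\tilde{\mathrm x}_{\bar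 i1}^{-1}\bar\theta_{i1}\big),\quad \tilde{\bar\Theta}_{1(i-1)}=i\big(\theta_{1i}\tilde{\mathrm x}_{\bar1i}^{-1}-\theta_{14}\tilde{\mathrm x}_{\bar14}^{-1}\big)\quad(i=2,3),$$ with $\Theta_{1(i)},\bar\Theta_{1(i)}$ the same spinors with raised indices, and for $i,j\in\{1,2\}$ $$I_{1ij}=-\tilde{\bar\Theta}_{1(j)}\tilde{\mathrm X}_{1(1)+}\tilde\Theta_{1(i)}/R,\qquad I_{2ij}=-\tilde{\bar\Theta}_{1(j)}\tilde{\mathrm X}_{1(2)-}\tilde\Theta_{1(i)}/R .$$ **Theorem.** All indices $i,j,k,l,m,n$ below run over $\{1,2\}$ unless said otherwise. On nondegenerate configurations the following holds. 1. $\mathcal I_1,\dots,\mathcal I_6$, $J_1$, $J_{1(1)}$, $J_{1(2)}$, $\hat X_{1(1)+}^2$, $\hat X_{1(1)+}^\mu\hat X_{1(2)-\mu}$, $\hat X_{1(2)-}^2$ and the eight $I_{nij}$ are superconformal invariants, and the $I_{nij}$ are nilpotent. 2. For $\{r,s,t,u\}=\{1,2,3,4\}$, the cross ratio $x_{\bar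 rs}^2x_{\bar tu}^2/(x_{\bar ru}^2x_{\bar ts}^2)$ is one of $\mathcal I_1,\dots,\mathcal I_6$ or the inverse of one of them, and $$\mathcal I_3=J_1^{-1}J_{1(1)}\mathcal I_2,\quad \mathcal I_4=J_1\mathcal I_1\mathcal I_2^{-1},\quad \mathcal I_5=J_1J_{1(2)}\mathcal I_1,\quad \mathcal I_6=J_1J_{1(1)}^{-1}J_{1(2)}\mathcal I_1\mathcal I_2^{-1}.$$ 3. Put $A=\hat X_{1(1)+}^2$, $B=\hat X_{1(1)+}^\mu\hat X_{1(2)-\mu}$, $C=\hat X_{1(2)-}^2$. Then $A=\sqrt{J_{1(1)}}=1-2iI_{111}+6I_{111}^2$ and $$I_{1jk}I_{2jk}=\tfrac BA I_{1jk}^2,\qquad I_{2jk}I_{2mn}=\tfrac CA I_{1jk}I_{1mn}\ \text{ if } j=m\text{ or }k=n,$$ $$I_{211}I_{112}=\tfrac{2B}A I_{111}I_{112}-I_{111}I_{212},\qquad I_{211}I_{121}=\tfrac{2B}A I_{111}I_{121}-I_{111}I_{221},$$ $$I_{112}I_{222}=\tfrac{2B}A I_{112}I_{122}-I_{212}I_{122},\qquad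 I_{121}I_{222}=\tfrac{2B}A I_{121}I_{122}-I_{221}I_{122},$$ $$I_{121}I_{212}=-I_{112}I_{221}-I_{111}I_{222}-I_{122}I_{211}+\tfrac{2B}A\,(I_{111}I_{122}+I_{112}I_{121}),$$ $$I_{211}I_{222}=-I_{212}I_{221}+\tfrac CA\,(I_{111}I_{122}+I_{112}I_{121}).$$ 4. With $P_{ij,kl}=\Theta_{1(i)}\sigma^\mu\bar\Theta_{1(j)}\,\Theta_{1(k)}\sigma_\mu\bar\Theta_{1(l)}/R$ (the invariants of lowest order $(\theta\bar\theta)^2$): $$I_{1ij}^2=\tfrac14A\,P_{ij,ij},\quad I_{1ii}I_{112}=\tfrac14A\,P_{ii,12},\quad I_{1ii}I_{121}=\tfrac14A\,P_{ii,21},\quad I_{111}I_{122}+I_{112}I_{121}=\tfrac12A\,P_{11,22}=\tfrac12A\,P_{12,21}.$$ 5. Let $\mathfrak I$ be the set of the following monomials: $1$; the eight $I_{nij}$; $I_{1ij}I_{1kl}$, $I_{1ii}I_{212}$, $I_{1ii}I_{221}$, $I_{111}I_{222}$, $I_{122}I_{211}$, $I_{i12}I_{221}$; $I_{111}^2I_{i22}$,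 $I_{122}^2I_{i11}$, $I_{112}^2I_{j21}$, $I_{121}^2I_{j12}$; $I_{111}^2I_{122}^2$. It has 36 elements: $1,8,18,8,1$ of degree $0,1,2,3,4$, hence 27 of degree $>1$. a. A superfunction $F$ on an open set $U$ of regular configurations is a superconformal invariant if and only if near each point of $U$ it is a linear combination $F=\sum_{m\in\mathfrak I}f_m(\mathcal I_1,\mathcal I_2)\,m$ with smooth complex-valued functions $f_m$ of two real variables (where $f_m(\mathcal I_1,\mathcal I_2)$ is defined by the terminating Taylor expansion in the nilpotent parts). So the ten invariants $\mathcal I_1,\mathcal I_2,I_{nij}$ generate all four-point invariants. b. On regular configurations the map to the bodies of $(\mathcal I_1,\mathcal I_2)$ is open, and the elements of $\mathfrak I$ are linearly independent over the functions of the cross ratios: if $V$ is an open set of regular configurations, the $f_m$ are smooth on an open set that contains the bodies of $(\mathcal I_1,\mathcal I_2)$ on $V$, and $\sum_{m\in\mathfrak I}f_m(\mathcal I_1,\mathcal I_2)\,m=0$ on $V$, then every $f_m$ vanishes at all values that the bodies of $(\mathcal I_1,\mathcal I_2)$ take on $V$. c. $\mathfrak I$ has minimal size: if $T$ is a finite set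 of monomials in the $I_{nij}$ and, near some regular configuration $p$, every invariant defined near $p$ is a linear combination of elements of $T$ with smooth functions of $\mathcal I_1,\mathcal I_2$ as coefficients, then $|T|\ge36$. -/

import Mathlib

open scoped ContDiff

noncomputable section

namespace FourPoint

/-! ## Superfunctions of four points of `N = 1` superspace

The four points are labelled `0, 1, 2, 3` (the points `1, 2, 3, 4` of the usual notation), the
spinor indices `1, 2` are labelled `0, 1`, and so are the labels `1, 2` of the invariants. -/

/-- The complex Grassmann algebra on the sixteen odd coordinates `θ_i^α`, `θbar_i^α̇` of four
points. -/
abbrev Grassmann : Type := ExteriorAlgebra ℂ (Fin 16 → ℂ)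

/-- The bosonic coordinates `x_i^μ` of four points of Minkowski space. -/
abbrev Config : Type := Fin 4 → Fin 4 → ℝ

/-- Superfunctions of four points: `F (x, θ, θbar)` is a Grassmann-algebra-valued function of
the bosonic coordinates. Sums and products are pointwise. -/
abbrev SuperFun : Type := Config → Grassmann

/-- The number of the odd coordinate `θ_i^α`. -/
def thetaIdx (i : Fin 4) (α : Fin 2) : Fin 16 := ⟨2 * i.val + α.val, by omega⟩

/-- The number of the odd coordinate `θbar_i^α̇`. -/
def thetaBarIdx (i : Fin 4) (α : Fin 2) : Fin 16 := ⟨8 + 2 * i.val + α.val, by omega⟩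

/-- The basis of the Grassmann algebra that consists of the monomials in the odd coordinates. -/
def monomialBasis : Module.Basis (Finset (Fin 16)) ℂ Grassmann :=
  (Pi.basisFun ℂ (Fin 16)).ExteriorAlgebra

/-- The component functions of a superfunction. -/
def component (F : SuperFun) (s : Finset (Fin 16)) : Config → ℂ :=
  fun c => monomialBasis.repr (F c) s

/-- A superfunction is smooth if its component functions are. -/
def SmoothOn (F : SuperFun) (U : Set Config) : Prop :=
  ∀ s : Finset (Fin 16), ContDiffOn ℝ ∞ (component F s) U

/-- `∂F/∂x_i^μ`. -/
def dX (i μ : Fin 4) (F : SuperFun) : SuperFun := fun c =>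
  ∑ s : Finset (Fin 16),
    (fderiv ℝ (component F s) c (Pi.single i (Pi.single μ 1))) • monomialBasis s

/-- The left derivative with respect to the `k`-th odd coordinate. -/
def dOdd (k : Fin 16) (F : SuperFun) : SuperFun := fun c =>
  CliffordAlgebra.contractLeft (Q := (0 : QuadraticForm ℂ (Fin 16 → ℂ)))
    (LinearMap.proj k) (F c)

/-- Pointwise inverse of a superfunction (where it is invertible). -/
def sinv (F : SuperFun) : SuperFun := fun c => Ring.inverse (F c)

/-- The body of an element of the Grassmann algebra: all odd coordinates are set to zero. -/
def body : Grassmann →ₐ[ℂ] ℂ := ExteriorAlgebra.algebraMapInv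

/-! ## Coordinates, Pauli matrices and intervals -/

/-- The coordinate `x_i^μ`. -/
def xCoord (i μ : Fin 4) : SuperFun := fun c => algebraMap ℂ Grassmann (c i μ : ℂ)

/-- The odd coordinate `θ_i^α`. -/
def theta (i : Fin 4) (α : Fin 2) : SuperFun := fun _ =>
  ExteriorAlgebra.ι ℂ (Pi.single (thetaIdx i α) 1)

/-- The odd coordinate `θbar_i^α̇`. -/
def thetaBar (i : Fin 4) (α : Fin 2) : SuperFun := fun _ =>
  ExteriorAlgebra.ι ℂ (Pi.single (thetaBarIdx i α) 1)

/-- The Minkowski metric `diag(1, -1, -1, -1)`. -/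
def eta : Fin 4 → ℂ := ![1, -1, -1, -1]

/-- The matrices `σ^μ_{αα̇}`. -/
def sigma : Fin 4 → Matrix (Fin 2) (Fin 2) ℂ :=
  ![1, !![0, 1; 1, 0], !![0, -Complex.I; Complex.I, 0], !![1, 0; 0, -1]]

/-- The matrices `σ̃^{μ α̇α}`. -/
def sigmaTilde : Fin 4 → Matrix (Fin 2) (Fin 2) ℂ :=
  ![1, -sigma 1, -sigma 2, -sigma 3]

/-- `ψ σ^μ χ = ψ^α σ^μ_{αα̇} χ^α̇`. -/
def bilinear (ψ χ : Fin 2 → SuperFun) (μ : Fin 4) : SuperFun :=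
  ∑ α : Fin 2, ∑ β : Fin 2, sigma μ α β • (ψ α * χ β)

/-- The chiral coordinates `x_{i+}^μ = x_i^μ - i θ_i σ^μ θbar_i`. -/
def xPlus (i μ : Fin 4) : SuperFun :=
  xCoord i μ - Complex.I • bilinear (theta i) (thetaBar i) μ

/-- The anti-chiral coordinates `x_{i-}^μ = x_i^μ + i θ_i σ^μ θbar_i`. -/
def xMinus (i μ : Fin 4) : SuperFun :=
  xCoord i μ + Complex.I • bilinear (theta i) (thetaBar i) μ

/-- The interval `x_{īj}^μ = x_{i-}^μ - x_{j+}^μ - 2i θ_j σ^μ θbar_i`. -/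
def interval (i j μ : Fin 4) : SuperFun :=
  xMinus i μ - xPlus j μ - (2 * Complex.I) • bilinear (theta j) (thetaBar i) μ

/-- The Minkowski product `v^μ w_μ`. -/
def minkDot (v w : Fin 4 → SuperFun) : SuperFun := ∑ μ : Fin 4, eta μ • (v μ * w μ)

/-- `v_{αα̇} = v^μ σ_{μ αα̇}`. -/
def toMat (v : Fin 4 → SuperFun) : Matrix (Fin 2) (Fin 2) SuperFun :=
  fun α β => ∑ μ : Fin 4, (eta μ * sigma μ α β) • v μ

/-- `ṽ^{α̇α} = v^μ σ̃_μ^{α̇α}`. -/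
def toMatTilde (v : Fin 4 → SuperFun) : Matrix (Fin 2) (Fin 2) SuperFun :=
  fun β α => ∑ μ : Fin 4, (eta μ * sigmaTilde μ β α) • v μ

/-- The four-vector `v^μ = ½ tr (σ^μ ṽ)` that corresponds to a matrix `ṽ^{α̇α}`. -/
def toVec (M : Matrix (Fin 2) (Fin 2) SuperFun) (μ : Fin 4) : SuperFun :=
  ∑ α : Fin 2, ∑ β : Fin 2, (1 / 2 * sigma μ α β) • M β α

/-- `x_{īj}²`. -/
def intervalSq (i j : Fin 4) : SuperFun := minkDot (interval i j) (interval i j)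

/-- `x_{īj}⁻¹ = x̃_{īj} / x_{īj}²`. -/
def intervalInv (i j : Fin 4) : Matrix (Fin 2) (Fin 2) SuperFun :=
  fun β α => sinv (intervalSq i j) * toMatTilde (interval i j) β α

/-- `x̃_{īj}⁻¹ = x_{īj} / x_{īj}²`. -/
def intervalTildeInv (i j : Fin 4) : Matrix (Fin 2) (Fin 2) SuperFun :=
  fun α β => sinv (intervalSq i j) * toMat (interval i j) α β

/-! ## Infinitesimal superconformal transformations -/

/-- The generators of the complexified `N = 1` superconformal algebra `sl(4|1)`: translations,
the two factors `gl(2)` whose sum is spanned by the Lorentz transformations, the dilation and the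
`U(1)` R-symmetry, special conformal transformations, and the supersymmetries `Q`, `Qbar`, `S`,
`Sbar`. -/
inductive Generator : Type
  | P (a : Matrix (Fin 2) (Fin 2) ℂ)
  | L (m : Matrix (Fin 2) (Fin 2) ℂ)
  | Lbar (n : Matrix (Fin 2) (Fin 2) ℂ)
  | K (k : Matrix (Fin 2) (Fin 2) ℂ)
  | Q (γ : Fin 2)
  | Qbar (γ : Fin 2)
  | S (γ : Fin 2)
  | Sbar (γ : Fin 2)

/-- A matrix of complex constants as a matrix of superfunctions. -/
def constMat (a : Matrix (Fin 2) (Fin 2) ℂ) : Matrix (Fin 2) (Fin 2) SuperFun :=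
  a.map (algebraMap ℂ SuperFun)

/-- The value of a generator on `x̃_{i+}^{α̇α}`. -/
def Generator.onXPlus (i : Fin 4) : Generator → Matrix (Fin 2) (Fin 2) SuperFun
  | .P a => constMat a
  | .L m => toMatTilde (xPlus i) * constMat m
  | .Lbar n => constMat n * toMatTilde (xPlus i)
  | .K k => toMatTilde (xPlus i) * constMat k * toMatTilde (xPlus i)
  | .Q _ => 0
  | .Qbar γ => fun β α => if β = γ then (4 * Complex.I) • theta i α else 0
  | .S γ => fun β α => (4 * Complex.I) • (toMatTilde (xPlus i) β γ * theta i α)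
  | .Sbar _ => 0

/-- The value of a generator on `x̃_{i-}^{α̇α}`. -/
def Generator.onXMinus (i : Fin 4) : Generator → Matrix (Fin 2) (Fin 2) SuperFun
  | .P a => constMat a
  | .L m => toMatTilde (xMinus i) * constMat m
  | .Lbar n => constMat n * toMatTilde (xMinus i)
  | .K k => toMatTilde (xMinus i) * constMat k * toMatTilde (xMinus i)
  | .Q γ => fun β α => if α = γ then (4 * Complex.I) • thetaBar i β else 0
  | .Qbar _ => 0
  | .S _ => 0
  | .Sbar γ => fun β α => (4 * Complex.I) • (toMatTilde (xMinus i) γ α * thetaBar i β)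

/-- The value of a generator on `θ_i^α`. -/
def Generator.onTheta (i : Fin 4) : Generator → Fin 2 → SuperFun
  | .P _ => 0
  | .L m => Matrix.vecMul (theta i) (constMat m)
  | .Lbar _ => 0
  | .K k => Matrix.vecMul (theta i) (constMat k * toMatTilde (xPlus i))
  | .Q γ => Pi.single γ 1
  | .Qbar _ => 0
  | .S γ => fun α => (-4 * Complex.I) • (theta i γ * theta i α)
  | .Sbar γ => fun α => toMatTilde (xPlus i) γ α

/-- The value of a generator on `θbar_i^α̇`. -/
def Generator.onThetaBar (i : Fin 4) : Generator → Fin 2 → SuperFun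
  | .P _ => 0
  | .L _ => 0
  | .Lbar n => Matrix.mulVec (constMat n) (thetaBar i)
  | .K k => Matrix.mulVec (toMatTilde (xMinus i) * constMat k) (thetaBar i)
  | .Q _ => 0
  | .Qbar γ => Pi.single γ 1
  | .S γ => fun β => toMatTilde (xMinus i) β γ
  | .Sbar γ => fun β => (-4 * Complex.I) • (thetaBar i γ * thetaBar i β)

/-- The action of a generator on superfunctions, as the super vector field `V = V(z^M) ∂_M` on
the four points with coordinates `x_i = (x_{i+} + x_{i-}) / 2`, `θ_i`, `θbar_i`. -/
def Generator.act (V : Generator) (F : SuperFun) : SuperFun :=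
  ∑ i : Fin 4,
    (∑ μ : Fin 4,
        toVec ((1 / 2 : ℂ) • (V.onXPlus i + V.onXMinus i)) μ * dX i μ F
      + ∑ α : Fin 2, V.onTheta i α * dOdd (thetaIdx i α) F
      + ∑ β : Fin 2, V.onThetaBar i β * dOdd (thetaBarIdx i β) F)

/-- A superconformal invariant of four points on a set of configurations: a smooth superfunction
that is annihilated by all generators of the superconformal algebra. -/
def IsInvariantOn (F : SuperFun) (U : Set Config) : Prop :=
  SmoothOn F U ∧ ∀ V : Generator, Set.EqOn (V.act F) 0 U

/-! ## Configurations -/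

/-- The squared distance `(x_i - x_j)²` in Minkowski space. -/
def distSq (c : Config) (i j : Fin 4) : ℝ :=
  (c i 0 - c j 0) ^ 2 - (c i 1 - c j 1) ^ 2 - (c i 2 - c j 2) ^ 2 - (c i 3 - c j 3) ^ 2

/-- Configurations of four points no two of which have light-like separation. -/
def nondegenerate : Set Config := {c | ∀ i j : Fin 4, i ≠ j → distSq c i j ≠ 0}

/-- Configurations in general position: moreover the Gram determinant of the four points as null
vectors in six dimensions does not vanish. -/
def regular : Set Config :=
  {c | c ∈ nondegenerate ∧
    (distSq c 0 1 * distSq c 2 3) ^ 2 + (distSq c 0 2 * distSq c 1 3) ^ 2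
      + (distSq c 0 3 * distSq c 1 2) ^ 2
      - 2 * (distSq c 0 1 * distSq c 2 3) * (distSq c 0 2 * distSq c 1 3)
      - 2 * (distSq c 0 2 * distSq c 1 3) * (distSq c 0 3 * distSq c 1 2)
      - 2 * (distSq c 0 3 * distSq c 1 2) * (distSq c 0 1 * distSq c 2 3) ≠ 0}

/-! ## Cross ratios -/

/-- `x_{r̄s}² x_{t̄u}² / (x_{r̄u}² x_{t̄s}²)`. -/
def crossRatio (r s t u : Fin 4) : SuperFun :=
  intervalSq r s * intervalSq t u * sinv (intervalSq r u) * sinv (intervalSq t s)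

/-- The cross ratios `𝓘₁, …, 𝓘₆` (numbered from `0`). -/
def crossI : Fin 6 → SuperFun :=
  ![crossRatio 0 3 2 1, crossRatio 0 3 1 2, crossRatio 2 1 3 0,
    crossRatio 1 3 2 0, crossRatio 1 2 3 0, crossRatio 0 2 3 1]

/-- The bodies of the cross ratios `𝓘₁, 𝓘₂`, which are real. -/
def crossBody (c : Config) : ℝ × ℝ := ((body (crossI 0 c)).re, (body (crossI 1 c)).re)

/-- The superfunction `f(𝓘₁, 𝓘₂)`, defined through the Taylor expansion of `f` about the body of
`(𝓘₁, 𝓘₂)`, which terminates because the nilpotent parts have vanishing ninth powers. -/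
def ofCrossRatios (f : ℝ × ℝ → ℂ) : SuperFun := fun c =>
  ∑ m ∈ Finset.range 17, ∑ n ∈ Finset.range 17,
    (((m.factorial : ℂ) * (n.factorial : ℂ))⁻¹ *
      iteratedFDeriv ℝ (m + n) f (crossBody c)
        (fun k => if k.val < m then ((1 : ℝ), (0 : ℝ)) else ((0 : ℝ), (1 : ℝ)))) •
      ((crossI 0 c - algebraMap ℂ Grassmann (body (crossI 0 c))) ^ m *
        (crossI 1 c - algebraMap ℂ Grassmann (body (crossI 1 c))) ^ n)

/-! ## The variables at the first point -/

/-- The point `i` with `i - 1 = k` for the labels `k = 1, 2` (in the usual numbering). -/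
def pt (k : Fin 2) : Fin 4 := ![1, 2] k

/-- `X_{1+}² = x_{2̄3}² / (x_{2̄1}² x_{1̄3}²)`. -/
def XPlusSq₃ : SuperFun :=
  intervalSq 1 2 * sinv (intervalSq 1 0) * sinv (intervalSq 0 2)

/-- `X_{1-}² = x_{3̄2}² / (x_{3̄1}² x_{1̄2}²)`. -/
def XMinusSq₃ : SuperFun :=
  intervalSq 2 1 * sinv (intervalSq 2 0) * sinv (intervalSq 0 1)

/-- `J₁ = X_{1+}² / X_{1-}²`. -/
def J₁ : SuperFun := XPlusSq₃ * sinv XMinusSq₃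

/-- `X_{1(i-1)+}² = x_{ī4}² / (x_{ī1}² x_{1̄4}²)`. -/
def XPlusSq (k : Fin 2) : SuperFun :=
  intervalSq (pt k) 3 * sinv (intervalSq (pt k) 0) * sinv (intervalSq 0 3)

/-- `X_{1(i-1)-}² = x_{4̄i}² / (x_{4̄1}² x_{1̄i}²)`. -/
def XMinusSq (k : Fin 2) : SuperFun :=
  intervalSq 3 (pt k) * sinv (intervalSq 3 0) * sinv (intervalSq 0 (pt k))

/-- `J_{1(k)} = X_{1(k)+}² / X_{1(k)-}²`. -/
def J (k : Fin 2) : SuperFun := XPlusSq k * sinv (XMinusSq k)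

/-- The square root with body `1` of a superfunction with body `1`, by the binomial series. -/
def unipotentSqrt (F : SuperFun) : SuperFun := fun c =>
  ∑ k ∈ Finset.range 17, ((Ring.choose (1 / 2 : ℚ) k : ℚ) : ℂ) • (F c - 1) ^ k

/-- `√(X_{1(1)+}² X_{1(1)-}²)`: the square root whose body is the common body of `X_{1(1)+}²` and
`X_{1(1)-}²`. -/
def rootX : SuperFun := XMinusSq 0 * unipotentSqrt (J 0)

/-- `X̃_{1(1)+} = -x_{1̄4}⁻¹ x_{2̄4} x_{2̄1}⁻¹`. -/
def XTilde11Plus : Matrix (Fin 2) (Fin 2) SuperFun :=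
  -(intervalInv 0 3 * toMat (interval 1 3) * intervalInv 1 0)

/-- `X̃_{1(2)-} = x_{1̄3}⁻¹ x_{4̄3} x_{4̄1}⁻¹`. -/
def XTilde12Minus : Matrix (Fin 2) (Fin 2) SuperFun :=
  intervalInv 0 2 * toMat (interval 3 2) * intervalInv 3 0

/-- `X̃_{1(1)+}` and `X̃_{1(2)-}`. -/
def XTilde : Fin 2 → Matrix (Fin 2) (Fin 2) SuperFun := ![XTilde11Plus, XTilde12Minus]

/-- The products `X̂_m^μ X̂_{n μ}` of the normalized four-vectors
`X̂ = X / (X_{1(1)+}² X_{1(1)-}²)^{1/4}`, with `X_0 = X_{1(1)+}` and `X_1 = X_{1(2)-}`. -/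
def hatDot (m n : Fin 2) : SuperFun :=
  minkDot (toVec (XTilde m)) (toVec (XTilde n)) * sinv rootX

/-- `Θ̃_{1(i-1) α} = i (x̃_{4̄1}⁻¹ θbar_{41} - x̃_{ī1}⁻¹ θbar_{i1})`. -/
def ThetaTilde (k : Fin 2) : Fin 2 → SuperFun :=
  Complex.I • (Matrix.mulVec (intervalTildeInv 3 0) (thetaBar 3 - thetaBar 0)
    - Matrix.mulVec (intervalTildeInv (pt k) 0) (thetaBar (pt k) - thetaBar 0))

/-- `Θ̃bar_{1(i-1) α̇} = i (θ_{1i} x̃_{1̄i}⁻¹ - θ_{14} x̃_{1̄4}⁻¹)`. -/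
def ThetaBarTilde (k : Fin 2) : Fin 2 → SuperFun :=
  Complex.I • (Matrix.vecMul (theta 0 - theta (pt k)) (intervalTildeInv 0 (pt k))
    - Matrix.vecMul (theta 0 - theta 3) (intervalTildeInv 0 3))

/-- Raising a spinor index: `ψ^α = ε^{αβ} ψ_β` with `ε^{21} = 1 = -ε^{12}`. -/
def raiseIndex (ψ : Fin 2 → SuperFun) : Fin 2 → SuperFun := ![-ψ 1, ψ 0]

/-! ## Nilpotent invariants -/

/-- The nilpotent invariants `I_{nij} = -Θ̃bar_{1(j)} X̃ Θ̃_{1(i)} / √(X_{1(1)+}² X_{1(1)-}²)` with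
`X̃ = X̃_{1(1)+}` for `n = 1` and `X̃ = X̃_{1(2)-}` for `n = 2` (all labels shifted by one). -/
def nilp (n i j : Fin 2) : SuperFun :=
  -((∑ β : Fin 2, ∑ α : Fin 2, ThetaBarTilde j β * XTilde n β α * ThetaTilde i α) * sinv rootX)

/-- The invariants
`Θ_{1(i)} σ^μ Θbar_{1(j)} Θ_{1(k)} σ_μ Θbar_{1(l)} / √(X_{1(1)+}² X_{1(1)-}²)`. -/
def parkInv (i j k l : Fin 2) : SuperFun :=
  minkDot (bilinear (raiseIndex (ThetaTilde i)) (raiseIndex (ThetaBarTilde j)))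
    (bilinear (raiseIndex (ThetaTilde k)) (raiseIndex (ThetaBarTilde l))) * sinv rootX

/-- Exponents of monomials in the eight invariants `I_{nij}`. -/
abbrev Exponent : Type := Fin 2 × Fin 2 × Fin 2 → ℕ

/-- The exponent of the monomial `I_{nij}`. -/
def ex (n i j : Fin 2) : Exponent := Pi.single (n, i, j) 1

/-- The degree of a monomial. -/
def degree (e : Exponent) : ℕ := ∑ t, e t

/-- The monomial `∏ I_{nij} ^ e(n,i,j)`. The factors are even, so that their order does not
matter. -/
def monomial (e : Exponent) : SuperFun :=
  nilp 0 0 0 ^ e (0, 0, 0) * nilp 0 0 1 ^ e (0, 0, 1) *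
  nilp 0 1 0 ^ e (0, 1, 0) * nilp 0 1 1 ^ e (0, 1, 1) *
  nilp 1 0 0 ^ e (1, 0, 0) * nilp 1 0 1 ^ e (1, 0, 1) *
  nilp 1 1 0 ^ e (1, 1, 0) * nilp 1 1 1 ^ e (1, 1, 1)

/-- The quadratic monomials `I_{1ij} I_{1kl}`, `I_{1ii} I_{212}`, `I_{1ii} I_{221}`,
`I_{111} I_{222}`, `I_{122} I_{211}`, `I_{i12} I_{221}`. -/
def chosen₂ : Finset Exponent :=
  Finset.univ.image (fun t : Fin 2 × Fin 2 × Fin 2 × Fin 2 =>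
      ex 0 t.1 t.2.1 + ex 0 t.2.2.1 t.2.2.2) ∪
  Finset.univ.image (fun i : Fin 2 => ex 0 i i + ex 1 0 1) ∪
  Finset.univ.image (fun i : Fin 2 => ex 0 i i + ex 1 1 0) ∪
  {ex 0 0 0 + ex 1 1 1, ex 0 1 1 + ex 1 0 0} ∪
  Finset.univ.image (fun i : Fin 2 => ex i 0 1 + ex 1 1 0)

/-- The cubic monomials `I_{111}² I_{i22}`, `I_{122}² I_{i11}`, `I_{112}² I_{j21}`,
`I_{121}² I_{j12}`. -/
def chosen₃ : Finset Exponent :=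
  Finset.univ.image (fun i : Fin 2 => 2 • ex 0 0 0 + ex i 1 1) ∪
  Finset.univ.image (fun i : Fin 2 => 2 • ex 0 1 1 + ex i 0 0) ∪
  Finset.univ.image (fun j : Fin 2 => 2 • ex 0 0 1 + ex j 1 0) ∪
  Finset.univ.image (fun j : Fin 2 => 2 • ex 0 1 0 + ex j 0 1)

/-- The set `𝔍` of chosen monomials: `1`, the `I_{nij}`, the quadratic and cubic monomials above,
and `I_{111}² I_{122}²`. -/
def chosen : Finset Exponent :=
  {0} ∪ Finset.univ.image (fun t : Fin 2 × Fin 2 × Fin 2 => ex t.1 t.2.1 t.2.2) ∪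
  chosen₂ ∪ chosen₃ ∪ {2 • ex 0 0 0 + 2 • ex 0 1 1}

/-- Near the configuration `p`, the superfunction `F` is a linear combination of the monomials in
`T`, whose coefficients are smooth functions of the cross ratios `𝓘₁, 𝓘₂`. -/
def IsCombinationNear (F : SuperFun) (T : Finset Exponent) (p : Config) : Prop :=
  ∃ V : Set Config, IsOpen V ∧ p ∈ V ∧ ∃ W : Set (ℝ × ℝ), IsOpen W ∧ Set.MapsTo crossBody V W ∧
    ∃ f : Exponent → ℝ × ℝ → ℂ, (∀ e ∈ T, ContDiffOn ℝ ∞ (f e) W) ∧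
      Set.EqOn F (∑ e ∈ T, ofCrossRatios (f e) * monomial e) V

end FourPoint

end

open FourPoint

noncomputable section

namespace FourPoint

/-! ## The Grassmann algebra as a normed algebra -/

/-- In finite dimension the choice of a norm does not affect smoothness. An operator norm, pulled
back along left multiplication, is submultiplicative, so that products and `Ring.inverse` are
smooth. -/
instance grassmannNormedRing : NormedRing Grassmann :=
  letI : NormedRing (Matrix (Finset (Fin 16)) (Finset (Fin 16)) ℂ) := Matrix.linftyOpNormedRing
  NormedRing.induced Grassmann (Matrix (Finset (Fin 16)) (Finset (Fin 16)) ℂ)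
    (Algebra.leftMulMatrix monomialBasis) (Algebra.leftMulMatrix_injective _)

instance grassmannNormedAlgebra : NormedAlgebra ℂ Grassmann :=
  letI : NormedRing (Matrix (Finset (Fin 16)) (Finset (Fin 16)) ℂ) := Matrix.linftyOpNormedRing
  letI : NormedAlgebra ℂ (Matrix (Finset (Fin 16)) (Finset (Fin 16)) ℂ) :=
    Matrix.linftyOpNormedAlgebra
  NormedAlgebra.induced ℂ Grassmann (Matrix (Finset (Fin 16)) (Finset (Fin 16)) ℂ)
    (Algebra.leftMulMatrix monomialBasis)

instance grassmannFinite : FiniteDimensional ℂ Grassmann :=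
  Module.Basis.finiteDimensional_of_finite monomialBasis

instance grassmannFiniteReal : FiniteDimensional ℝ Grassmann :=
  FiniteDimensional.trans ℝ ℂ Grassmann

instance grassmannComplete : CompleteSpace Grassmann := FiniteDimensional.complete ℂ Grassmann

/-- The coordinates of elements of the Grassmann algebra as a continuous linear equivalence. -/
def coordEquiv : Grassmann ≃L[ℂ] (Finset (Fin 16) → ℂ) :=
  monomialBasis.equivFun.toContinuousLinearEquiv

/-- The coordinates of elements of the Grassmann algebra as a real linear equivalence. -/
def coordEquivReal : Grassmann ≃L[ℝ] (Finset (Fin 16) → ℂ) :=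
  (monomialBasis.equivFun.restrictScalars ℝ).toContinuousLinearEquiv

/-- The coordinates with respect to `monomialBasis` are a continuous linear equivalence. From here
on the Fréchet calculus of `Grassmann`-valued maps replaces the component functions. -/
lemma smoothOn_iff {F : SuperFun} {U : Set Config} : SmoothOn F U ↔ ContDiffOn ℝ ∞ F U := by
  have h := coordEquivReal.comp_contDiffOn_iff (n := ∞) (f := F) (s := U)
  rw [← h, contDiffOn_pi]
  rfl

lemma dX_eq {F : SuperFun} {c : Config} (h : DifferentiableAt ℝ F c) (i μ : Fin 4) :
    dX i μ F c = fderiv ℝ F c (Pi.single i (Pi.single μ 1)) := by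
  have h1 : ∀ s, fderiv ℝ (component F s) c (Pi.single i (Pi.single μ 1)) =
      monomialBasis.repr (fderiv ℝ F c (Pi.single i (Pi.single μ 1))) s := by
    intro s
    have := (((ContinuousLinearMap.proj (R := ℂ) (φ := fun _ : Finset (Fin 16) => ℂ) s).comp
      coordEquiv.toContinuousLinearMap).restrictScalars ℝ).hasFDerivAt.comp c h.hasFDerivAt
    have h2 := this.fderiv
    change fderiv ℝ (component F s) c = _ at h2
    rw [h2]
    rfl
  simp only [dX, h1]
  exact monomialBasis.sum_repr _

lemma contDiffAt_sinv {F : SuperFun} {c : Config} {n : WithTop ℕ∞} (h : ContDiffAt ℝ n F c)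
    (hu : IsUnit (F c)) : ContDiffAt ℝ n (sinv F) c := by
  obtain ⟨u, hu⟩ := hu
  have := contDiffAt_ringInverse ℝ u (n := n)
  rw [hu] at this
  exact this.comp c h

/-! ## Parity -/

/-- The parity automorphism of the Grassmann algebra. -/
abbrev inv : Grassmann →ₐ[ℂ] Grassmann := CliffordAlgebra.involute

/-- Even elements. -/
def Ev (x : Grassmann) : Prop := inv x = x
/-- Odd elements. -/
def Od (x : Grassmann) : Prop := inv x = -x

lemma ι_mul_eq (v : Fin 16 → ℂ) (f : Grassmann) :
    ExteriorAlgebra.ι ℂ v * f = inv f * ExteriorAlgebra.ι ℂ v := by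
  induction f using ExteriorAlgebra.induction with
  | algebraMap r => rw [AlgHom.commutes, Algebra.commutes]
  | ι w =>
    rw [show inv (ExteriorAlgebra.ι ℂ w) = _ from CliffordAlgebra.involute_ι w, neg_mul]
    exact eq_neg_of_add_eq_zero_left (ExteriorAlgebra.ι_add_mul_swap v w)
  | mul a b ha hb => rw [← mul_assoc, ha, mul_assoc, hb, map_mul, mul_assoc]
  | add a b ha hb => rw [mul_add, ha, hb, map_add, add_mul]

/-- Up to a factor two these are the even and the odd part of `x`. Both claims are proved in one
induction, because the even part of a product is even times even plus odd times odd, and the odd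
part mixes the two likewise. -/
lemma add_inv_comm (x f : Grassmann) : (x + inv x) * f = f * (x + inv x) ∧
    (x - inv x) * f = inv f * (x - inv x) := by
  induction x using ExteriorAlgebra.induction generalizing f with
  | algebraMap r =>
    simp only [AlgHom.commutes, sub_self, zero_mul, mul_zero, and_true]
    rw [← map_add]; exact Algebra.commutes _ _
  | ι w =>
    rw [show inv (ExteriorAlgebra.ι ℂ w) = _ from CliffordAlgebra.involute_ι w]
    simp only [add_neg_cancel, zero_mul, mul_zero, sub_neg_eq_add, true_and]
    rw [add_mul, ι_mul_eq, mul_add]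
  | mul a b ha hb =>
    have e1 : a * b + inv (a * b) =
      (1/2:ℂ) • ((a + inv a) * (b + inv b) + (a - inv a) * (b - inv b)) := by
      rw [map_mul, show (a + inv a) * (b + inv b) + (a - inv a) * (b - inv b) =
        (2:ℂ) • (a * b + inv a * inv b) by rw [two_smul]; noncomm_ring, smul_smul]
      norm_num
    have e2 : a * b - inv (a * b) =
      (1/2:ℂ) • ((a + inv a) * (b - inv b) + (a - inv a) * (b + inv b)) := by
      rw [map_mul, show (a + inv a) * (b - inv b) + (a - inv a) * (b + inv b) =
        (2:ℂ) • (a * b - inv a * inv b) by rw [two_smul]; noncomm_ring, smul_smul]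
      norm_num
    rw [e1, e2]
    simp only [smul_mul_assoc, mul_smul_comm, add_mul _ _ f, mul_add f, mul_add (inv f)]
    constructor
    · congr 2
      · rw [mul_assoc, (hb f).1, ← mul_assoc, (ha f).1, mul_assoc]
      · rw [mul_assoc, (hb f).2, ← mul_assoc, (ha (inv f)).2, mul_assoc,
          CliffordAlgebra.involute_involute]
    · congr 2
      · rw [mul_assoc, (hb f).2, ← mul_assoc, (ha _).1, mul_assoc]
      · rw [mul_assoc, (hb f).1, ← mul_assoc, (ha f).2, mul_assoc]
  | add a b ha hb =>
    rw [map_add, show a + b + (inv a + inv b) = (a + inv a) + (b + inv b) by abel,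
      show a + b - (inv a + inv b) = (a - inv a) + (b - inv b) by abel, add_mul, (ha f).1, (hb f).1,
      add_mul, (ha f).2, (hb f).2, mul_add f (a + inv a), mul_add (inv f)]
    exact ⟨rfl, rfl⟩

lemma Ev.comm {x : Grassmann} (h : Ev x) (f : Grassmann) : x * f = f * x := by
  have := (add_inv_comm x f).1
  rw [h, ← two_smul ℂ x, smul_mul_assoc, mul_smul_comm] at this
  exact smul_right_injective _ (two_ne_zero (α := ℂ)) this

lemma Od.comm {x : Grassmann} (h : Od x) (f : Grassmann) : x * f = inv f * x := by
  have := (add_inv_comm x f).2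
  rw [h, sub_neg_eq_add, ← two_smul ℂ x, smul_mul_assoc, mul_smul_comm] at this
  exact smul_right_injective _ (two_ne_zero (α := ℂ)) this

lemma contractLeft_mul (d : Module.Dual ℂ (Fin 16 → ℂ)) (x y : Grassmann) :
    CliffordAlgebra.contractLeft (Q := (0 : QuadraticForm ℂ (Fin 16 → ℂ))) d (x * y) =
      CliffordAlgebra.contractLeft (Q := (0 : QuadraticForm ℂ (Fin 16 → ℂ))) d x * y +
      inv x * CliffordAlgebra.contractLeft (Q := (0 : QuadraticForm ℂ (Fin 16 → ℂ))) d y := by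
  induction x using ExteriorAlgebra.induction generalizing y with
  | algebraMap r =>
    rw [CliffordAlgebra.contractLeft_algebraMap_mul, CliffordAlgebra.contractLeft_algebraMap,
      AlgHom.commutes, zero_mul, zero_add]
  | ι w =>
    rw [show inv (ExteriorAlgebra.ι ℂ w) = _ from CliffordAlgebra.involute_ι w]
    rw [ExteriorAlgebra.ι, CliffordAlgebra.contractLeft_ι_mul, CliffordAlgebra.contractLeft_ι,
      neg_mul, sub_eq_add_neg, Algebra.smul_def]
  | mul a b ha hb => rw [mul_assoc, ha, hb, ha, map_mul]; noncomm_ring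
  | add a b ha hb => rw [add_mul, map_add, ha, hb, map_add, map_add]; noncomm_ring

/-! ## Super vector fields -/

/-- Contraction with the `k`-th coordinate. -/
abbrev ctr (k : Fin 16) : Grassmann →ₗ[ℂ] Grassmann :=
  CliffordAlgebra.contractLeft (Q := (0 : QuadraticForm ℂ (Fin 16 → ℂ))) (LinearMap.proj k)

/-- The coefficient of `∂/∂x_i^μ` in the vector field of a generator. -/
def Generator.coefX (V : Generator) (i μ : Fin 4) : SuperFun :=
  toVec ((1 / 2 : ℂ) • (V.onXPlus i + V.onXMinus i)) μ

lemma act_eq (V : Generator) {F : SuperFun} {c : Config} (h : DifferentiableAt ℝ F c) :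
    V.act F c = ∑ i : Fin 4,
      (∑ μ : Fin 4, V.coefX i μ c * fderiv ℝ F c (Pi.single i (Pi.single μ 1))
      + ∑ α : Fin 2, V.onTheta i α c * ctr (thetaIdx i α) (F c)
      + ∑ β : Fin 2, V.onThetaBar i β c * ctr (thetaBarIdx i β) (F c)) := by
  simp only [Generator.act, Finset.sum_apply, Pi.add_apply, Pi.mul_apply, dX_eq h]
  rfl

/-- Whether a generator is odd. -/
def Generator.isOdd : Generator → Bool
  | .P _ => false
  | .L _ => false
  | .Lbar _ => false
  | .K _ => false
  | _ => true

/-- The parity automorphism for odd generators, the identity for even ones. -/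
def Generator.sg (V : Generator) : Grassmann →ₐ[ℂ] Grassmann :=
  if V.isOdd then inv else AlgHom.id ℂ _

lemma Ev.sg {x : Grassmann} (h : Ev x) (V : Generator) : V.sg x = x := by
  unfold Generator.sg; split
  · exact h
  · rfl

/-- `F` is smooth at `c`, and `d` is the value of `V F` there. -/
structure HasAct (V : Generator) (c : Config) (F : SuperFun) (d : Grassmann) : Prop where
  smooth : ContDiffAt ℝ ∞ F c
  eq : V.act F c = d

lemma HasAct.diff {V : Generator} {c : Config} {F : SuperFun} {d : Grassmann}
    (h : HasAct V c F d) : DifferentiableAt ℝ F c := h.smooth.differentiableAt (by simp)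

lemma Ev.add {x y : Grassmann} (hx : Ev x) (hy : Ev y) : Ev (x + y) := by
  unfold Ev at *; rw [map_add, hx, hy]
lemma Ev.sub {x y : Grassmann} (hx : Ev x) (hy : Ev y) : Ev (x - y) := by
  unfold Ev at *; rw [map_sub, hx, hy]
lemma Ev.neg {x : Grassmann} (hx : Ev x) : Ev (-x) := by
  unfold Ev at *; rw [map_neg, hx]
lemma Ev.smul {x : Grassmann} (a : ℂ) (hx : Ev x) : Ev (a • x) := by
  unfold Ev at *; rw [map_smul, hx]
lemma Ev.mul {x y : Grassmann} (hx : Ev x) (hy : Ev y) : Ev (x * y) := by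
  unfold Ev at *; rw [map_mul, hx, hy]
lemma Ev.pow {x : Grassmann} (hx : Ev x) (n : ℕ) : Ev (x ^ n) := by
  unfold Ev at *; rw [map_pow, hx]
lemma ev_zero : Ev 0 := map_zero _
lemma ev_one : Ev 1 := map_one _
lemma ev_algebraMap (r : ℂ) : Ev (algebraMap ℂ Grassmann r) := AlgHom.commutes _ _
lemma Ev.sum {ι : Type*} {s : Finset ι} {f : ι → Grassmann} (h : ∀ i ∈ s, Ev (f i)) :
    Ev (∑ i ∈ s, f i) := by
  unfold Ev at *; rw [map_sum]; exact Finset.sum_congr rfl h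
lemma Od.add {x y : Grassmann} (hx : Od x) (hy : Od y) : Od (x + y) := by
  unfold Od at *; rw [map_add, hx, hy, neg_add]
lemma Od.sub {x y : Grassmann} (hx : Od x) (hy : Od y) : Od (x - y) := by
  unfold Od at *; rw [map_sub, hx, hy]; abel
lemma Od.smul {x : Grassmann} (a : ℂ) (hx : Od x) : Od (a • x) := by
  unfold Od at *; rw [map_smul, hx, smul_neg]
lemma od_zero : Od 0 := by unfold Od; rw [map_zero, neg_zero]
lemma Od.mul {x y : Grassmann} (hx : Od x) (hy : Od y) : Ev (x * y) := by
  unfold Ev Od at *; rw [map_mul, hx, hy, neg_mul_neg]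
lemma Ev.mul_od {x y : Grassmann} (hx : Ev x) (hy : Od y) : Od (x * y) := by
  unfold Ev Od at *; rw [map_mul, hx, hy, mul_neg]
lemma Od.mul_ev {x y : Grassmann} (hx : Od x) (hy : Ev y) : Od (x * y) := by
  unfold Ev Od at *; rw [map_mul, hx, hy, neg_mul]
lemma Od.sum {ι : Type*} {s : Finset ι} {f : ι → Grassmann} (h : ∀ i ∈ s, Od (f i)) :
    Od (∑ i ∈ s, f i) := by
  unfold Od at *; rw [map_sum, ← Finset.sum_neg_distrib]; exact Finset.sum_congr rfl h
lemma Od.anticomm {x y : Grassmann} (hx : Od x) (hy : Od y) : x * y = -(y * x) := by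
  rw [hx.comm, hy, neg_mul]
lemma Od.sq {x : Grassmann} (hx : Od x) : x * x = 0 := by
  have := hx.anticomm hx
  rwa [eq_neg_iff_add_eq_zero, ← two_smul ℂ, smul_eq_zero_iff_right (two_ne_zero)] at this
lemma Ev.ringInverse {x : Grassmann} (hx : Ev x) : Ev (Ring.inverse x) := by
  by_cases h : IsUnit x
  · obtain ⟨u, rfl⟩ := h
    unfold Ev at *
    have h1 : inv (↑u⁻¹ : Grassmann) * (u : Grassmann) = 1 := by
      have h2 : inv (↑u⁻¹ : Grassmann) * inv (u : Grassmann) = 1 := by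
        rw [← map_mul, Units.inv_mul, map_one]
      rwa [hx] at h2
    rw [Ring.inverse_unit]
    calc _ = inv (↑u⁻¹ : Grassmann) * ((u : Grassmann) * ↑u⁻¹) := by rw [Units.mul_inv, mul_one]
      _ = _ := by rw [← mul_assoc, h1, one_mul]
  · rw [Ring.inverse_non_unit _ h]; exact ev_zero

/-! ### Coordinates -/

lemma ι_od (v : Fin 16 → ℂ) : Od (ExteriorAlgebra.ι ℂ v) := CliffordAlgebra.involute_ι v
lemma theta_od (i : Fin 4) (α : Fin 2) (c : Config) : Od (theta i α c) := ι_od _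
lemma thetaBar_od (i : Fin 4) (α : Fin 2) (c : Config) : Od (thetaBar i α c) := ι_od _
lemma xCoord_ev (i μ : Fin 4) (c : Config) : Ev (xCoord i μ c) := ev_algebraMap _

lemma bilinear_apply (ψ χ : Fin 2 → SuperFun) (μ : Fin 4) (c : Config) :
    bilinear ψ χ μ c = ∑ α : Fin 2, ∑ β : Fin 2, sigma μ α β • (ψ α c * χ β c) := by
  simp [bilinear]

lemma bilinear_ev {ψ χ : Fin 2 → SuperFun} {c : Config} (hψ : ∀ α, Od (ψ α c))
    (hχ : ∀ α, Od (χ α c)) (μ : Fin 4) : Ev (bilinear ψ χ μ c) := by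
  rw [bilinear_apply]
  exact Ev.sum fun α _ => Ev.sum fun β _ => ((hψ α).mul (hχ β)).smul _

lemma xPlus_ev (i μ : Fin 4) (c : Config) : Ev (xPlus i μ c) :=
  (xCoord_ev i μ c).sub ((bilinear_ev (fun α => theta_od i α c) (fun α => thetaBar_od i α c) μ).smul _)
lemma xMinus_ev (i μ : Fin 4) (c : Config) : Ev (xMinus i μ c) :=
  (xCoord_ev i μ c).add ((bilinear_ev (fun α => theta_od i α c) (fun α => thetaBar_od i α c) μ).smul _)
lemma interval_ev (i j μ : Fin 4) (c : Config) : Ev (interval i j μ c) :=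
  ((xMinus_ev i μ c).sub (xPlus_ev j μ c)).sub
    ((bilinear_ev (fun α => theta_od j α c) (fun α => thetaBar_od i α c) μ).smul _)

lemma toMat_apply (v : Fin 4 → SuperFun) (α β : Fin 2) (c : Config) :
    toMat v α β c = ∑ μ : Fin 4, (eta μ * sigma μ α β) • v μ c := by
  simp [toMat]
lemma toMatTilde_apply (v : Fin 4 → SuperFun) (α β : Fin 2) (c : Config) :
    toMatTilde v β α c = ∑ μ : Fin 4, (eta μ * sigmaTilde μ β α) • v μ c := by
  simp [toMatTilde]
lemma toMat_ev {v : Fin 4 → SuperFun} {c : Config} (h : ∀ μ, Ev (v μ c)) (α β : Fin 2) :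
    Ev (toMat v α β c) := by
  rw [toMat_apply]; exact Ev.sum fun μ _ => (h μ).smul _
lemma toMatTilde_ev {v : Fin 4 → SuperFun} {c : Config} (h : ∀ μ, Ev (v μ c)) (α β : Fin 2) :
    Ev (toMatTilde v α β c) := by
  rw [toMatTilde_apply]; exact Ev.sum fun μ _ => (h μ).smul _

/-! ### Rules for the action of a generator -/

/-- Elements of the parity of a generator. -/
def Hom (V : Generator) (x : Grassmann) : Prop := if V.isOdd then Od x else Ev x

lemma Hom.comm {V : Generator} {x : Grassmann} (h : Hom V x) (f : Grassmann) :
    f * x = x * V.sg f := by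
  unfold Hom at h; unfold Generator.sg
  split at h
  · rename_i hv; rw [if_pos hv, h.comm, CliffordAlgebra.involute_involute]
  · rename_i hv; rw [if_neg hv, h.comm]; rfl

lemma Hom.sum {V : Generator} {ι : Type*} {s : Finset ι} {f : ι → Grassmann}
    (h : ∀ i ∈ s, Hom V (f i)) : Hom V (∑ i ∈ s, f i) := by
  unfold Hom at *; split
  · rename_i hv; simp only [hv, if_true] at h; exact Od.sum h
  · rename_i hv; simp only [hv, if_false, Bool.false_eq_true] at h; exact Ev.sum h

lemma Hom.smul {V : Generator} {x : Grassmann} (a : ℂ) (hx : Hom V x) : Hom V (a • x) := by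
  unfold Hom at *; split
  · rename_i hv; simp only [hv, if_true] at hx; exact hx.smul a
  · rename_i hv; simp only [hv, if_false, Bool.false_eq_true] at hx; exact hx.smul a

lemma Hom.add {V : Generator} {x y : Grassmann} (hx : Hom V x) (hy : Hom V y) : Hom V (x + y) := by
  unfold Hom at *; split
  · rename_i hv; simp only [hv, if_true] at hx hy; exact hx.add hy
  · rename_i hv; simp only [hv, if_false, Bool.false_eq_true] at hx hy; exact hx.add hy

/-- Elements of the parity opposite to that of a generator. -/
def AntiHom (V : Generator) (x : Grassmann) : Prop := if V.isOdd then Ev x else Od x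

lemma AntiHom.comm {V : Generator} {x : Grassmann} (h : AntiHom V x) (f : Grassmann) :
    x * inv f = V.sg f * x := by
  unfold AntiHom at h; unfold Generator.sg
  split at h
  · rename_i hv; rw [if_pos hv, h.comm]
  · rename_i hv; rw [if_neg hv, h.comm, CliffordAlgebra.involute_involute]; rfl

lemma Generator.sg_sg (V : Generator) (f : Grassmann) : V.sg (V.sg f) = f := by
  unfold Generator.sg; split
  · exact CliffordAlgebra.involute_involute f
  · rfl

lemma Hom.comm' {V : Generator} {x : Grassmann} (h : Hom V x) (f : Grassmann) :
    x * f = V.sg f * x := by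
  rw [h.comm, V.sg_sg]

/-- All entries of the matrix are even at `c`. -/
def EvM (c : Config) (M : Matrix (Fin 2) (Fin 2) SuperFun) : Prop := ∀ α β, Ev (M α β c)

lemma EvM.mul {c : Config} {M N : Matrix (Fin 2) (Fin 2) SuperFun} (hM : EvM c M) (hN : EvM c N) :
    EvM c (M * N) := fun α β => by
  rw [Matrix.mul_apply, Finset.sum_apply]
  exact Ev.sum fun γ _ => (hM α γ).mul (hN γ β)

lemma constMat_evM (c : Config) (a : Matrix (Fin 2) (Fin 2) ℂ) : EvM c (constMat a) :=
  fun α β => ev_algebraMap (a α β)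

lemma xPlus_evM (c : Config) (i : Fin 4) : EvM c (toMatTilde (xPlus i)) :=
  toMatTilde_ev fun μ => xPlus_ev i μ c
lemma xMinus_evM (c : Config) (i : Fin 4) : EvM c (toMatTilde (xMinus i)) :=
  toMatTilde_ev fun μ => xMinus_ev i μ c
lemma interval_evM (c : Config) (i j : Fin 4) : EvM c (toMatTilde (interval i j)) :=
  toMatTilde_ev fun μ => interval_ev i j μ c

lemma onXPlus_hom (V : Generator) (i : Fin 4) (α β : Fin 2) (c : Config) :
    Hom V (V.onXPlus i α β c) := by
  cases V with
  | P a => exact constMat_evM c a α β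
  | L m => exact (xPlus_evM c i).mul (constMat_evM c m) α β
  | Lbar n => exact (constMat_evM c n).mul (xPlus_evM c i) α β
  | K k => exact ((xPlus_evM c i).mul (constMat_evM c k)).mul (xPlus_evM c i) α β
  | Q γ => exact od_zero
  | Qbar γ =>
    change Od _
    simp only [Generator.onXPlus]
    split
    · exact (theta_od i β c).smul _
    · exact od_zero
  | S γ => exact ((xPlus_evM c i α γ).mul_od (theta_od i β c)).smul _
  | Sbar γ => exact od_zero

lemma onXMinus_hom (V : Generator) (i : Fin 4) (α β : Fin 2) (c : Config) :
    Hom V (V.onXMinus i α β c) := by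
  cases V with
  | P a => exact constMat_evM c a α β
  | L m => exact (xMinus_evM c i).mul (constMat_evM c m) α β
  | Lbar n => exact (constMat_evM c n).mul (xMinus_evM c i) α β
  | K k => exact ((xMinus_evM c i).mul (constMat_evM c k)).mul (xMinus_evM c i) α β
  | Qbar γ => exact od_zero
  | Q γ =>
    change Od _
    simp only [Generator.onXMinus]
    split
    · exact (thetaBar_od i α c).smul _
    · exact od_zero
  | Sbar γ => exact ((xMinus_evM c i γ β).mul_od (thetaBar_od i α c)).smul _
  | S γ => exact od_zero

lemma toVec_apply (M : Matrix (Fin 2) (Fin 2) SuperFun) (μ : Fin 4) (c : Config) :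
    toVec M μ c = ∑ α : Fin 2, ∑ β : Fin 2, (1 / 2 * sigma μ α β) • M β α c := by
  simp [toVec]

/-- The coefficients of the `x`-derivatives share the parity of the generator, those of the odd
derivatives have the opposite one (`onTheta_antiHom`, `onThetaBar_antiHom`). This homogeneity is
what the graded product rule needs. -/
lemma coefX_hom (V : Generator) (i μ : Fin 4) (c : Config) : Hom V (V.coefX i μ c) := by
  rw [Generator.coefX, toVec_apply]
  refine Hom.sum fun α _ => Hom.sum fun β _ => Hom.smul _ ?_
  exact ((onXPlus_hom V i β α c).add (onXMinus_hom V i β α c)).smul _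

lemma onTheta_antiHom (V : Generator) (i : Fin 4) (α : Fin 2) (c : Config) :
    AntiHom V (V.onTheta i α c) := by
  have h (M : Matrix (Fin 2) (Fin 2) SuperFun) (hM : EvM c M) :
      Od (Matrix.vecMul (theta i) M α c) := by
    simp only [Matrix.vecMul, dotProduct, Finset.sum_apply, Pi.mul_apply]
    exact Od.sum fun β _ => (theta_od i β c).mul_ev (hM β α)
  cases V with
  | P a => exact od_zero
  | L m => exact h _ (constMat_evM c m)
  | Lbar n => exact od_zero
  | K k => exact h _ ((constMat_evM c k).mul (xPlus_evM c i))
  | Q γ =>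
    change Ev ((Pi.single γ 1 : Fin 2 → SuperFun) α c)
    rw [Pi.single_apply]; split
    · exact ev_one
    · exact ev_zero
  | Qbar γ => exact ev_zero
  | S γ => exact ((theta_od i γ c).mul (theta_od i α c)).smul _
  | Sbar γ => exact xPlus_evM c i γ α

lemma onThetaBar_antiHom (V : Generator) (i : Fin 4) (β : Fin 2) (c : Config) :
    AntiHom V (V.onThetaBar i β c) := by
  have h (M : Matrix (Fin 2) (Fin 2) SuperFun) (hM : EvM c M) :
      Od (Matrix.mulVec M (thetaBar i) β c) := by
    simp only [Matrix.mulVec, dotProduct, Finset.sum_apply, Pi.mul_apply]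
    exact Od.sum fun α _ => (hM β α).mul_od (thetaBar_od i α c)
  cases V with
  | P a => exact od_zero
  | L m => exact od_zero
  | Lbar n => exact h _ (constMat_evM c n)
  | K k => exact h _ ((xMinus_evM c i).mul (constMat_evM c k))
  | Qbar γ =>
    change Ev ((Pi.single γ 1 : Fin 2 → SuperFun) β c)
    rw [Pi.single_apply]; split
    · exact ev_one
    · exact ev_zero
  | Q γ => exact ev_zero
  | Sbar γ => exact ((thetaBar_od i γ c).mul (thetaBar_od i β c)).smul _
  | S γ => exact xMinus_evM c i β γ

namespace HasAct
variable {V : Generator} {c : Config} {F G : SuperFun} {d e : Grassmann}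

lemma const (x : Grassmann) : HasAct V c (fun _ => x) (∑ i : Fin 4,
      (∑ α : Fin 2, V.onTheta i α c * ctr (thetaIdx i α) x
      + ∑ β : Fin 2, V.onThetaBar i β c * ctr (thetaBarIdx i β) x)) := by
  refine ⟨contDiffAt_const, ?_⟩
  rw [act_eq V (differentiableAt_const _)]
  simp

lemma algMap (r : ℂ) : HasAct V c (algebraMap ℂ SuperFun r) 0 := by
  have := const (V := V) (c := c) (algebraMap ℂ Grassmann r)
  simp only [CliffordAlgebra.contractLeft_algebraMap, mul_zero, Finset.sum_const_zero,
    add_zero] at this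
  exact this

lemma one : HasAct V c 1 0 := by
  have := algMap (V := V) (c := c) 1
  rwa [map_one] at this

lemma zero : HasAct V c 0 0 := by
  have := algMap (V := V) (c := c) 0
  rwa [map_zero] at this

lemma congr (h : HasAct V c F d) (hFG : F =ᶠ[nhds c] G) : HasAct V c G d := by
  have hG := h.diff.congr_of_eventuallyEq hFG.symm
  refine ⟨h.smooth.congr_of_eventuallyEq hFG.symm, ?_⟩
  rw [← h.eq, act_eq V hG, act_eq V h.diff, hFG.fderiv_eq, hFG.eq_of_nhds]

lemma add (hF : HasAct V c F d) (hG : HasAct V c G e) : HasAct V c (F + G) (d + e) := by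
  refine ⟨hF.smooth.add hG.smooth, ?_⟩
  rw [← hF.eq, ← hG.eq, act_eq V (hF.diff.add hG.diff), act_eq V hF.diff, act_eq V hG.diff,
    fderiv_add hF.diff hG.diff]
  simp only [Pi.add_apply, add_apply, map_add, mul_add, Finset.sum_add_distrib]
  abel

lemma smul (a : ℂ) (hF : HasAct V c F d) : HasAct V c (a • F) (a • d) := by
  refine ⟨contDiffAt_const.smul hF.smooth, ?_⟩
  rw [← hF.eq, act_eq V (hF.diff.const_smul a), act_eq V hF.diff, fderiv_const_smul hF.diff]
  simp only [Pi.smul_apply, smul_apply, map_smul, mul_smul_comm,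
    ← Finset.smul_sum, ← smul_add]

lemma neg (hF : HasAct V c F d) : HasAct V c (-F) (-d) := by
  simpa using hF.smul (-1)

lemma sub (hF : HasAct V c F d) (hG : HasAct V c G e) : HasAct V c (F - G) (d - e) := by
  simpa [sub_eq_add_neg] using hF.add hG.neg

lemma sum {ι : Type*} {s : Finset ι} {F : ι → SuperFun} {d : ι → Grassmann}
    (h : ∀ i ∈ s, HasAct V c (F i) (d i)) : HasAct V c (∑ i ∈ s, F i) (∑ i ∈ s, d i) := by
  classical
  induction s using Finset.induction_on with
  | empty => exact zero
  | insert a s ha ih =>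
    rw [Finset.sum_insert ha, Finset.sum_insert ha]
    exact (h a (Finset.mem_insert_self _ _)).add (ih fun i hi => h i (Finset.mem_insert_of_mem hi))

/-- Each summand of the vector field produces the same sign. A coefficient of an `x`-derivative
passes `F` at the cost of `V.sg`; an odd derivative contributes `inv`, which its coefficient of
opposite parity turns into `V.sg` again. -/
lemma mul (hF : HasAct V c F d) (hG : HasAct V c G e) :
    HasAct V c (F * G) (d * G c + V.sg (F c) * e) := by
  refine ⟨hF.smooth.mul hG.smooth, ?_⟩
  rw [← hF.eq, ← hG.eq, act_eq V (hF.diff.mul hG.diff), act_eq V hF.diff, act_eq V hG.diff,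
    fderiv_mul' hF.diff hG.diff, Finset.sum_mul, Finset.mul_sum, ← Finset.sum_add_distrib]
  refine Finset.sum_congr rfl fun i _ => ?_
  have h1 : ∀ μ, V.coefX i μ c * ((F c • fderiv ℝ G c + MulOpposite.op (G c) • fderiv ℝ F c)
      (Pi.single i (Pi.single μ 1))) = V.coefX i μ c * fderiv ℝ F c (Pi.single i (Pi.single μ 1))
      * G c + V.sg (F c) * (V.coefX i μ c * fderiv ℝ G c (Pi.single i (Pi.single μ 1))) := by
    intro μ
    simp only [add_apply, smul_apply, smul_eq_mul,
      MulOpposite.smul_eq_mul_unop, MulOpposite.unop_op, mul_add]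
    rw [← mul_assoc, (coefX_hom V i μ c).comm' (F c)]
    noncomm_ring
  have h2 : ∀ α, V.onTheta i α c * ctr (thetaIdx i α) ((F * G) c) =
      V.onTheta i α c * ctr (thetaIdx i α) (F c) * G c +
      V.sg (F c) * (V.onTheta i α c * ctr (thetaIdx i α) (G c)) := by
    intro α
    rw [Pi.mul_apply, ctr, contractLeft_mul, mul_add, ← mul_assoc, ← mul_assoc,
      (onTheta_antiHom V i α c).comm, mul_assoc (V.sg _)]
  have h3 : ∀ α, V.onThetaBar i α c * ctr (thetaBarIdx i α) ((F * G) c) =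
      V.onThetaBar i α c * ctr (thetaBarIdx i α) (F c) * G c +
      V.sg (F c) * (V.onThetaBar i α c * ctr (thetaBarIdx i α) (G c)) := by
    intro α
    rw [Pi.mul_apply, ctr, contractLeft_mul, mul_add, ← mul_assoc, ← mul_assoc,
      (onThetaBar_antiHom V i α c).comm, mul_assoc (V.sg _)]
  simp only [h1, h2, h3, Finset.sum_add_distrib, add_mul, mul_add, Finset.sum_mul, Finset.mul_sum]
  abel

lemma mul_ev (hF : HasAct V c F d) (hG : HasAct V c G e) (h : Ev (F c)) :
    HasAct V c (F * G) (d * G c + F c * e) := by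
  have := hF.mul hG
  rwa [h.sg] at this

lemma pow_zero_of (hF : HasAct V c F 0) (n : ℕ) : HasAct V c (F ^ n) 0 := by
  induction n with
  | zero => rw [pow_zero]; exact one
  | succ n ih =>
    rw [pow_succ]
    have := ih.mul hF
    rwa [zero_mul, mul_zero, add_zero] at this

end HasAct

lemma thetaIdx_inj {i j : Fin 4} {α β : Fin 2} : thetaIdx i α = thetaIdx j β ↔ i = j ∧ α = β := by
  revert i j α β; decide
lemma thetaBarIdx_inj {i j : Fin 4} {α β : Fin 2} :
    thetaBarIdx i α = thetaBarIdx j β ↔ i = j ∧ α = β := by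
  revert i j α β; decide
lemma thetaIdx_ne {i j : Fin 4} {α β : Fin 2} : thetaIdx i α ≠ thetaBarIdx j β := by
  revert i j α β; decide

lemma ctr_ι (k l : Fin 16) : ctr k (ExteriorAlgebra.ι ℂ (Pi.single l 1)) = if l = k then 1 else 0 := by
  rw [ctr, ExteriorAlgebra.ι, CliffordAlgebra.contractLeft_ι]
  simp only [LinearMap.proj_apply, Pi.single_apply, eq_comm (a := k)]
  split <;> simp

lemma hasAct_theta (V : Generator) (i : Fin 4) (α : Fin 2) (c : Config) :
    HasAct V c (theta i α) (V.onTheta i α c) := by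
  have := HasAct.const (V := V) (c := c) (theta i α c)
  change HasAct V c (theta i α) _ at this
  simp only [show theta i α c = ExteriorAlgebra.ι ℂ (Pi.single (thetaIdx i α) 1) from rfl, ctr_ι, thetaIdx_inj, thetaIdx_ne, if_false, mul_zero, Finset.sum_const_zero,
    add_zero, mul_ite, mul_one] at this
  simpa [ite_and, Finset.sum_ite_eq] using this

lemma hasAct_thetaBar (V : Generator) (i : Fin 4) (α : Fin 2) (c : Config) :
    HasAct V c (thetaBar i α) (V.onThetaBar i α c) := by
  have := HasAct.const (V := V) (c := c) (thetaBar i α c)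
  change HasAct V c (thetaBar i α) _ at this
  simp only [show thetaBar i α c = ExteriorAlgebra.ι ℂ (Pi.single (thetaBarIdx i α) 1) from rfl, ctr_ι, thetaBarIdx_inj, thetaIdx_ne.symm, if_false, mul_zero,
    Finset.sum_const_zero, zero_add, mul_ite, mul_one] at this
  simpa [ite_and, Finset.sum_ite_eq] using this

/-- A complex-valued function of the bosonic coordinates as a superfunction. -/
def scalarFun (f : Config → ℂ) : SuperFun := fun c => algebraMap ℂ Grassmann (f c)

lemma hasAct_scalarFun {f : Config → ℂ} {c : Config} (hf : ContDiffAt ℝ ∞ f c) (V : Generator) :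
    HasAct V c (scalarFun f) (∑ i : Fin 4, ∑ μ : Fin 4,
      fderiv ℝ f c (Pi.single i (Pi.single μ 1)) • V.coefX i μ c) := by
  have h := ((Algebra.linearMap ℂ Grassmann).toContinuousLinearMap.restrictScalars ℝ).hasFDerivAt.comp
    c (hf.differentiableAt (by simp)).hasFDerivAt
  have h1 : DifferentiableAt ℝ (scalarFun f) c := h.differentiableAt
  refine ⟨((Algebra.linearMap ℂ Grassmann).toContinuousLinearMap.restrictScalars
    ℝ).contDiff.contDiffAt.comp c hf, ?_⟩
  rw [act_eq V h1]
  have h2 : fderiv ℝ (scalarFun f) c = _ := h.fderiv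
  rw [h2]
  refine Finset.sum_congr rfl fun i _ => ?_
  simp only [scalarFun, CliffordAlgebra.contractLeft_algebraMap, mul_zero, Finset.sum_const_zero,
    add_zero]
  refine Finset.sum_congr rfl fun μ _ => ?_
  change V.coefX i μ c * algebraMap ℂ Grassmann _ = _
  rw [← Algebra.commutes, ← Algebra.smul_def]
  rfl

lemma hasAct_xCoord (V : Generator) (i μ : Fin 4) (c : Config) :
    HasAct V c (xCoord i μ) (V.coefX i μ c) := by
  obtain ⟨L, hL⟩ : ∃ L : Config →L[ℝ] ℂ, ∀ x, L x = (x i μ : ℂ) :=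
    ⟨Complex.ofRealCLM.comp ((ContinuousLinearMap.proj (R := ℝ) (φ := fun _ : Fin 4 => ℝ) μ).comp
      (ContinuousLinearMap.proj (R := ℝ) (φ := fun _ : Fin 4 => Fin 4 → ℝ) i)), fun x => rfl⟩
  have h := hasAct_scalarFun (f := L) L.contDiff.contDiffAt V (c := c)
  rw [L.fderiv, show scalarFun L = xCoord i μ from funext fun x => by rw [scalarFun, hL]; rfl] at h
  convert h using 1
  have h : ∀ j ν, L (Pi.single j (Pi.single ν 1)) = if j = i then if ν = μ then 1 else 0 else 0 := by
    intro j ν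
    rw [hL]
    by_cases h1 : j = i
    · subst h1; by_cases h2 : ν = μ
      · subst h2; simp
      · simp [h2]
    · simp [h1]
  simp [h, ite_smul]

/-! ## The grading by the number of odd coordinates -/

/-- The component of degree `n`. -/
def prj (n : ℕ) : Grassmann →ₗ[ℂ] Grassmann :=
  GradedAlgebra.proj (fun i : ℕ => ⋀[ℂ]^i (Fin 16 → ℂ)) n

lemma prj_mem (n : ℕ) (x : Grassmann) : prj n x ∈ ⋀[ℂ]^n (Fin 16 → ℂ) :=
  (DirectSum.decompose (fun i : ℕ => ⋀[ℂ]^i (Fin 16 → ℂ)) x n).2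

lemma prj_of_mem {n : ℕ} {x : Grassmann} (h : x ∈ ⋀[ℂ]^n (Fin 16 → ℂ)) (m : ℕ) :
    prj m x = if n = m then x else 0 := by
  change ((DirectSum.decompose (fun i : ℕ => ⋀[ℂ]^i (Fin 16 → ℂ)) x m : _) : Grassmann) = _
  split
  · rename_i h1; subst h1; exact DirectSum.decompose_of_mem_same _ h
  · rename_i h1; exact DirectSum.decompose_of_mem_ne _ h h1

lemma basis_mem (s : Finset (Fin 16)) : monomialBasis s ∈ ⋀[ℂ]^s.card (Fin 16 → ℂ) := by
  rw [monomialBasis, ExteriorAlgebra.basis_apply]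
  exact (exteriorPower.ιMulti_family ℂ s.card (Pi.basisFun ℂ (Fin 16)) _).2

lemma prj_basis (s : Finset (Fin 16)) (m : ℕ) :
    prj m (monomialBasis s) = if s.card = m then monomialBasis s else 0 :=
  prj_of_mem (basis_mem s) m

lemma sum_prj (x : Grassmann) : ∑ n ∈ Finset.range 17, prj n x = x := by
  have h : ∑ n ∈ Finset.range 17, prj n = LinearMap.id := by
    refine monomialBasis.ext fun s => ?_
    have : s.card ∈ Finset.range 17 := by
      rw [Finset.mem_range, Nat.lt_succ_iff]; simpa using s.card_le_univ
    simp [prj_basis, this]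
  simpa using congrArg (fun f => f x) h

lemma prj_prj (m n : ℕ) (x : Grassmann) : prj m (prj n x) = if n = m then prj n x else 0 :=
  prj_of_mem (prj_mem n x) m

/-- The elements without components of degree less than `k`. -/
def Fil (k : ℕ) : Submodule ℂ Grassmann := ⨅ n : Fin k, LinearMap.ker (prj n)

lemma mem_fil {k : ℕ} {x : Grassmann} : x ∈ Fil k ↔ ∀ n < k, prj n x = 0 := by
  simp only [Fil, Submodule.mem_iInf, LinearMap.mem_ker]
  exact ⟨fun h n hn => h ⟨n, hn⟩, fun h n => h n n.2⟩

lemma fil_zero (x : Grassmann) : x ∈ Fil 0 := mem_fil.2 fun n hn => absurd hn (Nat.not_lt_zero n)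

lemma fil_mono {k l : ℕ} (h : k ≤ l) {x : Grassmann} (hx : x ∈ Fil l) : x ∈ Fil k :=
  mem_fil.2 fun n hn => mem_fil.1 hx n (hn.trans_le h)

lemma fil_succ {k : ℕ} {x : Grassmann} : x ∈ Fil (k + 1) ↔ x ∈ Fil k ∧ prj k x = 0 := by
  simp only [mem_fil, Nat.lt_succ_iff]
  exact ⟨fun h => ⟨fun n hn => h n hn.le, h k le_rfl⟩,
    fun h n hn => hn.lt_or_eq.elim (h.1 n) (fun e => e ▸ h.2)⟩

lemma mem_fil_of_mem {n : ℕ} {x : Grassmann} (h : x ∈ ⋀[ℂ]^n (Fin 16 → ℂ)) {k : ℕ} (hk : k ≤ n) :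
    x ∈ Fil k :=
  mem_fil.2 fun m hm => by rw [prj_of_mem h, if_neg (by omega)]

lemma eq_zero_of_mem_fil {x : Grassmann} {k : ℕ} (hk : 17 ≤ k) (h : x ∈ Fil k) : x = 0 := by
  rw [← sum_prj x]
  exact Finset.sum_eq_zero fun n hn => mem_fil.1 h n (by rw [Finset.mem_range] at hn; omega)

lemma sub_prj_mem_fil {k : ℕ} {x : Grassmann} (h : x ∈ Fil k) : x - prj k x ∈ Fil (k + 1) := by
  refine fil_succ.2 ⟨Submodule.sub_mem _ h (mem_fil_of_mem (prj_mem k x) le_rfl), ?_⟩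
  rw [map_sub, prj_prj, if_pos rfl, sub_self]

lemma mul_mem_pow {m n : ℕ} {x y : Grassmann} (hx : x ∈ ⋀[ℂ]^m (Fin 16 → ℂ))
    (hy : y ∈ ⋀[ℂ]^n (Fin 16 → ℂ)) : x * y ∈ ⋀[ℂ]^(m + n) (Fin 16 → ℂ) :=
  SetLike.mul_mem_graded (A := fun i : ℕ => ⋀[ℂ]^i (Fin 16 → ℂ)) hx hy

lemma prj_mul (n : ℕ) (x y : Grassmann) :
    prj n (x * y) = ∑ p ∈ Finset.range 17 ×ˢ Finset.range 17,
      if p.1 + p.2 = n then prj p.1 x * prj p.2 y else 0 := by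
  conv_lhs => rw [← sum_prj x, ← sum_prj y, Finset.sum_mul_sum, ← Finset.sum_product', map_sum]
  exact Finset.sum_congr rfl fun p _ => prj_of_mem (mul_mem_pow (prj_mem p.1 x) (prj_mem p.2 y)) n

lemma mul_mem_fil {k l : ℕ} {x y : Grassmann} (hx : x ∈ Fil k) (hy : y ∈ Fil l) :
    x * y ∈ Fil (k + l) := by
  refine mem_fil.2 fun n hn => ?_
  rw [prj_mul]
  refine Finset.sum_eq_zero fun p _ => ?_
  split
  · rcases lt_or_ge p.1 k with h | h
    · rw [mem_fil.1 hx _ h, zero_mul]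
    · rw [mem_fil.1 hy p.2 (by omega), mul_zero]
  · rfl

/-- Replacing a factor by its leading term changes the product only in higher order. All later
leading-term computations rest on this. -/
lemma prj_mul_of_mem_fil {k l : ℕ} {x y : Grassmann} (hx : x ∈ Fil k) (hy : y ∈ Fil l) :
    prj (k + l) (x * y) = prj k x * prj l y := by
  have h1 := mul_mem_fil (sub_prj_mem_fil hx) hy
  have h2 := mul_mem_fil (mem_fil_of_mem (prj_mem k x) le_rfl) (sub_prj_mem_fil hy)
  have h : x * y = prj k x * prj l y + (x - prj k x) * y + prj k x * (y - prj l y) := by noncomm_ring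
  conv_lhs => rw [h]
  rw [map_add, map_add, mem_fil.1 h1 _ (by omega), mem_fil.1 h2 _ (by omega), add_zero, add_zero,
    prj_of_mem (mul_mem_pow (prj_mem k x) (prj_mem l y)), if_pos rfl]

lemma mul_mem_fil_left {k : ℕ} (x : Grassmann) {y : Grassmann} (hy : y ∈ Fil k) : x * y ∈ Fil k := by
  simpa using mul_mem_fil (fil_zero x) hy

lemma mul_mem_fil_right {k : ℕ} {x : Grassmann} (hx : x ∈ Fil k) (y : Grassmann) :
    x * y ∈ Fil k := by
  have := mul_mem_fil hx (fil_zero y)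
  rwa [add_zero] at this

lemma pow_mem_fil {k : ℕ} {x : Grassmann} (hx : x ∈ Fil k) (n : ℕ) : x ^ n ∈ Fil (n * k) := by
  induction n with
  | zero => rw [Nat.zero_mul]; exact fil_zero _
  | succ n ih => rw [pow_succ, Nat.succ_mul]; exact mul_mem_fil ih hx

lemma algebraMap_mem (r : ℂ) : algebraMap ℂ Grassmann r ∈ ⋀[ℂ]^0 (Fin 16 → ℂ) :=
  SetLike.algebraMap_mem_graded (fun i : ℕ => ⋀[ℂ]^i (Fin 16 → ℂ)) r

lemma prj_pow_of_mem_fil {k : ℕ} {x : Grassmann} (hx : x ∈ Fil k) (n : ℕ) :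
    prj (n * k) (x ^ n) = prj k x ^ n := by
  induction n with
  | zero =>
    have h1 : (1 : Grassmann) ∈ ⋀[ℂ]^0 (Fin 16 → ℂ) := by
      rw [← map_one (algebraMap ℂ Grassmann)]; exact algebraMap_mem 1
    rw [Nat.zero_mul, pow_zero, pow_zero, prj_of_mem h1, if_pos rfl]
  | succ n ih => rw [pow_succ, Nat.succ_mul, prj_mul_of_mem_fil (pow_mem_fil hx n) hx, ih, pow_succ]

lemma ι_mem (v : Fin 16 → ℂ) : ExteriorAlgebra.ι ℂ v ∈ ⋀[ℂ]^1 (Fin 16 → ℂ) := by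
  rw [ExteriorAlgebra.exteriorPower, pow_one]; exact LinearMap.mem_range_self _ _

lemma body_ι (v : Fin 16 → ℂ) : body (ExteriorAlgebra.ι ℂ v) = 0 := by
  simp [body, ExteriorAlgebra.algebraMapInv]

lemma prj_zero (x : Grassmann) : prj 0 x = algebraMap ℂ Grassmann (body x) := by
  induction x using ExteriorAlgebra.induction with
  | algebraMap r => rw [prj_of_mem (algebraMap_mem r), if_pos rfl, AlgHom.commutes]; rfl
  | ι v => rw [prj_of_mem (ι_mem v), if_neg one_ne_zero, body_ι, map_zero]
  | mul a b ha hb =>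
    have := prj_mul_of_mem_fil (fil_zero a) (fil_zero b)
    rw [map_mul body, map_mul (algebraMap ℂ Grassmann), ← ha, ← hb, ← this]
  | add a b ha hb => rw [map_add, map_add, map_add, ha, hb]

lemma mem_fil_one {x : Grassmann} : x ∈ Fil 1 ↔ body x = 0 := by
  rw [fil_succ, prj_zero]
  simp only [fil_zero, true_and]
  exact map_eq_zero_iff _ (ExteriorAlgebra.algebraMap_leftInverse _).injective

lemma body_algebraMap (r : ℂ) : body (algebraMap ℂ Grassmann r) = r := AlgHom.commutes _ _

lemma sub_body_mem_fil (x : Grassmann) : x - algebraMap ℂ Grassmann (body x) ∈ Fil 1 := by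
  rw [mem_fil_one, map_sub, body_algebraMap, sub_self]

lemma isNilpotent_of_body {x : Grassmann} (h : body x = 0) : IsNilpotent x :=
  ⟨17, eq_zero_of_mem_fil le_rfl (pow_mem_fil (mem_fil_one.2 h) 17)⟩

/-- An element is its body plus a nilpotent part, and scalars commute with everything. -/
lemma isUnit_iff_body {x : Grassmann} : IsUnit x ↔ body x ≠ 0 := by
  refine ⟨fun h => (h.map body).ne_zero, fun h => ?_⟩
  have h1 : IsUnit (algebraMap ℂ Grassmann (body x)) := (Ne.isUnit h).map _
  have h2 := isNilpotent_of_body (mem_fil_one.1 (sub_body_mem_fil x))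
  have := h2.isUnit_add_left_of_commute h1 (Algebra.commutes _ _).symm
  rwa [add_sub_cancel] at this

lemma inv_of_mem {n : ℕ} {x : Grassmann} (h : x ∈ ⋀[ℂ]^n (Fin 16 → ℂ)) :
    inv x = (-1 : ℂ) ^ n • x := by
  induction h using Submodule.pow_induction_on_left' with
  | algebraMap r => rw [AlgHom.commutes, pow_zero, one_smul]
  | add x y i hx hy ihx ihy => rw [map_add, ihx, ihy, smul_add]
  | mem_mul m hm i x hx ihx =>
    obtain ⟨v, rfl⟩ := hm
    rw [map_mul, ihx, (ι_od v : inv _ = _), pow_succ, mul_smul_comm, mul_neg_one, neg_smul, neg_mul,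
      smul_neg]

lemma prj_inv (n : ℕ) (x : Grassmann) : prj n (inv x) = (-1 : ℂ) ^ n • prj n x := by
  conv_lhs => rw [← sum_prj x, map_sum, map_sum]
  conv_rhs => rw [← sum_prj x, map_sum, Finset.smul_sum]
  refine Finset.sum_congr rfl fun m _ => ?_
  rw [inv_of_mem (prj_mem m x), map_smul, prj_prj]
  split
  · rename_i h; rw [h]
  · rw [smul_zero, smul_zero]

/-- An even element has no component of degree one, so its soul starts in degree two. This is why
the ninth powers of the nilpotent parts of the cross ratios vanish. -/
lemma Ev.sub_body_mem_fil {x : Grassmann} (h : Ev x) :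
    x - algebraMap ℂ Grassmann (body x) ∈ Fil 2 := by
  refine fil_succ.2 ⟨FourPoint.sub_body_mem_fil x, ?_⟩
  have h1 := prj_inv 1 (x - algebraMap ℂ Grassmann (body x))
  rw [(h.sub (ev_algebraMap _) : inv _ = _), pow_one, neg_one_smul] at h1
  rwa [eq_neg_iff_add_eq_zero, ← two_smul ℂ, smul_eq_zero_iff_right two_ne_zero] at h1

lemma Ev.body_zero_mem_fil {x : Grassmann} (h : Ev x) (hb : body x = 0) : x ∈ Fil 2 := by
  have := h.sub_body_mem_fil
  rwa [hb, map_zero, sub_zero] at this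

/-- The alternative treats scalars separately, since there is no degree below zero for the
contraction to lie in. -/
lemma ctr_mem_aux (k : Fin 16) {n : ℕ} {x : Grassmann} (h : x ∈ ⋀[ℂ]^n (Fin 16 → ℂ)) :
    (n = 0 ∧ ctr k x = 0) ∨ ∃ m, n = m + 1 ∧ ctr k x ∈ ⋀[ℂ]^m (Fin 16 → ℂ) := by
  induction h using Submodule.pow_induction_on_left' with
  | algebraMap r => exact Or.inl ⟨rfl, by rw [ctr, CliffordAlgebra.contractLeft_algebraMap]⟩
  | add x y i hx hy ihx ihy =>
    rcases ihx with ⟨h1, h2⟩ | ⟨m, h1, h2⟩ <;> rcases ihy with ⟨h3, h4⟩ | ⟨m', h3, h4⟩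
    · exact Or.inl ⟨h1, by rw [map_add, h2, h4, add_zero]⟩
    · omega
    · omega
    · obtain rfl : m = m' := by omega
      exact Or.inr ⟨m, h1, by rw [map_add]; exact Submodule.add_mem _ h2 h4⟩
  | mem_mul v hv i x hx ihx =>
    obtain ⟨v, rfl⟩ := hv
    refine Or.inr ⟨i, rfl, ?_⟩
    rw [ctr, ExteriorAlgebra.ι, CliffordAlgebra.contractLeft_ι_mul]
    refine Submodule.sub_mem _ (Submodule.smul_mem _ _ hx) ?_
    rcases ihx with ⟨h1, h2⟩ | ⟨m, h1, h2⟩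
    · change _ * ctr k x ∈ _
      rw [h2, mul_zero]; exact Submodule.zero_mem _
    · subst h1
      have := mul_mem_pow (ι_mem v) h2
      rwa [add_comm] at this

lemma prj_ctr (k : Fin 16) (n : ℕ) (x : Grassmann) : prj n (ctr k x) = ctr k (prj (n + 1) x) := by
  conv_lhs => rw [← sum_prj x, map_sum, map_sum]
  conv_rhs => rw [← sum_prj x, map_sum, map_sum]
  refine Finset.sum_congr rfl fun m _ => ?_
  rcases ctr_mem_aux k (prj_mem m x) with ⟨h1, h2⟩ | ⟨l, h1, h2⟩
  · rw [h2, prj_prj, if_neg (by omega), map_zero, map_zero]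
  · rw [prj_of_mem h2, prj_prj, apply_ite (ctr k), map_zero]
    exact if_congr (by omega) rfl rfl

/-! ## Covariance of the intervals -/

/-- The completeness relation of the Pauli matrices. Its factor two turns the `2i θσθbar` of the
intervals into the `4i` of all matrix formulas below. -/
lemma toMatTilde_bilinear (ψ χ : Fin 2 → SuperFun) (α β : Fin 2) (c : Config) :
    toMatTilde (bilinear ψ χ) β α c = (2 : ℂ) • (ψ α c * χ β c) := by
  rw [toMatTilde_apply]
  simp only [bilinear_apply, Fin.sum_univ_two, Fin.sum_univ_four]
  fin_cases α <;> fin_cases β <;>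
  simp [eta, sigma, sigmaTilde, smul_smul] <;> module

lemma xMinus_mat (i : Fin 4) (α β : Fin 2) (c : Config) :
    toMatTilde (xMinus i) β α c = toMatTilde (xPlus i) β α c +
      (4 * Complex.I) • (theta i α c * thetaBar i β c) := by
  have h := toMatTilde_bilinear (theta i) (thetaBar i) α β c
  simp only [toMatTilde_apply, xMinus, xPlus, Pi.add_apply, Pi.sub_apply, Pi.smul_apply] at h ⊢
  simp only [Fin.sum_univ_four] at h ⊢
  linear_combination (norm := module) (2 * Complex.I) • h

lemma interval_mat (i j : Fin 4) (α β : Fin 2) (c : Config) :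
    toMatTilde (interval i j) β α c = toMatTilde (xMinus i) β α c - toMatTilde (xPlus j) β α c -
      (4 * Complex.I) • (theta j α c * thetaBar i β c) := by
  have h := toMatTilde_bilinear (theta j) (thetaBar i) α β c
  simp only [toMatTilde_apply, interval, Pi.sub_apply, Pi.smul_apply] at h ⊢
  simp only [Fin.sum_univ_four] at h ⊢
  linear_combination (norm := module) (-2 * Complex.I) • h

/-- The values of the entries of a matrix of superfunctions. -/
def evm (c : Config) : Matrix (Fin 2) (Fin 2) SuperFun →+* Matrix (Fin 2) (Fin 2) Grassmann :=
  (Pi.evalRingHom (fun _ => Grassmann) c).mapMatrix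

lemma evm_apply (c : Config) (M : Matrix (Fin 2) (Fin 2) SuperFun) (α β : Fin 2) :
    evm c M α β = M α β c := rfl

lemma evm_const (c : Config) (a : Matrix (Fin 2) (Fin 2) ℂ) :
    evm c (constMat a) = a.map (algebraMap ℂ Grassmann) := rfl

/-- The value of `x̃_{i+}`. -/
def XP (c : Config) (i : Fin 4) : Matrix (Fin 2) (Fin 2) Grassmann := evm c (toMatTilde (xPlus i))
/-- The value of `x̃_{i-}`. -/
def XM (c : Config) (i : Fin 4) : Matrix (Fin 2) (Fin 2) Grassmann := evm c (toMatTilde (xMinus i))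
/-- The value of `x̃_{īj}`. -/
def XI (c : Config) (i j : Fin 4) : Matrix (Fin 2) (Fin 2) Grassmann :=
  evm c (toMatTilde (interval i j))

/-- The value of `θ_i`. -/
def th (c : Config) (i : Fin 4) (α : Fin 2) : Grassmann := theta i α c
/-- The value of `θbar_i`. -/
def tb (c : Config) (i : Fin 4) (α : Fin 2) : Grassmann := thetaBar i α c

/-- The matrix by which a generator multiplies the intervals `x̃_{īj}` from the left. -/
def Generator.left (i : Fin 4) (c : Config) : Generator → Matrix (Fin 2) (Fin 2) Grassmann
  | .Lbar n => n.map (algebraMap ℂ Grassmann)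
  | .K k => XM c i * k.map (algebraMap ℂ Grassmann)
  | .Sbar γ => Matrix.of fun α β => if β = γ then (4 * Complex.I) • tb c i α else 0
  | _ => 0

/-- The matrix by which a generator multiplies the intervals `x̃_{īj}` from the right. -/
def Generator.right (j : Fin 4) (c : Config) : Generator → Matrix (Fin 2) (Fin 2) Grassmann
  | .L m => m.map (algebraMap ℂ Grassmann)
  | .K k => k.map (algebraMap ℂ Grassmann) * XP c j
  | .S γ => Matrix.of fun α β => if α = γ then (4 * Complex.I) • th c j β else 0
  | _ => 0

lemma sg_even {V : Generator} (h : V.isOdd = false) (x : Grassmann) : V.sg x = x := by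
  simp [Generator.sg, h]
lemma sg_odd {V : Generator} (h : V.isOdd = true) {x : Grassmann} (hx : Od x) : V.sg x = -x := by
  simp only [Generator.sg, h, if_true]; exact hx

/-! ### Covariance identities in an arbitrary complex algebra -/

section abstract
variable {R : Type*} [Ring R] [Algebra ℂ R]

lemma mul_algMap (x : R) (r : ℂ) : x * algebraMap ℂ R r = r • x := by
  rw [← Algebra.commutes, Algebra.smul_def]

lemma algMap_mul (x : R) (r : ℂ) : algebraMap ℂ R r * x = r • x :=
  (Algebra.smul_def r x).symm

variable {M P X : Matrix (Fin 2) (Fin 2) R} {t b : Fin 2 → R}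

/-- This and the following identities check generator by generator that `M - P - 4i t b` transforms
homogeneously. They are stated for free variables with only the needed commutation rules as
hypotheses, so that they become formal consequences of these rules. -/
lemma cov_L (m : Matrix (Fin 2) (Fin 2) ℂ)
    (hX : ∀ α β, X β α = M β α - P β α - (4 * Complex.I) • (t α * b β)) (α β : Fin 2) :
    (M * m.map (algebraMap ℂ R)) β α - (P * m.map (algebraMap ℂ R)) β α -
      (4 * Complex.I) • ((∑ γ, t γ * m.map (algebraMap ℂ R) γ α) * b β) =
    (X * m.map (algebraMap ℂ R)) β α := by
  simp only [Matrix.mul_apply, Fin.sum_univ_two, hX, Matrix.map_apply, mul_algMap, add_mul,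
    smul_mul_assoc]
  module

lemma cov_Lbar (n : Matrix (Fin 2) (Fin 2) ℂ)
    (hX : ∀ α β, X β α = M β α - P β α - (4 * Complex.I) • (t α * b β)) (α β : Fin 2) :
    (n.map (algebraMap ℂ R) * M) β α - (n.map (algebraMap ℂ R) * P) β α -
      (4 * Complex.I) • (t α * ∑ γ, n.map (algebraMap ℂ R) β γ * b γ) =
    (n.map (algebraMap ℂ R) * X) β α := by
  simp only [Matrix.mul_apply, Fin.sum_univ_two, hX, Matrix.map_apply, algMap_mul, mul_add,
    mul_smul_comm]
  module

/-- The identity `MkM - PkP = Mk(M - P) + (M - P)kP` carries the bosonic part; the variations of `t`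
and `b` supply exactly the corrections that complete `M - P` to `X` in both terms. -/
lemma cov_K (k : Matrix (Fin 2) (Fin 2) ℂ)
    (hX : ∀ α β, X β α = M β α - P β α - (4 * Complex.I) • (t α * b β))
    (hM : ∀ α β y, y * M β α = M β α * y) (hP : ∀ α β y, y * P β α = P β α * y)
    (α β : Fin 2) :
    (M * k.map (algebraMap ℂ R) * M) β α - (P * k.map (algebraMap ℂ R) * P) β α -
      (4 * Complex.I) • ((∑ γ, t γ * (k.map (algebraMap ℂ R) * P) γ α) * b β +
        t α * ∑ γ, (M * k.map (algebraMap ℂ R)) β γ * b γ) =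
    (M * k.map (algebraMap ℂ R) * X) β α + (X * (k.map (algebraMap ℂ R) * P)) β α := by
  simp only [Matrix.mul_apply, Fin.sum_univ_two, hX, Matrix.map_apply, algMap_mul, mul_algMap,
    mul_add, add_mul, mul_sub, sub_mul, mul_smul_comm, smul_mul_assoc, mul_assoc, hP _ _ (b _),
    ← mul_assoc (t _) (M _ _), hM _ _ (t _)]
  module

lemma cov_S (γ : Fin 2) (hX : ∀ α β, X β α = M β α - P β α - (4 * Complex.I) • (t α * b β))
    (hM : ∀ α β y, y * M β α = M β α * y) (h : ∀ α β, b β * t α = -(t α * b β)) (α β : Fin 2) :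
    - (4 * Complex.I) • (P β γ * t α) - (4 * Complex.I) • ((-4 * Complex.I) • (t γ * t α) * b β +
      - t α * M β γ) = (4 * Complex.I) • (X β γ * t α) := by
  simp only [hX, sub_mul, smul_mul_assoc, mul_assoc, h, neg_mul, hM _ _ (t _), mul_neg]
  match_scalars <;> ring_nf

lemma cov_Sbar (γ : Fin 2) (hX : ∀ α β, X β α = M β α - P β α - (4 * Complex.I) • (t α * b β))
    (hM : ∀ α β y, y * M β α = M β α * y) (hP : ∀ α β y, y * P β α = P β α * y)
    (h : ∀ α β, b β * t α = -(t α * b β)) (hb : ∀ α β, b α * b β = -(b β * b α)) (α β : Fin 2) :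
    (4 * Complex.I) • (M γ α * b β) - (4 * Complex.I) • (P γ α * b β +
      - t α * ((-4 * Complex.I) • (b γ * b β))) = (4 * Complex.I) • (b β * X γ α) := by
  simp only [hX, mul_sub, mul_smul_comm, ← mul_assoc, h, neg_mul, hM _ _ (b _), hP _ _ (b _)]
  simp only [mul_assoc, hb β γ, mul_neg]
  match_scalars <;> ring_nf

end abstract

lemma mul_eval (A B : Matrix (Fin 2) (Fin 2) SuperFun) (α β : Fin 2) (c : Config) :
    (A * B) α β c = (evm c A * evm c B) α β := by
  rw [← map_mul]; rfl

lemma vecMul_eval (ψ : Fin 2 → SuperFun) (M : Matrix (Fin 2) (Fin 2) SuperFun) (α : Fin 2)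
    (c : Config) : Matrix.vecMul ψ M α c = ∑ γ, ψ γ c * evm c M γ α := by
  simp only [Matrix.vecMul, dotProduct, Finset.sum_apply]; rfl

lemma mulVec_eval (M : Matrix (Fin 2) (Fin 2) SuperFun) (ψ : Fin 2 → SuperFun) (α : Fin 2)
    (c : Config) : Matrix.mulVec M ψ α c = ∑ γ, evm c M α γ * ψ γ c := by
  simp only [Matrix.mulVec, dotProduct, Finset.sum_apply]; rfl

lemma single_eval (γ α : Fin 2) (c : Config) :
    (Pi.single γ 1 : Fin 2 → SuperFun) α c = if α = γ then 1 else 0 := by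
  rw [Pi.single_apply]; split <;> rfl

lemma tb_th (c : Config) (i j : Fin 4) (α β : Fin 2) :
    tb c i β * th c j α = -(th c j α * tb c i β) :=
  (thetaBar_od i β c).anticomm (theta_od j α c)

lemma XP_comm (c : Config) (i : Fin 4) (α β : Fin 2) (y : Grassmann) :
    y * XP c i β α = XP c i β α * y := ((xPlus_evM c i β α).comm y).symm
lemma XM_comm (c : Config) (i : Fin 4) (α β : Fin 2) (y : Grassmann) :
    y * XM c i β α = XM c i β α * y := ((xMinus_evM c i β α).comm y).symm

lemma XI_eq (c : Config) (i j : Fin 4) (α β : Fin 2) :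
    XI c i j β α = XM c i β α - XP c j β α - (4 * Complex.I) • (th c j α * tb c i β) :=
  interval_mat i j α β c

/-- The transformation of `x_{i-} - x_{j+} - 4i θ_j θbar_i`. -/
lemma interval_aux (V : Generator) (i j : Fin 4) (β α : Fin 2) (c : Config) :
    V.onXMinus i β α c - V.onXPlus j β α c - (4 * Complex.I) • (V.onTheta j α c * thetaBar i β c +
      V.sg (theta j α c) * V.onThetaBar i β c) =
    (V.left i c * XI c i j) β α + (XI c i j * V.right j c) β α := by
  have htt : ∀ α β, tb c i α * tb c i β = -(tb c i β * tb c i α) :=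
    fun α β => (thetaBar_od i α c).anticomm (thetaBar_od i β c)
  cases V with
  | P a => simp [Generator.onXPlus, Generator.onXMinus, Generator.onTheta, Generator.onThetaBar,
      Generator.left, Generator.right]
  | L m =>
    simp only [Generator.onXPlus, Generator.onXMinus, Generator.onTheta, Generator.onThetaBar,
      Generator.left, Generator.right, mul_eval, vecMul_eval, evm_const, zero_mul,
      Matrix.zero_apply, zero_add, Pi.zero_apply, mul_zero, add_zero]
    exact cov_L m (XI_eq c i j) α β
  | Lbar n =>
    simp only [Generator.onXPlus, Generator.onXMinus, Generator.onTheta, Generator.onThetaBar,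
      Generator.left, Generator.right, mul_eval, mulVec_eval, evm_const, zero_mul,
      Matrix.zero_apply, zero_add, Pi.zero_apply, mul_zero, add_zero,
      sg_even (V := .Lbar n) rfl]
    exact cov_Lbar n (XI_eq c i j) α β
  | K k =>
    simp only [Generator.onXPlus, Generator.onXMinus, Generator.onTheta, Generator.onThetaBar,
      Generator.left, Generator.right, mul_eval, mulVec_eval, vecMul_eval, evm_const, map_mul,
      sg_even (V := .K k) rfl]
    exact cov_K k (XI_eq c i j) (XM_comm c i) (XP_comm c j) α β
  | Q γ =>
    simp only [Generator.onXPlus, Generator.onXMinus, Generator.onTheta, Generator.onThetaBar,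
      Generator.left, Generator.right, zero_mul, mul_zero, Matrix.zero_apply, single_eval,
      Pi.zero_apply]
    split <;> simp
  | Qbar γ =>
    simp only [Generator.onXPlus, Generator.onXMinus, Generator.onTheta, Generator.onThetaBar,
      Generator.left, Generator.right, zero_mul, mul_zero, Matrix.zero_apply, single_eval,
      Pi.zero_apply, sg_odd (V := .Qbar γ) rfl (theta_od j α c)]
    split <;> simp
  | S γ =>
    have := cov_S γ (XI_eq c i j) (XM_comm c i) (tb_th c i j) α β
    simp only [Generator.onXPlus, Generator.onXMinus, Generator.onTheta, Generator.onThetaBar,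
      Generator.left, Generator.right, zero_mul, Matrix.zero_apply, zero_add, Pi.zero_apply,
      sg_odd (V := .S γ) rfl (theta_od j α c), zero_sub, Matrix.mul_apply, Matrix.of_apply,
      mul_ite, mul_zero, Finset.sum_ite_eq', Finset.mem_univ, if_true, mul_smul_comm,
      Finset.sum_const_zero]
    rw [← this, neg_smul]; rfl
  | Sbar γ =>
    have := cov_Sbar γ (XI_eq c i j) (XM_comm c i) (XP_comm c j) (tb_th c i j) htt α β
    simp only [Generator.onXPlus, Generator.onXMinus, Generator.onTheta, Generator.onThetaBar,
      Generator.left, Generator.right, mul_zero, Matrix.zero_apply, add_zero, Pi.zero_apply,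
      sg_odd (V := .Sbar γ) rfl (theta_od j α c), sub_zero, Matrix.mul_apply, Matrix.of_apply,
      ite_mul, zero_mul, Finset.sum_ite_eq', Finset.mem_univ, if_true, smul_mul_assoc,
      Finset.sum_const_zero]
    rw [← this]; rfl

lemma XI_self (c : Config) (i : Fin 4) : XI c i i = 0 := by
  ext β α
  rw [XI_eq, show XM c i β α = _ from xMinus_mat i α β c]
  simp only [th, tb, XP, evm_apply, Matrix.zero_apply]
  abel

lemma toMatTilde_toVec (M : Matrix (Fin 2) (Fin 2) SuperFun) (β α : Fin 2) (c : Config) :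
    ∑ μ : Fin 4, (eta μ * sigmaTilde μ β α) • toVec M μ c = M β α c := by
  have h2 : Complex.I ^ 2 = -1 := Complex.I_sq
  simp only [toVec_apply, Fin.sum_univ_two, Fin.sum_univ_four]
  fin_cases α <;> fin_cases β <;>
  simp [eta, sigma, sigmaTilde, smul_smul] <;> match_scalars <;> first | ring1 | linear_combination (1 / 2 : ℂ) * h2 | linear_combination (-1 / 2 : ℂ) * h2

lemma toMatTilde_xPlus (i : Fin 4) (β α : Fin 2) : toMatTilde (xPlus i) β α =
    toMatTilde (xCoord i) β α - (2 * Complex.I) • (theta i α * thetaBar i β) := by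
  funext c
  have h := toMatTilde_bilinear (theta i) (thetaBar i) α β c
  simp only [toMatTilde_apply, xPlus, Pi.sub_apply, Pi.smul_apply, Pi.mul_apply] at h ⊢
  simp only [Fin.sum_univ_four] at h ⊢
  linear_combination (norm := module) (-Complex.I) • h

lemma toMatTilde_xMinus (i : Fin 4) (β α : Fin 2) : toMatTilde (xMinus i) β α =
    toMatTilde (xCoord i) β α + (2 * Complex.I) • (theta i α * thetaBar i β) := by
  funext c
  have h := toMatTilde_bilinear (theta i) (thetaBar i) α β c
  simp only [toMatTilde_apply, xMinus, Pi.add_apply, Pi.smul_apply, Pi.mul_apply] at h ⊢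
  simp only [Fin.sum_univ_four] at h ⊢
  linear_combination (norm := module) (Complex.I) • h

lemma hasAct_xCoordMat (V : Generator) (i : Fin 4) (β α : Fin 2) (c : Config) :
    HasAct V c (toMatTilde (xCoord i) β α) ((1 / 2 : ℂ) • (V.onXPlus i β α c + V.onXMinus i β α c)) := by
  have := HasAct.sum (s := Finset.univ) (fun μ _ =>
    (hasAct_xCoord V i μ c).smul (eta μ * sigmaTilde μ β α))
  rw [show (∑ μ : Fin 4, (eta μ * sigmaTilde μ β α) • V.coefX i μ c) = _ from
    toMatTilde_toVec _ β α c] at this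
  exact this

/-- The generators are vector fields in `x = (x₊ + x₋) / 2`, `θ`, `θbar`, so the prescribed values
on `x₊` and `x₋` have to be consistent with those on `θ` and `θbar`. The consistency condition is
the case `i = j` of `interval_aux`, where the interval vanishes by `XI_self`. -/
lemma hasAct_xPlus (V : Generator) (i : Fin 4) (β α : Fin 2) (c : Config) :
    HasAct V c (toMatTilde (xPlus i) β α) (V.onXPlus i β α c) := by
  have h := interval_aux V i i β α c
  rw [XI_self, mul_zero, zero_mul, Matrix.zero_apply, add_zero] at h
  rw [toMatTilde_xPlus]
  convert (hasAct_xCoordMat V i β α c).sub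
    (((hasAct_theta V i α c).mul (hasAct_thetaBar V i β c)).smul (2 * Complex.I)) using 1
  linear_combination (norm := module) (-1 / 2 : ℂ) • h

lemma hasAct_xMinus (V : Generator) (i : Fin 4) (β α : Fin 2) (c : Config) :
    HasAct V c (toMatTilde (xMinus i) β α) (V.onXMinus i β α c) := by
  have h := interval_aux V i i β α c
  rw [XI_self, mul_zero, zero_mul, Matrix.zero_apply, add_zero] at h
  rw [toMatTilde_xMinus]
  convert (hasAct_xCoordMat V i β α c).add
    (((hasAct_theta V i α c).mul (hasAct_thetaBar V i β c)).smul (2 * Complex.I)) using 1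
  linear_combination (norm := module) (1 / 2 : ℂ) • h

/-- The basic covariance: the matrix on the left depends on the barred point only and the matrix on
the right on the unbarred point only. Every weight and every cancellation below is a consequence. -/
lemma hasAct_interval (V : Generator) (i j : Fin 4) (β α : Fin 2) (c : Config) :
    HasAct V c (toMatTilde (interval i j) β α)
      ((V.left i c * XI c i j + XI c i j * V.right j c) β α) := by
  have h : toMatTilde (interval i j) β α = toMatTilde (xMinus i) β α - toMatTilde (xPlus j) β α -
      (4 * Complex.I) • (theta j α * thetaBar i β) := funext fun c => interval_mat i j α β c
  rw [h, Matrix.add_apply, ← interval_aux]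
  exact ((hasAct_xMinus V i β α c).sub (hasAct_xPlus V j β α c)).sub
    (((hasAct_theta V j α c).mul (hasAct_thetaBar V i β c)).smul _)

/-! ## Covariance of the variables at the first point -/

lemma HasAct.unique {V : Generator} {c : Config} {F : SuperFun} {d e : Grassmann}
    (h : HasAct V c F d) (h' : HasAct V c F e) : d = e := h.eq.symm.trans h'.eq

lemma eventually_isUnit {F : SuperFun} {c : Config} (h : ContinuousAt F c) (hu : IsUnit (F c)) :
    ∀ᶠ x in nhds c, IsUnit (F x) := h.eventually (Units.isOpen.mem_nhds hu)

/-- The product rule applied to `F F⁻¹ = 1`, an equation that holds in a neighbourhood because the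
units form an open set. -/
lemma HasAct.sinv {V : Generator} {c : Config} {F : SuperFun} {d : Grassmann}
    (h : HasAct V c F d) (hu : IsUnit (F c)) (he : Ev (F c)) :
    HasAct V c (sinv F) (-(FourPoint.sinv F c * d * FourPoint.sinv F c)) := by
  have h1 : HasAct V c (FourPoint.sinv F) _ := ⟨contDiffAt_sinv h.smooth hu, rfl⟩
  have h2 := h.mul_ev h1 he
  have h3 : HasAct V c (F * FourPoint.sinv F) 0 := HasAct.one.congr (by
    filter_upwards [eventually_isUnit h.smooth.continuousAt hu] with x hx
    exact (Ring.mul_inverse_cancel _ hx).symm)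
  have h4 := h2.unique h3
  have h5 : FourPoint.sinv F c * F c = 1 := Ring.inverse_mul_cancel _ hu
  convert h1 using 1
  calc -(FourPoint.sinv F c * d * FourPoint.sinv F c)
      = FourPoint.sinv F c * (F c * V.act (FourPoint.sinv F) c) := by
        rw [eq_neg_of_add_eq_zero_right h4]; noncomm_ring
    _ = _ := by rw [← mul_assoc, h5, one_mul]

/-- The center of the Grassmann algebra. -/
def Cen : Type := Subalgebra.center ℂ Grassmann

instance cenCommRing : CommRing Cen :=
  inferInstanceAs (CommRing (Subalgebra.center ℂ Grassmann))

instance cenComplexAlgebra : Algebra ℂ Cen :=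
  inferInstanceAs (Algebra ℂ (Subalgebra.center ℂ Grassmann))

/-- The inclusion of the center. -/
def cenVal : Cen →ₐ[ℂ] Grassmann := (Subalgebra.center ℂ Grassmann).val

instance cenAlgebra : Algebra Cen Grassmann :=
  cenVal.toRingHom.toAlgebra' fun z x => ((Subalgebra.mem_center_iff.1 z.2) x).symm

/-- Even elements are central. Lifting them to `Cen` moves identities into a commutative ring, and
makes `Grassmann` an algebra over that ring where even factors become scalars. -/
lemma Ev.lift {x : Grassmann} (h : Ev x) : ∃ z : Cen, algebraMap Cen Grassmann z = x :=
  ⟨⟨x, Subalgebra.mem_center_iff.2 fun b => (h.comm b).symm⟩, rfl⟩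

section abstract
variable {R : Type*} [Ring R] [Algebra ℂ R]

lemma cov_tb_K {M M0 P0 X : Matrix (Fin 2) (Fin 2) R} {t b b0 : Fin 2 → R}
    (k : Matrix (Fin 2) (Fin 2) R)
    (hX : ∀ α β, X β α = M β α - P0 β α - (4 * Complex.I) • (t α * b β))
    (hM : ∀ α β, M0 β α = P0 β α + (4 * Complex.I) • (t α * b0 β))
    (hk : ∀ α β y, y * k β α = k β α * y)
    (h : ∀ α β, b β * t α = -(t α * b β)) (h0 : ∀ α β, b0 β * t α = -(t α * b0 β)) (β : Fin 2) :
    ∑ γ, (M * k) β γ * b γ - ∑ γ, (M0 * k) β γ * b0 γ =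
    ∑ γ, (M * k) β γ * (b γ - b0 γ) + ∑ α, X β α * ∑ γ, k α γ * b0 γ +
      (b β - b0 β) * -((4 * Complex.I) • ∑ α, t α * ∑ γ, k α γ * b0 γ) := by
  have h' : ∀ α β y, b β * (t α * y) = -(t α * (b β * y)) := fun α β y => by
    rw [← mul_assoc, h, neg_mul, mul_assoc]
  have h0' : ∀ α β y, b0 β * (t α * y) = -(t α * (b0 β * y)) := fun α β y => by
    rw [← mul_assoc, h0, neg_mul, mul_assoc]
  have hk' : ∀ α β y z, y * (k β α * z) = k β α * (y * z) := fun α β y z => by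
    rw [← mul_assoc, hk, mul_assoc]
  simp only [Matrix.mul_apply, Fin.sum_univ_two, hX, hM, mul_add, add_mul, mul_sub, sub_mul,
    mul_smul_comm, smul_mul_assoc, mul_assoc, hk', h', h0', smul_add, mul_neg]
  module

lemma cov_th_K {M0 P0 P X : Matrix (Fin 2) (Fin 2) R} {t t0 b0 : Fin 2 → R}
    (k : Matrix (Fin 2) (Fin 2) R)
    (hX : ∀ α β, X β α = M0 β α - P β α - (4 * Complex.I) • (t α * b0 β))
    (hM : ∀ α β, M0 β α = P0 β α + (4 * Complex.I) • (t0 α * b0 β))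
    (hk : ∀ α β y, y * k β α = k β α * y)
    (h : ∀ α β, b0 β * t α = -(t α * b0 β)) (h0 : ∀ α β, b0 β * t0 α = -(t0 α * b0 β)) (α : Fin 2) :
    ∑ γ, t0 γ * (k * P0) γ α - ∑ γ, t γ * (k * P) γ α =
    ∑ γ, (t0 γ - t γ) * (k * P) γ α + ∑ β, (∑ γ, t0 γ * k γ β) * X β α +
      ((4 * Complex.I) • ∑ α, t0 α * ∑ γ, k α γ * b0 γ) * (t0 α - t α) := by
  have hk' : ∀ α β y z, y * (k β α * z) = k β α * (y * z) := fun α β y z => by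
    rw [← mul_assoc, hk, mul_assoc]
  simp only [Matrix.mul_apply, Fin.sum_univ_two, hX, hM, mul_add, add_mul, mul_sub, sub_mul,
    mul_smul_comm, smul_mul_assoc, mul_assoc, hk', smul_add, h, h0, mul_neg, smul_neg]
  module

variable {S : Type*} [CommRing S] [Algebra S R]

/-- Jacobi's formula for the variation `AX + XB` of a determinant. Only the entries of `X` are
central; those of `A` and `B` may be odd, so everything is collected as combinations of them with
scalar coefficients. -/
lemma cov_det (x : Matrix (Fin 2) (Fin 2) S) (A B : Matrix (Fin 2) (Fin 2) R) {X : Matrix (Fin 2) (Fin 2) R}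
    (hX : X = x.map (algebraMap S R)) :
    (A * X + X * B) 0 0 * X 1 1 + X 0 0 * (A * X + X * B) 1 1 -
      ((A * X + X * B) 0 1 * X 1 0 + X 0 1 * (A * X + X * B) 1 0) =
    (A.trace + B.trace) * (X 0 0 * X 1 1 - X 0 1 * X 1 0) := by
  have e : ∀ (s : S) (y : R), algebraMap S R s * y = s • y := fun s y => (Algebra.smul_def s y).symm
  have e' : ∀ (s : S) (y : R), y * algebraMap S R s = s • y := fun s y => by
    rw [← Algebra.commutes, Algebra.smul_def]
  subst hX
  simp only [Matrix.mul_apply, Matrix.add_apply, Matrix.map_apply, Matrix.trace_fin_two,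
    Fin.sum_univ_two, e, e', mul_sub, smul_add, smul_smul, mul_smul_comm]
  module

/-- The adjugate of a matrix of size two. -/
def adj2 {R : Type*} [Ring R] (X : Matrix (Fin 2) (Fin 2) R) : Matrix (Fin 2) (Fin 2) R :=
  !![X 1 1, - X 0 1; - X 1 0, X 0 0]

lemma adj2_apply {R : Type*} [Ring R] (X : Matrix (Fin 2) (Fin 2) R) : adj2 X 0 0 = X 1 1 ∧
    adj2 X 0 1 = - X 0 1 ∧ adj2 X 1 0 = - X 1 0 ∧ adj2 X 1 1 = X 0 0 := ⟨rfl, rfl, rfl, rfl⟩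

/-- For matrices of size two the adjugate is linear, reverses products and equals the trace minus
the matrix. Hence `AX` contributes `adj X (tr A - A)` and `XB` contributes `(tr B - B) adj X`. -/
lemma cov_adj (x : Matrix (Fin 2) (Fin 2) S) (A B : Matrix (Fin 2) (Fin 2) R) {X : Matrix (Fin 2) (Fin 2) R}
    (hX : X = x.map (algebraMap S R)) :
    adj2 (A * X + X * B) = (A.trace + B.trace) • adj2 X - adj2 X * A - B * adj2 X := by
  have e : ∀ (s : S) (y : R), algebraMap S R s * y = s • y := fun s y => (Algebra.smul_def s y).symm
  have e' : ∀ (s : S) (y : R), y * algebraMap S R s = s • y := fun s y => by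
    rw [← Algebra.commutes, Algebra.smul_def]
  subst hX
  ext i j
  fin_cases i <;> fin_cases j <;>
  simp only [Fin.zero_eta, Fin.mk_one, Fin.isValue, adj2_apply, Matrix.sub_apply, Matrix.smul_apply,
    Matrix.mul_apply, Fin.sum_univ_two, Matrix.add_apply, Matrix.map_apply, Matrix.trace_fin_two,
    smul_eq_mul, mul_neg, neg_mul, e, e', smul_add] <;> module

end abstract

/-! ### Transformation of differences of odd coordinates -/

/-- The inhomogeneous part of the transformation of `θbar_i - θbar_0`. -/
def Generator.shiftBar (c : Config) : Generator → Fin 2 → Grassmann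
  | .K k => fun α => ∑ γ, k.map (algebraMap ℂ Grassmann) α γ * tb c 0 γ
  | .S γ => fun α => if α = γ then 1 else 0
  | _ => 0

/-- The inhomogeneous part of the transformation of `θ_0 - θ_j`. -/
def Generator.shift (c : Config) : Generator → Fin 2 → Grassmann
  | .K k => fun β => ∑ γ, th c 0 γ * k.map (algebraMap ℂ Grassmann) γ β
  | .Sbar γ => fun β => if β = γ then 1 else 0
  | _ => 0

/-- The scalar part of the transformation of `θbar_i - θbar_0`. -/
def Generator.scale (c : Config) : Generator → Grassmann
  | .K k => -((4 * Complex.I) • ∑ α, th c 0 α * ∑ γ, k.map (algebraMap ℂ Grassmann) α γ * tb c 0 γ)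
  | .S γ => (-4 * Complex.I) • th c 0 γ
  | .Sbar γ => (4 * Complex.I) • tb c 0 γ
  | _ => 0

/-- The scalar part of the transformation of `θ_0 - θ_j`. -/
def Generator.scale' (V : Generator) (c : Config) : Grassmann :=
  if V.isOdd then V.scale c else - V.scale c

lemma map_comm (k : Matrix (Fin 2) (Fin 2) ℂ) (α β : Fin 2) (y : Grassmann) :
    y * k.map (algebraMap ℂ Grassmann) β α = k.map (algebraMap ℂ Grassmann) β α * y :=
  (Algebra.commutes (k β α) y).symm

/-- The inhomogeneous term has the form `x̃_{ī1} · h` with a vector `h` that does not depend on `i`.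
After multiplication with the inverse interval it becomes `h`, and it cancels in the difference of
two points that defines `Θ̃`. -/
lemma onThetaBar_sub (V : Generator) (i : Fin 4) (β : Fin 2) (c : Config) :
    V.onThetaBar i β c - V.onThetaBar 0 β c =
      ∑ γ, V.left i c β γ * (tb c i γ - tb c 0 γ) + ∑ α, XI c i 0 β α * V.shiftBar c α +
      (tb c i β - tb c 0 β) * V.scale c := by
  cases V with
  | P a => simp [Generator.onThetaBar, Generator.left, Generator.shiftBar, Generator.scale]
  | L m => simp [Generator.onThetaBar, Generator.left, Generator.shiftBar, Generator.scale]
  | Lbar n =>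
    simp only [Generator.onThetaBar, Generator.left, Generator.shiftBar, Generator.scale,
      mulVec_eval, evm_const, Pi.zero_apply, mul_zero, Finset.sum_const_zero, add_zero, mul_sub,
      Finset.sum_sub_distrib]
    rfl
  | K k =>
    simp only [Generator.onThetaBar, Generator.left, Generator.shiftBar, Generator.scale,
      mulVec_eval, evm_const, map_mul]
    exact cov_tb_K _ (XI_eq c i 0) (fun α β => xMinus_mat 0 α β c) (map_comm k)
      (tb_th c i 0) (tb_th c 0 0) β
  | Q γ => simp [Generator.onThetaBar, Generator.left, Generator.shiftBar, Generator.scale]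
  | Qbar γ =>
    simp [Generator.onThetaBar, Generator.left, Generator.shiftBar, Generator.scale, single_eval]
  | S γ =>
    simp only [Generator.onThetaBar, Generator.left, Generator.shiftBar, Generator.scale,
      Matrix.zero_apply, zero_mul, Finset.sum_const_zero, zero_add, mul_ite, mul_one, mul_zero,
      Finset.sum_ite_eq', Finset.mem_univ, if_true]
    simp only [XI_eq, mul_smul_comm, sub_mul, tb_th]
    have := xMinus_mat 0 γ β c
    change XM c i β γ - XM c 0 β γ = _
    rw [show XM c 0 β γ = _ from this]
    simp only [th, tb, XP, evm_apply]
    module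
  | Sbar γ =>
    have h1 : tb c i γ * tb c i β = -(tb c i β * tb c i γ) :=
      (thetaBar_od i γ c).anticomm (thetaBar_od i β c)
    have h2 : tb c 0 γ * tb c 0 β = -(tb c 0 β * tb c 0 γ) :=
      (thetaBar_od 0 γ c).anticomm (thetaBar_od 0 β c)
    simp only [Generator.left, Generator.shiftBar, Generator.scale,
      Matrix.of_apply, ite_mul, zero_mul, Pi.zero_apply, mul_zero, Finset.sum_const_zero, add_zero,
      Finset.sum_ite_eq', Finset.mem_univ, if_true]
    simp only [mul_smul_comm, smul_mul_assoc, sub_mul, mul_sub]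
    change (-4 * Complex.I) • (tb c i γ * tb c i β) - (-4 * Complex.I) • (tb c 0 γ * tb c 0 β) = _
    rw [h1, h2]
    module

lemma onTheta_sub (V : Generator) (j : Fin 4) (α : Fin 2) (c : Config) :
    V.onTheta 0 α c - V.onTheta j α c =
      ∑ γ, V.sg (th c 0 γ - th c j γ) * V.right j c γ α + ∑ β, V.shift c β * XI c 0 j β α +
      V.scale' c * (th c 0 α - th c j α) := by
  cases V with
  | P a => simp [Generator.onTheta, Generator.right, Generator.shift, Generator.scale,
      Generator.scale']
  | Lbar m => simp [Generator.onTheta, Generator.right, Generator.shift, Generator.scale,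
      Generator.scale']
  | L n =>
    simp only [Generator.onTheta, Generator.right, Generator.shift, Generator.scale,
      Generator.scale', sg_even (V := .L n) rfl, neg_zero, ite_self, Generator.isOdd,
      vecMul_eval, evm_const, Pi.zero_apply, zero_mul, Finset.sum_const_zero, add_zero, sub_mul,
      Finset.sum_sub_distrib]
    rfl
  | K k =>
    simp only [Generator.onTheta, Generator.right, Generator.shift, Generator.scale,
      Generator.scale', sg_even (V := .K k) rfl, neg_neg, Generator.isOdd, if_false,
      Bool.false_eq_true, vecMul_eval, evm_const, map_mul]
    exact cov_th_K _ (XI_eq c 0 j) (fun α β => xMinus_mat 0 α β c) (map_comm k)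
      (tb_th c 0 j) (tb_th c 0 0) α
  | Qbar γ => simp [Generator.onTheta, Generator.right, Generator.shift, Generator.scale,
      Generator.scale']
  | Q γ =>
    simp [Generator.onTheta, Generator.right, Generator.shift, Generator.scale,
      Generator.scale', single_eval]
  | S γ =>
    simp only [Generator.right, Generator.shift, Generator.scale,
      Generator.scale', Generator.isOdd, if_true, Pi.zero_apply, zero_mul, Finset.sum_const_zero,
      add_zero, Matrix.of_apply, mul_ite, mul_zero, Finset.sum_ite_eq', Finset.mem_univ]
    rw [show (Generator.S γ).sg (th c 0 γ - th c j γ) = -(th c 0 γ - th c j γ) from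
      sg_odd rfl ((theta_od 0 γ c).sub (theta_od j γ c))]
    simp only [mul_smul_comm, smul_mul_assoc]
    change (-4 * Complex.I) • (th c 0 γ * th c 0 α) - (-4 * Complex.I) • (th c j γ * th c j α) = _
    simp only [neg_sub, sub_mul, mul_sub]
    module
  | Sbar γ =>
    simp only [Generator.right, Generator.shift, Generator.scale,
      Generator.scale', Generator.isOdd, if_true, Matrix.zero_apply, mul_zero,
      Finset.sum_const_zero, zero_add, ite_mul, one_mul, zero_mul, Finset.sum_ite_eq',
      Finset.mem_univ]
    simp only [XI_eq, smul_mul_assoc, mul_sub, tb_th]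
    change XP c 0 γ α - XP c j γ α = _
    rw [show XM c 0 γ α = _ from xMinus_mat 0 α γ c]
    simp only [th, tb, XP, evm_apply]
    module

/-! ### Squared and inverse intervals -/

lemma XI_lift (c : Config) (i j : Fin 4) :
    ∃ x : Matrix (Fin 2) (Fin 2) Cen, XI c i j = x.map (algebraMap Cen Grassmann) := by
  choose x hx using fun β α => (interval_evM c i j β α).lift
  exact ⟨Matrix.of x, by ext β α; exact (hx β α).symm⟩

lemma toMat_eq (v : Fin 4 → SuperFun) : toMat v =
    !![toMatTilde v 1 1, - toMatTilde v 0 1; - toMatTilde v 1 0, toMatTilde v 0 0] := by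
  ext α β
  fin_cases α <;> fin_cases β <;>
  simp [toMat, toMatTilde, Fin.sum_univ_four, eta, sigma, sigmaTilde] <;> abel

lemma mink_det {S : Type*} [CommRing S] [Algebra ℂ S] (x : Fin 4 → S) :
    ∑ μ, eta μ • (x μ * x μ) = (∑ μ, (eta μ * sigmaTilde μ 0 0) • x μ) *
      (∑ μ, (eta μ * sigmaTilde μ 1 1) • x μ) - (∑ μ, (eta μ * sigmaTilde μ 0 1) • x μ) *
      (∑ μ, (eta μ * sigmaTilde μ 1 0) • x μ) := by
  have h : algebraMap ℂ S Complex.I * algebraMap ℂ S Complex.I = -1 := by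
    rw [← map_mul, Complex.I_mul_I, map_neg, map_one]
  simp [Fin.sum_univ_four, eta, sigma, sigmaTilde, Algebra.smul_def]
  linear_combination (-(x 2 * x 2)) * h

lemma minkDot_eq {v : Fin 4 → SuperFun} {c : Config} (hv : ∀ μ, Ev (v μ c)) : minkDot v v c =
    toMatTilde v 0 0 c * toMatTilde v 1 1 c - toMatTilde v 0 1 c * toMatTilde v 1 0 c := by
  choose x hx using fun μ => (hv μ).lift
  replace hx : ∀ μ, v μ c = cenVal (x μ) := fun μ => (hx μ).symm
  simp only [minkDot, toMatTilde_apply, Finset.sum_apply, Pi.smul_apply, Pi.mul_apply, hx]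
  simp only [← map_mul, ← map_smul, ← map_sum, ← map_sub]
  exact congrArg _ (mink_det x)

lemma intervalSq_apply (i j : Fin 4) (c : Config) : intervalSq i j c =
    XI c i j 0 0 * XI c i j 1 1 - XI c i j 0 1 * XI c i j 1 0 := minkDot_eq fun μ => interval_ev i j μ c

lemma intervalSq_eq (i j : Fin 4) : intervalSq i j =
    toMatTilde (interval i j) 0 0 * toMatTilde (interval i j) 1 1 -
      toMatTilde (interval i j) 0 1 * toMatTilde (interval i j) 1 0 :=
  funext fun c => intervalSq_apply i j c

lemma intervalSq_ev (i j : Fin 4) (c : Config) : Ev (intervalSq i j c) := by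
  rw [intervalSq_apply]
  exact ((interval_evM c i j _ _).mul (interval_evM c i j _ _)).sub
    ((interval_evM c i j _ _).mul (interval_evM c i j _ _))

lemma sinv_ev {F : SuperFun} {c : Config} (h : Ev (F c)) : Ev (sinv F c) := h.ringInverse

/-- The trace of the left transformation matrix. -/
def Generator.wl (V : Generator) (c : Config) (i : Fin 4) : Grassmann := (V.left i c).trace
/-- The trace of the right transformation matrix. -/
def Generator.wr (V : Generator) (c : Config) (i : Fin 4) : Grassmann := (V.right i c).trace

lemma hasAct_intervalSq (V : Generator) (i j : Fin 4) (c : Config) :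
    HasAct V c (intervalSq i j) ((V.wl c i + V.wr c j) * intervalSq i j c) := by
  obtain ⟨x, hx⟩ := XI_lift c i j
  have h := hasAct_interval V i j
  have := ((h 0 0 c).mul_ev (h 1 1 c) (interval_evM c i j _ _)).sub
    ((h 0 1 c).mul_ev (h 1 0 c) (interval_evM c i j _ _))
  rw [intervalSq_eq]
  convert this using 1
  have h2 := cov_det x (V.left i c) (V.right j c) hx
  rw [← intervalSq_eq, intervalSq_apply]
  exact h2.symm

lemma toMat_interval (c : Config) (i j : Fin 4) :
    evm c (toMat (interval i j)) = adj2 (XI c i j) := by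
  rw [toMat_eq]
  ext α β
  fin_cases α <;> fin_cases β <;> rfl

/-- The values of `x̃_{īj}⁻¹`. -/
def XJ (c : Config) (i j : Fin 4) : Matrix (Fin 2) (Fin 2) Grassmann :=
  evm c (intervalTildeInv i j)

lemma XJ_eq (c : Config) (i j : Fin 4) : XJ c i j = sinv (intervalSq i j) c • adj2 (XI c i j) := by
  rw [← toMat_interval]; rfl

lemma smul_eq_center (s : Grassmann) {z : Cen} (h : algebraMap Cen Grassmann z = s)
    (M : Matrix (Fin 2) (Fin 2) Grassmann) : s • M = z • M := by
  ext α β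
  rw [Matrix.smul_apply, Matrix.smul_apply, ← h, smul_eq_mul, ← Algebra.smul_def]

lemma adj2_mul {S R : Type*} [CommRing S] [Ring R] [Algebra S R] (x : Matrix (Fin 2) (Fin 2) S)
    {X : Matrix (Fin 2) (Fin 2) R} (hX : X = x.map (algebraMap S R)) :
    adj2 X * X = (X 0 0 * X 1 1 - X 0 1 * X 1 0) • (1 : Matrix (Fin 2) (Fin 2) R) ∧
    X * adj2 X = (X 0 0 * X 1 1 - X 0 1 * X 1 0) • (1 : Matrix (Fin 2) (Fin 2) R) := by
  subst hX
  have h0 : ∀ a : S, a = 0 → algebraMap S R a = 0 := fun a h => by rw [h, map_zero]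
  have h1 : ∀ a b : S, a = b → algebraMap S R a = algebraMap S R b := fun a b h => by rw [h]
  constructor <;> ext i j <;> fin_cases i <;> fin_cases j <;>
  simp [adj2_apply, Matrix.mul_apply, Fin.sum_univ_two, ← map_mul, ← map_sub, ← map_neg,
    ← map_add] <;> first | (apply h1; ring1) | (apply h0; ring1)

lemma XJ_mul {c : Config} {i j : Fin 4} (hu : IsUnit (intervalSq i j c)) :
    XJ c i j * XI c i j = 1 ∧ XI c i j * XJ c i j = 1 := by
  obtain ⟨x, hx⟩ := XI_lift c i j
  obtain ⟨z, hz⟩ := (sinv_ev (intervalSq_ev i j c)).lift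
  have h := adj2_mul x hx
  rw [← intervalSq_apply] at h
  rw [XJ_eq, smul_eq_center _ hz, smul_mul_assoc, mul_smul_comm, h.1, h.2, ← smul_eq_center _ hz,
    smul_smul, show sinv (intervalSq i j) c * intervalSq i j c = 1 from
    Ring.inverse_mul_cancel _ hu, one_smul]
  exact ⟨rfl, rfl⟩

/-- `D` is the value of `V M` at `c`. -/
def HasActM (V : Generator) (c : Config) (M : Matrix (Fin 2) (Fin 2) SuperFun)
    (D : Matrix (Fin 2) (Fin 2) Grassmann) : Prop := ∀ α β, HasAct V c (M α β) (D α β)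

lemma HasActM.mul {V : Generator} {c : Config} {M N : Matrix (Fin 2) (Fin 2) SuperFun}
    {D E : Matrix (Fin 2) (Fin 2) Grassmann} (hM : HasActM V c M D) (hN : HasActM V c N E)
    (he : EvM c M) : HasActM V c (M * N) (D * evm c N + evm c M * E) := fun α β => by
  have := HasAct.sum (s := Finset.univ) fun γ _ => (hM α γ).mul_ev (hN γ β) (he α γ)
  rw [Finset.sum_add_distrib] at this
  exact this

lemma HasActM.neg {V : Generator} {c : Config} {M : Matrix (Fin 2) (Fin 2) SuperFun}
    {D : Matrix (Fin 2) (Fin 2) Grassmann} (hM : HasActM V c M D) : HasActM V c (-M) (-D) :=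
  fun α β => (hM α β).neg

lemma sinv_weight {R : Type*} [Ring R] {q s : R} (h : q * s = 1) (w : R) :
    s * (w * q) * s = s * w := by
  rw [mul_assoc, mul_assoc w, h, mul_one]

lemma hasActM_intervalInv {V : Generator} {i j : Fin 4} {c : Config}
    (hu : IsUnit (intervalSq i j c)) : HasActM V c (intervalInv i j)
      (V.left i c * evm c (intervalInv i j) + evm c (intervalInv i j) * V.right j c -
        (V.wl c i + V.wr c j) • evm c (intervalInv i j)) := fun α β => by
  have h := ((hasAct_intervalSq V i j c).sinv hu (intervalSq_ev i j c)).mul_ev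
    (hasAct_interval V i j α β c) (sinv_ev (intervalSq_ev i j c))
  change HasAct V c (sinv (intervalSq i j) * toMatTilde (interval i j) α β) _
  convert h using 1
  have e : evm c (intervalInv i j) = sinv (intervalSq i j) c • XI c i j := rfl
  obtain ⟨z, hz⟩ := (sinv_ev (intervalSq_ev i j c)).lift
  rw [e, smul_eq_center _ hz, mul_smul_comm, smul_mul_assoc, ← smul_eq_center _ hz,
    ← smul_eq_center _ hz, ← smul_eq_center _ hz]
  simp only [Matrix.sub_apply, Matrix.add_apply, Matrix.smul_apply, smul_eq_mul, mul_add]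
  rw [sinv_weight (show intervalSq i j c * sinv (intervalSq i j) c = 1 from
    Ring.mul_inverse_cancel _ hu), (sinv_ev (intervalSq_ev i j c)).comm (_ + _)]
  rw [show toMatTilde (interval i j) α β c = XI c i j α β from rfl]
  noncomm_ring

lemma hasActM_toMat (V : Generator) (i j : Fin 4) (c : Config) : HasActM V c (toMat (interval i j))
      ((V.wl c i + V.wr c j) • evm c (toMat (interval i j)) - evm c (toMat (interval i j)) *
        V.left i c - V.right j c * evm c (toMat (interval i j))) := by
  obtain ⟨x, hx⟩ := XI_lift c i j
  rw [toMat_interval]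
  have h := cov_adj x (V.left i c) (V.right j c) hx
  rw [Generator.wl, Generator.wr, ← h, toMat_eq]
  intro α β
  fin_cases α <;> fin_cases β
  · exact hasAct_interval V i j 1 1 c
  · exact (hasAct_interval V i j 0 1 c).neg
  · exact (hasAct_interval V i j 1 0 c).neg
  · exact hasAct_interval V i j 0 0 c

lemma hasActM_intervalTildeInv {V : Generator} {i j : Fin 4} {c : Config}
    (hu : IsUnit (intervalSq i j c)) : HasActM V c (intervalTildeInv i j)
      (- (XJ c i j * V.left i c) - V.right j c * XJ c i j) := fun α β => by
  have h := ((hasAct_intervalSq V i j c).sinv hu (intervalSq_ev i j c)).mul_ev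
    (hasActM_toMat V i j c α β) (sinv_ev (intervalSq_ev i j c))
  change HasAct V c (sinv (intervalSq i j) * toMat (interval i j) α β) _
  convert h using 1
  have e : XJ c i j = sinv (intervalSq i j) c • evm c (toMat (interval i j)) := rfl
  obtain ⟨z, hz⟩ := (sinv_ev (intervalSq_ev i j c)).lift
  rw [e, smul_eq_center _ hz, mul_smul_comm, smul_mul_assoc, ← smul_eq_center _ hz,
    ← smul_eq_center _ hz]
  simp only [Matrix.sub_apply, Matrix.neg_apply, Matrix.smul_apply, smul_eq_mul, mul_sub]
  rw [sinv_weight (show intervalSq i j c * sinv (intervalSq i j) c = 1 from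
    Ring.mul_inverse_cancel _ hu)]
  rw [show toMat (interval i j) α β c = evm c (toMat (interval i j)) α β from rfl]
  noncomm_ring

/-! ## Invariance -/

lemma HasAct.cast {V : Generator} {c : Config} {F : SuperFun} {d e : Grassmann}
    (h : HasAct V c F d) (he : d = e) : HasAct V c F e := he ▸ h

lemma EvM.lift {c : Config} {M : Matrix (Fin 2) (Fin 2) SuperFun} (h : EvM c M) :
    ∃ x : Matrix (Fin 2) (Fin 2) Cen, evm c M = x.map (algebraMap Cen Grassmann) := by
  choose x hx using fun β α => (h β α).lift
  exact ⟨Matrix.of x, by ext β α; exact (hx β α).symm⟩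

lemma EvM.mul_smul {c : Config} {M : Matrix (Fin 2) (Fin 2) SuperFun} (h : EvM c M)
    (w : Grassmann) (N : Matrix (Fin 2) (Fin 2) Grassmann) :
    evm c M * (w • N) = w • (evm c M * N) := by
  ext α β
  simp only [Matrix.mul_apply, Matrix.smul_apply, smul_eq_mul, Fin.sum_univ_two, mul_add,
    ← mul_assoc, evm_apply, (h _ _).comm w]

lemma toMat_evM (c : Config) (i j : Fin 4) : EvM c (toMat (interval i j)) :=
  toMat_ev fun μ => interval_ev i j μ c
lemma intervalInv_evM (c : Config) (i j : Fin 4) : EvM c (intervalInv i j) :=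
  fun α β => (sinv_ev (intervalSq_ev i j c)).mul (interval_evM c i j α β)
lemma intervalTildeInv_evM (c : Config) (i j : Fin 4) : EvM c (intervalTildeInv i j) :=
  fun α β => (sinv_ev (intervalSq_ev i j c)).mul (toMat_evM c i j α β)

/-- In the product of the three factors the inner matrices `B3` and `A1` occur with both signs and
cancel, and so do their traces `w3` and `w1`. Only the two outer ends of the chain remain. -/
lemma chain_identity {R M : Type*} [Ring R] [Ring M] [Module R M] [IsScalarTower R M M]
    (w0 w0' w1 w3 : R) (p y q A0 A1 B0 B3 : M)
    (hp : ∀ (w : R) (x : M), p * (w • x) = w • (p * x))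
    (hy : ∀ (w : R) (x : M), y * (w • x) = w • (y * x)) :
    ((A0 * p + p * B3 - (w0 + w3) • p) * y + p * ((w1 + w3) • y - y * A1 - B3 * y)) * q +
      p * y * (A1 * q + q * B0 - (w1 + w0') • q) =
    A0 * (p * y * q) + p * y * q * B0 - (w0 + w0') • (p * y * q) := by
  simp only [mul_sub, sub_mul, mul_add, add_mul, smul_mul_assoc, hp, hy, mul_assoc, add_smul]
  abel

lemma hasActM_chain {V : Generator} {c : Config} {i j k l : Fin 4}
    (h1 : IsUnit (intervalSq i j c)) (h2 : IsUnit (intervalSq k l c)) :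
    HasActM V c (intervalInv i j * toMat (interval k j) * intervalInv k l)
      (V.left i c * evm c (intervalInv i j * toMat (interval k j) * intervalInv k l) +
        evm c (intervalInv i j * toMat (interval k j) * intervalInv k l) * V.right l c -
        (V.wl c i + V.wr c l) •
          evm c (intervalInv i j * toMat (interval k j) * intervalInv k l)) := by
  have h := ((hasActM_intervalInv h1).mul (hasActM_toMat V k j c) (intervalInv_evM c i j)).mul
    (hasActM_intervalInv h2) ((intervalInv_evM c i j).mul (toMat_evM c k j))
  rw [map_mul, map_mul, ← chain_identity _ (V.wr c l) (V.wl c k) (V.wr c j) _ _ _ _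
    (V.left k c) _ (V.right j c) (intervalInv_evM c i j).mul_smul (toMat_evM c k j).mul_smul]
  rwa [map_mul] at h

lemma XTilde_evM (n : Fin 2) (c : Config) : EvM c (XTilde n) := by
  fin_cases n
  · exact fun α β => ((((intervalInv_evM c 0 3).mul (toMat_evM c 1 3)).mul
      (intervalInv_evM c 1 0)) α β).neg
  · exact ((intervalInv_evM c 0 2).mul (toMat_evM c 3 2)).mul (intervalInv_evM c 3 0)

/-! ### Bodies and configurations -/

lemma body_theta (i : Fin 4) (α : Fin 2) (c : Config) : body (theta i α c) = 0 := body_ι _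
lemma body_thetaBar (i : Fin 4) (α : Fin 2) (c : Config) : body (thetaBar i α c) = 0 := body_ι _

lemma body_interval (i j μ : Fin 4) (c : Config) : body (interval i j μ c) = (c i μ - c j μ : ℝ) := by
  simp [interval, xMinus, xPlus, bilinear_apply, body_theta, xCoord]

lemma body_intervalSq (i j : Fin 4) (c : Config) : body (intervalSq i j c) = (distSq c i j : ℝ) := by
  simp [intervalSq, minkDot, body_interval, Fin.sum_univ_four, eta, distSq]
  ring

lemma isUnit_intervalSq {c : Config} (hc : c ∈ nondegenerate) {i j : Fin 4} (h : i ≠ j) :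
    IsUnit (intervalSq i j c) := by
  rw [isUnit_iff_body, body_intervalSq]
  exact Complex.ofReal_ne_zero.2 (hc i j h)

lemma continuous_distSq (i j : Fin 4) : Continuous fun c : Config => distSq c i j := by
  unfold distSq; fun_prop

lemma isOpen_nondegenerate : IsOpen nondegenerate := by
  have : nondegenerate = ⋂ i : Fin 4, ⋂ j : Fin 4, {c | i ≠ j → distSq c i j ≠ 0} := by
    ext c; simp [nondegenerate]
  rw [this]
  refine isOpen_iInter_of_finite fun i => isOpen_iInter_of_finite fun j => ?_
  by_cases h : i = j
  · simp [h]
  · simpa [h] using isOpen_ne_fun (continuous_distSq i j) continuous_const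

lemma isOpen_regular : IsOpen regular := by
  refine isOpen_nondegenerate.inter (isOpen_ne_fun ?_ continuous_const)
  have := continuous_distSq
  fun_prop

lemma isInvariantOn_iff {F : SuperFun} {U : Set Config} (hU : IsOpen U) :
    IsInvariantOn F U ↔ ∀ c ∈ U, ∀ V : Generator, HasAct V c F 0 := by
  rw [IsInvariantOn, smoothOn_iff]
  refine ⟨fun h c hc V => ⟨h.1.contDiffAt (hU.mem_nhds hc), h.2 V hc⟩, fun h => ⟨fun c hc => ?_, ?_⟩⟩
  · exact (h c hc (.P 0)).smooth.contDiffWithinAt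
  · exact fun V c hc => (h c hc V).eq

/-! ### Weights -/

/-- The even superfunction `F` has weight `w`. -/
structure HasWt (V : Generator) (c : Config) (F : SuperFun) (w : Grassmann) : Prop where
  act : HasAct V c F (w * F c)
  ev : Ev (F c)

namespace HasWt
variable {V : Generator} {c : Config} {F G : SuperFun} {v w : Grassmann}

lemma of_eq (h : HasWt V c F w) (e : w = v) : HasWt V c F v := e ▸ h

lemma mul (hF : HasWt V c F w) (hG : HasWt V c G v) : HasWt V c (F * G) (w + v) := by
  refine ⟨?_, hF.ev.mul hG.ev⟩
  have h := hF.act.mul_ev hG.act hF.ev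
  rwa [← mul_assoc (F c), hF.ev.comm v, mul_assoc v, mul_assoc w, ← add_mul] at h

lemma sinv (hF : HasWt V c F w) (hu : IsUnit (F c)) : HasWt V c (sinv F) (-w) := by
  refine ⟨?_, sinv_ev hF.ev⟩
  have h := hF.act.sinv hu hF.ev
  rwa [sinv_weight (show F c * FourPoint.sinv F c = 1 from Ring.mul_inverse_cancel _ hu),
    (sinv_ev hF.ev).comm, ← neg_mul] at h

lemma zero_iff : HasWt V c F 0 ↔ HasAct V c F 0 ∧ Ev (F c) :=
  ⟨fun h => ⟨by simpa using h.act, h.ev⟩, fun h => ⟨by simpa using h.1, h.2⟩⟩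

lemma act_zero (h : HasWt V c F 0) : HasAct V c F 0 := (zero_iff.1 h).1
end HasWt

lemma hasWt_intervalSq (V : Generator) (i j : Fin 4) (c : Config) :
    HasWt V c (intervalSq i j) (V.wl c i + V.wr c j) :=
  ⟨hasAct_intervalSq V i j c, intervalSq_ev i j c⟩

lemma isUnit_sinv {F : SuperFun} {c : Config} (h : IsUnit (F c)) : IsUnit (sinv F c) := by
  obtain ⟨u, hu⟩ := h
  rw [sinv, ← hu, Ring.inverse_unit]; exact u⁻¹.isUnit

lemma hasWt_sinv_intervalSq {c : Config} (hc : c ∈ nondegenerate) (V : Generator) {i j : Fin 4}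
    (h : i ≠ j) : HasWt V c (sinv (intervalSq i j)) (-(V.wl c i + V.wr c j)) :=
  (hasWt_intervalSq V i j c).sinv (isUnit_intervalSq hc h)

/-- The barred labels `r`, `t` and the unbarred labels `s`, `u` each occur once in the numerator and
once in the denominator. -/
lemma hasWt_crossRatio {c : Config} (hc : c ∈ nondegenerate) (V : Generator) {r s t u : Fin 4}
    (h : r ≠ u) (h' : t ≠ s) : HasWt V c (crossRatio r s t u) 0 :=
  ((((hasWt_intervalSq V r s c).mul (hasWt_intervalSq V t u c)).mul
    (hasWt_sinv_intervalSq hc V h)).mul (hasWt_sinv_intervalSq hc V h')).of_eq (by abel)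

lemma crossI_wt {c : Config} (hc : c ∈ nondegenerate) (V : Generator) (k : Fin 6) :
    HasWt V c (crossI k) 0 := by
  fin_cases k <;> exact hasWt_crossRatio hc V (by decide) (by decide)

/-- The labels `i` and `j` cancel, so the weight belongs to the point `0` alone. All quantities of
this shape have the same weight, and the ratios `J₁`, `J k` are invariant. -/
lemma triple_wt {c : Config} (hc : c ∈ nondegenerate) (V : Generator) {i j : Fin 4} (hi : i ≠ 0)
    (hj : j ≠ 0) :
    HasWt V c (intervalSq i j * sinv (intervalSq i 0) * sinv (intervalSq 0 j))
      (-(V.wl c 0 + V.wr c 0)) :=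
  (((hasWt_intervalSq V i j c).mul (hasWt_sinv_intervalSq hc V hi)).mul
    (hasWt_sinv_intervalSq hc V hj.symm)).of_eq (by abel)

lemma triple_unit {c : Config} (hc : c ∈ nondegenerate) {i j : Fin 4} (hi : i ≠ 0)
    (hj : j ≠ 0) (hij : i ≠ j) :
    IsUnit ((intervalSq i j * sinv (intervalSq i 0) * sinv (intervalSq 0 j)) c) :=
  ((isUnit_intervalSq hc hij).mul (isUnit_sinv (isUnit_intervalSq hc hi))).mul
    (isUnit_sinv (isUnit_intervalSq hc hj.symm))

lemma pt_ne (k : Fin 2) : pt k ≠ 0 ∧ pt k ≠ 3 := by revert k; decide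

lemma J₁_wt {c : Config} (hc : c ∈ nondegenerate) (V : Generator) : HasWt V c J₁ 0 :=
  ((triple_wt hc V (i := 1) (j := 2) (by decide) (by decide)).mul
    ((triple_wt hc V (i := 2) (j := 1) (by decide) (by decide)).sinv
      (triple_unit hc (by decide) (by decide) (by decide)))).of_eq (by abel)

lemma J_wt {c : Config} (hc : c ∈ nondegenerate) (V : Generator) (k : Fin 2) : HasWt V c (J k) 0 :=
  ((triple_wt hc V (i := pt k) (j := 3) (pt_ne k).1 (by decide)).mul
    ((triple_wt hc V (i := 3) (j := pt k) (by decide) (pt_ne k).1).sinv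
      (triple_unit hc (by decide) (pt_ne k).1 (pt_ne k).2.symm))).of_eq (by abel)

lemma unipotentSqrt_eq (F : SuperFun) : unipotentSqrt F =
    ∑ k ∈ Finset.range 17, ((Ring.choose (1 / 2 : ℚ) k : ℚ) : ℂ) • (F - 1) ^ k := by
  funext c; simp [unipotentSqrt]

lemma unipotentSqrt_wt {V : Generator} {c : Config} {F : SuperFun} (h : HasWt V c F 0) :
    HasWt V c (unipotentSqrt F) 0 := by
  rw [HasWt.zero_iff] at h ⊢
  constructor
  · rw [unipotentSqrt_eq]
    have h1 : HasAct V c (F - 1) 0 := by simpa using h.1.sub HasAct.one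
    simpa using HasAct.sum (s := Finset.range 17) fun k _ =>
      (h1.pow_zero_of k).smul ((Ring.choose (1 / 2 : ℚ) k : ℚ) : ℂ)
  · exact Ev.sum fun k _ => ((h.2.sub ev_one).pow k).smul _

lemma body_sinv {F : SuperFun} {c : Config} (h : IsUnit (F c)) :
    body (sinv F c) = (body (F c))⁻¹ := by
  obtain ⟨u, hu⟩ := h
  rw [sinv, ← hu, Ring.inverse_unit]
  refine eq_inv_of_mul_eq_one_left ?_
  rw [← map_mul, Units.inv_mul, map_one]

lemma distSq_comm (c : Config) (i j : Fin 4) : distSq c i j = distSq c j i := by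
  unfold distSq; ring

lemma body_triple {c : Config} (hc : c ∈ nondegenerate) {i j : Fin 4} (hi : i ≠ 0)
    (hj : j ≠ 0) :
    body ((intervalSq i j * sinv (intervalSq i 0) * sinv (intervalSq 0 j)) c) =
      ((distSq c i j / (distSq c 0 i * distSq c 0 j) : ℝ) : ℂ) := by
  simp only [Pi.mul_apply, map_mul, body_sinv (isUnit_intervalSq hc hi),
    body_sinv (isUnit_intervalSq hc hj.symm), body_intervalSq, distSq_comm c i 0]
  push_cast
  rw [div_eq_mul_inv, mul_inv, mul_assoc]

lemma body_J {c : Config} (hc : c ∈ nondegenerate) (k : Fin 2) : body (J k c) = 1 := by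
  rw [J, Pi.mul_apply, map_mul, XPlusSq, XMinusSq,
    body_sinv (triple_unit hc (by decide) (pt_ne k).1 (pt_ne k).2.symm),
    body_triple hc (pt_ne k).1 (by decide), body_triple hc (by decide) (pt_ne k).1,
    distSq_comm c 3, mul_comm (distSq c 0 3)]
  refine mul_inv_cancel₀ (Complex.ofReal_ne_zero.2 (div_ne_zero ?_ (mul_ne_zero ?_ ?_)))
  · exact hc _ _ (pt_ne k).2
  · exact hc _ _ (pt_ne k).1.symm
  · exact hc _ _ (by decide)

lemma body_unipotentSqrt {F : SuperFun} {c : Config} (h : body (F c) = 1) :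
    body (unipotentSqrt F c) = 1 := by
  simp only [unipotentSqrt, map_sum, map_smul, map_pow, map_sub, h, map_one, sub_self]
  rw [Finset.sum_eq_single 0 (fun k _ hk => by rw [zero_pow hk, smul_zero]) (by simp)]
  simp

lemma rootX_wt {c : Config} (hc : c ∈ nondegenerate) (V : Generator) :
    HasWt V c rootX (-(V.wl c 0 + V.wr c 0)) :=
  ((triple_wt hc V (i := 3) (j := pt 0) (by decide) (by decide)).mul
    (unipotentSqrt_wt (J_wt hc V 0))).of_eq (by abel)

lemma rootX_unit {c : Config} (hc : c ∈ nondegenerate) : IsUnit (rootX c) := by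
  refine (triple_unit hc (i := 3) (j := pt 0) (by decide) (by decide) (by decide)).mul ?_
  rw [isUnit_iff_body, body_unipotentSqrt (body_J hc 0)]; exact one_ne_zero

/-! ### The variables at the first point -/

section abstract
variable {R : Type*} [Ring R]

lemma cov_thetaBar {x y a b : Matrix (Fin 2) (Fin 2) R} (e : x * y = 1) (t : Fin 2 → R)
    (h : Fin 2 → R) (s : R) (α : Fin 2) :
    -(∑ γ, b α γ * ∑ δ, x γ δ * t δ) + (∑ γ, x α γ * t γ) * s + h α =
    ∑ β, ((-(x * a) - b * x) α β * t β +
      x α β * (∑ γ, a β γ * t γ + ∑ γ, y β γ * h γ + t β * s)) := by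
  have e0 : ∀ γ, x α 0 * y 0 γ + x α 1 * y 1 γ = (1 : Matrix (Fin 2) (Fin 2) R) α γ := fun γ => by
    rw [← e, Matrix.mul_apply, Fin.sum_univ_two]
  -- The bare inhomogeneous term is written as `(xy)h`, so that it matches the term `x(yh)` of the
  -- right-hand side.
  have e1 : h α = (x α 0 * y 0 0 + x α 1 * y 1 0) * h 0 + (x α 0 * y 0 1 + x α 1 * y 1 1) * h 1 := by
    rw [e0, e0]; revert e0; fin_cases α <;> intro e0 <;> simp [Matrix.one_apply]
  rw [e1]
  simp only [Matrix.sub_apply, Matrix.neg_apply, Matrix.mul_apply, Fin.sum_univ_two]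
  noncomm_ring

lemma cov_theta {x y a b : Matrix (Fin 2) (Fin 2) R} (e : y * x = 1) (t t' : Fin 2 → R)
    (h : Fin 2 → R) (s : R) (α : Fin 2) :
    -(∑ γ, (∑ δ, t' δ * x δ γ) * a γ α) + s * (∑ γ, t γ * x γ α) + h α =
    ∑ β, ((∑ γ, t' γ * b γ β + ∑ γ, h γ * y γ β + s * t β) * x β α +
      t' β * (-(x * a) - b * x) β α) := by
  have e0 : ∀ γ, y γ 0 * x 0 α + y γ 1 * x 1 α = (1 : Matrix (Fin 2) (Fin 2) R) γ α := fun γ => by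
    rw [← e, Matrix.mul_apply, Fin.sum_univ_two]
  have e1 : h α = h 0 * (y 0 0 * x 0 α + y 0 1 * x 1 α) + h 1 * (y 1 0 * x 0 α + y 1 1 * x 1 α) := by
    rw [e0, e0]; revert e0; fin_cases α <;> intro e0 <;> simp [Matrix.one_apply]
  rw [e1]
  simp only [Matrix.sub_apply, Matrix.neg_apply, Matrix.mul_apply, Fin.sum_univ_two]
  noncomm_ring

/-- The matrices `a` and `b` cancel between neighbouring factors and the scalar parts `s`, `s'`
cancel between the two odd factors. What remains is the weight of the middle matrix. The vector `p'`
stands for the image of `p` under the sign of the generator. -/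
lemma cov_sandwich {w s s' : R} {p p' t : Fin 2 → R} {x a b : Matrix (Fin 2) (Fin 2) R}
    (hx : ∀ β α f, x β α * f = f * x β α) (hw : ∀ β, p' β * w = w * p β)
    (hs : ∀ β α, p' β * (t α * s) = -(s' * (p β * t α))) :
    -w * ∑ β, ∑ α, p β * x β α * t α = ∑ β, ∑ α,
      (((-(∑ γ, p' γ * a γ β) + s' * p β) * x β α +
        p' β * (∑ γ, a β γ * x γ α + ∑ γ, x β γ * b γ α - w * x β α)) * t α +
        p' β * x β α * (-(∑ γ, b α γ * t γ) + t α * s)) := by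
  have hs' : ∀ β α, p' β * x β α * (t α * s) = -(s' * (p β * x β α * t α)) := fun β α => by
    rw [mul_assoc, hx, ← mul_assoc, hs, mul_assoc (p β), hx, neg_mul]; noncomm_ring
  have hw' : ∀ β α, p' β * (w * x β α) = w * (p β * x β α) := fun β α => by
    rw [← mul_assoc, hw, mul_assoc]
  simp only [mul_add, hs', mul_sub, hw']
  simp only [Fin.sum_univ_two]
  noncomm_ring

end abstract

lemma XTilde_act {c : Config} (hc : c ∈ nondegenerate) (V : Generator) (n : Fin 2) :
    HasActM V c (XTilde n) (V.left 0 c * evm c (XTilde n) + evm c (XTilde n) * V.right 0 c -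
      (V.wl c 0 + V.wr c 0) • evm c (XTilde n)) := by
  have h : ∀ i j, i ≠ j → IsUnit (intervalSq i j c) := fun i j h => isUnit_intervalSq hc h
  fin_cases n
  · have := (hasActM_chain (V := V) (h 0 3 (by decide)) (h 1 0 (by decide))).neg
    change HasActM V c XTilde11Plus (V.left 0 c * evm c XTilde11Plus +
      evm c XTilde11Plus * V.right 0 c - (V.wl c 0 + V.wr c 0) • evm c XTilde11Plus)
    rw [XTilde11Plus, map_neg, mul_neg, neg_mul, smul_neg]
    convert this using 1
    abel
  · exact hasActM_chain (h 0 2 (by decide)) (h 3 0 (by decide))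

/-- The polarized form of Jacobi's formula contributes the trace `w` once, while the terms `-w • X`
and `-w • Y` contribute `-w` twice. -/
lemma cov_polar {S R : Type*} [CommRing S] [Ring R] [Algebra S R] (x y : Matrix (Fin 2) (Fin 2) S)
    (A B : Matrix (Fin 2) (Fin 2) R) {X Y : Matrix (Fin 2) (Fin 2) R}
    (hX : X = x.map (algebraMap S R)) (hY : Y = y.map (algebraMap S R)) (w : R)
    (hw : w = A.trace + B.trace) :
    (A * X + X * B - w • X) 0 0 * Y 1 1 + X 0 0 * (A * Y + Y * B - w • Y) 1 1 +
      ((A * X + X * B - w • X) 1 1 * Y 0 0 + X 1 1 * (A * Y + Y * B - w • Y) 0 0) -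
      ((A * X + X * B - w • X) 0 1 * Y 1 0 + X 0 1 * (A * Y + Y * B - w • Y) 1 0) -
      ((A * X + X * B - w • X) 1 0 * Y 0 1 + X 1 0 * (A * Y + Y * B - w • Y) 0 1) =
    -w * (X 0 0 * Y 1 1 + X 1 1 * Y 0 0 - X 0 1 * Y 1 0 - X 1 0 * Y 0 1) := by
  have e : ∀ (s : S) (y : R), algebraMap S R s * y = s • y := fun s y => (Algebra.smul_def s y).symm
  have e' : ∀ (s : S) (y : R), y * algebraMap S R s = s • y := fun s y => by
    rw [← Algebra.commutes, Algebra.smul_def]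
  subst hX hY hw
  simp only [Matrix.mul_apply, Matrix.add_apply, Matrix.sub_apply, Matrix.smul_apply, smul_eq_mul,
    Matrix.map_apply, Matrix.trace_fin_two, Fin.sum_univ_two, e, e', mul_sub, mul_add, smul_add,
    smul_sub, smul_smul, mul_smul_comm]
  module

lemma mink_polar {S : Type*} [CommRing S] [Algebra ℂ S] (x y : Fin 4 → S) :
    ∑ μ, eta μ • (x μ * y μ) = (1 / 2 : ℂ) • ((∑ μ, (eta μ * sigmaTilde μ 0 0) • x μ) *
      (∑ μ, (eta μ * sigmaTilde μ 1 1) • y μ) + (∑ μ, (eta μ * sigmaTilde μ 1 1) • x μ) *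
      (∑ μ, (eta μ * sigmaTilde μ 0 0) • y μ) - (∑ μ, (eta μ * sigmaTilde μ 0 1) • x μ) *
      (∑ μ, (eta μ * sigmaTilde μ 1 0) • y μ) - (∑ μ, (eta μ * sigmaTilde μ 1 0) • x μ) *
      (∑ μ, (eta μ * sigmaTilde μ 0 1) • y μ)) := by
  have h : algebraMap ℂ S Complex.I * algebraMap ℂ S Complex.I = -1 := by
    rw [← map_mul, Complex.I_mul_I, map_neg, map_one]
  have h2 : algebraMap ℂ S 2⁻¹ * 2 = 1 := by
    rw [← map_ofNat (algebraMap ℂ S), ← map_mul, inv_mul_cancel₀ two_ne_zero, map_one]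
  simp [Fin.sum_univ_four, eta, sigma, sigmaTilde, Algebra.smul_def]
  linear_combination (-(x 2 * y 2)) * h + (-(x 0 * y 0) + x 1 * y 1 + x 2 * y 2*
    (-(algebraMap ℂ S Complex.I * algebraMap ℂ S Complex.I)) + x 3 * y 3) * h2

lemma minkDot_toVec {M N : Matrix (Fin 2) (Fin 2) SuperFun} {c : Config} (hM : EvM c M)
    (hN : EvM c N) : minkDot (toVec M) (toVec N) c = (1 / 2 : ℂ) • (M 0 0 c * N 1 1 c +
      M 1 1 c * N 0 0 c - M 0 1 c * N 1 0 c - M 1 0 c * N 0 1 c) := by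
  have hev : ∀ M, EvM c M → ∀ μ, Ev (toVec M μ c) := fun M hM μ => by
    rw [toVec_apply]; exact Ev.sum fun α _ => Ev.sum fun β _ => (hM _ _).smul _
  choose x hx using fun μ => (hev M hM μ).lift
  choose y hy using fun μ => (hev N hN μ).lift
  simp only [← toMatTilde_toVec M, ← toMatTilde_toVec N]
  replace hx : ∀ μ, toVec M μ c = cenVal (x μ) := fun μ => (hx μ).symm
  replace hy : ∀ μ, toVec N μ c = cenVal (y μ) := fun μ => (hy μ).symm
  simp only [minkDot, Finset.sum_apply, Pi.smul_apply, Pi.mul_apply, hx, hy]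
  simp only [← map_mul, ← map_smul, ← map_sum, ← map_sub, ← map_add]
  exact congrArg _ (mink_polar x y)

lemma hatDot_wt {c : Config} (hc : c ∈ nondegenerate) (V : Generator) (m n : Fin 2) :
    HasWt V c (hatDot m n) 0 := by
  obtain ⟨x, hx⟩ := (XTilde_evM m c).lift
  obtain ⟨y, hy⟩ := (XTilde_evM n c).lift
  have hX := XTilde_act hc V m
  have hY := XTilde_act hc V n
  have ev := XTilde_evM
  have h := (((((hX 0 0).mul_ev (hY 1 1) (ev _ _ _ _)).add ((hX 1 1).mul_ev (hY 0 0) (ev _ _ _ _))).sub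
    ((hX 0 1).mul_ev (hY 1 0) (ev _ _ _ _))).sub
    ((hX 1 0).mul_ev (hY 0 1) (ev _ _ _ _))).smul (1 / 2)
  have h1 := cov_polar x y (V.left 0 c) (V.right 0 c) hx hy (V.wl c 0 + V.wr c 0) rfl
  have h2 : HasWt V c (minkDot (toVec (XTilde m)) (toVec (XTilde n)))
      (-(V.wl c 0 + V.wr c 0)) := by
    constructor
    · rw [minkDot_toVec (ev m c) (ev n c), mul_smul_comm]
      rw [show minkDot (toVec (XTilde m)) (toVec (XTilde n)) = _ from
        funext fun c => minkDot_toVec (ev m c) (ev n c)]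
      convert h using 1
      · rfl
      · exact congrArg ((1 / 2 : ℂ) • ·) h1.symm
    · rw [minkDot_toVec (ev m c) (ev n c)]
      exact (((((ev _ _ _ _).mul (ev _ _ _ _)).add ((ev _ _ _ _).mul (ev _ _ _ _))).sub
        ((ev _ _ _ _).mul (ev _ _ _ _))).sub ((ev _ _ _ _).mul (ev _ _ _ _))).smul _
  exact (h2.mul ((rootX_wt hc V).sinv (rootX_unit hc))).of_eq (by abel)

lemma left_hom (V : Generator) (i : Fin 4) (c : Config) (α β : Fin 2) : Hom V (V.left i c α β) := by
  cases V with
  | Lbar n => exact ev_algebraMap (n α β)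
  | K k =>
    exact Ev.sum (s := Finset.univ) fun γ _ => (xMinus_evM c i α γ).mul (ev_algebraMap (k γ β))
  | Sbar γ =>
    change Od (if β = γ then _ else _)
    split
    exacts [(thetaBar_od i α c).smul _, od_zero]
  | P a => exact ev_zero
  | L m => exact ev_zero
  | _ => exact od_zero

lemma right_hom (V : Generator) (i : Fin 4) (c : Config) (α β : Fin 2) :
    Hom V (V.right i c α β) := by
  cases V with
  | L n => exact ev_algebraMap (n α β)
  | K k =>
    exact Ev.sum (s := Finset.univ) fun γ _ => (ev_algebraMap (k α γ)).mul (xPlus_evM c i γ β)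
  | S γ =>
    change Od (if α = γ then _ else _)
    split
    exacts [(theta_od i β c).smul _, od_zero]
  | P a => exact ev_zero
  | Lbar m => exact ev_zero
  | _ => exact od_zero

lemma wl_hom (V : Generator) (i : Fin 4) (c : Config) : Hom V (V.wl c i) :=
  Hom.sum (s := Finset.univ) fun α _ => left_hom V i c α α
lemma wr_hom (V : Generator) (i : Fin 4) (c : Config) : Hom V (V.wr c i) :=
  Hom.sum (s := Finset.univ) fun α _ => right_hom V i c α α

lemma scale_hom (V : Generator) (c : Config) : Hom V (V.scale c) := by
  cases V with
  | K k =>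
    exact ((Ev.sum fun α _ => (theta_od 0 α c).mul (Od.sum fun γ _ =>
      (ev_algebraMap (k α γ)).mul_od (thetaBar_od 0 γ c))).smul _).neg
  | S γ => exact (theta_od 0 γ c).smul _
  | Sbar γ => exact (thetaBar_od 0 γ c).smul _
  | P a => exact ev_zero
  | L m => exact ev_zero
  | Lbar m => exact ev_zero
  | _ => exact od_zero

/-- The summand `x̃_{ī1}⁻¹ θbar_{i1}` of the variable `Θ̃`. -/
lemma hasAct_tildeInv_thetaBar {V : Generator} {c : Config} {i : Fin 4}
    (hu : IsUnit (intervalSq i 0 c)) (α : Fin 2) :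
    HasAct V c (Matrix.mulVec (intervalTildeInv i 0) (thetaBar i - thetaBar 0) α)
      (-(∑ γ, V.right 0 c α γ * Matrix.mulVec (intervalTildeInv i 0) (thetaBar i - thetaBar 0) γ c)
        + Matrix.mulVec (intervalTildeInv i 0) (thetaBar i - thetaBar 0) α c * V.scale c
        + V.shiftBar c α) := by
  have h : HasAct V c (Matrix.mulVec (intervalTildeInv i 0) (thetaBar i - thetaBar 0) α) _ :=
    HasAct.sum (s := Finset.univ) fun β _ => (hasActM_intervalTildeInv hu α β).mul_ev
      ((hasAct_thetaBar V i β c).sub (hasAct_thetaBar V 0 β c)) (intervalTildeInv_evM c i 0 α β)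
  convert h using 1
  have e := (XJ_mul hu).1
  simp only [onThetaBar_sub, mulVec_eval]
  simp only [show ∀ α β, intervalTildeInv i 0 α β c = XJ c i 0 α β from fun _ _ => rfl,
    show ∀ β, (thetaBar i - thetaBar 0) β c = tb c i β - tb c 0 β from fun _ => rfl,
    show evm c (intervalTildeInv i 0) = XJ c i 0 from rfl]
  generalize XJ c i 0 = x at *
  exact (cov_thetaBar e _ _ _ _)

lemma hasAct_theta_tildeInv {V : Generator} {c : Config} {j : Fin 4}
    (hu : IsUnit (intervalSq 0 j c)) (α : Fin 2) :
    HasAct V c (Matrix.vecMul (theta 0 - theta j) (intervalTildeInv 0 j) α)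
      (-(∑ γ, V.sg (Matrix.vecMul (theta 0 - theta j) (intervalTildeInv 0 j) γ c) * V.left 0 c γ α)
        + V.scale' c * Matrix.vecMul (theta 0 - theta j) (intervalTildeInv 0 j) α c
        + V.shift c α) := by
  have h : HasAct V c (Matrix.vecMul (theta 0 - theta j) (intervalTildeInv 0 j) α) _ :=
    HasAct.sum (s := Finset.univ) fun β _ =>
      ((hasAct_theta V 0 β c).sub (hasAct_theta V j β c)).mul (hasActM_intervalTildeInv hu β α)
  convert h using 1
  have e := (XJ_mul hu).2
  have hs : ∀ β α, V.sg (XJ c 0 j β α) = XJ c 0 j β α := fun β α =>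
    (intervalTildeInv_evM c 0 j β α).sg V
  simp only [onTheta_sub, vecMul_eval]
  simp only [show ∀ α β, intervalTildeInv 0 j α β c = XJ c 0 j α β from fun _ _ => rfl,
    show ∀ β, (theta 0 - theta j) β c = th c 0 β - th c j β from fun _ => rfl,
    show evm c (intervalTildeInv 0 j) = XJ c 0 j from rfl, map_sum, map_mul, hs]
  exact cov_theta e _ _ _ _ _

lemma ThetaTilde_act {c : Config} (hc : c ∈ nondegenerate) (V : Generator) (k α : Fin 2) :
    HasAct V c (ThetaTilde k α) (-(∑ γ, V.right 0 c α γ * ThetaTilde k γ c) +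
      ThetaTilde k α c * V.scale c) := by
  have h := ((hasAct_tildeInv_thetaBar (V := V)
    (isUnit_intervalSq hc (i := 3) (j := 0) (by decide)) α).sub
    (hasAct_tildeInv_thetaBar (isUnit_intervalSq hc (pt_ne k).1) α)).smul Complex.I
  refine h.cast ?_
  simp only [ThetaTilde, Pi.smul_apply, Pi.sub_apply, mul_smul_comm, mul_sub, Fin.sum_univ_two,
    smul_mul_assoc, sub_mul]
  module

lemma ThetaBarTilde_act {c : Config} (hc : c ∈ nondegenerate) (V : Generator) (k α : Fin 2) :
    HasAct V c (ThetaBarTilde k α) (-(∑ γ, V.sg (ThetaBarTilde k γ c) * V.left 0 c γ α) +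
      V.scale' c * ThetaBarTilde k α c) := by
  have h := ((hasAct_theta_tildeInv (V := V) (isUnit_intervalSq hc (pt_ne k).1.symm) α).sub
    (hasAct_theta_tildeInv (isUnit_intervalSq hc (i := 0) (j := 3) (by decide)) α)).smul Complex.I
  refine h.cast ?_
  simp only [ThetaBarTilde, Pi.smul_apply, Pi.sub_apply, mul_smul_comm, mul_sub, Fin.sum_univ_two,
    smul_mul_assoc, sub_mul, map_smul, map_sub]
  module

lemma ThetaTilde_od (k α : Fin 2) (c : Config) : Od (ThetaTilde k α c) := by
  have h : ∀ i : Fin 4, Od (Matrix.mulVec (intervalTildeInv i 0) (thetaBar i - thetaBar 0) α c) :=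
    fun i => by
      rw [mulVec_eval]
      exact Od.sum fun γ _ => (intervalTildeInv_evM c i 0 α γ).mul_od
        ((thetaBar_od i γ c).sub (thetaBar_od 0 γ c))
  exact ((h 3).sub (h (pt k))).smul _

lemma ThetaBarTilde_od (k α : Fin 2) (c : Config) : Od (ThetaBarTilde k α c) := by
  have h : ∀ j : Fin 4, Od (Matrix.vecMul (theta 0 - theta j) (intervalTildeInv 0 j) α c) :=
    fun j => by
      rw [vecMul_eval]
      exact Od.sum fun γ _ => ((theta_od 0 γ c).sub (theta_od j γ c)).mul_ev
        (intervalTildeInv_evM c 0 j γ α)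
  exact ((h (pt k)).sub (h 3)).smul _

/-- `Θ̃bar_j X̃_n Θ̃_i`. -/
def sandwich (n i j : Fin 2) : SuperFun :=
  ∑ β : Fin 2, ∑ α : Fin 2, ThetaBarTilde j β * XTilde n β α * ThetaTilde i α

lemma sandwich_wt {c : Config} (hc : c ∈ nondegenerate) (V : Generator) (n i j : Fin 2) :
    HasWt V c (sandwich n i j) (-(V.wl c 0 + V.wr c 0)) := by
  constructor
  · have h := HasAct.sum (s := Finset.univ) fun β _ => HasAct.sum (s := Finset.univ) fun α _ =>
      ((ThetaBarTilde_act hc V j β).mul (XTilde_act hc V n β α)).mul (ThetaTilde_act hc V i α)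
    refine h.cast ?_
    have hX : ∀ β α, V.sg (XTilde n β α c) = XTilde n β α c := fun β α => (XTilde_evM n c β α).sg V
    have hX' : ∀ β α f, XTilde n β α c * f = f * XTilde n β α c :=
      fun β α => (XTilde_evM n c β α).comm
    have hw : ∀ f, V.sg f * (V.wl c 0 + V.wr c 0) = (V.wl c 0 + V.wr c 0) * f := fun f => by
      rw [((wl_hom V 0 c).add (wr_hom V 0 c)).comm, V.sg_sg]
    -- The sign in `Generator.scale'` is made for this: moving the scale to the left past both odd
    -- factors yields the negative of the contribution of `Θ̃bar`, for even and for odd generators.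
    have hs : ∀ β α, V.sg (ThetaBarTilde j β c) * (ThetaTilde i α c * V.scale c) =
        -(V.scale' c * (ThetaBarTilde j β c * ThetaTilde i α c)) := fun β α => by
      have h1 := (scale_hom V c).comm (ThetaTilde i α c)
      have h2 := (scale_hom V c).comm (V.sg (ThetaBarTilde j β c))
      rw [V.sg_sg] at h2
      rw [h1, ← mul_assoc, h2, mul_assoc, Generator.scale', Generator.sg]
      split
      · rw [show inv (ThetaTilde i α c) = - ThetaTilde i α c from ThetaTilde_od i α c]; noncomm_ring
      · simp
    simp only [sandwich, Finset.sum_apply, Pi.mul_apply, map_mul, hX, Matrix.sub_apply,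
      Matrix.add_apply, Matrix.smul_apply, smul_eq_mul, Matrix.mul_apply, evm_apply]
    exact (cov_sandwich hX' (fun β => hw _) hs).symm
  · rw [sandwich, Finset.sum_apply]
    refine Ev.sum fun β _ => ?_
    rw [Finset.sum_apply]
    exact Ev.sum fun α _ => ((ThetaBarTilde_od j β c).mul_ev (XTilde_evM n c β α)).mul
      (ThetaTilde_od i α c)

lemma nilp_wt {c : Config} (hc : c ∈ nondegenerate) (V : Generator) (n i j : Fin 2) :
    HasWt V c (nilp n i j) 0 := by
  have h := ((sandwich_wt hc V n i j).mul ((rootX_wt hc V).sinv (rootX_unit hc))).of_eq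
    (show _ = 0 by abel)
  rw [HasWt.zero_iff] at h ⊢
  exact ⟨h.1.neg.cast neg_zero, h.2.neg⟩

lemma body_nilp (n i j : Fin 2) (c : Config) : body (nilp n i j c) = 0 := by
  have h : ∀ x, Od x → body x = 0 := fun x hx => by
    have := prj_inv 0 x
    rw [show inv x = -x from hx, map_neg, pow_zero, one_smul, neg_eq_iff_add_eq_zero,
      ← two_smul ℂ, smul_eq_zero_iff_right two_ne_zero, prj_zero] at this
    exact (map_eq_zero_iff _ (ExteriorAlgebra.algebraMap_leftInverse _).injective).1 this
  have h2 : ∀ α, body (ThetaTilde i α c) = 0 := fun α => h _ (ThetaTilde_od i α c)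
  simp [nilp, h2]

/-! ## Cross ratios -/

lemma cen_injective : Function.Injective (algebraMap Cen Grassmann) := Subtype.val_injective

/-- A unit of the center as a unit. -/
abbrev cenUnit : Cenˣ →* Grassmannˣ := Units.map (algebraMap Cen Grassmann).toMonoidHom

lemma Ev.lift_unit {x : Grassmann} (h : Ev x) (hu : IsUnit x) : ∃ u : Cenˣ, (cenUnit u : Grassmann) = x := by
  obtain ⟨z, hz⟩ := h.lift
  obtain ⟨y, hy⟩ := h.ringInverse.lift
  have h1 : z * y = 1 := cen_injective (by
    rw [map_mul, hz, hy, Ring.mul_inverse_cancel _ hu, map_one])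
  exact ⟨⟨z, y, h1, by rw [mul_comm, h1]⟩, hz⟩

/-- With squared intervals as units of a commutative ring, relations between cross ratios become
relations in an abelian group. Written additively, they are linear. -/
lemma exists_units {c : Config} (hc : c ∈ nondegenerate) : ∃ u : Fin 4 → Fin 4 → Cenˣ,
    ∀ i j, i ≠ j → intervalSq i j c = cenUnit (u i j) := by
  have : ∀ i j, ∃ u : Cenˣ, i ≠ j → intervalSq i j c = cenUnit u := fun i j => by
    by_cases h : i = j
    · exact ⟨1, fun h' => absurd h h'⟩
    · obtain ⟨u, hu⟩ := (intervalSq_ev i j c).lift_unit (isUnit_intervalSq hc h)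
      exact ⟨u, fun _ => hu.symm⟩
  choose u hu using this
  exact ⟨u, hu⟩

lemma sinv_of_unit {F : SuperFun} {c : Config} {u : Cenˣ} (h : F c = cenUnit u) :
    sinv F c = cenUnit u⁻¹ := by
  rw [sinv, h, Ring.inverse_unit, map_inv]

lemma mul_of_unit {F G : SuperFun} {c : Config} {u v : Cenˣ} (h : F c = cenUnit u)
    (h' : G c = cenUnit v) : (F * G) c = cenUnit (u * v) := by
  rw [Pi.mul_apply, h, h', map_mul, Units.val_mul]

/-- The units `u i j` are the values of the squared intervals at `c`. -/
abbrev UnitValues (c : Config) (u : Fin 4 → Fin 4 → Cenˣ) : Prop :=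
  ∀ i j, i ≠ j → intervalSq i j c = cenUnit (u i j)

section
variable {c : Config} {u : Fin 4 → Fin 4 → Cenˣ}

lemma crossRatio_unit (hu : UnitValues c u)
    {r s t v : Fin 4} (h1 : r ≠ s) (h2 : t ≠ v) (h3 : r ≠ v) (h4 : t ≠ s) :
    crossRatio r s t v c = cenUnit (u r s * u t v * (u r v)⁻¹ * (u t s)⁻¹) :=
  mul_of_unit (mul_of_unit (mul_of_unit (hu r s h1) (hu t v h2)) (sinv_of_unit (hu r v h3)))
    (sinv_of_unit (hu t s h4))

lemma triple_of_unit (hu : UnitValues c u) {i j : Fin 4} (hi : i ≠ 0) (hj : j ≠ 0) (hij : i ≠ j) :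
    (intervalSq i j * sinv (intervalSq i 0) * sinv (intervalSq 0 j)) c =
      cenUnit (u i j * (u i 0)⁻¹ * (u 0 j)⁻¹) :=
  mul_of_unit (mul_of_unit (hu i j hij) (sinv_of_unit (hu i 0 hi))) (sinv_of_unit (hu 0 j hj.symm))

lemma J₁_unit (hu : UnitValues c u) : J₁ c = cenUnit (u 1 2 * (u 1 0)⁻¹ * (u 0 2)⁻¹ *
    (u 2 1 * (u 2 0)⁻¹ * (u 0 1)⁻¹)⁻¹) :=
  mul_of_unit (triple_of_unit hu (i := 1) (j := 2) (by decide) (by decide) (by decide))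
    (sinv_of_unit (triple_of_unit hu (i := 2) (j := 1) (by decide) (by decide) (by decide)))

lemma J_unit (hu : UnitValues c u)
    (k : Fin 2) : J k c = cenUnit (u (pt k) 3 * (u (pt k) 0)⁻¹ * (u 0 3)⁻¹ *
    (u 3 (pt k) * (u 3 0)⁻¹ * (u 0 (pt k))⁻¹)⁻¹) :=
  mul_of_unit (triple_of_unit hu (i := pt k) (j := 3) (pt_ne k).1 (by decide) (pt_ne k).2)
    (sinv_of_unit (triple_of_unit hu (i := 3) (j := pt k) (by decide) (pt_ne k).1 (pt_ne k).2.symm))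

end

/-- The points that occur in the cross ratios `𝓘₁, …, 𝓘₆`. -/
def crossIdx : Fin 6 → Fin 4 × Fin 4 × Fin 4 × Fin 4 :=
  ![(0, 3, 2, 1), (0, 3, 1, 2), (2, 1, 3, 0), (1, 3, 2, 0), (1, 2, 3, 0), (0, 2, 3, 1)]

lemma crossI_eq (k : Fin 6) : crossI k =
    crossRatio (crossIdx k).1 (crossIdx k).2.1 (crossIdx k).2.2.1 (crossIdx k).2.2.2 := by
  fin_cases k <;> rfl

-- The 24 orderings of the points fall into six classes of four: exchanging the two numerator
-- factors fixes a cross ratio, and exchanging `s` with `u` inverts it.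
set_option maxRecDepth 4000 in
lemma exists_crossIdx : ∀ r s t u : Fin 4, [r, s, t, u].Nodup → ∃ k : Fin 6,
    (r, s, t, u) = crossIdx k ∨ (t, u, r, s) = crossIdx k ∨ (r, u, t, s) = crossIdx k ∨
      (t, s, r, u) = crossIdx k := by decide

lemma crossRatio_swap {c : Config} (hc : c ∈ nondegenerate) {r s t v : Fin 4} (h1 : r ≠ s)
    (h2 : t ≠ v) (h3 : r ≠ v) (h4 : t ≠ s) : crossRatio t v r s c = crossRatio r s t v c ∧
      crossRatio r s t v c = sinv (crossRatio r v t s) c := by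
  obtain ⟨u, hu⟩ := exists_units hc
  rw [crossRatio_unit hu h1 h2 h3 h4, crossRatio_unit hu h2 h1 h4 h3,
    sinv_of_unit (crossRatio_unit hu h3 h4 h1 h2)]
  constructor
  · congr 2
    rw [mul_comm (u t v), mul_right_comm]
  · congr 2
    simp only [mul_inv, inv_inv]
    apply Additive.ofMul.injective
    simp only [ofMul_mul, ofMul_inv]
    abel

lemma exists_crossI (r s t u : Fin 4) (h : [r, s, t, u].Nodup) : ∃ k : Fin 6,
    Set.EqOn (crossRatio r s t u) (crossI k) nondegenerate ∨
      Set.EqOn (crossRatio r s t u) (sinv (crossI k)) nondegenerate := by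
  obtain ⟨k, hk⟩ := exists_crossIdx r s t u h
  have h1 : r ≠ s ∧ t ≠ u ∧ r ≠ u ∧ t ≠ s := by
    simp at h; tauto
  refine ⟨k, ?_⟩
  rw [crossI_eq]
  rcases hk with hk | hk | hk | hk <;> rw [← hk]
  · exact Or.inl fun c _ => rfl
  · exact Or.inl fun c hc => (crossRatio_swap hc h1.1 h1.2.1 h1.2.2.1 h1.2.2.2).1.symm
  · exact Or.inr fun c hc => (crossRatio_swap hc h1.1 h1.2.1 h1.2.2.1 h1.2.2.2).2
  · refine Or.inr fun c hc => ?_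
    have h2 := crossRatio_swap hc h1.1 h1.2.1 h1.2.2.1 h1.2.2.2
    have h3 := crossRatio_swap hc h1.2.1 h1.1 h1.2.2.2 h1.2.2.1
    rw [← h2.1]; exact h3.2

lemma crossI_relations {c : Config} (hc : c ∈ nondegenerate) :
    crossI 2 c = (sinv J₁ * J 0 * crossI 1) c ∧ crossI 3 c = (J₁ * crossI 0 * sinv (crossI 1)) c ∧
    crossI 4 c = (J₁ * J 1 * crossI 0) c ∧
    crossI 5 c = (J₁ * sinv (J 0) * J 1 * crossI 0 * sinv (crossI 1)) c := by
  obtain ⟨u, hu⟩ := exists_units hc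
  have hI : ∀ k, crossI k c = cenUnit (u (crossIdx k).1 (crossIdx k).2.1 *
      u (crossIdx k).2.2.1 (crossIdx k).2.2.2 * (u (crossIdx k).1 (crossIdx k).2.2.2)⁻¹ *
      (u (crossIdx k).2.2.1 (crossIdx k).2.1)⁻¹) := fun k => by
    rw [crossI_eq]
    apply crossRatio_unit hu <;> revert k <;> decide
  have hJ₁ := J₁_unit hu
  have hJ := J_unit hu
  refine ⟨?_, ?_, ?_, ?_⟩
  · rw [hI, mul_of_unit (mul_of_unit (sinv_of_unit hJ₁) (hJ 0)) (hI 1)]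
    congr 2
    apply Additive.ofMul.injective
    simp only [ofMul_mul, ofMul_inv, crossIdx, pt, Matrix.cons_val]
    abel
  · rw [hI, mul_of_unit (mul_of_unit hJ₁ (hI 0)) (sinv_of_unit (hI 1))]
    congr 2
    apply Additive.ofMul.injective
    simp only [ofMul_mul, ofMul_inv, crossIdx, Matrix.cons_val]
    abel
  · rw [hI, mul_of_unit (mul_of_unit hJ₁ (hJ 1)) (hI 0)]
    congr 2
    apply Additive.ofMul.injective
    simp only [ofMul_mul, ofMul_inv, crossIdx, pt, Matrix.cons_val]
    abel
  · rw [hI, mul_of_unit (mul_of_unit (mul_of_unit (mul_of_unit hJ₁ (sinv_of_unit (hJ 0))) (hJ 1))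
      (hI 0)) (sinv_of_unit (hI 1))]
    congr 2
    apply Additive.ofMul.injective
    simp only [ofMul_mul, ofMul_inv, crossIdx, pt, Matrix.cons_val]
    abel

/-! ## The square root -/

/-- By Vandermonde's identity for `1/2 + 1/2 = 1`, the truncated binomial series squares to `1 + X`
modulo `X ^ 17`; and `F c - 1`, having body zero, is annihilated by the seventeenth power. -/
lemma unipotentSqrt_sq {F : SuperFun} {c : Config} (h : body (F c) = 1) :
    unipotentSqrt F c * unipotentSqrt F c = F c := by
  have hn : (F c - 1) ^ 17 = 0 := eq_zero_of_mem_fil le_rfl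
    (by simpa using pow_mem_fil (k := 1) (mem_fil_one.2 (by rw [map_sub, h, map_one, sub_self])) 17)
  let p : Polynomial ℂ := ∑ k ∈ Finset.range 17,
    Polynomial.C ((Ring.choose (1 / 2 : ℚ) k : ℚ) : ℂ) * Polynomial.X ^ k
  have hp : ∀ k < 17, p.coeff k = ((Ring.choose (1 / 2 : ℚ) k : ℚ) : ℂ) := fun k hk => by
    simp [p, Polynomial.coeff_X_pow, hk]
  have hd : Polynomial.X ^ 17 ∣ p * p - (1 + Polynomial.X) := by
    rw [Polynomial.X_pow_dvd_iff]
    intro d hd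
    have h1 := Ring.add_choose_eq d (Commute.all (1 / 2 : ℚ) (1 / 2))
    rw [show (1 / 2 + 1 / 2 : ℚ) = ((1 : ℕ) : ℚ) by norm_num, Ring.choose_natCast] at h1
    rw [Polynomial.coeff_sub, Polynomial.coeff_mul, sub_eq_zero]
    trans (((Nat.choose 1 d : ℕ) : ℚ) : ℂ)
    · rw [h1, Rat.cast_sum]
      refine Finset.sum_congr rfl fun ij hij => ?_
      rw [Finset.HasAntidiagonal.mem_antidiagonal] at hij
      rw [hp _ (by omega), hp _ (by omega), Rat.cast_mul]
    · rcases d with _ | _ | d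
      · simp
      · simp [Polynomial.coeff_one]
      · simp [Polynomial.coeff_one, Polynomial.coeff_X, Nat.choose_eq_zero_of_lt]
  have hs : unipotentSqrt F c = Polynomial.aeval (F c - 1) p := by
    simp [unipotentSqrt, p, map_sum, Algebra.smul_def]
  obtain ⟨g, hg⟩ := hd
  have h2 := congrArg (Polynomial.aeval (F c - 1)) hg
  simp only [map_mul, map_sub, map_add, map_one, Polynomial.aeval_X, map_pow, hn, zero_mul,
    sub_eq_zero] at h2
  rw [hs, h2]; abel

/-! ## Relations between the nilpotent invariants -/

section abstract
variable {S : Type*} [CommRing S] [Algebra ℂ S] {w : Fin 2 → Fin 2 → Fin 2 → Fin 2 → S}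

/-- The sum of `w j β i α` with coefficients `M β α`. -/
def pair (w : Fin 2 → Fin 2 → Fin 2 → Fin 2 → S) (M : Matrix (Fin 2) (Fin 2) S) (i j : Fin 2) : S :=
  ∑ β, ∑ α, M β α * w j β i α

/-- The determinant of a matrix of size two and its polarization. -/
def polar (M N : Matrix (Fin 2) (Fin 2) S) : S :=
  M 0 0 * N 1 1 + M 1 1 * N 0 0 - M 0 1 * N 1 0 - M 1 0 * N 0 1

lemma half_cancel {x : S} (h : x = -x) : x = 0 := by
  rw [eq_neg_iff_add_eq_zero, ← two_smul ℂ] at h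
  have := congrArg ((2⁻¹ : ℂ) • ·) h
  simpa [smul_smul] using this

/-- The exchange relation of products of two anticommuting families. -/
abbrev Exchange (w : Fin 2 → Fin 2 → Fin 2 → Fin 2 → S) : Prop :=
  ∀ j β i α l β' k α', w j β i α * w l β' k α' = -(w j β k α' * w l β' i α)

lemma w_zero (hw : Exchange w)
    (j β l β' i α : Fin 2) : w j β i α * w l β' i α = 0 := half_cancel (hw _ _ _ _ _ _ _ _)

lemma w_zero' (hw : Exchange w) (j β i α k α' : Fin 2) : w j β i α * w j β k α' = 0 :=
  half_cancel ((hw _ _ _ _ _ _ _ _).trans (by rw [mul_comm]))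

/-- With the same `Θ̃_i` in both factors, its two components must be different, and only an
expression antisymmetric in the columns of `M` and `N` survives. For `M = N` this is the determinant
times the antisymmetric symbol in `β, β'`. -/
lemma pair_mul_left (hw : Exchange w) (M N : Matrix (Fin 2) (Fin 2) S) (i j l : Fin 2) :
    pair w M i j * pair w N i l =
      ∑ β, ∑ β', (M β 0 * N β' 1 - M β 1 * N β' 0) * (w j β i 0 * w l β' i 1) := by
  have h0 := fun β β' => w_zero hw j β l β' i 0
  have h1 := fun β β' => w_zero hw j β l β' i 1
  have h2 := fun β β' => hw j β i 1 l β' i 0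
  rw [pair, pair, Finset.sum_mul_sum]
  refine Finset.sum_congr rfl fun β _ => Finset.sum_congr rfl fun β' _ => ?_
  simp only [Fin.sum_univ_two]
  linear_combination M β 0 * N β' 0 * h0 β β' + M β 1 * N β' 1 * h1 β β' + M β 1 * N β' 0 * h2 β β'

lemma pair_mul_right (hw : Exchange w) (M N : Matrix (Fin 2) (Fin 2) S) (i j k : Fin 2) :
    pair w M i j * pair w N k j =
      ∑ α, ∑ α', (M 0 α * N 1 α' - M 1 α * N 0 α') * (w j 0 i α * w j 1 k α') := by
  have h0 := fun α α' => w_zero' hw j 0 i α k α'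
  have h1 := fun α α' => w_zero' hw j 1 i α k α'
  have h2 := fun α α' => hw j 1 i α j 0 k α'
  rw [pair, pair, Finset.sum_comm, Finset.sum_comm (γ := Fin 2) (s := Finset.univ)
    (f := fun β α => N β α * w j β k α), Finset.sum_mul_sum]
  refine Finset.sum_congr rfl fun α _ => Finset.sum_congr rfl fun α' _ => ?_
  simp only [Fin.sum_univ_two]
  linear_combination M 0 α * N 0 α' * h0 α α' + M 1 α * N 1 α' * h1 α α' + M 1 α * N 0 α' * h2 α α'

/-- The exchange rule brings this product to the words `w 0 · 0 · * w 1 · 1 ·`, in which the product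
of the diagonal pairs is already written. The cross relations then are identities of commutative
polynomials. -/
lemma pair_mul_cross (hw : Exchange w) (M N : Matrix (Fin 2) (Fin 2) S) :
    pair w M 0 1 * pair w N 1 0 =
      -∑ β, ∑ α, ∑ β', ∑ α', M β α * N β' α' * (w 0 β' 0 α * w 1 β 1 α') := by
  rw [pair, pair, Finset.sum_mul, ← Finset.sum_neg_distrib]
  refine Finset.sum_congr rfl fun β _ => ?_
  rw [Finset.sum_mul, ← Finset.sum_neg_distrib]
  refine Finset.sum_congr rfl fun α _ => ?_
  rw [Finset.mul_sum, ← Finset.sum_neg_distrib]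
  refine Finset.sum_congr rfl fun β' _ => ?_
  rw [Finset.mul_sum, ← Finset.sum_neg_distrib]
  refine Finset.sum_congr rfl fun α' _ => ?_
  linear_combination M β α * N β' α' * hw 1 β 0 α 0 β' 1 α'

lemma pair_same (hw : Exchange w) (X Y : Matrix (Fin 2) (Fin 2) S) (i j : Fin 2) :
    pair w X i j * pair w Y i j = polar X Y * (w j 0 i 0 * w j 1 i 1) := by
  rw [pair_mul_left hw]
  simp only [Fin.sum_univ_two, polar]
  linear_combination (X 0 0 * Y 0 1 - X 0 1 * Y 0 0) * w_zero' hw j 0 i 0 i 1 +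
    (X 1 0 * Y 1 1 - X 1 1 * Y 1 0) * w_zero' hw j 1 i 0 i 1 +
    (X 1 0 * Y 0 1 - X 1 1 * Y 0 0) * hw j 1 i 0 j 0 i 1

/-- By `pair_mul_left`, a product with a common label and one matrix is that matrix's determinant
times a factor that does not depend on it. Polarizing this statement gives the mixed relations
below. -/
lemma pair_YY_left (hw : Exchange w) (X Y : Matrix (Fin 2) (Fin 2) S) (i j l : Fin 2) :
    polar X X * (pair w Y i j * pair w Y i l) = polar Y Y * (pair w X i j * pair w X i l) := by
  simp only [pair_mul_left hw, Fin.sum_univ_two, polar]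
  ring

lemma pair_YY_right (hw : Exchange w) (X Y : Matrix (Fin 2) (Fin 2) S) (i j k : Fin 2) :
    polar X X * (pair w Y i j * pair w Y k j) = polar Y Y * (pair w X i j * pair w X k j) := by
  simp only [pair_mul_right hw, Fin.sum_univ_two, polar]
  ring

lemma pair_XY_left (hw : Exchange w) (X Y : Matrix (Fin 2) (Fin 2) S) (i j l : Fin 2) :
    polar X X * (pair w Y i j * pair w X i l + pair w X i j * pair w Y i l) =
      2 * polar X Y * (pair w X i j * pair w X i l) := by
  simp only [pair_mul_left hw, Fin.sum_univ_two, polar]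
  ring

lemma pair_XY_right (hw : Exchange w) (X Y : Matrix (Fin 2) (Fin 2) S) (i j k : Fin 2) :
    polar X X * (pair w Y i j * pair w X k j + pair w X i j * pair w Y k j) =
      2 * polar X Y * (pair w X i j * pair w X k j) := by
  simp only [pair_mul_right hw, Fin.sum_univ_two, polar]
  ring

/-- The sum of the diagonal and the cross product is antisymmetric in the row labels by
`pair_mul_cross`, hence proportional to the determinant of the matrix. This is the polarization of
that fact, and `pair_cross₂` compares its values at `X` and `Y`. -/
lemma pair_cross₁ (hw : Exchange w) (X Y : Matrix (Fin 2) (Fin 2) S) :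
    polar X X * (pair w Y 0 1 * pair w X 1 0 + pair w X 0 1 * pair w Y 1 0 +
      pair w X 0 0 * pair w Y 1 1 + pair w Y 0 0 * pair w X 1 1) =
      2 * polar X Y * (pair w X 0 0 * pair w X 1 1 + pair w X 0 1 * pair w X 1 0) := by
  simp only [pair_mul_cross hw]
  simp only [pair, Fin.sum_univ_two, polar]
  ring

lemma pair_cross₂ (hw : Exchange w) (X Y : Matrix (Fin 2) (Fin 2) S) :
    polar X X * (pair w Y 0 0 * pair w Y 1 1 + pair w Y 0 1 * pair w Y 1 0) =
      polar Y Y * (pair w X 0 0 * pair w X 1 1 + pair w X 0 1 * pair w X 1 0) := by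
  simp only [pair_mul_cross hw]
  simp only [pair, Fin.sum_univ_two, polar]
  ring

/-- The square already contains both components of each of the two spinors, so that a third factor
repeats one of them. -/
lemma pair_cube (hw : Exchange w) (X : Matrix (Fin 2) (Fin 2) S) (i j : Fin 2) :
    pair w X i j * pair w X i j * pair w X i j = 0 := by
  have h : ∀ β α, (w j 0 i 0 * w j 1 i 1) * w j β i α = 0 := fun β α => by
    fin_cases β
    · change w j 0 i 0 * w j 1 i 1 * w j 0 i α = 0
      rw [mul_right_comm, w_zero' hw, zero_mul]
    · change w j 0 i 0 * w j 1 i 1 * w j 1 i α = 0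
      rw [mul_assoc, w_zero' hw, mul_zero]
  rw [pair_same hw, mul_assoc, pair, Finset.mul_sum]
  simp only [Finset.mul_sum, mul_left_comm _ (X _ _), h, mul_zero, Finset.sum_const_zero]

/-- The quartic combination that occurs in the products of two vectors `Θσ^μΘ̄`. -/
def quart (w : Fin 2 → Fin 2 → Fin 2 → Fin 2 → S) (i j k l : Fin 2) : S :=
  w j 0 i 0 * w l 1 k 1 - w j 1 i 0 * w l 0 k 1 - w j 0 i 1 * w l 1 k 0 + w j 1 i 1 * w l 0 k 0

/-- The factor four has two sources: `polar X X` is twice the determinant, and by the exchange rule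
the four terms of `quart` coincide in pairs. -/
lemma quart_left (hw : Exchange w) (X : Matrix (Fin 2) (Fin 2) S) (i j l : Fin 2) :
    4 * (pair w X i j * pair w X i l) = polar X X * quart w i j i l := by
  have h2 := fun β β' => hw j β i 1 l β' i 0
  simp only [pair_mul_left hw, Fin.sum_univ_two, polar, quart]
  linear_combination (-1) * (2 * (X 0 0 * X 1 1 - X 0 1 * X 1 0)) * (h2 1 0 - h2 0 1)

lemma quart_right (hw : Exchange w) (X : Matrix (Fin 2) (Fin 2) S) (i j k : Fin 2) :
    4 * (pair w X i j * pair w X k j) = polar X X * quart w i j k j := by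
  have h2 := fun α α' => hw j 1 i α j 0 k α'
  simp only [pair_mul_right hw, Fin.sum_univ_two, polar, quart]
  linear_combination (-1) * (2 * (X 0 0 * X 1 1 - X 0 1 * X 1 0)) * (h2 1 0 - h2 0 1)

lemma quart_cross₁ (hw : Exchange w) (X : Matrix (Fin 2) (Fin 2) S) :
    2 * (pair w X 0 0 * pair w X 1 1 + pair w X 0 1 * pair w X 1 0) =
      polar X X * quart w 0 0 1 1 := by
  simp only [pair_mul_cross hw]
  simp only [pair, Fin.sum_univ_two, polar, quart]
  ring

lemma quart_cross₂ (hw : Exchange w) : quart w 0 1 1 0 = quart w 0 0 1 1 := by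
  simp only [quart]
  linear_combination hw 1 0 0 0 0 1 1 1 - hw 1 1 0 0 0 0 1 1 - hw 1 0 0 1 0 1 1 0 + hw 1 1 0 1 0 0 1 0

end abstract

/-! ### The difference of the two versions of `X̃_{1(1)}` -/

/-- The value of `x̃_{ī1}⁻¹ θbar_{i1}`. -/
def av (c : Config) (i : Fin 4) : Fin 2 → Grassmann := Matrix.mulVec (XJ c i 0) (tb c i - tb c 0)
/-- The value of `θ_{i1} x̃_{1ī}⁻¹`. -/
def bv (c : Config) (i : Fin 4) : Fin 2 → Grassmann := Matrix.vecMul (th c i - th c 0) (XJ c 0 i)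

lemma ThetaTilde_apply (k α : Fin 2) (c : Config) :
    ThetaTilde k α c = Complex.I • (av c 3 α - av c (pt k) α) := by
  simp only [ThetaTilde, Pi.smul_apply, Pi.sub_apply, mulVec_eval]
  rfl

lemma ThetaBarTilde_apply (k α : Fin 2) (c : Config) :
    ThetaBarTilde k α c = Complex.I • (bv c 3 α - bv c (pt k) α) := by
  have h : ∀ j, Matrix.vecMul (theta 0 - theta j) (intervalTildeInv 0 j) α c = -bv c j α :=
    fun j => by
      rw [vecMul_eval, bv, Matrix.vecMul, dotProduct, ← Finset.sum_neg_distrib]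
      refine Finset.sum_congr rfl fun γ _ => ?_
      have e : -((th c j - th c 0) γ) = th c 0 γ - th c j γ := by rw [Pi.sub_apply, neg_sub]
      rw [← neg_mul, e]
      rfl
  simp only [ThetaBarTilde, Pi.smul_apply, Pi.sub_apply, h]
  congr 1
  abel

/-- The failure of additivity of the intervals is a rank-one term in the odd differences; the
vanishing of `x̃_{1̄1}` removes the chiral coordinates of the intermediate point. -/
lemma XI_split (c : Config) (i j : Fin 4) : XI c i j = XI c i 0 + XI c 0 j +
    (4 * Complex.I) • Matrix.vecMulVec (tb c i - tb c 0) (th c j - th c 0) := by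
  ext β α
  have h : XI c 0 0 β α = 0 := by rw [XI_self]; rfl
  simp only [Matrix.add_apply, Matrix.smul_apply, Matrix.vecMulVec_apply, Pi.sub_apply, sub_mul,
    mul_sub, tb_th]
  rw [XI_eq] at h
  simp only [XI_eq]
  linear_combination (norm := module) -h

/-- Dividing `XI_split` by the intervals to the point `0` turns it into additivity of the inverse
intervals up to a rank-one term in the odd variables. For `i = j` the left-hand side vanishes, which
relates the two inverse intervals between `i` and the point `0`. -/
lemma XI_sandwich {c : Config} {i j : Fin 4} (hi : IsUnit (intervalSq i 0 c))
    (hj : IsUnit (intervalSq 0 j c)) : XJ c i 0 * XI c i j * XJ c 0 j =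
      XJ c i 0 + XJ c 0 j + (4 * Complex.I) • Matrix.vecMulVec (av c i) (bv c j) := by
  rw [XI_split, mul_add, mul_add, add_mul, add_mul, (XJ_mul hi).1, mul_assoc _ (XI c 0 j),
    (XJ_mul hj).2, one_mul, mul_one, mul_smul_comm, smul_mul_assoc, Matrix.mul_vecMulVec,
    Matrix.vecMulVec_mul, add_comm (XJ c 0 j)]
  rfl

lemma XI_sandwich_self {c : Config} {i : Fin 4} (hi : IsUnit (intervalSq i 0 c))
    (hj : IsUnit (intervalSq 0 i c)) :
      XJ c i 0 + XJ c 0 i + (4 * Complex.I) • Matrix.vecMulVec (av c i) (bv c i) = 0 := by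
  rw [← XI_sandwich hi hj, XI_self, mul_zero, zero_mul]

section
variable {R : Type*} [Ring R] {S : Type*} [CommRing S] [Algebra S R]

lemma adj2_map (x : Matrix (Fin 2) (Fin 2) S) :
    adj2 (x.map (algebraMap S R)) = (adj2 x).map (algebraMap S R) := by
  ext i j; fin_cases i <;> fin_cases j <;> simp [adj2]

lemma adj2_prod (x y z : Matrix (Fin 2) (Fin 2) S) :
    adj2 (x * y * z) = adj2 z * adj2 y * adj2 x := by
  ext i j; fin_cases i <;> fin_cases j <;>
  simp [adj2, Matrix.mul_apply, Fin.sum_univ_two] <;> ring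

lemma adj2_adj2 (x : Matrix (Fin 2) (Fin 2) R) : adj2 (adj2 x) = x := by
  ext i j; fin_cases i <;> fin_cases j <;> simp [adj2]

lemma adj2_neg (x : Matrix (Fin 2) (Fin 2) R) : adj2 (-x) = -adj2 x := by
  ext i j; fin_cases i <;> fin_cases j <;> simp [adj2]

end

/-- `x_{ij}⁻¹ x_{kj} x_{kl}⁻¹` in terms of the inverse intervals. -/
lemma adj2_chain (c : Config) (i j k l : Fin 4) :
    adj2 (evm c (intervalInv i j * toMat (interval k j) * intervalInv k l)) =
      XJ c k l * XI c k j * XJ c i j := by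
  obtain ⟨x, hx⟩ := (intervalInv_evM c i j).lift
  obtain ⟨y, hy⟩ := (toMat_evM c k j).lift
  obtain ⟨z, hz⟩ := (intervalInv_evM c k l).lift
  have hJ : ∀ i j, adj2 (evm c (intervalInv i j)) = XJ c i j := fun i j => by
    rw [XJ, ← adj2_adj2 (evm c (intervalTildeInv i j))]
    congr 1
    ext α β
    fin_cases α <;> fin_cases β <;>
    simp [adj2, evm_apply, intervalInv, intervalTildeInv, toMat_eq]
  have hI : adj2 (evm c (toMat (interval k j))) = XI c k j := by
    rw [toMat_interval, adj2_adj2]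
  rw [← hJ, ← hJ, ← hI, map_mul, map_mul, hx, hy, hz, adj2_map, adj2_map, adj2_map,
    ← Matrix.map_mul, ← Matrix.map_mul, ← Matrix.map_mul, ← Matrix.map_mul, adj2_map, adj2_prod]

/-- `X̃_{1(1)-} = x_{1̄2}⁻¹ x_{4̄2} x_{4̄1}⁻¹`. -/
def XTilde11Minus : Matrix (Fin 2) (Fin 2) SuperFun :=
  intervalInv 0 1 * toMat (interval 3 1) * intervalInv 3 0

/-- The adjugates of both matrices are given by `XI_sandwich`. The inverse intervals cancel by the
self-relations of the points `1` and `3`, and the four rank-one terms assemble to the product of the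
differences `Θ̃` and `Θ̃bar`. -/
lemma adj2_XTilde_diff {c : Config} (hc : c ∈ nondegenerate) (β α : Fin 2) :
    evm c XTilde11Minus β α = evm c XTilde11Plus β α +
      (4 * Complex.I) • adj2 (Matrix.of fun α β => ThetaTilde 0 α c * ThetaBarTilde 0 β c) β α := by
  have h : ∀ i j, i ≠ j → IsUnit (intervalSq i j c) := fun i j h => isUnit_intervalSq hc h
  have e1 : adj2 (evm c XTilde11Minus) = _ := adj2_chain c 0 1 3 0
  have e2 : adj2 (evm c XTilde11Plus) = -(XJ c 1 0 * XI c 1 3 * XJ c 0 3) := by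
    rw [XTilde11Plus, map_neg, adj2_neg, adj2_chain]
  rw [XI_sandwich (h 3 0 (by decide)) (h 0 1 (by decide))] at e1
  rw [XI_sandwich (h 1 0 (by decide)) (h 0 3 (by decide))] at e2
  have e3 := XI_sandwich_self (h 3 0 (by decide)) (h 0 3 (by decide))
  have e4 := XI_sandwich_self (h 1 0 (by decide)) (h 0 1 (by decide))
  have e : adj2 (evm c XTilde11Minus) = adj2 (evm c XTilde11Plus) + (4 * Complex.I) •
      Matrix.of fun α β => ThetaTilde 0 α c * ThetaBarTilde 0 β c := by
    have e5 : (Matrix.of fun α β => ThetaTilde 0 α c * ThetaBarTilde 0 β c) =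
        -(Matrix.vecMulVec (av c 3) (bv c 3) - Matrix.vecMulVec (av c 3) (bv c 1) -
          Matrix.vecMulVec (av c 1) (bv c 3) + Matrix.vecMulVec (av c 1) (bv c 1)) := by
      ext α β
      simp only [Matrix.of_apply, ThetaTilde_apply, ThetaBarTilde_apply, smul_mul_smul_comm,
        Complex.I_mul_I, pt, Matrix.cons_val_zero, Matrix.neg_apply, Matrix.add_apply,
        Matrix.sub_apply, Matrix.vecMulVec_apply, sub_mul, mul_sub]
      module
    rw [e1, e2, e5]
    linear_combination (norm := module) e3 + e4
  rw [← adj2_adj2 (evm c XTilde11Minus), e]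
  conv_rhs => rw [← adj2_adj2 (evm c XTilde11Plus)]
  fin_cases β <;> fin_cases α <;> simp [adj2] <;> abel

lemma EvM.lift' {c : Config} {M : Matrix (Fin 2) (Fin 2) SuperFun} (h : EvM c M) :
    ∃ x : Matrix (Fin 2) (Fin 2) Cen, ∀ β α, M β α c = cenVal (x β α) := by
  choose x hx using fun β α => (h β α).lift
  exact ⟨Matrix.of x, fun β α => (hx β α).symm⟩

lemma minkDot_toVec_cen {M N : Matrix (Fin 2) (Fin 2) SuperFun} {c : Config} (hM : EvM c M)
    (hN : EvM c N) {m n : Matrix (Fin 2) (Fin 2) Cen} (hm : ∀ β α, M β α c = cenVal (m β α))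
    (hn : ∀ β α, N β α c = cenVal (n β α)) :
    minkDot (toVec M) (toVec N) c = cenVal ((1 / 2 : ℂ) • polar m n) := by
  rw [minkDot_toVec hM hN]
  simp only [hm, hn, ← map_mul, ← map_add, ← map_sub, ← map_smul]
  rfl

lemma chain_evM (c : Config) (i j k l : Fin 4) :
    EvM c (intervalInv i j * toMat (interval k j) * intervalInv k l) :=
  ((intervalInv_evM c i j).mul (toMat_evM c k j)).mul (intervalInv_evM c k l)

lemma polar_self {S : Type*} [CommRing S] (m : Matrix (Fin 2) (Fin 2) S) :
    polar m m = 2 * m.det := by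
  rw [polar, Matrix.det_fin_two]; ring

lemma half_polar {S : Type*} [CommRing S] [Algebra ℂ S] (m : Matrix (Fin 2) (Fin 2) S) :
    (1 / 2 : ℂ) • polar m m = m.det := by
  rw [polar_self, show (2 : S) = (2 : ℂ) • 1 by rw [two_smul, one_add_one_eq_two],
    smul_mul_assoc, one_mul, smul_smul]
  norm_num

/-- The square of the vector `x_{ij}⁻¹ x_{kj} x_{kl}⁻¹`. -/
lemma minkDot_chain {c : Config} (hc : c ∈ nondegenerate) {i j k l : Fin 4} (h1 : i ≠ j)
    (h2 : k ≠ l) (h3 : k ≠ j) :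
    minkDot (toVec (intervalInv i j * toMat (interval k j) * intervalInv k l))
      (toVec (intervalInv i j * toMat (interval k j) * intervalInv k l)) c =
    (intervalSq k j * sinv (intervalSq k l) * sinv (intervalSq i j)) c := by
  obtain ⟨u, hu⟩ := exists_units hc
  have hq : ∀ i j, ∃ x : Matrix (Fin 2) (Fin 2) Cen, (∀ β α, XI c i j β α = cenVal (x β α)) ∧
      (i ≠ j → x.det = u i j) := fun i j => by
    obtain ⟨x, hx⟩ := (interval_evM c i j).lift'
    refine ⟨x, hx, fun h => cen_injective ?_⟩
    have e := intervalSq_apply i j c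
    rw [hu i j h] at e
    have e2 : cenVal x.det = cenVal (x 0 0) * cenVal (x 1 1) - cenVal (x 0 1) * cenVal (x 1 0) := by
      rw [Matrix.det_fin_two]
      exact (map_sub cenVal _ _).trans (by rw [map_mul, map_mul])
    exact e2.trans ((by simp only [← hx]; rfl : _ = _).trans e.symm)
  have hinv : ∀ i j, i ≠ j → ∃ x : Matrix (Fin 2) (Fin 2) Cen,
      (∀ β α, intervalInv i j β α c = cenVal (x β α)) ∧ x.det = ↑(u i j)⁻¹ := fun i j h => by
    obtain ⟨x, hx, hd⟩ := hq i j
    refine ⟨(↑(u i j)⁻¹ : Cen) • x, fun β α => ?_, ?_⟩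
    · change sinv (intervalSq i j) c * XI c i j β α = _
      rw [sinv_of_unit (hu i j h), hx, Matrix.smul_apply, smul_eq_mul, map_mul]
      rfl
    · rw [Matrix.det_smul, hd h, Fintype.card_fin, pow_two, mul_assoc, Units.inv_mul, mul_one]
  obtain ⟨x, hx, hxd⟩ := hinv i j h1
  obtain ⟨y, hy, hyd⟩ := hq k j
  obtain ⟨z, hz, hzd⟩ := hinv k l h2
  have hy' : ∀ α β, toMat (interval k j) α β c = cenVal (y.adjugate α β) := fun α β => by
    rw [Matrix.adjugate_fin_two]
    have e := toMat_interval c k j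
    have e' : toMat (interval k j) α β c = adj2 (XI c k j) α β := by rw [← e]; rfl
    rw [e']
    fin_cases α <;> fin_cases β <;> simp [adj2, hy]
  have hM : ∀ α β, (intervalInv i j * toMat (interval k j) * intervalInv k l) α β c =
      cenVal ((x * y.adjugate * z) α β) := fun α β => by
    simp only [Matrix.mul_apply, Finset.sum_apply, Pi.mul_apply, Fin.sum_univ_two, hx, hy', hz,
      map_add, map_mul, Pi.add_apply]
  rw [minkDot_toVec_cen (chain_evM c i j k l) (chain_evM c i j k l) hM hM, half_polar,
    Matrix.det_mul, Matrix.det_mul, Matrix.det_adjugate, Fintype.card_fin, pow_one, hxd, hyd h3,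
    hzd, mul_of_unit (mul_of_unit (hu k j h3) (sinv_of_unit (hu k l h2)))
    (sinv_of_unit (hu i j h1))]
  change cenVal _ = cenVal ((u k j * (u k l)⁻¹ * (u i j)⁻¹ : Cenˣ) : Cen)
  congr 1
  push_cast
  ring

/-- The Fierz identity for two vectors `Θσ^μΘbar`; the signs in the parentheses come from raising
the spinor indices and from reordering the odd factors. -/
lemma mink_quart {S : Type*} [CommRing S] [Algebra ℂ S] (w : Fin 2 → Fin 2 → Fin 2 → Fin 2 → S)
    (i j k l : Fin 2) : ∑ μ, eta μ •
      (-(sigma μ 0 0 • w j 1 i 1 - sigma μ 0 1 • w j 0 i 1 - sigma μ 1 0 • w j 1 i 0 +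
        sigma μ 1 1 • w j 0 i 0) * -(sigma μ 0 0 • w l 1 k 1 - sigma μ 0 1 • w l 0 k 1 -
        sigma μ 1 0 • w l 1 k 0 + sigma μ 1 1 • w l 0 k 0)) = (2 : ℂ) • quart w i j k l := by
  have h : algebraMap ℂ S Complex.I * algebraMap ℂ S Complex.I = -1 := by
    rw [← map_mul, Complex.I_mul_I, map_neg, map_one]
  simp [Fin.sum_univ_four, eta, sigma, Algebra.smul_def, quart]
  rw [show algebraMap ℂ S 2 = 2 from map_ofNat _ 2]
  linear_combination (-(w j 0 i 1 - w j 1 i 0) * (w l 0 k 1 - w l 1 k 0)) * h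

/-! ### Transfer to commuting variables -/

/-- The variables at the first point in terms of central elements. -/
structure CenData (c : Config) where
  w : Fin 2 → Fin 2 → Fin 2 → Fin 2 → Cen
  X : Fin 2 → Matrix (Fin 2) (Fin 2) Cen
  r : Cen
  anti : Exchange w
  hw : ∀ j β i α, ThetaBarTilde j β c * ThetaTilde i α c = cenVal (w j β i α)
  hX : ∀ n β α, XTilde n β α c = cenVal (X n β α)
  hr : sinv rootX c = cenVal r

/-- The exchange rule expresses that the two factors `Θ̃` in a product of four odd elements
anticommute. -/
lemma exists_cenData {c : Config} (hc : c ∈ nondegenerate) : Nonempty (CenData c) := by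
  choose w hw using fun j β i α => ((ThetaBarTilde_od j β c).mul (ThetaTilde_od i α c)).lift
  choose X hX using fun n β α => (XTilde_evM n c β α).lift
  obtain ⟨r, hr⟩ := (sinv_ev (rootX_wt hc (.P 0)).ev).lift
  refine ⟨⟨w, fun n => Matrix.of (X n), r, fun j β i α l β' k α' => cen_injective ?_,
    fun j β i α => (hw _ _ _ _).symm, fun n β α => (hX _ _ _).symm, hr.symm⟩⟩
  rw [map_neg, map_mul, map_mul, hw, hw, hw, hw]
  have h1 := (ThetaTilde_od i α c).anticomm ((ThetaBarTilde_od l β' c))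
  have h2 := (ThetaTilde_od k α' c).anticomm ((ThetaBarTilde_od l β' c))
  have h3 := (ThetaTilde_od i α c).anticomm ((ThetaTilde_od k α' c))
  rw [mul_assoc, mul_assoc, ← mul_assoc (ThetaTilde i α c), h1, ← mul_assoc (ThetaTilde k α' c), h2,
    neg_mul, neg_mul, mul_assoc (ThetaBarTilde l β' c), h3, mul_assoc (ThetaBarTilde l β' c)]
  noncomm_ring

namespace CenData
variable {c : Config} (D : CenData c)

lemma nilp_eq (n i j : Fin 2) : nilp n i j c = cenVal (-(pair D.w (D.X n) i j * D.r)) := by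
  have h : ∀ β α, ThetaBarTilde j β c * XTilde n β α c * ThetaTilde i α c =
      cenVal (D.X n β α * D.w j β i α) := fun β α => by
    rw [← (XTilde_evM n c β α).comm, mul_assoc, D.hw, D.hX, map_mul]
  simp only [nilp, Pi.neg_apply, Pi.mul_apply, Finset.sum_apply, h, D.hr, pair, map_neg, map_mul, map_sum]

lemma hatDot_eq (m n : Fin 2) :
    hatDot m n c = cenVal ((1 / 2 : ℂ) • polar (D.X m) (D.X n) * D.r) := by
  rw [hatDot, Pi.mul_apply, D.hr, minkDot_toVec_cen (XTilde_evM m c) (XTilde_evM n c) (D.hX m)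
    (D.hX n), ← map_mul]

lemma parkInv_eq (i j k l : Fin 2) :
    parkInv i j k l c = cenVal ((2 : ℂ) • quart D.w i j k l * D.r) := by
  have h : ∀ j β i α, ThetaTilde i α c * ThetaBarTilde j β c = - cenVal (D.w j β i α) :=
    fun j β i α => by rw [(ThetaTilde_od i α c).anticomm (ThetaBarTilde_od j β c), D.hw]
  have hb : ∀ i j μ, bilinear (raiseIndex (ThetaTilde i)) (raiseIndex (ThetaBarTilde j)) μ c =
      cenVal (-(sigma μ 0 0 • D.w j 1 i 1 - sigma μ 0 1 • D.w j 0 i 1 - sigma μ 1 0 • D.w j 1 i 0 +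
        sigma μ 1 1 • D.w j 0 i 0)) := fun i j μ => by
    simp only [bilinear_apply, Fin.sum_univ_two, raiseIndex, Matrix.cons_val_zero,
      Matrix.cons_val_one, Pi.neg_apply, neg_mul, mul_neg, h, map_neg, map_add,
      map_sub, map_smul]
    module
  rw [parkInv, Pi.mul_apply, D.hr, map_mul]
  congr 1
  simp only [minkDot, Finset.sum_apply, Pi.smul_apply, Pi.mul_apply, hb, ← map_mul, ← map_smul,
    ← map_sum]
  exact congrArg _ (mink_quart D.w i j k l)

end CenData

/-- The numerator is `X₊²` by `minkDot_chain`, and the root is `X₋² √J` with `J = X₊² / X₋²`. The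
quotient is `J / √J = √J`, once the square of `√J` is known to be `J`. -/
lemma hatDot_zero {c : Config} (hc : c ∈ nondegenerate) :
    hatDot 0 0 c = unipotentSqrt (J 0) c := by
  have h1 : minkDot (toVec (XTilde 0)) (toVec (XTilde 0)) c = XPlusSq 0 c := by
    have h := minkDot_chain hc (i := 0) (j := 3) (k := 1) (l := 0) (by decide) (by decide) (by decide)
    rw [minkDot_toVec (chain_evM c 0 3 1 0) (chain_evM c 0 3 1 0)] at h
    rw [minkDot_toVec (XTilde_evM 0 c) (XTilde_evM 0 c)]
    change (1 / 2 : ℂ) • ((-_) * (-_) + (-_) * (-_) - (-_) * (-_) - (-_) * (-_)) = _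
    simp only [neg_mul_neg]
    exact h
  have hs := unipotentSqrt_sq (body_J hc 0)
  obtain ⟨u, hu⟩ := exists_units hc
  have hm := triple_of_unit hu (i := 3) (j := pt 0) (by decide) (by decide) (by decide)
  have hp := triple_of_unit hu (i := pt 0) (j := 3) (by decide) (by decide) (by decide)
  change XMinusSq 0 c = _ at hm
  change XPlusSq 0 c = _ at hp
  obtain ⟨v, hv⟩ := (unipotentSqrt_wt (J_wt hc (.P 0) 0)).ev.lift_unit
    (isUnit_iff_body.2 (by rw [body_unipotentSqrt (body_J hc 0)]; exact one_ne_zero))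
  have hJ := mul_of_unit hp (sinv_of_unit hm)
  change J 0 c = _ at hJ
  have hR := mul_of_unit hm hv.symm
  change rootX c = _ at hR
  rw [← hv, hJ, ← Units.val_mul, ← map_mul] at hs
  have hs' : v * v = _ := Units.ext (cen_injective hs)
  have hA : hatDot 0 0 c = cenUnit _ := mul_of_unit (h1.trans hp) (sinv_of_unit hR)
  rw [hA, ← hv]
  congr 2
  rw [← mul_right_inj v]
  rw [hs']
  generalize u (pt 0) 3 * (u (pt 0) 0)⁻¹ * (u 0 3)⁻¹ = p
  generalize u 3 (pt 0) * (u 3 0)⁻¹ * (u 0 (pt 0))⁻¹ = m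
  rw [mul_inv]
  apply Additive.ofMul.injective
  simp only [ofMul_mul, ofMul_inv]
  abel

lemma XMinusSq_zero {c : Config} (hc : c ∈ nondegenerate) :
    minkDot (toVec XTilde11Minus) (toVec XTilde11Minus) c = XMinusSq 0 c :=
  minkDot_chain hc (i := 0) (j := 1) (k := 3) (l := 0) (by decide) (by decide) (by decide)


namespace CenData
variable {c : Config} (D : CenData c)

lemma sinv_cen {F : SuperFun} {z z' : Cen} (h : F c = cenVal z) (h' : z * z' = 1) :
    sinv F c = cenVal z' := by
  rw [sinv, h]
  have h1 : z' * z = 1 := by rw [mul_comm, h']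
  exact Ring.inverse_unit ⟨cenVal z, cenVal z', by rw [← map_mul, h', map_one],
    by rw [← map_mul, h1, map_one]⟩

/-- The invariants `X̂²` and `X̂_{1(1)+}·X̂_{1(2)-}`. -/
def dot (m n : Fin 2) : Cen := (1 / 2 : ℂ) • polar (D.X m) (D.X n) * D.r

lemma dot_mul (m n : Fin 2) : polar (D.X m) (D.X n) * D.r = 2 * D.dot m n := by
  rw [dot, two_mul, ← add_mul, ← two_smul ℂ, smul_smul]; norm_num


lemma exists_inv (hc : c ∈ nondegenerate)
    : ∃ a : Cen, D.dot 0 0 * a = 1 ∧ sinv (hatDot 0 0) c = cenVal a := by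
  have h1 : IsUnit (hatDot 0 0 c) := by
    rw [hatDot_zero hc, isUnit_iff_body, body_unipotentSqrt (body_J hc 0)]; exact one_ne_zero
  obtain ⟨u, hu⟩ := (hatDot_wt hc (.P 0) 0 0).ev.lift_unit h1
  rw [D.hatDot_eq] at hu
  have hu' : (u : Cen) = D.dot 0 0 := cen_injective hu
  have h2 : D.dot 0 0 * ↑u⁻¹ = 1 := by rw [← hu', Units.mul_inv]
  exact ⟨↑u⁻¹, h2, sinv_cen (D.hatDot_eq 0 0) h2⟩

/-- Multiplication by powers of `1/R` turns a homogeneous relation between the matrices into a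
relation between invariants, with a quotient such as `B/A` or `C/A` as coefficient. -/
lemma scaled {a x y : Cen} (ha : D.dot 0 0 * a = 1) (n m : Fin 2)
    (h : polar (D.X 0) (D.X 0) * x = polar (D.X n) (D.X m) * y) :
    x * (D.r * D.r) = D.dot n m * a * (y * (D.r * D.r)) := by
  have h1 := D.dot_mul 0 0
  have h2 := D.dot_mul n m
  have h3 : D.dot 0 0 * (x * (D.r * D.r)) = D.dot n m * (y * (D.r * D.r)) := by
    have : (2 : Cen) * (D.dot 0 0 * (x * (D.r * D.r)) - D.dot n m * (y * (D.r * D.r))) = 0 := by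
      linear_combination (D.r * D.r * D.r) * h - x * (D.r * D.r) * h1 + y * (D.r * D.r) * h2
    rw [two_mul, ← two_smul ℂ, smul_eq_zero_iff_right two_ne_zero, sub_eq_zero] at this
    exact this
  linear_combination a * h3 - x * (D.r * D.r) * ha

end CenData

lemma quarter_smul {S : Type*} [CommRing S] [Algebra ℂ S] {x y : S} (h : 4 * x = y) :
    x = (1 / 4 : ℂ) • y := by
  rw [← h, show (4 : S) = algebraMap ℂ S 4 from (map_ofNat _ 4).symm, ← Algebra.smul_def, smul_smul]
  norm_num

lemma half_smul {S : Type*} [CommRing S] [Algebra ℂ S] {x y : S} (h : 2 * x = y) :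
    x = (1 / 2 : ℂ) • y := by
  rw [← h, show (2 : S) = algebraMap ℂ S 2 from (map_ofNat _ 2).symm, ← Algebra.smul_def, smul_smul]
  norm_num

section relations
variable {c : Config}

lemma nilp_same (hc : c ∈ nondegenerate) (j k : Fin 2) : (nilp 0 j k * nilp 1 j k) c =
    (hatDot 0 1 * sinv (hatDot 0 0) * (nilp 0 j k * nilp 0 j k)) c := by
  obtain ⟨D⟩ := exists_cenData hc
  obtain ⟨a, ha, ha'⟩ := D.exists_inv hc
  have h := D.scaled ha 0 1 (x := pair D.w (D.X 0) j k * pair D.w (D.X 1) j k)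
    (y := pair D.w (D.X 0) j k * pair D.w (D.X 0) j k) (by
    rw [pair_same D.anti, pair_same D.anti]; ring)
  simp only [Pi.mul_apply, D.nilp_eq, ha', D.hatDot_eq, ← map_mul]
  refine congrArg _ ?_
  rw [CenData.dot] at h
  linear_combination h

lemma nilp_adjacent (hc : c ∈ nondegenerate)
    (j k m n : Fin 2) (hjk : j = m ∨ k = n) : (nilp 1 j k * nilp 1 m n) c =
    (hatDot 1 1 * sinv (hatDot 0 0) * (nilp 0 j k * nilp 0 m n)) c := by
  obtain ⟨D⟩ := exists_cenData hc
  obtain ⟨a, ha, ha'⟩ := D.exists_inv hc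
  have h := D.scaled ha 1 1 (x := pair D.w (D.X 1) j k * pair D.w (D.X 1) m n)
    (y := pair D.w (D.X 0) j k * pair D.w (D.X 0) m n) (by
    rcases hjk with rfl | rfl
    · exact pair_YY_left D.anti _ _ _ _ _
    · exact pair_YY_right D.anti _ _ _ _ _)
  simp only [Pi.mul_apply, D.nilp_eq, ha', D.hatDot_eq, ← map_mul]
  refine congrArg _ ?_
  rw [CenData.dot] at h
  linear_combination h

lemma nilp_mixed_left (hc : c ∈ nondegenerate) (i j l : Fin 2) : (nilp 1 i j * nilp 0 i l) c =
    ((2 : ℂ) • (hatDot 0 1 * sinv (hatDot 0 0) * (nilp 0 i j * nilp 0 i l))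
        - nilp 0 i j * nilp 1 i l) c := by
  obtain ⟨D⟩ := exists_cenData hc
  obtain ⟨a, ha, ha'⟩ := D.exists_inv hc
  have h := D.scaled ha 0 1 (x := _) (y := 2 * (pair D.w (D.X 0) i j * pair D.w (D.X 0) i l))
    ((pair_XY_left D.anti (D.X 0) (D.X 1) i j l).trans (by ring))
  simp only [Pi.mul_apply, Pi.sub_apply, Pi.smul_apply, D.nilp_eq, ha', D.hatDot_eq, ← map_mul,
    ← map_sub, ← map_smul]
  refine congrArg _ ?_
  rw [CenData.dot] at h
  rw [two_smul]
  linear_combination h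

lemma nilp_mixed_right (hc : c ∈ nondegenerate) (i j k : Fin 2) : (nilp 1 i j * nilp 0 k j) c =
    ((2 : ℂ) • (hatDot 0 1 * sinv (hatDot 0 0) * (nilp 0 i j * nilp 0 k j))
        - nilp 0 i j * nilp 1 k j) c := by
  obtain ⟨D⟩ := exists_cenData hc
  obtain ⟨a, ha, ha'⟩ := D.exists_inv hc
  have h := D.scaled ha 0 1 (x := _) (y := 2 * (pair D.w (D.X 0) i j * pair D.w (D.X 0) k j))
    ((pair_XY_right D.anti (D.X 0) (D.X 1) i j k).trans (by ring))
  simp only [Pi.mul_apply, Pi.sub_apply, Pi.smul_apply, D.nilp_eq, ha', D.hatDot_eq, ← map_mul,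
    ← map_sub, ← map_smul]
  refine congrArg _ ?_
  rw [CenData.dot] at h
  rw [two_smul]
  linear_combination h

lemma nilp_mixed_left' (hc : c ∈ nondegenerate) (i j l : Fin 2) : (nilp 0 i j * nilp 1 i l) c =
    ((2 : ℂ) • (hatDot 0 1 * sinv (hatDot 0 0) * (nilp 0 i j * nilp 0 i l))
        - nilp 1 i j * nilp 0 i l) c := by
  have h := nilp_mixed_left hc i j l
  rw [Pi.sub_apply] at h ⊢
  rw [h]; abel

lemma nilp_mixed_right' (hc : c ∈ nondegenerate) (i j k : Fin 2) : (nilp 0 i j * nilp 1 k j) c =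
    ((2 : ℂ) • (hatDot 0 1 * sinv (hatDot 0 0) * (nilp 0 i j * nilp 0 k j))
        - nilp 1 i j * nilp 0 k j) c := by
  have h := nilp_mixed_right hc i j k
  rw [Pi.sub_apply] at h ⊢
  rw [h]; abel

lemma nilp_cross₁ (hc : c ∈ nondegenerate) : (nilp 0 1 0 * nilp 1 0 1) c =
    (-(nilp 0 0 1 * nilp 1 1 0) - nilp 0 0 0 * nilp 1 1 1 - nilp 0 1 1 * nilp 1 0 0
        + (2 : ℂ) • (hatDot 0 1 * sinv (hatDot 0 0) *
          (nilp 0 0 0 * nilp 0 1 1 + nilp 0 0 1 * nilp 0 1 0))) c := by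
  obtain ⟨D⟩ := exists_cenData hc
  obtain ⟨a, ha, ha'⟩ := D.exists_inv hc
  have h := D.scaled ha 0 1 (x := _) (y := 2 * (pair D.w (D.X 0) 0 0 * pair D.w (D.X 0) 1 1 +
    pair D.w (D.X 0) 0 1 * pair D.w (D.X 0) 1 0))
    ((pair_cross₁ D.anti (D.X 0) (D.X 1)).trans (by ring))
  simp only [Pi.mul_apply, Pi.sub_apply, Pi.add_apply, Pi.neg_apply, Pi.smul_apply, D.nilp_eq, ha',
    D.hatDot_eq, ← map_mul, ← map_add, ← map_smul]
  refine (congrArg cenVal ?_).trans ((map_add cenVal _ _).trans (congrArg (· + _)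
    ((map_sub cenVal _ _).trans (congrArg (· - _) ((map_sub cenVal _ _).trans
    (congrArg (· - _) (map_neg cenVal _)))))))
  rw [CenData.dot] at h
  rw [two_smul]
  linear_combination h

lemma nilp_cross₂ (hc : c ∈ nondegenerate) : (nilp 1 0 0 * nilp 1 1 1) c =
    (-(nilp 1 0 1 * nilp 1 1 0) + hatDot 1 1 * sinv (hatDot 0 0) *
          (nilp 0 0 0 * nilp 0 1 1 + nilp 0 0 1 * nilp 0 1 0)) c := by
  obtain ⟨D⟩ := exists_cenData hc
  obtain ⟨a, ha, ha'⟩ := D.exists_inv hc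
  have h := D.scaled ha 1 1 (pair_cross₂ D.anti (D.X 0) (D.X 1))
  simp only [Pi.mul_apply, Pi.add_apply, Pi.neg_apply, D.nilp_eq, ha',
    D.hatDot_eq, ← map_mul, ← map_add]
  refine (congrArg cenVal ?_).trans ((map_add cenVal _ _).trans (congrArg (· + _)
    (map_neg cenVal _)))
  rw [CenData.dot] at h
  linear_combination h

lemma parkInv_rel {x : Cen} {F : SuperFun} (q : ℂ) (D : CenData c)
    (i j k l : Fin 2) (hF : F c = cenVal (x * (D.r * D.r)))
    (h : x = q • (polar (D.X 0) (D.X 0) * quart D.w i j k l)) :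
    F c = (q • (hatDot 0 0 * parkInv i j k l)) c := by
  rw [hF, Pi.smul_apply, Pi.mul_apply, D.hatDot_eq, D.parkInv_eq, ← map_mul, ← map_smul, h]
  congr 1
  generalize polar (D.X 0) (D.X 0) = p
  simp only [smul_mul_assoc, mul_smul_comm, smul_smul]
  norm_num
  congr 1
  ring

lemma nilp_parkInv_left (hc : c ∈ nondegenerate) (i j l : Fin 2) : (nilp 0 i j * nilp 0 i l) c =
    ((1 / 4 : ℂ) • (hatDot 0 0 * parkInv i j i l)) c := by
  obtain ⟨D⟩ := exists_cenData hc
  refine parkInv_rel _ D i j i l ?_ (quarter_smul (quart_left D.anti (D.X 0) i j l))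
  rw [Pi.mul_apply, D.nilp_eq, D.nilp_eq, ← map_mul]
  congr 1; ring

lemma nilp_parkInv_right (hc : c ∈ nondegenerate) (i j k : Fin 2) : (nilp 0 i j * nilp 0 k j) c =
    ((1 / 4 : ℂ) • (hatDot 0 0 * parkInv i j k j)) c := by
  obtain ⟨D⟩ := exists_cenData hc
  refine parkInv_rel _ D i j k j ?_ (quarter_smul (quart_right D.anti (D.X 0) i j k))
  rw [Pi.mul_apply, D.nilp_eq, D.nilp_eq, ← map_mul]
  congr 1; ring

lemma nilp_parkInv_cross (hc : c ∈ nondegenerate)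
    : (nilp 0 0 0 * nilp 0 1 1 + nilp 0 0 1 * nilp 0 1 0) c =
    ((1 / 2 : ℂ) • (hatDot 0 0 * parkInv 0 0 1 1)) c ∧
    (nilp 0 0 0 * nilp 0 1 1 + nilp 0 0 1 * nilp 0 1 0) c =
    ((1 / 2 : ℂ) • (hatDot 0 0 * parkInv 0 1 1 0)) c := by
  obtain ⟨D⟩ := exists_cenData hc
  have h := quart_cross₁ D.anti (D.X 0)
  constructor
  · refine parkInv_rel _ D 0 0 1 1 ?_ (half_smul h)
    rw [Pi.add_apply, Pi.mul_apply, Pi.mul_apply, D.nilp_eq, D.nilp_eq, D.nilp_eq, D.nilp_eq,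
      ← map_mul, ← map_mul, ← map_add]
    congr 1; ring
  · rw [← quart_cross₂ D.anti] at h
    refine parkInv_rel _ D 0 1 1 0 ?_ (half_smul h)
    rw [Pi.add_apply, Pi.mul_apply, Pi.mul_apply, D.nilp_eq, D.nilp_eq, D.nilp_eq, D.nilp_eq,
      ← map_mul, ← map_mul, ← map_add]
    congr 1; ring

end relations

/-- Here `m` is the matrix of `X₋`, whose normalized square is `1/A`. Expanding that square in terms
of `X₊` gives `A² + 4iIA - 16I² = 1`. Completing the square, `(A + 2iI)² = 1 + 12I² = (1 + 6I²)²`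
because `I³ = 0`, and the difference of squares factors. -/
lemma root_relation {S : Type*} [CommRing S] [Algebra ℂ S] {w : Fin 2 → Fin 2 → Fin 2 → Fin 2 → S}
    (hw : ∀ j β i α l β' k α', w j β i α * w l β' k α' = -(w j β k α' * w l β' i α))
    {X m : Matrix (Fin 2) (Fin 2) S} {r a A I i : S} (hi : i * i = -1)
    (hm : ∀ β α, m β α = X β α - 4 * i * adj2 (Matrix.of fun α β => w 0 β 0 α) β α)
    (hA : polar X X * r = 2 * A) (ha : A * a = 1) (hI : I = -(pair w X 0 0 * r))
    (hd : polar m m * r = 2 * a) :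
    (A + 2 * i * I - (1 + 6 * I ^ 2)) * (A + 2 * i * I + (1 + 6 * I ^ 2)) = 0 := by
  have h2 : ∀ x : S, 2 * x = 0 → x = 0 := fun x hx => by
    rw [two_mul, ← two_smul ℂ, smul_eq_zero_iff_right two_ne_zero] at hx
    exact hx
  have h3 := pair_same hw X X 0 0
  have h4 := pair_cube hw X 0 0
  have h5 := hw 0 1 0 0 0 0 0 1
  have h6 : polar m m = polar X X - 8 * i * pair w X 0 0 - 64 * (w 0 0 0 0 * w 0 1 0 1) := by
    simp only [polar, hm, adj2_apply, pair, Fin.sum_univ_two, Matrix.of_apply]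
    linear_combination 32 * (w 0 0 0 0 * w 0 1 0 1 - w 0 1 0 0 * w 0 0 0 1) * hi + 32 * h5
  have h7 : I * I = 2 * A * (w 0 0 0 0 * w 0 1 0 1) * r := by
    rw [hI]
    linear_combination (r * r) * h3 + (r * (w 0 0 0 0 * w 0 1 0 1)) * hA
  have h8 : I * I * I = 0 := by rw [hI]; linear_combination (-(r * r * r)) * h4
  have h9 : A * A + 4 * i * I * A - 16 * (I * I) = 1 := by
    refine sub_eq_zero.1 (h2 _ ?_)
    rw [h6] at hd
    rw [h7, hI]
    linear_combination (-A) * hA + A * hd + 2 * ha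
  linear_combination h9 - (36 * I) * h8 + 4 * I * I * hi

lemma hatDot_zero_eq {c : Config} (hc : c ∈ nondegenerate) : hatDot 0 0 c =
    (1 - (2 * Complex.I) • nilp 0 0 0 + (6 : ℂ) • nilp 0 0 0 ^ 2 : SuperFun) c := by
  obtain ⟨D⟩ := exists_cenData hc
  obtain ⟨a, ha, ha'⟩ := D.exists_inv hc
  let m : Matrix (Fin 2) (Fin 2) Cen := Matrix.of fun β α => D.X 0 β α -
    4 * algebraMap ℂ Cen Complex.I * adj2 (Matrix.of fun α β => D.w 0 β 0 α) β α
  have hev : EvM c XTilde11Minus := chain_evM c 0 1 3 0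
  have hm : ∀ β α, XTilde11Minus β α c = cenVal (m β α) := fun β α => by
    have h := adj2_XTilde_diff hc β α
    have e : ∀ α β, ThetaTilde 0 α c * ThetaBarTilde 0 β c = -cenVal (D.w 0 β 0 α) := fun α β => by
      rw [(ThetaTilde_od 0 α c).anticomm (ThetaBarTilde_od 0 β c), D.hw]
    have h1 : evm c XTilde11Plus β α = cenVal (D.X 0 β α) := D.hX 0 β α
    have h2 : (4 * algebraMap ℂ Cen Complex.I) = algebraMap ℂ Cen (4 * Complex.I) := by
      rw [map_mul, show algebraMap ℂ Cen 4 = 4 from map_ofNat _ 4]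
    change evm c XTilde11Minus β α = _
    rw [h, h1, show m β α = D.X 0 β α - (4 * Complex.I) •
      adj2 (Matrix.of fun α β => D.w 0 β 0 α) β α by rw [Algebra.smul_def, ← h2]; rfl,
      map_sub, map_smul, sub_eq_add_neg, ← smul_neg]
    congr 2
    fin_cases β <;> fin_cases α <;> simp [adj2, e]
  have hd := minkDot_toVec_cen hev hev hm hm
  rw [XMinusSq_zero hc] at hd
  have hroot : XMinusSq 0 c * sinv rootX c = cenVal a := by
    have h1 : rootX c = XMinusSq 0 c * hatDot 0 0 c := by rw [hatDot_zero hc]; rfl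
    have h2 : XMinusSq 0 c = rootX c * cenVal a := by
      rw [h1, mul_assoc, D.hatDot_eq, ← map_mul, show (1 / 2 : ℂ) • polar (D.X 0) (D.X 0) * D.r * a = 1 from ha,
        map_one, mul_one]
    rw [h2, D.hr, mul_assoc, ← map_mul, mul_comm a, map_mul, ← mul_assoc, ← D.hr,
      show rootX c * sinv rootX c = 1 from Ring.mul_inverse_cancel _ (rootX_unit hc), one_mul]
  rw [hd, D.hr, ← map_mul] at hroot
  have hroot' := cen_injective hroot
  have h := root_relation D.anti (i := algebraMap ℂ Cen Complex.I)
    (by rw [← map_mul, Complex.I_mul_I, map_neg, map_one]) (fun β α => rfl) (D.dot_mul 0 0) ha rfl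
    (show polar m m * D.r = 2 * a by
      rw [← hroot', two_mul, ← add_mul, ← two_smul ℂ, smul_smul]; norm_num)
  have h' := congrArg cenVal h
  rw [map_mul, map_zero] at h'
  have e1 : cenVal (D.dot 0 0) = hatDot 0 0 c := (D.hatDot_eq 0 0).symm
  have e2 : cenVal (-(pair D.w (D.X 0) 0 0 * D.r)) = nilp 0 0 0 c := (D.nilp_eq 0 0 0).symm
  have e3 : ∀ x, cenVal (2 * algebraMap ℂ Cen Complex.I * x) = (2 * Complex.I) • cenVal x :=
    fun x => by
    rw [← map_smul, Algebra.smul_def, map_mul (algebraMap ℂ Cen),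
      show algebraMap ℂ Cen 2 = 2 from map_ofNat _ 2]
  have e4 : ∀ x, cenVal (6 * x) = (6 : ℂ) • cenVal x := fun x => by
    rw [← map_smul, Algebra.smul_def, show algebraMap ℂ Cen 6 = 6 from map_ofNat _ 6]
  simp only [map_sub, map_add, map_one, e1, e2, e3, e4, map_pow] at h'
  -- This factor has body `1 + 1 = 2`, so the other factor of `root_relation` vanishes. The body
  -- thus selects the branch of the root.
  have hu : IsUnit (hatDot 0 0 c + (2 * Complex.I) • nilp 0 0 0 c +
      (1 + (6 : ℂ) • nilp 0 0 0 c ^ 2)) := by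
    rw [isUnit_iff_body, hatDot_zero hc]
    simp only [map_add, map_smul, map_pow, body_nilp, body_unipotentSqrt (body_J hc 0), map_one]
    norm_num
  have h5 := (hu.mul_left_eq_zero).1 h'
  simp only [Pi.add_apply, Pi.sub_apply, Pi.smul_apply, Pi.pow_apply, Pi.one_apply]
  rw [sub_eq_zero] at h5
  rw [eq_sub_of_add_eq h5]
  abel

set_option maxRecDepth 100000 in
lemma chosen_card : chosen.card = 36 ∧ (chosen.filter fun e => 1 < degree e).card = 27 ∧
    (∀ d : Fin 5, (chosen.filter fun e => degree e = d).card = ![1, 8, 18, 8, 1] d) := by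
  refine ⟨by decide +kernel, by decide +kernel, by decide +kernel⟩

/-! ## Functions of the cross ratios -/

/-- The derivative in the direction `v`. -/
def dirD (v : ℝ × ℝ) (f : ℝ × ℝ → ℂ) : ℝ × ℝ → ℂ := fun y => fderiv ℝ f y v

section dirD
variable {W : Set (ℝ × ℝ)} {f g : ℝ × ℝ → ℂ} {v w : ℝ × ℝ}

lemma dirD_congr (hW : IsOpen W) (h : Set.EqOn f g W) : Set.EqOn (dirD v f) (dirD v g) W :=
  fun y hy => by
    have : f =ᶠ[nhds y] g := Filter.eventuallyEq_of_mem (hW.mem_nhds hy) h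
    rw [dirD, dirD, this.fderiv_eq]

lemma dirD_iter_congr (hW : IsOpen W) (h : Set.EqOn f g W) (n : ℕ) :
    Set.EqOn ((dirD v)^[n] f) ((dirD v)^[n] g) W := by
  induction n with
  | zero => exact h
  | succ n ih =>
    rw [Function.iterate_succ_apply', Function.iterate_succ_apply']
    exact dirD_congr hW ih

lemma dirD_smooth (hW : IsOpen W) (hf : ContDiffOn ℝ ∞ f W) : ContDiffOn ℝ ∞ (dirD v f) W :=
  (hf.fderiv_of_isOpen hW (by simp)).clm_apply contDiffOn_const

lemma dirD_iter_smooth (hW : IsOpen W) (hf : ContDiffOn ℝ ∞ f W) (n : ℕ) :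
    ContDiffOn ℝ ∞ ((dirD v)^[n] f) W := by
  induction n with
  | zero => exact hf
  | succ n ih => rw [Function.iterate_succ_apply']; exact dirD_smooth hW ih

lemma diff_of_smooth (hW : IsOpen W) (hf : ContDiffOn ℝ ∞ f W) {y : ℝ × ℝ} (hy : y ∈ W) :
    DifferentiableAt ℝ f y := (hf.contDiffAt (hW.mem_nhds hy)).differentiableAt (by simp)

lemma dirD_add (hW : IsOpen W) (hf : ContDiffOn ℝ ∞ f W) (hg : ContDiffOn ℝ ∞ g W) :
    Set.EqOn (dirD v (f + g)) (dirD v f + dirD v g) W := fun y hy => by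
  simp only [dirD, Pi.add_apply, fderiv_add (diff_of_smooth hW hf hy) (diff_of_smooth hW hg hy),
    add_apply]

lemma dirD_iter_add (hW : IsOpen W) (hf : ContDiffOn ℝ ∞ f W) (hg : ContDiffOn ℝ ∞ g W) (n : ℕ) :
    Set.EqOn ((dirD v)^[n] (f + g)) ((dirD v)^[n] f + (dirD v)^[n] g) W := by
  induction n with
  | zero => exact fun _ _ => rfl
  | succ n ih =>
    simp only [Function.iterate_succ_apply']
    exact (dirD_congr hW ih).trans
      (dirD_add hW (dirD_iter_smooth hW hf n) (dirD_iter_smooth hW hg n))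

lemma dirD_zero : dirD v (0 : ℝ × ℝ → ℂ) = 0 := by
  funext y
  rw [dirD, fderiv_zero]; rfl

lemma dirD_iter_zero (n : ℕ) : (dirD v)^[n] (0 : ℝ × ℝ → ℂ) = 0 := by
  induction n with
  | zero => rfl
  | succ n ih => rw [Function.iterate_succ_apply', ih, dirD_zero]

lemma dirD_sum (hW : IsOpen W) {ι : Type*} (s : Finset ι) {F : ι → ℝ × ℝ → ℂ}
    (hF : ∀ i ∈ s, ContDiffOn ℝ ∞ (F i) W) :
    Set.EqOn (dirD v (∑ i ∈ s, F i)) (∑ i ∈ s, dirD v (F i)) W := fun y hy => by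
  rw [dirD, fderiv_sum fun i hi => diff_of_smooth hW (hF i hi) hy]
  simp [dirD]

lemma dirD_iter_sum (hW : IsOpen W) {ι : Type*} (s : Finset ι) {F : ι → ℝ × ℝ → ℂ}
    (hF : ∀ i ∈ s, ContDiffOn ℝ ∞ (F i) W) (n : ℕ) :
    Set.EqOn ((dirD v)^[n] (∑ i ∈ s, F i)) (∑ i ∈ s, (dirD v)^[n] (F i)) W := by
  induction n with
  | zero => exact fun _ _ => rfl
  | succ n ih =>
    simp only [Function.iterate_succ_apply']
    exact (dirD_congr hW ih).trans (dirD_sum hW s fun i hi => dirD_iter_smooth hW (hF i hi) n)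

lemma dirD_mul (hW : IsOpen W) (hf : ContDiffOn ℝ ∞ f W) (hg : ContDiffOn ℝ ∞ g W) :
    Set.EqOn (dirD v (f * g)) (f * dirD v g + dirD v f * g) W := fun y hy => by
  simp only [dirD, Pi.add_apply, Pi.mul_apply,
    fderiv_mul (diff_of_smooth hW hf hy) (diff_of_smooth hW hg hy), add_apply, smul_apply,
    smul_eq_mul]
  ring

lemma smooth_smul (hf : ContDiffOn ℝ ∞ f W) (a : ℂ) : ContDiffOn ℝ ∞ (a • f) W :=
  contDiffOn_const.smul hf

lemma dirD_smul (hW : IsOpen W) (hf : ContDiffOn ℝ ∞ f W) (a : ℂ) :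
    Set.EqOn (dirD v (a • f)) (a • dirD v f) W := fun y hy => by
  simp only [dirD, Pi.smul_apply, fderiv_const_smul (diff_of_smooth hW hf hy), smul_apply]

lemma dirD_iter_smul (hW : IsOpen W) (hf : ContDiffOn ℝ ∞ f W) (a : ℂ) (n : ℕ) :
    Set.EqOn ((dirD v)^[n] (a • f)) (a • (dirD v)^[n] f) W := by
  induction n with
  | zero => exact fun _ _ => rfl
  | succ n ih =>
    simp only [Function.iterate_succ_apply']
    exact (dirD_congr hW ih).trans (dirD_smul hW (dirD_iter_smooth hW hf n) a)

lemma dirD_comm (hW : IsOpen W) (hf : ContDiffOn ℝ ∞ f W) :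
    Set.EqOn (dirD v (dirD w f)) (dirD w (dirD v f)) W := fun y hy => by
  have h := hf.contDiffAt (hW.mem_nhds hy)
  have h1 : DifferentiableAt ℝ (fderiv ℝ f) y :=
    (h.fderiv_right (m := 1) (WithTop.coe_le_coe.2 le_top)).differentiableAt (by simp)
  have h2 := h.isSymmSndFDerivAt (by simp; exact WithTop.coe_le_coe.2 le_top)
  have h3 : ∀ u : ℝ × ℝ, HasFDerivAt (dirD u f) ((fderiv ℝ (fderiv ℝ f) y).flip u) y := by
    intro u
    have := h1.hasFDerivAt.clm_apply (hasFDerivAt_const u y)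
    rw [ContinuousLinearMap.comp_zero, zero_add] at this
    exact this
  change fderiv ℝ (dirD w f) y v = fderiv ℝ (dirD v f) y w
  rw [(h3 w).fderiv, (h3 v).fderiv]
  exact h2.eq v w

lemma dirD_iter_comm (hW : IsOpen W) (hf : ContDiffOn ℝ ∞ f W) (n : ℕ) :
    Set.EqOn (dirD v ((dirD w)^[n] f)) ((dirD w)^[n] (dirD v f)) W := by
  induction n with
  | zero => exact fun _ _ => rfl
  | succ n ih =>
    simp only [Function.iterate_succ_apply']
    exact (dirD_comm hW (dirD_iter_smooth hW hf n)).trans (dirD_congr hW ih)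

lemma dirD_iter_mul (hW : IsOpen W) (hf : ContDiffOn ℝ ∞ f W) (hg : ContDiffOn ℝ ∞ g W) (n : ℕ) :
    Set.EqOn ((dirD v)^[n] (f * g)) (∑ p ∈ Finset.HasAntidiagonal.antidiagonal n,
      (n.choose p.1 : ℂ) • ((dirD v)^[p.1] f * (dirD v)^[p.2] g)) W := by
  induction n with
  | zero => intro y _; simp
  | succ n ih =>
    rw [Function.iterate_succ_apply']
    have hs : ∀ i j, ContDiffOn ℝ ∞ ((dirD v)^[i] f * (dirD v)^[j] g) W := fun i j =>
      (dirD_iter_smooth hW hf i).mul (dirD_iter_smooth hW hg j)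
    refine (dirD_congr hW ih).trans ((dirD_sum hW _ fun p _ =>
      smooth_smul (hs _ _) _).trans fun y hy => ?_)
    have h1 := Finset.sum_antidiagonal_choose_succ_mul
      (fun i j => (dirD v)^[i] f y * (dirD v)^[j] g y) n
    simp only [Finset.sum_apply, Pi.smul_apply, Pi.mul_apply, smul_eq_mul]
    rw [h1, ← Finset.sum_add_distrib]
    refine Finset.sum_congr rfl fun p hp => ?_
    rw [dirD_smul hW (hs _ _) _ hy, Pi.smul_apply, dirD_mul hW (dirD_iter_smooth hW hf _)
      (dirD_iter_smooth hW hg _) hy]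
    have h2 : n.choose p.2 = n.choose p.1 :=
      (Nat.choose_symm_of_eq_add (Finset.HasAntidiagonal.mem_antidiagonal.1 hp).symm).symm
    simp only [Function.iterate_succ_apply', Pi.add_apply, Pi.mul_apply, smul_eq_mul, h2]
    ring

end dirD

/-- The mixed derivatives. -/
def mixD (m n : ℕ) (f : ℝ × ℝ → ℂ) : ℝ × ℝ → ℂ := (dirD (1, 0))^[m] ((dirD (0, 1))^[n] f)

section mixD
variable {W : Set (ℝ × ℝ)} {f g : ℝ × ℝ → ℂ}

lemma mixD_smooth (hW : IsOpen W) (hf : ContDiffOn ℝ ∞ f W) (m n : ℕ) :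
    ContDiffOn ℝ ∞ (mixD m n f) W := dirD_iter_smooth hW (dirD_iter_smooth hW hf n) m

lemma dirD_mixD₁ (m n : ℕ) : dirD (1, 0) (mixD m n f) = mixD (m + 1) n f := by
  rw [mixD, mixD, Function.iterate_succ_apply']

lemma dirD_mixD₂ (hW : IsOpen W) (hf : ContDiffOn ℝ ∞ f W) (m n : ℕ) :
    Set.EqOn (dirD (0, 1) (mixD m n f)) (mixD m (n + 1) f) W := by
  rw [mixD, mixD, Function.iterate_succ_apply']
  exact dirD_iter_comm hW (dirD_iter_smooth hW hf n) m

lemma mixD_add (hW : IsOpen W) (hf : ContDiffOn ℝ ∞ f W) (hg : ContDiffOn ℝ ∞ g W) (m n : ℕ) :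
    Set.EqOn (mixD m n (f + g)) (mixD m n f + mixD m n g) W :=
  (dirD_iter_congr hW (dirD_iter_add hW hf hg n) m).trans
    (dirD_iter_add hW (dirD_iter_smooth hW hf n) (dirD_iter_smooth hW hg n) m)

lemma mixD_smul (hW : IsOpen W) (hf : ContDiffOn ℝ ∞ f W) (a : ℂ) (m n : ℕ) :
    Set.EqOn (mixD m n (a • f)) (a • mixD m n f) W :=
  (dirD_iter_congr hW (dirD_iter_smul hW hf a n) m).trans
    (dirD_iter_smul hW (dirD_iter_smooth hW hf n) a m)

/-- The Taylor coefficients. -/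
def taylor (f : ℝ × ℝ → ℂ) (y : ℝ × ℝ) (m n : ℕ) : ℂ :=
  ((m.factorial : ℂ) * (n.factorial : ℂ))⁻¹ * mixD m n f y

lemma choose_fact {n : ℕ} {p : ℕ × ℕ} (hp : p ∈ Finset.HasAntidiagonal.antidiagonal n) :
    ((n.factorial : ℂ))⁻¹ * (n.choose p.1 : ℂ) =
      ((p.1.factorial : ℂ))⁻¹ * ((p.2.factorial : ℂ))⁻¹ := by
  rw [Finset.HasAntidiagonal.mem_antidiagonal] at hp
  have h := Nat.add_choose_mul_factorial_mul_factorial p.1 p.2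
  rw [hp, ← Nat.choose_symm_of_eq_add hp.symm] at h
  have h1 : (p.1.factorial : ℂ) ≠ 0 := by exact_mod_cast p.1.factorial_ne_zero
  have h2 : (p.2.factorial : ℂ) ≠ 0 := by exact_mod_cast p.2.factorial_ne_zero
  have h3 : (n.factorial : ℂ) ≠ 0 := by exact_mod_cast n.factorial_ne_zero
  field_simp
  exact_mod_cast h

/-- The Leibniz rule in both variables; dividing by the factorials absorbs the binomial coefficients
and leaves the Cauchy product. -/
lemma taylor_mul (hW : IsOpen W) (hf : ContDiffOn ℝ ∞ f W) (hg : ContDiffOn ℝ ∞ g W)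
    {y : ℝ × ℝ} (hy : y ∈ W) (m n : ℕ) : taylor (f * g) y m n =
      ∑ p ∈ Finset.HasAntidiagonal.antidiagonal m, ∑ q ∈ Finset.HasAntidiagonal.antidiagonal n,
        taylor f y p.1 q.1 * taylor g y p.2 q.2 := by
  have hs : ∀ i j, ContDiffOn ℝ ∞ ((dirD (0, 1))^[i] f * (dirD (0, 1))^[j] g) W := fun i j =>
    (dirD_iter_smooth hW hf i).mul (dirD_iter_smooth hW hg j)
  have h : mixD m n (f * g) y = ∑ q ∈ Finset.HasAntidiagonal.antidiagonal n, ∑ p ∈ Finset.HasAntidiagonal.antidiagonal m,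
      ((m.choose p.1 : ℂ) * (n.choose q.1 : ℂ)) * (mixD p.1 q.1 f y * mixD p.2 q.2 g y) := by
    rw [mixD, dirD_iter_congr hW (dirD_iter_mul hW hf hg n) m hy,
      dirD_iter_sum hW _ (fun p _ => smooth_smul (hs _ _) _) m hy, Finset.sum_apply]
    refine Finset.sum_congr rfl fun q _ => ?_
    rw [dirD_iter_smul hW (hs _ _) _ m hy, Pi.smul_apply, dirD_iter_mul hW
      (dirD_iter_smooth hW hf _) (dirD_iter_smooth hW hg _) m hy, Finset.sum_apply,
      Finset.smul_sum]
    refine Finset.sum_congr rfl fun p _ => ?_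
    simp only [Pi.smul_apply, Pi.mul_apply, smul_eq_mul, mixD]
    ring
  rw [taylor, h, Finset.sum_comm, Finset.mul_sum]
  refine Finset.sum_congr rfl fun p hp => ?_
  rw [Finset.mul_sum]
  refine Finset.sum_congr rfl fun q hq => ?_
  rw [taylor, taylor, mul_inv, mul_inv, mul_inv]
  linear_combination (mixD p.1 q.1 f y * mixD p.2 q.2 g y) * (((n.factorial : ℂ)⁻¹ * n.choose q.1) *
    choose_fact hp + ((p.1.factorial : ℂ)⁻¹ * (p.2.factorial : ℂ)⁻¹) * choose_fact hq)

/-- One slot at a time is peeled off from the left: first the `m` derivatives in the first variable,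
then the `n` in the second, which is the order of composition in `mixD`. -/
lemma iteratedFDeriv_eq_mixD (hW : IsOpen W) (hf : ContDiffOn ℝ ∞ f W) (k m n : ℕ)
    (hk : k = m + n) : ∀ y ∈ W, iteratedFDeriv ℝ k f y
      (fun j => if j.val < m then ((1 : ℝ), (0 : ℝ)) else ((0 : ℝ), (1 : ℝ))) = mixD m n f y := by
  have step : ∀ (k : ℕ) (v : Fin (k + 1) → ℝ × ℝ), ∀ y ∈ W, iteratedFDeriv ℝ (k + 1) f y v =
      dirD (v 0) (fun z => iteratedFDeriv ℝ k f z (Fin.tail v)) y := by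
    intro k v y hy
    rw [iteratedFDeriv_succ_apply_left, dirD, fderiv_continuousMultilinear_apply_const_apply]
    exact (hf.contDiffAt (hW.mem_nhds hy)).differentiableAt_iteratedFDeriv
      (by exact_mod_cast ENat.natCast_lt_top k)
  induction k generalizing m n with
  | zero =>
    obtain ⟨rfl, rfl⟩ : m = 0 ∧ n = 0 := by omega
    intro y _
    rfl
  | succ k ih =>
    intro y hy
    rw [step k _ y hy]
    rcases m with _ | m
    · obtain ⟨l, rfl⟩ : ∃ l, n = l + 1 := ⟨n - 1, by omega⟩
      have h := ih 0 l (by omega)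
      rw [mixD, Function.iterate_succ_apply']
      refine dirD_congr hW (fun z hz => ?_) hy
      rw [← show mixD 0 l f z = (dirD (0, 1))^[l] f z from rfl, ← h z hz]
      rfl
    · have h := ih m n (by omega)
      rw [← dirD_mixD₁]
      refine dirD_congr hW (fun z hz => ?_) hy
      rw [← h z hz]
      congr 1
      funext j
      simp [Fin.tail]

end mixD

/-! ### Substitution of the cross ratios into Taylor expansions -/

/-- The nilpotent part of the first two cross ratios. -/
def crossNil (k : Fin 6) : SuperFun := fun c =>
  crossI k c - algebraMap ℂ Grassmann (body (crossI k c))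

lemma ofCrossRatios_apply {W : Set (ℝ × ℝ)} {f : ℝ × ℝ → ℂ} (hW : IsOpen W)
    (hf : ContDiffOn ℝ ∞ f W) {c : Config} (hc : crossBody c ∈ W) :
    ofCrossRatios f c = ∑ m ∈ Finset.range 17, ∑ n ∈ Finset.range 17,
      taylor f (crossBody c) m n • (crossNil 0 c ^ m * crossNil 1 c ^ n) := by
  unfold ofCrossRatios
  refine Finset.sum_congr rfl fun m _ => Finset.sum_congr rfl fun n _ => ?_
  rw [iteratedFDeriv_eq_mixD hW hf (m + n) m n rfl _ hc]
  rfl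

/-- The triangle `i + j < 17` can be enlarged to the full square, since the added terms contain a
vanishing power of `N`. -/
lemma sum_antidiagonal_nilpotent {A : Type*} [CommRing A] {N : A} (hN : N ^ 17 = 0)
    (F : ℕ → ℕ → A) : ∑ m ∈ Finset.range 17, (∑ p ∈ Finset.HasAntidiagonal.antidiagonal m, F p.1 p.2) * N ^ m =
      ∑ i ∈ Finset.range 17, ∑ j ∈ Finset.range 17, F i j * N ^ (i + j) := by
  have h0 : ∀ k, 17 ≤ k → N ^ k = 0 := fun k hk => pow_eq_zero_of_le hk hN
  have h1 : ∀ i ∈ Finset.range 17, ∑ j ∈ Finset.range 17, F i j * N ^ (i + j) =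
      ∑ m ∈ Finset.range 17, if i ≤ m then F i (m - i) * N ^ m else 0 := by
    intro i hi
    rw [Finset.mem_range] at hi
    rw [← Finset.sum_filter]
    have : (Finset.range 17).filter (fun m => i ≤ m) =
        (Finset.range (17 - i)).image (fun j => i + j) := by
      ext m
      simp only [Finset.mem_filter, Finset.mem_range, Finset.mem_image]
      exact ⟨fun h => ⟨m - i, by omega, by omega⟩, by rintro ⟨j, h, rfl⟩; omega⟩
    rw [this, Finset.sum_image fun a _ b _ h => by simpa using h]
    simp only [Nat.add_sub_cancel_left]
    refine (Finset.sum_subset (Finset.range_mono (by omega)) fun j _ hj => ?_).symm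
    rw [Finset.mem_range] at hj
    rw [h0 _ (by omega), mul_zero]
  rw [Finset.sum_congr rfl h1, Finset.sum_comm]
  refine Finset.sum_congr rfl fun m hm => ?_
  rw [Finset.mem_range] at hm
  rw [← Finset.sum_filter, Finset.Nat.sum_antidiagonal_eq_sum_range_succ_mk, Finset.sum_mul]
  refine Finset.sum_congr ?_ fun _ _ => rfl
  ext i
  simp only [Finset.mem_filter, Finset.mem_range]
  omega

section ofCrossRatios
variable {W : Set (ℝ × ℝ)} {f g : ℝ × ℝ → ℂ} {c : Config}

lemma crossI_ev (hc : c ∈ nondegenerate) (k : Fin 6) : Ev (crossI k c) :=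
  (crossI_wt hc (.P 0) k).ev

lemma crossNil_ev (hc : c ∈ nondegenerate) (k : Fin 6) : Ev (crossNil k c) :=
  (crossI_ev hc k).sub (ev_algebraMap _)

lemma crossNil_mem_fil (hc : c ∈ nondegenerate) (k : Fin 6) : crossNil k c ∈ Fil 2 :=
  (crossI_ev hc k).sub_body_mem_fil

lemma crossNil_pow (hc : c ∈ nondegenerate) (k : Fin 6) {n : ℕ} (hn : 9 ≤ n) :
    crossNil k c ^ n = 0 :=
  eq_zero_of_mem_fil (by omega) (pow_mem_fil (crossNil_mem_fil hc k) n)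

lemma taylor_eq_zero (h : f =ᶠ[nhds (crossBody c)] 0) (m n : ℕ) : taylor f (crossBody c) m n = 0 := by
  obtain ⟨U, hU, hUo, hc⟩ := eventually_nhds_iff.1 h
  have h1 := dirD_iter_congr (v := (1, 0)) hUo
    (dirD_iter_congr (v := (0, 1)) hUo (f := f) (g := 0) (fun y hy => hU y hy) n) m hc
  rw [taylor, mixD, h1, dirD_iter_zero, dirD_iter_zero, Pi.zero_apply, mul_zero]

lemma ofCrossRatios_eq_zero (h : f =ᶠ[nhds (crossBody c)] 0) : ofCrossRatios f c = 0 := by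
  obtain ⟨U, hU, hUo, hc⟩ := eventually_nhds_iff.1 h
  have hf : ContDiffOn ℝ ∞ f U := contDiffOn_const.congr fun y hy => hU y hy
  rw [ofCrossRatios_apply hUo hf hc]
  refine Finset.sum_eq_zero fun m _ => Finset.sum_eq_zero fun n _ => ?_
  rw [taylor_eq_zero h, zero_smul]

lemma ofCrossRatios_add (hW : IsOpen W) (hf : ContDiffOn ℝ ∞ f W) (hg : ContDiffOn ℝ ∞ g W)
    (hc : crossBody c ∈ W) :
    ofCrossRatios (f + g) c = ofCrossRatios f c + ofCrossRatios g c := by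
  rw [ofCrossRatios_apply hW (f := f + g) (hf.add hg) hc, ofCrossRatios_apply hW hf hc,
    ofCrossRatios_apply hW hg hc]
  simp only [← Finset.sum_add_distrib]
  refine Finset.sum_congr rfl fun m _ => Finset.sum_congr rfl fun n _ => ?_
  rw [← add_smul, taylor, mixD_add hW hf hg m n hc, Pi.add_apply, mul_add]
  rfl

lemma ofCrossRatios_smul (hW : IsOpen W) (hf : ContDiffOn ℝ ∞ f W) (a : ℂ)
    (hc : crossBody c ∈ W) : ofCrossRatios (a • f) c = a • ofCrossRatios f c := by
  rw [ofCrossRatios_apply hW (smooth_smul hf a) hc, ofCrossRatios_apply hW hf hc]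
  simp only [Finset.smul_sum, smul_smul]
  refine Finset.sum_congr rfl fun m _ => Finset.sum_congr rfl fun n _ => ?_
  rw [taylor, mixD_smul hW hf a m n hc, Pi.smul_apply, smul_eq_mul, mul_left_comm]
  rfl

lemma ofCrossRatios_sum (hW : IsOpen W) {ι : Type*} (s : Finset ι) {F : ι → ℝ × ℝ → ℂ}
    (hF : ∀ i ∈ s, ContDiffOn ℝ ∞ (F i) W) (hc : crossBody c ∈ W) :
    ofCrossRatios (∑ i ∈ s, F i) c = ∑ i ∈ s, ofCrossRatios (F i) c := by
  classical
  induction s using Finset.induction_on with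
  | empty => exact ofCrossRatios_eq_zero Filter.EventuallyEq.rfl
  | insert a s ha ih =>
    have h1 : ContDiffOn ℝ ∞ (∑ i ∈ s, F i) W := by
      rw [show (∑ i ∈ s, F i) = fun y => ∑ i ∈ s, F i y from funext fun y => Finset.sum_apply _ _ _]
      exact ContDiffOn.sum fun i hi => hF i (Finset.mem_insert_of_mem hi)
    rw [Finset.sum_insert ha, Finset.sum_insert ha,
      ofCrossRatios_add hW (hF a (Finset.mem_insert_self _ _)) h1 hc,
      ih fun i hi => hF i (Finset.mem_insert_of_mem hi)]

lemma convolution {A : Type*} [CommRing A] {M N : A} (hM : M ^ 17 = 0) (hN : N ^ 17 = 0)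
    (p q : ℕ → ℕ → A) : ∑ m ∈ Finset.range 17, ∑ n ∈ Finset.range 17,
      (∑ i ∈ Finset.HasAntidiagonal.antidiagonal m, ∑ j ∈ Finset.HasAntidiagonal.antidiagonal n,
        p i.1 j.1 * q i.2 j.2) * (M ^ m * N ^ n) =
    (∑ m ∈ Finset.range 17, ∑ n ∈ Finset.range 17, p m n * (M ^ m * N ^ n)) *
      ∑ m ∈ Finset.range 17, ∑ n ∈ Finset.range 17, q m n * (M ^ m * N ^ n) := by
  have h1 : ∀ n, ∑ m ∈ Finset.range 17,
      (∑ i ∈ Finset.HasAntidiagonal.antidiagonal m, ∑ j ∈ Finset.HasAntidiagonal.antidiagonal n,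
        p i.1 j.1 * q i.2 j.2) * (M ^ m * N ^ n) =
      (∑ j ∈ Finset.HasAntidiagonal.antidiagonal n, ∑ a ∈ Finset.range 17, ∑ b ∈ Finset.range 17,
        p a j.1 * q b j.2 * M ^ (a + b)) * N ^ n := by
    intro n
    have := sum_antidiagonal_nilpotent hM
      (fun a b => ∑ j ∈ Finset.HasAntidiagonal.antidiagonal n, p a j.1 * q b j.2)
    simp only [← mul_assoc, ← Finset.sum_mul]
    rw [this, Finset.sum_comm (s := Finset.HasAntidiagonal.antidiagonal n)]
    congr 1
    refine Finset.sum_congr rfl fun a _ => ?_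
    rw [Finset.sum_comm]
    simp only [Finset.sum_mul]
  rw [Finset.sum_comm, Finset.sum_congr rfl fun n _ => h1 n, sum_antidiagonal_nilpotent hN
    (fun i j => ∑ a ∈ Finset.range 17, ∑ b ∈ Finset.range 17, p a i * q b j * M ^ (a + b)),
    Finset.sum_comm (f := fun m n => p m n * _), Finset.sum_comm (f := fun m n => q m n * _),
    Finset.sum_mul_sum]
  refine Finset.sum_congr rfl fun i _ => Finset.sum_congr rfl fun j _ => ?_
  rw [Finset.sum_mul_sum, Finset.sum_mul]
  refine Finset.sum_congr rfl fun a _ => ?_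
  rw [Finset.sum_mul]
  refine Finset.sum_congr rfl fun b _ => ?_
  rw [pow_add, pow_add]; ring

/-- Taylor substitution is multiplicative because truncated Cauchy products are exact on nilpotent
arguments. This composes the two expansions in the proof of minimality. -/
lemma ofCrossRatios_mul (hcn : c ∈ nondegenerate) (hW : IsOpen W) (hf : ContDiffOn ℝ ∞ f W)
    (hg : ContDiffOn ℝ ∞ g W) (hc : crossBody c ∈ W) :
    ofCrossRatios (f * g) c = ofCrossRatios f c * ofCrossRatios g c := by
  obtain ⟨M, hM⟩ := (crossNil_ev hcn 0).lift
  obtain ⟨N, hN⟩ := (crossNil_ev hcn 1).lift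
  have hM0 : M ^ 17 = 0 := cen_injective (by
    rw [map_pow, hM, crossNil_pow hcn 0 (by norm_num), map_zero])
  have hN0 : N ^ 17 = 0 := cen_injective (by
    rw [map_pow, hN, crossNil_pow hcn 1 (by norm_num), map_zero])
  have key : ∀ {h : ℝ × ℝ → ℂ}, ContDiffOn ℝ ∞ h W → ofCrossRatios h c = algebraMap Cen Grassmann
      (∑ m ∈ Finset.range 17, ∑ n ∈ Finset.range 17,
        algebraMap ℂ Cen (taylor h (crossBody c) m n) * (M ^ m * N ^ n)) := by
    intro h hh
    rw [ofCrossRatios_apply hW hh hc, map_sum]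
    refine Finset.sum_congr rfl fun m _ => ?_
    rw [map_sum]
    refine Finset.sum_congr rfl fun n _ => ?_
    rw [map_mul, map_mul, map_pow, map_pow, hM, hN, Algebra.smul_def]
    congr 1
  rw [key (h := f * g) (hf.mul hg), key hf, key hg, ← map_mul, ← convolution hM0 hN0]
  refine congrArg (algebraMap Cen Grassmann) ?_
  refine Finset.sum_congr rfl fun m _ => Finset.sum_congr rfl fun n _ => ?_
  rw [taylor_mul hW hf hg hc]
  simp only [map_sum, map_mul]

lemma ofCrossRatios_sub_mem_fil (hcn : c ∈ nondegenerate) (hW : IsOpen W)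
    (hf : ContDiffOn ℝ ∞ f W) (hc : crossBody c ∈ W) :
    ofCrossRatios f c - algebraMap ℂ Grassmann (f (crossBody c)) ∈ Fil 1 := by
  rw [mem_fil_one, map_sub, body_algebraMap, ofCrossRatios_apply hW hf hc, map_sum,
    Finset.sum_eq_single 0, map_sum, Finset.sum_eq_single 0]
  · simp [taylor, mixD]
  · intro n _ hn
    rw [map_smul, map_mul, map_pow, map_pow, mem_fil_one.1 (fil_mono one_le_two
      (crossNil_mem_fil hcn 1)), zero_pow hn, mul_zero, smul_zero]
  · simp
  · intro m _ hm
    rw [map_sum]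
    refine Finset.sum_eq_zero fun n _ => ?_
    rw [map_smul, map_mul, map_pow, map_pow, mem_fil_one.1 (fil_mono one_le_two
      (crossNil_mem_fil hcn 0)), zero_pow hm, zero_mul, smul_zero]
  · simp

lemma ofCrossRatios_const (a : ℂ) : ofCrossRatios (fun _ => a) c = algebraMap ℂ Grassmann a := by
  have h0 : ∀ v n, n ≠ 0 → (dirD v)^[n] (fun _ : ℝ × ℝ => a) = 0 := by
    intro v n hn
    obtain ⟨k, rfl⟩ := Nat.exists_eq_succ_of_ne_zero hn
    rw [Function.iterate_succ_apply, show dirD v (fun _ : ℝ × ℝ => a) = 0 from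
      funext fun y => by rw [dirD, fderiv_const_apply]; rfl, dirD_iter_zero]
  rw [ofCrossRatios_apply isOpen_univ contDiffOn_const (Set.mem_univ _),
    Finset.sum_eq_single 0, Finset.sum_eq_single 0]
  · simp [taylor, mixD, Algebra.algebraMap_eq_smul_one]
  · intro n _ hn
    rw [taylor, mixD, h0 _ n hn]; simp
  · simp
  · intro m _ hm
    refine Finset.sum_eq_zero fun n _ => ?_
    rcases eq_or_ne n 0 with rfl | hn
    · rw [taylor, mixD, Function.iterate_zero, id, h0 _ m hm]; simp
    · rw [taylor, mixD, h0 _ n hn, dirD_iter_zero]; simp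
  · simp

/-! ### Superconformal invariance -/

lemma distSq_smooth (i j : Fin 4) : ContDiff ℝ ∞ fun c : Config => distSq c i j := by
  have h : ∀ i μ : Fin 4, ContDiff ℝ ∞ fun c : Config => c i μ := fun i μ =>
    contDiff_apply_apply ℝ ℝ i μ
  exact (((((h i 0).sub (h j 0)).pow 2).sub (((h i 1).sub (h j 1)).pow 2)).sub
    (((h i 2).sub (h j 2)).pow 2)).sub (((h i 3).sub (h j 3)).pow 2)

lemma body_crossRatio (hc : c ∈ nondegenerate) {r s t u : Fin 4} (h : r ≠ u) (h' : t ≠ s) :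
    body (crossRatio r s t u c) =
      ((distSq c r s * distSq c t u / (distSq c r u * distSq c t s) : ℝ) : ℂ) := by
  simp only [crossRatio, Pi.mul_apply, map_mul, body_sinv (isUnit_intervalSq hc h),
    body_sinv (isUnit_intervalSq hc h'), body_intervalSq]
  push_cast
  rw [div_eq_mul_inv, mul_inv]; ring

lemma crossBody_eq (hc : c ∈ nondegenerate) : crossBody c =
    (distSq c 0 3 * distSq c 2 1 / (distSq c 0 1 * distSq c 2 3),
      distSq c 0 3 * distSq c 1 2 / (distSq c 0 2 * distSq c 1 3)) := by
  rw [crossBody, show crossI 0 = crossRatio 0 3 2 1 from rfl,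
    show crossI 1 = crossRatio 0 3 1 2 from rfl, body_crossRatio hc (by decide) (by decide),
    body_crossRatio hc (by decide) (by decide), Complex.ofReal_re, Complex.ofReal_re]

lemma body_crossI (hc : c ∈ nondegenerate) : body (crossI 0 c) = ((crossBody c).1 : ℂ) ∧
    body (crossI 1 c) = ((crossBody c).2 : ℂ) := by
  rw [crossBody_eq hc, show crossI 0 = crossRatio 0 3 2 1 from rfl,
    show crossI 1 = crossRatio 0 3 1 2 from rfl, body_crossRatio hc (by decide) (by decide),
    body_crossRatio hc (by decide) (by decide)]
  exact ⟨rfl, rfl⟩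

lemma crossBody_smooth (hc : c ∈ nondegenerate) : ContDiffAt ℝ ∞ crossBody c := by
  have h : ∀ i j, ContDiffAt ℝ ∞ (fun c : Config => distSq c i j) c := fun i j =>
    (distSq_smooth i j).contDiffAt
  have h1 : ContDiffAt ℝ ∞ (fun c : Config =>
      (distSq c 0 3 * distSq c 2 1 / (distSq c 0 1 * distSq c 2 3),
        distSq c 0 3 * distSq c 1 2 / (distSq c 0 2 * distSq c 1 3))) c :=
    (((h 0 3).mul (h 2 1)).div ((h 0 1).mul (h 2 3))
      (mul_ne_zero (hc _ _ (by decide)) (hc _ _ (by decide)))).prodMk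
    (((h 0 3).mul (h 1 2)).div ((h 0 2).mul (h 1 3))
      (mul_ne_zero (hc _ _ (by decide)) (hc _ _ (by decide))))
  exact h1.congr_of_eventuallyEq (Filter.eventuallyEq_of_mem (isOpen_nondegenerate.mem_nhds hc)
    fun c' hc' => crossBody_eq hc')

/-- The value of a generator on the body of a cross ratio. -/
def crossAct (V : Generator) (c : Config) (k : Fin 6) : Grassmann :=
  V.act (scalarFun fun c => body (crossI k c)) c

/-- The full cross ratio is invariant, so its nilpotent part varies oppositely to its body. -/
lemma hasAct_crossNil (hc : c ∈ nondegenerate) (V : Generator) :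
    HasAct V c (crossNil 0) (-crossAct V c 0) ∧ HasAct V c (crossNil 1) (-crossAct V c 1) := by
  have key : ∀ (k : Fin 6) {g : Config → ℝ}, ContDiffAt ℝ ∞ g c →
      (∀ c ∈ nondegenerate, body (crossI k c) = (g c : ℂ)) →
      HasAct V c (crossNil k) (-crossAct V c k) := by
    intro k g hg h
    have h1 : (fun c => (g c : ℂ)) =ᶠ[nhds c] fun c => body (crossI k c) :=
      Filter.eventuallyEq_of_mem (isOpen_nondegenerate.mem_nhds hc) fun c' hc' => (h c' hc').symm
    have h2 : ContDiffAt ℝ ∞ (fun c => body (crossI k c)) c :=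
      (Complex.ofRealCLM.contDiff.contDiffAt.comp c hg).congr_of_eventuallyEq h1.symm
    have h3 := hasAct_scalarFun h2 V
    rw [← h3.eq] at h3
    have h4 := (crossI_wt hc V k).act_zero.sub h3
    rwa [zero_sub] at h4
  exact ⟨key 0 (crossBody_smooth hc).fst fun c hc => (body_crossI hc).1,
    key 1 (crossBody_smooth hc).snd fun c hc => (body_crossI hc).2⟩

lemma hasAct_comp_crossBody (hc : c ∈ nondegenerate) (V : Generator) {g : ℝ × ℝ → ℂ}
    (hg : ContDiffAt ℝ ∞ g (crossBody c)) : HasAct V c (scalarFun (g ∘ crossBody))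
      (dirD (1, 0) g (crossBody c) • crossAct V c 0 +
        dirD (0, 1) g (crossBody c) • crossAct V c 1) := by
  have hs := crossBody_smooth hc
  have hd := hs.differentiableAt (by simp)
  refine (hasAct_scalarFun (hg.comp c hs) V).cast ?_
  have h1 : ∀ (k : Fin 6) (L : ℝ × ℝ →L[ℝ] ℝ),
      (∀ c ∈ nondegenerate, body (crossI k c) = (L (crossBody c) : ℂ)) →
      crossAct V c k = ∑ i : Fin 4, ∑ μ : Fin 4,
        (L (fderiv ℝ crossBody c (Pi.single i (Pi.single μ 1))) : ℂ) • V.coefX i μ c := by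
    intro k L h
    have e : (fun c => (L (crossBody c) : ℂ)) =ᶠ[nhds c] fun c => body (crossI k c) :=
      Filter.eventuallyEq_of_mem (isOpen_nondegenerate.mem_nhds hc) fun c' hc' => (h c' hc').symm
    have h3 := (Complex.ofRealCLM.comp L).hasFDerivAt.comp c hd.hasFDerivAt
    have h2 : ContDiffAt ℝ ∞ (fun c => body (crossI k c)) c :=
      ((Complex.ofRealCLM.comp L).contDiff.contDiffAt.comp c hs).congr_of_eventuallyEq e.symm
    rw [crossAct, (hasAct_scalarFun h2 V).eq]
    have h4 : fderiv ℝ (fun c => body (crossI k c)) c = _ :=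
      e.symm.fderiv_eq.trans h3.fderiv
    rw [h4]
    rfl
  rw [h1 0 (.fst ℝ ℝ ℝ) fun c hc => (body_crossI hc).1,
    h1 1 (.snd ℝ ℝ ℝ) fun c hc => (body_crossI hc).2, Finset.smul_sum, Finset.smul_sum,
    ← Finset.sum_add_distrib]
  refine Finset.sum_congr rfl fun i _ => ?_
  rw [Finset.smul_sum, Finset.smul_sum, ← Finset.sum_add_distrib]
  refine Finset.sum_congr rfl fun μ _ => ?_
  rw [fderiv_comp c (hg.differentiableAt (by simp)) hd, smul_smul, smul_smul, ← add_smul]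
  congr 1
  set v := fderiv ℝ crossBody c (Pi.single i (Pi.single μ 1))
  change fderiv ℝ g (crossBody c) v = fderiv ℝ g (crossBody c) (1, 0) * (v.1 : ℂ) +
    fderiv ℝ g (crossBody c) (0, 1) * (v.2 : ℂ)
  have : v = v.1 • ((1 : ℝ), (0 : ℝ)) + v.2 • ((0 : ℝ), (1 : ℝ)) := by ext <;> simp
  conv_lhs => rw [this]
  rw [map_add, map_smul, map_smul, Complex.real_smul, Complex.real_smul]
  ring

lemma HasAct.pow_of_ev {V : Generator} {F : SuperFun} {d : Grassmann} (h : HasAct V c F d)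
    (he : Ev (F c)) (n : ℕ) : HasAct V c (F ^ n) ((n : ℂ) • (F c ^ (n - 1) * d)) := by
  induction n with
  | zero => rw [pow_zero, Nat.cast_zero, zero_smul]; exact one
  | succ n ih =>
    rw [pow_succ]
    refine (ih.mul_ev h (he.pow n)).cast ?_
    rw [Nat.add_sub_cancel, Pi.pow_apply, smul_mul_assoc, ← he.comm, ← mul_assoc]
    rcases n with _ | n
    · simp
    · rw [Nat.add_sub_cancel, ← pow_succ', Nat.cast_succ (n + 1), add_smul, one_smul]

/-- Varying the Taylor coefficients raises an index, and varying the powers of the nilpotent parts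
by the opposite amount lowers one. The two sums telescope; at the lower end the factor `m` or `n` is
zero, at the upper end the sixteenth power vanishes. This is the invariance of `f(𝓘₁, 𝓘₂)`. -/
lemma taylor_telescope {R : Type*} [Ring R] [Algebra ℂ R] {A B : R} (hA : A ^ 16 = 0)
    (hB : B ^ 16 = 0) (t : ℕ → ℕ → ℂ) (d e : R) (hAd : Commute A d) (hAe : Commute A e)
    (hBe : Commute B e) :
    ∑ m ∈ Finset.range 17, ∑ n ∈ Finset.range 17,
      ((((m + 1 : ℕ) * t (m + 1) n) • d + ((n + 1 : ℕ) * t m (n + 1)) • e) * (A ^ m * B ^ n) +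
        algebraMap ℂ R (t m n) * (((m : ℂ) • (A ^ (m - 1) * -d)) * B ^ n +
          A ^ m * ((n : ℂ) • (B ^ (n - 1) * -e)))) = 0 := by
  have h : ∀ m n, ((((m + 1 : ℕ) * t (m + 1) n) • d + ((n + 1 : ℕ) * t m (n + 1)) • e) *
      (A ^ m * B ^ n) + algebraMap ℂ R (t m n) * (((m : ℂ) • (A ^ (m - 1) * -d)) * B ^ n +
        A ^ m * ((n : ℂ) • (B ^ (n - 1) * -e)))) =
      ((((m + 1 : ℕ) * t (m + 1) n) • (A ^ (m + 1 - 1) * d * B ^ n) -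
        ((m : ℕ) * t m n) • (A ^ (m - 1) * d * B ^ n)) +
      (((n + 1 : ℕ) * t m (n + 1)) • (A ^ m * (B ^ (n + 1 - 1) * e)) -
        ((n : ℕ) * t m n) • (A ^ m * (B ^ (n - 1) * e)))) := by
    intro m n
    rw [← Algebra.smul_def, Nat.add_sub_cancel, Nat.add_sub_cancel, ← (hBe.pow_left n).eq.symm,
      ← mul_assoc (A ^ m) e, (hAe.pow_left m).eq, (hAd.pow_left m).eq]
    simp only [add_mul, smul_mul_assoc, mul_smul_comm, mul_neg, neg_mul, smul_neg, smul_add,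
      smul_smul, mul_assoc, mul_comm (t m n)]
    abel
  simp only [h, Finset.sum_add_distrib]
  rw [Finset.sum_comm]
  have h1 : ∀ n, ∑ m ∈ Finset.range 17, ((((m + 1 : ℕ) * t (m + 1) n) •
      (A ^ (m + 1 - 1) * d * B ^ n) - ((m : ℕ) * t m n) • (A ^ (m - 1) * d * B ^ n))) = 0 := by
    intro n
    rw [Finset.sum_range_sub (fun m => ((m : ℕ) * t m n) • (A ^ (m - 1) * d * B ^ n))]
    simp [hA]
  have h2 : ∀ m, ∑ n ∈ Finset.range 17, (((n + 1 : ℕ) * t m (n + 1)) •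
      (A ^ m * (B ^ (n + 1 - 1) * e)) - ((n : ℕ) * t m n) • (A ^ m * (B ^ (n - 1) * e))) = 0 := by
    intro m
    rw [Finset.sum_range_sub (fun n => ((n : ℕ) * t m n) • (A ^ m * (B ^ (n - 1) * e)))]
    simp [hB]
  simp only [h1, h2, Finset.sum_const_zero, add_zero]

lemma hasAct_ofCrossRatios (hcn : c ∈ nondegenerate) (hW : IsOpen W) (hf : ContDiffOn ℝ ∞ f W)
    (hc : crossBody c ∈ W) (V : Generator) : HasAct V c (ofCrossRatios f) 0 := by
  have hcont := (crossBody_smooth hcn).continuousAt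
  have e : (∑ m ∈ Finset.range 17, ∑ n ∈ Finset.range 17,
      scalarFun ((fun y => taylor f y m n) ∘ crossBody) * (crossNil 0 ^ m * crossNil 1 ^ n))
      =ᶠ[nhds c] ofCrossRatios f := by
    refine Filter.eventuallyEq_of_mem (hcont.preimage_mem_nhds (hW.mem_nhds hc)) fun x hx => ?_
    rw [ofCrossRatios_apply hW hf hx]
    simp only [Finset.sum_apply, Pi.mul_apply, Pi.pow_apply, scalarFun, Function.comp_apply,
      ← Algebra.smul_def]
  refine HasAct.congr ?_ e
  have hA := hasAct_crossNil hcn V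
  have hts : ∀ m n, ContDiffOn ℝ ∞ (fun y => taylor f y m n) W := fun m n =>
    contDiffOn_const.mul (mixD_smooth hW hf m n)
  refine (HasAct.sum fun m _ => HasAct.sum fun n _ => (hasAct_comp_crossBody hcn V
    ((hts m n).contDiffAt (hW.mem_nhds hc))).mul_ev (((hA.1.pow_of_ev (crossNil_ev hcn 0) m).mul_ev
      (hA.2.pow_of_ev (crossNil_ev hcn 1) n) ((crossNil_ev hcn 0).pow m)))
    (ev_algebraMap _)).cast ?_
  rw [← taylor_telescope (A := crossNil 0 c) (B := crossNil 1 c) (crossNil_pow hcn 0 (by norm_num))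
    (crossNil_pow hcn 1 (by norm_num)) (taylor f (crossBody c)) (crossAct V c 0) (crossAct V c 1)
    ((crossNil_ev hcn 0).comm _) ((crossNil_ev hcn 0).comm _) ((crossNil_ev hcn 1).comm _)]
  refine Finset.sum_congr rfl fun m _ => Finset.sum_congr rfl fun n _ => ?_
  have h1 : dirD (1, 0) (fun y => taylor f y m n) (crossBody c) =
      (m + 1 : ℕ) * taylor f (crossBody c) (m + 1) n := by
    have := dirD_smul (v := (1, 0)) hW (mixD_smooth hW hf m n)
      (((m.factorial : ℂ) * (n.factorial : ℂ))⁻¹) hc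
    rw [dirD_mixD₁] at this
    rw [show (fun y => taylor f y m n) = ((m.factorial : ℂ) * (n.factorial : ℂ))⁻¹ • mixD m n f
      from rfl, this, taylor, Nat.factorial_succ]
    have : ((m + 1 : ℕ) : ℂ) ≠ 0 := by exact_mod_cast m.succ_ne_zero
    rw [Pi.smul_apply, smul_eq_mul, Nat.cast_mul]
    field_simp
  have h2 : dirD (0, 1) (fun y => taylor f y m n) (crossBody c) =
      (n + 1 : ℕ) * taylor f (crossBody c) m (n + 1) := by
    have := dirD_smul (v := (0, 1)) hW (mixD_smooth hW hf m n)
      (((m.factorial : ℂ) * (n.factorial : ℂ))⁻¹) hc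
    rw [Pi.smul_apply, dirD_mixD₂ hW hf m n hc] at this
    rw [show (fun y => taylor f y m n) = ((m.factorial : ℂ) * (n.factorial : ℂ))⁻¹ • mixD m n f
      from rfl, this, taylor, Nat.factorial_succ]
    have : ((n + 1 : ℕ) : ℂ) ≠ 0 := by exact_mod_cast n.succ_ne_zero
    rw [smul_eq_mul, Nat.cast_mul]
    field_simp
  rw [h1, h2]
  rfl

end ofCrossRatios

/-! ## Leading terms of invariance equations -/

/-- Projection to a degree as a real continuous linear map. -/
def prjReal (n : ℕ) : Grassmann →L[ℝ] Grassmann :=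
  ((prj n).toContinuousLinearMap).restrictScalars ℝ

lemma fderiv_mem_fil {G : SuperFun} {c : Config} {k : ℕ} (hd : DifferentiableAt ℝ G c)
    (h : ∀ᶠ x in nhds c, G x ∈ Fil k) (v : Config) : fderiv ℝ G c v ∈ Fil k := by
  refine mem_fil.2 fun n hn => ?_
  have h1 : (fun x => prjReal n (G x)) =ᶠ[nhds c] fun _ => 0 := by
    filter_upwards [h] with x hx using mem_fil.1 hx n hn
  have h2 := ((prjReal n).hasFDerivAt.comp c hd.hasFDerivAt).fderiv
  change fderiv ℝ (fun x => prjReal n (G x)) c = _ at h2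
  rw [h1.fderiv_eq, fderiv_const_apply] at h2
  have h3 := DFunLike.congr_fun h2 v
  exact h3.symm

lemma Od.mem_fil {x : Grassmann} (h : Od x) : x ∈ Fil 1 := by
  rw [mem_fil_one]
  have h1 := congrArg body (h : inv x = -x)
  have h2 := congrArg body (show algebraMap ℂ Grassmann (body (inv x)) =
    algebraMap ℂ Grassmann (body x) by
      rw [← prj_zero, prj_inv, pow_zero, one_smul, prj_zero])
  rw [body_algebraMap, body_algebraMap] at h2
  rw [h2, map_neg] at h1
  exact self_eq_neg.1 h1

lemma prj_od (x : Grassmann) : Od (prj 1 x) := by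
  have := inv_of_mem (prj_mem 1 x)
  rwa [pow_one, neg_one_smul] at this

lemma ctr_algebraMap (k : Fin 16) (r : ℂ) : ctr k (algebraMap ℂ Grassmann r) = 0 :=
  CliffordAlgebra.contractLeft_algebraMap (Q := (0 : QuadraticForm ℂ (Fin 16 → ℂ))) (d := LinearMap.proj k) r

lemma ctr_mem_fil {k : ℕ} {x : Grassmann} (j : Fin 16) (h : x ∈ Fil (k + 1)) : ctr j x ∈ Fil k := by
  refine mem_fil.2 fun n hn => ?_
  rw [prj_ctr, mem_fil.1 h _ (by omega), map_zero]

lemma mul_ctr_mem_fil {k : ℕ} {a x : Grassmann} (j : Fin 16) (ha : a ∈ Fil 1) (hx : x ∈ Fil k) :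
    a * ctr j x ∈ Fil k := by
  rcases k with _ | k
  · exact fil_zero _
  · rw [add_comm]; exact mul_mem_fil ha (ctr_mem_fil j hx)

lemma prj_mul_ctr {k : ℕ} {a x : Grassmann} (j : Fin 16) (ha : a ∈ Fil 1) (hx : x ∈ Fil k) :
    prj k (a * ctr j x) = prj 1 a * ctr j (prj k x) := by
  rcases k with _ | k
  · rw [prj_zero, prj_zero, map_mul, mem_fil_one.1 ha, zero_mul, map_zero, ctr_algebraMap, mul_zero]
  · rw [add_comm, prj_mul_of_mem_fil ha (ctr_mem_fil j hx), prj_ctr, add_comm]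

lemma onTheta_od {V : Generator} (hV : V.isOdd = false) (i : Fin 4) (α : Fin 2) (c : Config) :
    Od (V.onTheta i α c) := by
  have := onTheta_antiHom V i α c
  rwa [AntiHom, if_neg (by simp [hV])] at this

lemma onThetaBar_od {V : Generator} (hV : V.isOdd = false) (i : Fin 4) (α : Fin 2) (c : Config) :
    Od (V.onThetaBar i α c) := by
  have := onThetaBar_antiHom V i α c
  rwa [AntiHom, if_neg (by simp [hV])] at this

lemma coefX_od {V : Generator} (hV : V.isOdd = true) (i μ : Fin 4) (c : Config) :
    Od (V.coefX i μ c) := by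
  have := coefX_hom V i μ c
  rwa [Hom, if_pos hV] at this

/-- The part of a generator that rotates the odd coordinates linearly. -/
def Generator.rot (V : Generator) (c : Config) : Grassmann →ₗ[ℂ] Grassmann :=
  ∑ i : Fin 4, (∑ α : Fin 2, LinearMap.mulLeft ℂ (prj 1 (V.onTheta i α c)) ∘ₗ ctr (thetaIdx i α)
    + ∑ β : Fin 2, LinearMap.mulLeft ℂ (prj 1 (V.onThetaBar i β c)) ∘ₗ ctr (thetaBarIdx i β))

lemma rot_apply (V : Generator) (c : Config) (x : Grassmann) : V.rot c x =
    ∑ i : Fin 4, (∑ α : Fin 2, prj 1 (V.onTheta i α c) * ctr (thetaIdx i α) x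
    + ∑ β : Fin 2, prj 1 (V.onThetaBar i β c) * ctr (thetaBarIdx i β) x) := by
  simp [Generator.rot, LinearMap.sum_apply]

lemma od_ctr_mul {a : Grassmann} (ha : Od a) (j : Fin 16) (x y : Grassmann) :
    a * ctr j (x * y) = a * ctr j x * y + x * (a * ctr j y) := by
  rw [ctr, contractLeft_mul, mul_add, ← mul_assoc, ← mul_assoc, ha.comm (inv x),
    CliffordAlgebra.involute_involute, mul_assoc x]

lemma rot_mul (V : Generator) (c : Config) (x y : Grassmann) :
    V.rot c (x * y) = V.rot c x * y + x * V.rot c y := by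
  simp only [rot_apply, od_ctr_mul (prj_od _), Finset.sum_add_distrib, add_mul, mul_add,
    Finset.sum_mul, Finset.mul_sum]
  abel

/-- The value of a generator on a function of the bosonic coordinates with the given
partial derivatives, to lowest order. -/
def Generator.shiftX (V : Generator) (c : Config) (d : Fin 4 → Fin 4 → Grassmann) : Grassmann :=
  ∑ i : Fin 4, ∑ μ : Fin 4, body (V.coefX i μ c) • d i μ

section lead
variable {V : Generator} {G : SuperFun} {c : Config} {k : ℕ}

lemma act_mem_fil (hV : V.isOdd = false) (hd : DifferentiableAt ℝ G c)
    (h : ∀ᶠ x in nhds c, G x ∈ Fil k) : V.act G c ∈ Fil k := by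
  rw [act_eq V hd]
  refine Submodule.sum_mem _ fun i _ => Submodule.add_mem _ (Submodule.add_mem _
    (Submodule.sum_mem _ fun μ _ => mul_mem_fil_left _ (fderiv_mem_fil hd h _))
    (Submodule.sum_mem _ fun α _ => mul_ctr_mem_fil _ (onTheta_od hV i α c).mem_fil h.self_of_nhds))
    (Submodule.sum_mem _ fun α _ =>
      mul_ctr_mem_fil _ (onThetaBar_od hV i α c).mem_fil h.self_of_nhds)

/-- An even generator preserves the filtration: its odd derivatives lower the degree by one, and
their odd coefficients restore it. To lowest order there remain the bosonic vector field and a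
linear rotation of the odd coordinates. -/
lemma prj_act_even (hV : V.isOdd = false) (hd : DifferentiableAt ℝ G c)
    (h : ∀ᶠ x in nhds c, G x ∈ Fil k) : prj k (V.act G c) =
      V.shiftX c (fun i μ => prj k (fderiv ℝ G c (Pi.single i (Pi.single μ 1)))) +
        V.rot c (prj k (G c)) := by
  have h1 : ∀ i μ, prj k (V.coefX i μ c * fderiv ℝ G c (Pi.single i (Pi.single μ 1))) =
      body (V.coefX i μ c) • prj k (fderiv ℝ G c (Pi.single i (Pi.single μ 1))) := by
    intro i μ
    have := prj_mul_of_mem_fil (fil_zero (V.coefX i μ c))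
      (fderiv_mem_fil hd h (Pi.single i (Pi.single μ 1)))
    rw [zero_add] at this
    rw [this, prj_zero, Algebra.smul_def]
  simp only [act_eq V hd, map_sum, map_add, h1, prj_mul_ctr _ (onTheta_od hV _ _ c).mem_fil
    h.self_of_nhds, prj_mul_ctr _ (onThetaBar_od hV _ _ c).mem_fil h.self_of_nhds, rot_apply,
    Generator.shiftX, ← Finset.sum_add_distrib]
  refine Finset.sum_congr rfl fun i _ => ?_
  rw [add_assoc, ← Finset.sum_add_distrib]

/-- An odd generator lowers the degree by one, through the bodies of the coefficients of its odd
derivatives. The `x`-derivatives have odd coefficients and contribute only two degrees higher. -/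
lemma prj_act_odd (hV : V.isOdd = true) (hd : DifferentiableAt ℝ G c)
    (h : ∀ᶠ x in nhds c, G x ∈ Fil (k + 1)) : prj k (V.act G c) =
      ∑ i : Fin 4, (∑ α : Fin 2, body (V.onTheta i α c) • ctr (thetaIdx i α) (prj (k + 1) (G c))
    + ∑ β : Fin 2, body (V.onThetaBar i β c) • ctr (thetaBarIdx i β) (prj (k + 1) (G c))) := by
  have h1 : ∀ i μ, prj k (V.coefX i μ c * fderiv ℝ G c (Pi.single i (Pi.single μ 1))) = 0 :=
    fun i μ => mem_fil.1 (mul_mem_fil (coefX_od hV i μ c).mem_fil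
      (fderiv_mem_fil hd h (Pi.single i (Pi.single μ 1)))) k (by omega)
  have h2 : ∀ (a : Grassmann) j, prj k (a * ctr j (G c)) = body a • ctr j (prj (k + 1) (G c)) := by
    intro a j
    have := prj_mul_of_mem_fil (fil_zero a) (ctr_mem_fil j h.self_of_nhds)
    rw [zero_add] at this
    rw [this, prj_zero, prj_ctr, Algebra.smul_def]
  simp only [act_eq V hd, map_sum, map_add, h1, h2, Finset.sum_const_zero, zero_add]

lemma lead_odd (hV : V.isOdd = true) (hG : HasAct V c G 0) (h : ∀ᶠ x in nhds c, G x ∈ Fil k) :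
    ∑ i : Fin 4, (∑ α : Fin 2, body (V.onTheta i α c) • ctr (thetaIdx i α) (prj k (G c))
    + ∑ β : Fin 2, body (V.onThetaBar i β c) • ctr (thetaBarIdx i β) (prj k (G c))) = 0 := by
  rcases k with _ | k
  · simp only [prj_zero, ctr_algebraMap, smul_zero, Finset.sum_const_zero, add_zero]
  · rw [← prj_act_odd hV hG.diff h, hG.eq, map_zero]

end lead

/-! ### Bodies of the even generators -/

/-- A matrix of bodies. -/
def bodyM (M : Matrix (Fin 2) (Fin 2) Grassmann) : Matrix (Fin 2) (Fin 2) ℂ := body.mapMatrix M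

lemma bodyM_apply (M : Matrix (Fin 2) (Fin 2) Grassmann) (α β : Fin 2) :
    bodyM M α β = body (M α β) := rfl

/-- The matrices of the bosonic coordinates. -/
def xb (c : Config) (i : Fin 4) : Matrix (Fin 2) (Fin 2) ℂ :=
  fun β α => ∑ μ : Fin 4, (eta μ * sigmaTilde μ β α) * (c i μ : ℂ)

lemma body_xCoordMat (c : Config) (i : Fin 4) (β α : Fin 2) :
    body (toMatTilde (xCoord i) β α c) = xb c i β α := by
  rw [toMatTilde_apply, map_sum]
  refine Finset.sum_congr rfl fun μ _ => ?_
  rw [map_smul, xCoord, body_algebraMap, smul_eq_mul]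

lemma bodyM_XP (c : Config) (i : Fin 4) : bodyM (XP c i) = xb c i := by
  ext β α
  rw [bodyM_apply, XP, evm_apply, toMatTilde_xPlus, ← body_xCoordMat]
  change body (_ - (2 * Complex.I) • (theta i α c * thetaBar i β c)) = _
  rw [map_sub, map_smul, map_mul, body_theta, zero_mul, smul_zero, sub_zero]

lemma bodyM_XM (c : Config) (i : Fin 4) : bodyM (XM c i) = xb c i := by
  ext β α
  rw [bodyM_apply, XM, evm_apply, toMatTilde_xMinus, ← body_xCoordMat]
  change body (_ + (2 * Complex.I) • (theta i α c * thetaBar i β c)) = _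
  rw [map_add, map_smul, map_mul, body_theta, zero_mul, smul_zero, add_zero]

lemma bodyM_XI (c : Config) (i j : Fin 4) : bodyM (XI c i j) = xb c i - xb c j := by
  ext β α
  rw [bodyM_apply, XI_eq, map_sub, map_sub, map_smul, map_mul]
  rw [show body (th c j α) = 0 from body_theta j α c, zero_mul, smul_zero, sub_zero,
    Matrix.sub_apply, ← bodyM_XM, ← bodyM_XP, bodyM_apply, bodyM_apply]

/-- The velocity `δx_i` under the sum of the generators `P a`, `L m`, `Lbar n`, `K k`. -/
def velocity (c : Config) (a m n k : Matrix (Fin 2) (Fin 2) ℂ) (i : Fin 4) :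
    Matrix (Fin 2) (Fin 2) ℂ :=
  a + xb c i * m + n * xb c i + xb c i * k * xb c i

/-- The four-vector of a matrix of complex numbers. -/
def vecOf (M : Matrix (Fin 2) (Fin 2) ℂ) (μ : Fin 4) : ℂ :=
  ∑ α : Fin 2, ∑ β : Fin 2, 1 / 2 * sigma μ α β * M β α

lemma body_coefX (V : Generator) (i μ : Fin 4) (c : Config) :
    body (V.coefX i μ c) = vecOf (bodyM (evm c (V.onXPlus i))) μ / 2 +
      vecOf (bodyM (evm c (V.onXMinus i))) μ / 2 := by
  rw [Generator.coefX, toVec_apply]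
  simp only [map_sum, vecOf, Finset.sum_div, ← Finset.sum_add_distrib]
  refine Finset.sum_congr rfl fun α _ => Finset.sum_congr rfl fun β _ => ?_
  rw [map_smul]
  change (1 / 2 * sigma μ α β) • body ((1 / 2 : ℂ) • (V.onXPlus i β α c + V.onXMinus i β α c)) = _
  rw [map_smul, map_add, bodyM_apply, bodyM_apply, evm_apply, evm_apply, smul_eq_mul, smul_eq_mul]
  ring

lemma bodyM_mul (M N : Matrix (Fin 2) (Fin 2) Grassmann) : bodyM (M * N) = bodyM M * bodyM N :=
  map_mul body.mapMatrix M N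

lemma bodyM_const (a : Matrix (Fin 2) (Fin 2) ℂ) : bodyM (a.map (algebraMap ℂ Grassmann)) = a := by
  ext α β
  rw [bodyM_apply, Matrix.map_apply, body_algebraMap]

lemma bodyM_onX (c : Config) (i : Fin 4) (a : Matrix (Fin 2) (Fin 2) ℂ) :
    (bodyM (evm c ((Generator.P a).onXPlus i)) = a ∧
      bodyM (evm c ((Generator.P a).onXMinus i)) = a) ∧
    (bodyM (evm c ((Generator.L a).onXPlus i)) = xb c i * a ∧
      bodyM (evm c ((Generator.L a).onXMinus i)) = xb c i * a) ∧
    (bodyM (evm c ((Generator.Lbar a).onXPlus i)) = a * xb c i ∧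
      bodyM (evm c ((Generator.Lbar a).onXMinus i)) = a * xb c i) ∧
    (bodyM (evm c ((Generator.K a).onXPlus i)) = xb c i * a * xb c i ∧
      bodyM (evm c ((Generator.K a).onXMinus i)) = xb c i * a * xb c i) := by
  simp only [Generator.onXPlus, Generator.onXMinus, map_mul, evm_const, bodyM_mul, bodyM_const,
    ← bodyM_XP c i]
  refine ⟨⟨trivial, trivial⟩, ⟨rfl, ?_⟩, ⟨rfl, ?_⟩, ⟨rfl, ?_⟩⟩ <;>
    rw [bodyM_XP, ← bodyM_XM c i] <;> rfl

lemma vecOf_add (M N : Matrix (Fin 2) (Fin 2) ℂ) : vecOf (M + N) = vecOf M + vecOf N := by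
  funext μ
  simp only [vecOf, Matrix.add_apply, mul_add, Finset.sum_add_distrib, Pi.add_apply]

/-- The sum of the values of `P a`, `L m`, `Lbar n` and `K k`. -/
def sumEven {M : Type*} [AddCommMonoid M] (a m n k : Matrix (Fin 2) (Fin 2) ℂ)
    (f : Generator → M) : M := f (.P a) + f (.L m) + f (.Lbar n) + f (.K k)

lemma sumEven_coefX (c : Config) (a m n k : Matrix (Fin 2) (Fin 2) ℂ) (i μ : Fin 4) :
    sumEven a m n k (fun V => body (V.coefX i μ c)) = vecOf (velocity c a m n k i) μ := by
  obtain ⟨⟨h1, h1'⟩, -⟩ := bodyM_onX c i a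
  obtain ⟨-, ⟨h2, h2'⟩, -⟩ := bodyM_onX c i m
  obtain ⟨-, -, ⟨h3, h3'⟩, -⟩ := bodyM_onX c i n
  obtain ⟨-, -, -, ⟨h4, h4'⟩⟩ := bodyM_onX c i k
  simp only [sumEven, body_coefX, h1, h1', h2, h2', h3, h3', h4, h4', velocity, vecOf_add,
    Pi.add_apply]
  ring

/-- The linear rotation of the odd coordinates by the sum of `P a`, `L m`, `Lbar n` and `K k`. -/
def rotSum (c : Config) (a m n k : Matrix (Fin 2) (Fin 2) ℂ) : Grassmann →ₗ[ℂ] Grassmann :=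
  sumEven a m n k fun V => V.rot c

lemma rotSum_mul (c : Config) (a m n k : Matrix (Fin 2) (Fin 2) ℂ) (x y : Grassmann) :
    rotSum c a m n k (x * y) = rotSum c a m n k x * y + x * rotSum c a m n k y := by
  simp only [rotSum, sumEven, LinearMap.add_apply, rot_mul, add_mul, mul_add]
  abel

/-- The leading term of the action of generators that fix the configuration. -/
lemma prj_act_stabilizer {G : SuperFun} {c : Config} {l : ℕ} (hd : DifferentiableAt ℝ G c)
    (h : ∀ᶠ x in nhds c, G x ∈ Fil l) {a m n k : Matrix (Fin 2) (Fin 2) ℂ}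
    (h0 : ∀ i, velocity c a m n k i = 0) :
    sumEven a m n k (fun V => prj l (V.act G c)) = rotSum c a m n k (prj l (G c)) := by
  have h1 : ∀ i μ, sumEven a m n k (fun V => body (V.coefX i μ c)) = 0 := by
    intro i μ
    rw [sumEven_coefX, h0]
    simp [vecOf]
  have h2 : ∀ d, sumEven a m n k (fun V => V.shiftX c d) = 0 := by
    intro d
    simp only [sumEven, Generator.shiftX, ← Finset.sum_add_distrib, ← add_smul] at h1 ⊢
    simp only [h1, zero_smul, Finset.sum_const_zero]
  have h3 := h2 (fun i μ => prj l (fderiv ℝ G c (Pi.single i (Pi.single μ 1))))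
  simp only [sumEven, rotSum, LinearMap.add_apply] at h3 ⊢
  rw [prj_act_even rfl hd h, prj_act_even rfl hd h, prj_act_even rfl hd h, prj_act_even rfl hd h,
    ← sub_eq_zero, ← h3]
  abel

/-! ## Monomials in the odd coordinates -/

/-- The `k`-th odd coordinate. -/
def gen (k : Fin 16) : Grassmann := ExteriorAlgebra.ι ℂ (Pi.single k 1)

/-- The product of a list of odd coordinates. -/
def listProd (l : List (Fin 16)) : Grassmann := (l.map gen).prod

lemma gen_od (k : Fin 16) : Od (gen k) := ι_od _

lemma basis_eq_listProd (s : Finset (Fin 16)) :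
    ∃ l : List (Fin 16), l.Nodup ∧ l.toFinset = s ∧ monomialBasis s = listProd l := by
  rw [monomialBasis, ExteriorAlgebra.basis_apply]
  set t := (Set.powersetCard.prodEquiv.symm s).2
  refine ⟨List.ofFn (Set.powersetCard.ofFinEmbEquiv.symm t), ?_, ?_, ?_⟩
  · exact List.nodup_ofFn_ofInjective (Set.powersetCard.ofFinEmbEquiv.symm t).injective
  · ext k
    rw [List.mem_toFinset, List.mem_ofFn]
    exact Set.powersetCard.mem_range_ofFinEmbEquiv_symm_iff_mem t k
  · rw [listProd, List.map_ofFn]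
    refine (ExteriorAlgebra.ιMulti_apply _).trans ?_
    congr 2
    funext i
    rw [Function.comp_apply, Pi.basisFun_apply]
    rfl

lemma listProd_perm {l l' : List (Fin 16)} (h : l.Perm l') :
    listProd l = listProd l' ∨ listProd l = -listProd l' := by
  induction h with
  | nil => exact Or.inl rfl
  | cons a _ ih =>
    rw [listProd, List.map_cons, List.prod_cons, listProd, List.map_cons, List.prod_cons]
    rcases ih with ih | ih
    · exact Or.inl (congrArg _ ih)
    · refine Or.inr ?_
      rw [← mul_neg]
      exact congrArg _ ih
  | swap a b l =>
    refine Or.inr ?_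
    simp only [listProd, List.map_cons, List.prod_cons, ← mul_assoc]
    rw [(gen_od b).anticomm (gen_od a), neg_mul]
  | trans _ _ ih ih' =>
    rcases ih with ih | ih <;> rcases ih' with ih' | ih' <;> rw [ih, ih'] <;> simp

lemma listProd_eq_basis {l : List (Fin 16)} (h : l.Nodup) :
    ∃ a : ℂ, a ≠ 0 ∧ listProd l = a • monomialBasis l.toFinset := by
  obtain ⟨l', h1, h2, h3⟩ := basis_eq_listProd l.toFinset
  rw [h3]
  have hp := List.toFinset_eq_iff_perm_dedup.1 h2.symm
  rw [h.dedup, h1.dedup] at hp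
  rcases listProd_perm hp with e | e
  · exact ⟨1, one_ne_zero, by rw [e, one_smul]⟩
  · exact ⟨-1, by norm_num, by rw [e, neg_one_smul]⟩

/-- The operator that counts the `k`-th odd coordinate. -/
def num (k : Fin 16) (x : Grassmann) : Grassmann := gen k * ctr k x

lemma num_mul (k : Fin 16) (x y : Grassmann) : num k (x * y) = num k x * y + x * num k y :=
  od_ctr_mul (gen_od k) k x y

lemma num_gen (k l : Fin 16) : num k (gen l) = if l = k then gen l else 0 := by
  rw [num, gen, gen, ctr_ι]
  split
  · rename_i h; rw [h, mul_one]
  · rw [mul_zero]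

lemma num_listProd (k : Fin 16) (l : List (Fin 16)) :
    num k (listProd l) = (l.count k : ℂ) • listProd l := by
  induction l with
  | nil =>
    have h1 : listProd [] = algebraMap ℂ Grassmann 1 := (map_one _).symm
    rw [h1, num, ctr_algebraMap, mul_zero, List.count_nil, Nat.cast_zero, zero_smul]
  | cons a l ih =>
    have h : listProd (a :: l) = gen a * listProd l := by
      rw [listProd, List.map_cons, List.prod_cons]; rfl
    rw [h, num_mul, ih, num_gen, mul_smul_comm, List.count_cons]
    by_cases e : a = k
    · simp only [e, if_true, beq_self_eq_true, Nat.cast_add, Nat.cast_one, add_smul, one_smul]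
      rw [add_comm]
    · simp [e]

lemma num_basis (k : Fin 16) (s : Finset (Fin 16)) :
    num k (monomialBasis s) = (if k ∈ s then (1 : ℂ) else 0) • monomialBasis s := by
  obtain ⟨l, h1, h2, h3⟩ := basis_eq_listProd s
  rw [h3, num_listProd, h1.count, ← h2]
  simp

lemma num_repr (k : Fin 16) (x : Grassmann) (s : Finset (Fin 16)) :
    monomialBasis.repr (num k x) s = (if k ∈ s then 1 else 0) * monomialBasis.repr x s := by
  have h : monomialBasis.coord s ∘ₗ LinearMap.mulLeft ℂ (gen k) ∘ₗ ctr k =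
      (if k ∈ s then (1 : ℂ) else 0) • monomialBasis.coord s := by
    refine monomialBasis.ext fun t => ?_
    have h1 : (monomialBasis.coord s ∘ₗ LinearMap.mulLeft ℂ (gen k) ∘ₗ ctr k) (monomialBasis t) =
      monomialBasis.coord s (num k (monomialBasis t)) := rfl
    rw [h1, num_basis, map_smul, LinearMap.smul_apply, smul_eq_mul, smul_eq_mul,
      Module.Basis.coord_apply, Module.Basis.repr_self]
    rcases eq_or_ne t s with rfl | hts
    · rfl
    · rw [Finsupp.single_eq_of_ne hts.symm, mul_zero, mul_zero]
  exact LinearMap.congr_fun h x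

/-! ### Balanced monomials -/

/-- The odd coordinates of the points `2` and `3`. -/
def active : Finset (Fin 16) :=
  Finset.univ.image (fun t : Fin 2 × Fin 2 => thetaIdx (pt t.1) t.2) ∪
    Finset.univ.image (fun t : Fin 2 × Fin 2 => thetaBarIdx (pt t.1) t.2)

/-- The balanced monomials in the odd coordinates with spinor index `σ`. -/
def halfWord (σ : Fin 2) : Fin 6 → List (Fin 16) :=
  ![[], [thetaIdx 1 σ, thetaBarIdx 1 σ], [thetaIdx 2 σ, thetaBarIdx 1 σ],
    [thetaIdx 1 σ, thetaBarIdx 2 σ], [thetaIdx 2 σ, thetaBarIdx 2 σ],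
    [thetaIdx 1 σ, thetaBarIdx 1 σ, thetaIdx 2 σ, thetaBarIdx 2 σ]]

/-- The balanced monomials. -/
def word (p : Fin 6 × Fin 6) : List (Fin 16) := halfWord 0 p.1 ++ halfWord 1 p.2

lemma word_nodup : ∀ p, (word p).Nodup := by decide +kernel

lemma word_injective : ∀ p q, (word p).toFinset = (word q).toFinset → p = q := by decide +kernel

lemma word_active : ∀ p, ∀ k ∈ word p, k ∈ active := by decide +kernel

/-- Among two coordinates `θ` and two coordinates `θbar`, the subsets with equally many of both
kinds number `1 + 4 + 1 = 6`. -/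
lemma exists_halfWord : ∀ (σ : Fin 2) (t b : Fin 2 → Bool),
    (∑ j, if t j then 1 else 0) = (∑ i, if b i then 1 else 0) → ∃ q : Fin 6, ∀ i,
      (thetaIdx (pt i) σ ∈ halfWord σ q ↔ t i) ∧ (thetaBarIdx (pt i) σ ∈ halfWord σ q ↔ b i) := by
  decide +kernel

lemma mem_word_iff : ∀ (p : Fin 6 × Fin 6) (σ i : Fin 2),
    (thetaIdx (pt i) σ ∈ word p ↔ thetaIdx (pt i) σ ∈ halfWord σ (![p.1, p.2] σ)) ∧
    (thetaBarIdx (pt i) σ ∈ word p ↔ thetaBarIdx (pt i) σ ∈ halfWord σ (![p.1, p.2] σ)) := by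
  decide +kernel

lemma exists_word {s : Finset (Fin 16)} (hs : s ⊆ active)
    (h : ∀ σ, (∑ j, if thetaIdx (pt j) σ ∈ s then 1 else 0) =
      ∑ i, if thetaBarIdx (pt i) σ ∈ s then 1 else 0) : ∃ p, (word p).toFinset = s := by
  have h1 : ∀ σ, ∃ q : Fin 6, ∀ i, (thetaIdx (pt i) σ ∈ halfWord σ q ↔ thetaIdx (pt i) σ ∈ s) ∧
      (thetaBarIdx (pt i) σ ∈ halfWord σ q ↔ thetaBarIdx (pt i) σ ∈ s) := by
    intro σ
    simpa using exists_halfWord σ (fun j => thetaIdx (pt j) σ ∈ s)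
      (fun i => thetaBarIdx (pt i) σ ∈ s) (by simpa using h σ)
  choose q hq using h1
  have hp : ![q 0, q 1] = q := by funext σ; fin_cases σ <;> rfl
  refine ⟨(q 0, q 1), ?_⟩
  have key : ∀ k ∈ active, (k ∈ word (q 0, q 1) ↔ k ∈ s) := by
    intro k hk
    simp only [active, Finset.mem_union, Finset.mem_image, Finset.mem_univ, true_and] at hk
    rcases hk with ⟨t, rfl⟩ | ⟨t, rfl⟩
    · rw [(mem_word_iff _ _ _).1, hp]; exact (hq t.2 t.1).1
    · rw [(mem_word_iff _ _ _).2, hp]; exact (hq t.2 t.1).2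
  ext k
  rw [List.mem_toFinset]
  exact ⟨fun hk => (key k (word_active _ k hk)).1 hk, fun hk => (key k (hs hk)).2 hk⟩

lemma linearIndependent_word : LinearIndependent ℂ fun p => listProd (word p) := by
  choose a h0 ha using fun p => listProd_eq_basis (word_nodup p)
  have h1 : LinearIndependent ℂ fun p => monomialBasis (word p).toFinset :=
    monomialBasis.linearIndependent.comp _ fun p q h => word_injective p q h
  have := h1.units_smul fun p => Units.mk0 (a p) (h0 p)
  convert this using 1
  funext p
  rw [ha]; rfl

/-- The counting operators are diagonal in the monomial basis, so the conditions can be read off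
from each monomial of the support: it involves active coordinates only and is balanced for each `σ`.
-/
lemma mem_span_word {x : Grassmann} (h0 : ∀ k ∉ active, ctr k x = 0)
    (h1 : ∀ σ, ∑ j, num (thetaIdx (pt j) σ) x = ∑ i, num (thetaBarIdx (pt i) σ) x) :
    x ∈ Submodule.span ℂ (Set.range fun p => listProd (word p)) := by
  rw [← monomialBasis.sum_repr x]
  refine Submodule.sum_mem _ fun s _ => ?_
  by_cases hs : monomialBasis.repr x s = 0
  · rw [hs, zero_smul]; exact Submodule.zero_mem _
  have h2 : s ⊆ active := by
    intro k hk
    by_contra hka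
    have := num_repr k x s
    rw [num, h0 k hka, mul_zero, map_zero, if_pos hk, one_mul] at this
    exact hs this.symm
  have h3 : ∀ σ, (∑ j, if thetaIdx (pt j) σ ∈ s then 1 else 0) =
      ∑ i, if thetaBarIdx (pt i) σ ∈ s then 1 else 0 := by
    intro σ
    have := congrArg (fun y => monomialBasis.repr y s) (h1 σ)
    simp only [map_sum, Finsupp.finsetSum_apply, num_repr, ← Finset.sum_mul] at this
    have h4 := mul_right_cancel₀ hs this
    have h5 : (((∑ j, if thetaIdx (pt j) σ ∈ s then 1 else 0 : ℕ)) : ℂ) =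
      ((∑ i, if thetaBarIdx (pt i) σ ∈ s then 1 else 0 : ℕ) : ℂ) := by
      push_cast; exact h4
    exact_mod_cast h5
  obtain ⟨p, rfl⟩ := exists_word h2 h3
  obtain ⟨a, ha0, ha⟩ := listProd_eq_basis (word_nodup p)
  refine Submodule.smul_mem _ _ ?_
  rw [show monomialBasis (word p).toFinset = a⁻¹ • listProd (word p) by
    rw [ha, smul_smul, inv_mul_cancel₀ ha0, one_smul]]
  exact Submodule.smul_mem _ _ (Submodule.subset_span ⟨p, rfl⟩)

/-! ## Leading terms of the chosen monomials -/

/-- The monomial with exponent `e` in eight given elements. -/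
def monProd {R : Type*} [Monoid R] (v : Fin 2 × Fin 2 × Fin 2 → R) (e : Exponent) : R :=
  v (0, 0, 0) ^ e (0, 0, 0) * v (0, 0, 1) ^ e (0, 0, 1) *
  v (0, 1, 0) ^ e (0, 1, 0) * v (0, 1, 1) ^ e (0, 1, 1) *
  v (1, 0, 0) ^ e (1, 0, 0) * v (1, 0, 1) ^ e (1, 0, 1) *
  v (1, 1, 0) ^ e (1, 1, 0) * v (1, 1, 1) ^ e (1, 1, 1)

lemma map_monProd {R S F : Type*} [Monoid R] [Monoid S] [FunLike F R S] [MonoidHomClass F R S]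
    (f : F) (v : Fin 2 × Fin 2 × Fin 2 → R) (e : Exponent) :
    f (monProd v e) = monProd (fun t => f (v t)) e := by
  simp only [monProd, map_mul, map_pow]

lemma monProd_add {R : Type*} [CommMonoid R] (v : Fin 2 × Fin 2 × Fin 2 → R) (e f : Exponent) :
    monProd v (e + f) = monProd v e * monProd v f := by
  simp only [monProd, Pi.add_apply, pow_add]
  ac_rfl

lemma monProd_ex {R : Type*} [CommMonoid R] (v : Fin 2 × Fin 2 × Fin 2 → R) (n i j : Fin 2) :
    monProd v (ex n i j) = v (n, i, j) := by
  fin_cases n <;> fin_cases i <;> fin_cases j <;> simp [monProd, ex]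

lemma monProd_zero {R : Type*} [Monoid R] (v : Fin 2 × Fin 2 × Fin 2 → R) : monProd v 0 = 1 := by
  simp [monProd]

section span
variable {S : Type*} [CommRing S] [Algebra ℂ S]

/-- The balanced monomials with one spinor index. -/
def halfProd (n : Fin 2 → Fin 2 → S) : Fin 6 → S :=
  ![1, n 0 0, n 0 1, n 1 0, n 1 1, n 0 0 * n 1 1]

/-- The leading terms of the invariants `I_{nij}`. -/
def leadVal (y : Fin 2 → ℂ) (n m : Fin 2 → Fin 2 → S) (t : Fin 2 × Fin 2 × Fin 2) : S :=
  ![n t.2.1 t.2.2 + m t.2.1 t.2.2, y 0 • n t.2.1 t.2.2 + y 1 • m t.2.1 t.2.2] t.1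

/-- Cramer's rule. -/
lemma mem_of_two {P : Submodule ℂ S} {x w p q : S} {a b c d : ℂ} (hp : p ∈ P) (hq : q ∈ P)
    (h1 : p = a • x + b • w) (h2 : q = c • x + d • w) (h : a * d - b * c ≠ 0) : x ∈ P ∧ w ∈ P := by
  subst h1 h2
  constructor
  · have h3 : (a * d - b * c) • x ∈ P := by
      have := P.sub_mem (P.smul_mem d hp) (P.smul_mem b hq)
      convert this using 1
      module
    simpa [smul_smul, inv_mul_cancel₀ h] using P.smul_mem (a * d - b * c)⁻¹ h3
  · have h3 : (a * d - b * c) • w ∈ P := by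
      have := P.sub_mem (P.smul_mem a hq) (P.smul_mem c hp)
      convert this using 1
      module
    simpa [smul_smul, inv_mul_cancel₀ h] using P.smul_mem (a * d - b * c)⁻¹ h3

/-- The relations between the products of two anticommuting families. -/
structure Quadric (n : Fin 2 → Fin 2 → S) : Prop where
  left : ∀ i j k, n i j * n i k = 0
  right : ∀ i j k, n i j * n k j = 0
  cross : n 0 1 * n 1 0 = -(n 0 0 * n 1 1)

/-- In the eigenbasis, `I_{1ij}` is `n + m` and `I_{2ij}` is `y₀ n + y₁ m` to lowest order, where
`n` and `m` belong to the two eigenvectors. As `y₀ ≠ y₁`, linear systems of size two recover the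
separate products of `n` and `m` from the chosen monomials. The list at the end goes through all 36
balanced products. -/
lemma halfProd_mem {y : Fin 2 → ℂ} (hy : y 0 ≠ y 1) {n m : Fin 2 → Fin 2 → S} (hn : Quadric n)
    (hm : Quadric m) (p : Fin 6 × Fin 6) : halfProd n p.1 * halfProd m p.2 ∈
      Submodule.span ℂ (monProd (leadVal y n m) '' (chosen : Set Exponent)) := by
  set P := Submodule.span ℂ (monProd (leadVal y n m) '' (chosen : Set Exponent)) with hP
  have hyz : y 0 - y 1 ≠ 0 := sub_ne_zero.2 hy
  have hyz' : y 1 - y 0 ≠ 0 := sub_ne_zero.2 hy.symm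
  have key : ∀ e ∈ chosen, monProd (leadVal y n m) e ∈ P := fun e he =>
    Submodule.subset_span ⟨e, he, rfl⟩
  have k1 : ∀ n' i j, leadVal y n m (n', i, j) ∈ P := fun n' i j => by
    rw [← monProd_ex (leadVal y n m)]; exact key _ (by revert n' i j; decide +kernel)
  have k2 : ∀ {n' i j k l}, ex 0 i j + ex n' k l ∈ chosen →
      leadVal y n m (0, i, j) * leadVal y n m (n', k, l) ∈ P := fun {n' i j k l} h => by
    rw [← monProd_ex (leadVal y n m) 0 i j, ← monProd_ex (leadVal y n m) n' k l, ← monProd_add]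
    exact key _ h
  have k3 : ∀ {n' i j k l}, 2 • ex 0 i j + ex n' k l ∈ chosen →
      leadVal y n m (0, i, j) * leadVal y n m (0, i, j) * leadVal y n m (n', k, l) ∈ P :=
      fun {n' i j k l} h => by
    rw [← monProd_ex (leadVal y n m) 0 i j, ← monProd_ex (leadVal y n m) n' k l, ← monProd_add,
      ← monProd_add, ← two_nsmul]
    exact key _ h
  have l0 : ∀ i j, leadVal y n m (0, i, j) = n i j + m i j := fun _ _ => rfl
  have l1 : ∀ i j, leadVal y n m (1, i, j) = y 0 • n i j + y 1 • m i j := fun _ _ => rfl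
  have one : (1 : S) ∈ P := by
    rw [← monProd_zero (leadVal y n m)]; exact key _ (by decide +kernel)
  have lin : ∀ i j, n i j ∈ P ∧ m i j ∈ P := fun i j =>
    mem_of_two (k1 0 i j) (k1 1 i j) (by rw [l0, one_smul, one_smul]) (l1 i j)
      (by rw [one_mul, one_mul]; exact hyz')
  have sq : ∀ i j, n i j * m i j ∈ P := fun i j => by
    have h := k2 (n' := 0) (i := i) (j := j) (k := i) (l := j) (by revert i j; decide +kernel)
    have e : n i j * m i j = (1 / 2 : ℂ) •
        (leadVal y n m (0, i, j) * leadVal y n m (0, i, j)) := by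
      rw [l0]
      have : (n i j + m i j) * (n i j + m i j) = (2 : ℂ) • (n i j * m i j) := by
        rw [two_smul]
        linear_combination hn.left i j j + hm.left i j j
      rw [this, smul_smul]; norm_num
    rw [e]; exact P.smul_mem _ h
  -- For pairs with a common label the products within one family vanish, and two mixed products
  -- remain as unknowns of two equations.
  have adj : ∀ {i j k l}, ex 0 i j + ex 0 k l ∈ chosen → ex 0 i j + ex 1 k l ∈ chosen →
      n i j * n k l = 0 → m i j * m k l = 0 → n i j * m k l ∈ P ∧ n k l * m i j ∈ P := by
    intro i j k l h0 h1 hn0 hm0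
    refine mem_of_two (a := 1) (b := 1) (c := y 1) (d := y 0) (k2 h0) (k2 h1) ?_ ?_
      (by rw [one_mul, one_mul]; exact hyz)
    · rw [l0, l0, one_smul, one_smul]; linear_combination hn0 + hm0
    · rw [l0, l1]
      simp only [add_mul, mul_add, mul_smul_comm, hn0, hm0]
      rw [mul_comm (m i j)]; module
  -- The square of `n + m` is `2nm`, so a cubic monomial has one term for each choice of the family
  -- in its last factor.
  have cub : ∀ {i j k l}, 2 • ex 0 i j + ex 0 k l ∈ chosen → 2 • ex 0 i j + ex 1 k l ∈ chosen →
      n i j * n k l * m i j ∈ P ∧ n i j * (m i j * m k l) ∈ P := by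
    intro i j k l h0 h1
    have e : (n i j + m i j) * (n i j + m i j) = (2 : ℂ) • (n i j * m i j) := by
      rw [two_smul]
      linear_combination hn.left i j j + hm.left i j j
    refine mem_of_two (a := 2) (b := 2) (c := 2 * y 0) (d := 2 * y 1) (k3 h0) (k3 h1) ?_ ?_
      (by rw [show (2 : ℂ) * (2 * y 1) - 2 * (2 * y 0) = 4 * (y 1 - y 0) by ring]
          exact mul_ne_zero (by norm_num) hyz')
    · rw [l0, l0, e]
      simp only [smul_mul_assoc, ← smul_add]
      congr 1; ring
    · rw [l0, l1, e]
      simp only [smul_mul_assoc, mul_add, mul_smul_comm, smul_smul]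
      congr 2 <;> ring
  have a1 := adj (i := 0) (j := 0) (k := 0) (l := 1) (by decide +kernel) (by decide +kernel)
    (hn.left _ _ _) (hm.left _ _ _)
  have a2 := adj (i := 0) (j := 0) (k := 1) (l := 0) (by decide +kernel) (by decide +kernel)
    (hn.right _ _ _) (hm.right _ _ _)
  have a3 := adj (i := 1) (j := 1) (k := 0) (l := 1) (by decide +kernel) (by decide +kernel)
    (hn.right _ _ _) (hm.right _ _ _)
  have a4 := adj (i := 1) (j := 1) (k := 1) (l := 0) (by decide +kernel) (by decide +kernel)
    (hn.left _ _ _) (hm.left _ _ _)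
  have b1 := cub (i := 0) (j := 0) (k := 1) (l := 1) (by decide +kernel) (by decide +kernel)
  have b2 := cub (i := 1) (j := 1) (k := 0) (l := 0) (by decide +kernel) (by decide +kernel)
  have b3 := cub (i := 0) (j := 1) (k := 1) (l := 0) (by decide +kernel) (by decide +kernel)
  have b4 := cub (i := 1) (j := 0) (k := 0) (l := 1) (by decide +kernel) (by decide +kernel)
  have q1 := k2 (n' := 0) (i := 0) (j := 0) (k := 1) (l := 1) (by decide +kernel)
  have q2 := k2 (n' := 0) (i := 0) (j := 1) (k := 1) (l := 0) (by decide +kernel)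
  have q3 := k2 (n' := 1) (i := 0) (j := 0) (k := 1) (l := 1) (by decide +kernel)
  have q4 := k2 (n' := 1) (i := 1) (j := 1) (k := 0) (l := 0) (by decide +kernel)
  have q5 := k2 (n' := 1) (i := 0) (j := 1) (k := 1) (l := 0) (by decide +kernel)
  have q6 : leadVal y n m (1, 0, 1) * leadVal y n m (1, 1, 0) ∈ P := by
    rw [← monProd_ex (leadVal y n m) 1 0 1, ← monProd_ex (leadVal y n m) 1 1 0, ← monProd_add]
    exact key _ (by decide +kernel)
  -- The first combination eliminates the mixed products `n₀₀m₁₁` and `n₁₁m₀₀`, the second the mixed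
  -- products `n₀₁m₁₀` and `n₁₀m₀₁`. By the cross relation both then involve only the two unknowns
  -- here, with determinant `-(y₀ - y₁)³`.
  have d1 : n 0 0 * n 1 1 ∈ P ∧ m 0 0 * m 1 1 ∈ P := by
    refine mem_of_two (a := y 0 - y 1) (b := -(y 0 - y 1)) (c := -(y 0 - y 1) * y 0)
      (d := (y 0 - y 1) * y 1) (P.sub_mem (P.add_mem q3 q4) (P.smul_mem (y 0 + y 1) q1))
      (P.sub_mem q6 (P.smul_mem (y 0 * y 1) q2)) ?_ ?_ ?_
    · simp only [l0, l1, add_mul, mul_add, mul_smul_comm, smul_add]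
      rw [mul_comm (n 1 1), mul_comm (m 1 1), mul_comm (n 1 1), mul_comm (m 1 1)]
      module
    · simp only [l0, l1, add_mul, mul_add, mul_smul_comm, smul_mul_assoc, smul_add, smul_smul,
        hn.cross, hm.cross]
      module
    · rw [show (y 0 - y 1) * ((y 0 - y 1) * y 1) - -(y 0 - y 1) * (-(y 0 - y 1) * y 0) =
        -(y 0 - y 1) ^ 3 by ring]
      exact neg_ne_zero.2 (pow_ne_zero _ hyz)
  have d2 : n 0 0 * m 1 1 ∈ P ∧ n 1 1 * m 0 0 ∈ P := by
    refine mem_of_two (a := 1) (b := 1) (c := y 1) (d := y 0)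
      (P.sub_mem (P.sub_mem q1 d1.1) d1.2)
      (P.sub_mem (P.sub_mem q3 (P.smul_mem (y 0) d1.1)) (P.smul_mem (y 1) d1.2)) ?_ ?_
      (by rw [one_mul, one_mul]; exact hyz)
    · rw [l0, l0, one_smul, one_smul]; ring
    · simp only [l0, l1, add_mul, mul_add, mul_smul_comm]
      rw [mul_comm (m 0 0) (n 1 1)]; module
  have d3 : n 0 1 * m 1 0 ∈ P ∧ n 1 0 * m 0 1 ∈ P := by
    refine mem_of_two (a := 1) (b := 1) (c := y 1) (d := y 0)
      (P.add_mem (P.add_mem q2 d1.1) d1.2)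
      (P.add_mem (P.add_mem q5 (P.smul_mem (y 0) d1.1)) (P.smul_mem (y 1) d1.2)) ?_ ?_
      (by rw [one_mul, one_mul]; exact hyz)
    · rw [l0, l0, one_smul, one_smul]; linear_combination hn.cross + hm.cross
    · simp only [l0, l1, add_mul, mul_add, mul_smul_comm, hn.cross, hm.cross]
      rw [mul_comm (m 0 1) (n 1 0)]; module
  have top : n 0 0 * n 1 1 * (m 0 0 * m 1 1) ∈ P := by
    have h : monProd (leadVal y n m) (2 • ex 0 0 0 + 2 • ex 0 1 1) ∈ P := key _ (by decide +kernel)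
    rw [monProd_add, two_nsmul, two_nsmul, monProd_add, monProd_add, monProd_ex, monProd_ex, l0, l0]
      at h
    have e : n 0 0 * n 1 1 * (m 0 0 * m 1 1) = (1 / 4 : ℂ) • ((n 0 0 + m 0 0) * (n 0 0 + m 0 0) *
        ((n 1 1 + m 1 1) * (n 1 1 + m 1 1))) := by
      have e1 : ∀ i j, (n i j + m i j) * (n i j + m i j) = (2 : ℂ) • (n i j * m i j) := by
        intro i j
        rw [two_smul]
        linear_combination hn.left i j j + hm.left i j j
      rw [e1, e1, smul_mul_assoc, mul_smul_comm, smul_smul, smul_smul,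
        show (1 / 4 * 2 * 2 : ℂ) = 1 by norm_num, one_smul]
      ring
    rw [e]; exact P.smul_mem _ h
  have c1 : ∀ {x w : S}, x * w ∈ P → w * x ∈ P := fun h => by rwa [mul_comm]
  have c3 : n 0 0 * n 1 1 * m 1 1 ∈ P := by rw [mul_comm (n 0 0)]; exact b2.1
  have c4 : n 1 1 * (m 0 0 * m 1 1) ∈ P := by rw [mul_comm (m 0 0)]; exact b2.2
  -- In `c5` to `c8` the cross relation replaces the diagonal product by the off-diagonal one, which
  -- the cubic monomials with squares of `I_{112}` and `I_{121}` provide.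
  have c5 : n 0 0 * n 1 1 * m 0 1 ∈ P := by
    rw [← neg_neg (n 0 0 * n 1 1), ← hn.cross, neg_mul]; exact P.neg_mem b3.1
  have c6 : n 0 1 * (m 0 0 * m 1 1) ∈ P := by
    rw [← neg_neg (m 0 0 * m 1 1), ← hm.cross, mul_neg]; exact P.neg_mem b3.2
  have c7 : n 0 0 * n 1 1 * m 1 0 ∈ P := by
    rw [← neg_neg (n 0 0 * n 1 1), ← hn.cross, neg_mul, mul_comm (n 0 1)]; exact P.neg_mem b4.1
  have c8 : n 1 0 * (m 0 0 * m 1 1) ∈ P := by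
    rw [← neg_neg (m 0 0 * m 1 1), ← hm.cross, mul_neg, mul_comm (m 0 1)]; exact P.neg_mem b4.2
  have r1 : ∀ {x : S}, x ∈ P → x * 1 ∈ P := fun h => by rwa [mul_one]
  have r2 : ∀ {x : S}, x ∈ P → 1 * x ∈ P := fun h => by rwa [one_mul]
  obtain ⟨p, q⟩ := p
  fin_cases p <;> fin_cases q
  exacts [r1 one, r2 (lin 0 0).2, r2 (lin 0 1).2, r2 (lin 1 0).2, r2 (lin 1 1).2, r2 d1.2,
    r1 (lin 0 0).1, sq 0 0, a1.1, a2.1, d2.1, b1.2,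
    r1 (lin 0 1).1, a1.2, sq 0 1, d3.1, a3.2, c6,
    r1 (lin 1 0).1, a2.2, d3.2, sq 1 0, a4.2, c8,
    r1 (lin 1 1).1, d2.2, a3.1, a4.1, sq 1 1, c4,
    r1 d1.1, b1.1, c5, c7, c3, top]

end span

/-- The leading terms of the invariants `I_{nij}` in adapted odd coordinates. -/
def leadGen (y : Fin 2 → ℂ) (t : Fin 2 × Fin 2 × Fin 2) : Grassmann :=
  ∑ σ : Fin 2, (if t.1 = 0 then 1 else y σ) •
    (gen (thetaIdx (pt t.2.2) σ) * gen (thetaBarIdx (pt t.2.1) σ))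

/-- For a fixed spinor index each point contributes one `θ` and one `θbar`, so a repeated label
gives a repeated odd coordinate. -/
lemma exists_pairLift (σ : Fin 2) : ∃ n : Fin 2 → Fin 2 → Cen,
    (∀ i j, algebraMap Cen Grassmann (n i j) =
      gen (thetaIdx (pt j) σ) * gen (thetaBarIdx (pt i) σ)) ∧ Quadric n := by
  choose n hn using fun i j =>
    ((gen_od (thetaIdx (pt j) σ)).mul (gen_od (thetaBarIdx (pt i) σ))).lift
  have h : ∀ a b x y : Grassmann, Od b → Od x → a * b * (x * y) = -(a * x * (b * y)) := by
    intro a b x y hb hx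
    rw [mul_assoc, ← mul_assoc b, hb.anticomm hx]; noncomm_ring
  refine ⟨n, hn, ⟨fun i j k => cen_injective ?_, fun i j k => cen_injective ?_, cen_injective ?_⟩⟩
  · rw [map_mul, hn, hn, h _ _ _ _ (gen_od _) (gen_od _), (gen_od (thetaBarIdx (pt i) σ)).sq,
      mul_zero, neg_zero, map_zero]
  · rw [map_mul, hn, hn, h _ _ _ _ (gen_od _) (gen_od _), (gen_od (thetaIdx (pt j) σ)).sq,
      zero_mul, neg_zero, map_zero]
  · rw [map_neg, map_mul, map_mul, hn, hn, hn, hn,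
      h (gen (thetaIdx (pt 1) σ)) _ (gen (thetaIdx (pt 0) σ)) _ (gen_od _) (gen_od _),
      h (gen (thetaIdx (pt 0) σ)) _ (gen (thetaIdx (pt 1) σ)) _ (gen_od _) (gen_od _),
      (gen_od (thetaIdx (pt 1) σ)).anticomm (gen_od (thetaIdx (pt 0) σ)), neg_mul]

lemma listProd_append (l l' : List (Fin 16)) : listProd (l ++ l') = listProd l * listProd l' := by
  rw [listProd, List.map_append, List.prod_append]; rfl

lemma listProd_halfWord {σ : Fin 2} {n : Fin 2 → Fin 2 → Cen}
    (hn : ∀ i j, algebraMap Cen Grassmann (n i j) =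
      gen (thetaIdx (pt j) σ) * gen (thetaBarIdx (pt i) σ)) (q : Fin 6) :
    listProd (halfWord σ q) = algebraMap Cen Grassmann (halfProd n q) := by
  have h2 : ∀ a b, listProd [a, b] = gen a * gen b := fun a b => by simp [listProd]
  fin_cases q
  · exact (map_one _).symm
  · exact (h2 _ _).trans (hn 0 0).symm
  · exact (h2 _ _).trans (hn 0 1).symm
  · exact (h2 _ _).trans (hn 1 0).symm
  · exact (h2 _ _).trans (hn 1 1).symm
  · change _ = algebraMap Cen Grassmann (n 0 0 * n 1 1)
    rw [map_mul, hn, hn]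
    simp [listProd, halfWord, pt, mul_assoc]

lemma word_mem_span {y : Fin 2 → ℂ} (hy : y 0 ≠ y 1) (p : Fin 6 × Fin 6) :
    listProd (word p) ∈ Submodule.span ℂ (Set.range fun e : chosen => monProd (leadGen y) e) := by
  obtain ⟨n, hn, hn'⟩ := exists_pairLift 0
  obtain ⟨m, hm, hm'⟩ := exists_pairLift 1
  have h := Submodule.mem_map_of_mem (f := cenVal.toLinearMap) (halfProd_mem hy hn' hm' p)
  rw [Submodule.map_span] at h
  have h1 : cenVal.toLinearMap (halfProd n p.1 * halfProd m p.2) = listProd (word p) := by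
    rw [word, listProd_append, listProd_halfWord hn, listProd_halfWord hm, ← map_mul]; rfl
  have h2 : ∀ t, cenVal (leadVal y n m t) = leadGen y t := by
    rintro ⟨a, i, j⟩
    rw [leadGen, Fin.sum_univ_two]
    fin_cases a
    · change cenVal (n i j + m i j) = _
      rw [map_add]
      change algebraMap Cen Grassmann (n i j) + algebraMap Cen Grassmann (m i j) = _
      rw [hn, hm]; simp
    · change cenVal (y 0 • n i j + y 1 • m i j) = _
      rw [map_add, map_smul, map_smul]
      change y 0 • algebraMap Cen Grassmann (n i j) + y 1 • algebraMap Cen Grassmann (m i j) = _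
      rw [hn, hm]; simp
  rw [h1] at h
  refine Submodule.span_mono ?_ h
  rintro _ ⟨_, ⟨e, he, rfl⟩, rfl⟩
  refine ⟨⟨e, he⟩, ?_⟩
  change monProd (leadGen y) e = cenVal (monProd (leadVal y n m) e)
  rw [map_monProd]
  simp only [h2]

/-- By counting: the span of these 36 vectors contains the 36 independent words. -/
lemma linearIndependent_lead {y : Fin 2 → ℂ} (hy : y 0 ≠ y 1) :
    LinearIndependent ℂ fun e : chosen => monProd (leadGen y) (e : Exponent) := by
  rw [linearIndependent_iff_card_eq_finrank_span]
  refine le_antisymm ?_ (finrank_range_le_card _)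
  have h : Submodule.span ℂ (Set.range fun p => listProd (word p)) ≤
      Submodule.span ℂ (Set.range fun e : chosen => monProd (leadGen y) (e : Exponent)) := by
    rw [Submodule.span_le]
    rintro _ ⟨p, rfl⟩
    exact word_mem_span hy p
  have h1 := Submodule.finrank_mono h
  rw [finrank_span_eq_card linearIndependent_word] at h1
  rw [Fintype.card_coe, chosen_card.1]
  rw [Fintype.card_prod, Fintype.card_fin] at h1
  exact h1

/-! ## The bodies of the variables at the first point -/

section matrix
variable {x y z : Matrix (Fin 2) (Fin 2) ℂ}

/-- The eigenvalues are `(tr K ± s) / 2` with a nonzero square root `s` of the discriminant. The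
rows of `L` are left eigenvectors, independent because the eigenvalues differ. -/
lemma exists_diagonalization {K : Matrix (Fin 2) (Fin 2) ℂ} (h : K.trace ^ 2 - 4 * K.det ≠ 0) :
    ∃ (L : Matrix (Fin 2) (Fin 2) ℂ) (y : Fin 2 → ℂ), y 0 ≠ y 1 ∧ IsUnit L.det ∧
      L * K = Matrix.diagonal y * L := by
  obtain ⟨s, hs⟩ := IsAlgClosed.exists_pow_nat_eq (K.trace ^ 2 - 4 * K.det) (n := 2) two_pos
  have hs0 : s ≠ 0 := fun h0 => h (by rw [← hs, h0]; ring)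
  have hv : ∀ t : ℂ, t ^ 2 = K.trace ^ 2 - 4 * K.det → ∃ v : Fin 2 → ℂ, v ≠ 0 ∧
      Matrix.vecMul v K = ((K.trace + t) / 2) • v := by
    intro t ht
    have hd : (K - ((K.trace + t) / 2) • (1 : Matrix (Fin 2) (Fin 2) ℂ)).det = 0 := by
      rw [Matrix.trace_fin_two, Matrix.det_fin_two] at ht ⊢
      simp only [Matrix.sub_apply, Matrix.smul_apply, Matrix.one_apply, smul_eq_mul, Fin.isValue,
        if_true, zero_ne_one, one_ne_zero, if_false]
      linear_combination ht / 4
    obtain ⟨v, hv0, hv⟩ := Matrix.exists_vecMul_eq_zero_iff.2 hd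
    refine ⟨v, hv0, ?_⟩
    rw [Matrix.vecMul_sub, Matrix.vecMul_smul, Matrix.vecMul_one, sub_eq_zero] at hv
    exact hv
  obtain ⟨v, hv0, hv1⟩ := hv s hs
  obtain ⟨w, hw0, hw1⟩ := hv (-s) (by rw [neg_sq, hs])
  have hne : (K.trace + s) / 2 ≠ (K.trace + -s) / 2 := fun e => hs0 (by linear_combination e)
  refine ⟨Matrix.of ![v, w], ![(K.trace + s) / 2, (K.trace + -s) / 2], hne, ?_, ?_⟩
  · rw [isUnit_iff_ne_zero]
    intro hd
    obtain ⟨a, ha0, ha⟩ := Matrix.exists_vecMul_eq_zero_iff.2 hd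
    have e1 : a 0 • v + a 1 • w = 0 := by
      rw [← ha]; funext i
      simp [Matrix.vecMul, dotProduct, Fin.sum_univ_two]
    have e2 := congrArg (fun u => Matrix.vecMul u K) e1
    simp only [Matrix.add_vecMul, Matrix.smul_vecMul, hv1, hw1, Matrix.zero_vecMul] at e2
    have e3 : a 1 • w = 0 := by
      have : ((K.trace + -s) / 2 - (K.trace + s) / 2) • (a 1 • w) = 0 := by
        linear_combination (norm := module) e2 - ((K.trace + s) / 2) • e1
      exact (smul_eq_zero.1 this).resolve_left (sub_ne_zero.2 hne.symm)
    have h1 : a 1 = 0 := (smul_eq_zero.1 e3).resolve_right hw0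
    rw [e3, add_zero] at e1
    have h0 : a 0 = 0 := (smul_eq_zero.1 e1).resolve_right hv0
    exact ha0 (by funext i; fin_cases i <;> assumption)
  · ext i j
    have h1 : ∀ i, (Matrix.of ![v, w] * K) i = Matrix.vecMul (![v, w] i) K := fun i => rfl
    rw [h1, Matrix.diagonal_mul]
    fin_cases i
    · change Matrix.vecMul v K j = _
      rw [hv1]; rfl
    · change Matrix.vecMul w K j = _
      rw [hw1]; rfl

lemma inverse_sub_inverse (hx : z * x = 1) {z' x' : Matrix (Fin 2) (Fin 2) ℂ} (hx' : x' * z' = 1) :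
    z * (x' - x) * z' = z - z' := by
  rw [mul_sub, sub_mul, mul_assoc, hx', mul_one, hx, one_mul]

lemma det_sub_fin_two (x y : Matrix (Fin 2) (Fin 2) ℂ) :
    (x - y).det = x.det + y.det - (x * y.adjugate).trace := by
  rw [Matrix.adjugate_fin_two, Matrix.det_fin_two, Matrix.det_fin_two, Matrix.det_fin_two,
    Matrix.trace_fin_two]
  simp [Matrix.mul_apply, Fin.sum_univ_two]
  ring

lemma adjugate_adjugate_fin_two (x : Matrix (Fin 2) (Fin 2) ℂ) : x.adjugate.adjugate = x := by
  rw [Matrix.adjugate_fin_two, Matrix.adjugate_fin_two]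
  ext i j
  fin_cases i <;> fin_cases j <;> simp

lemma adj2_eq_adjugate (x : Matrix (Fin 2) (Fin 2) ℂ) : adj2 x = x.adjugate :=
  (Matrix.adjugate_fin_two x).symm

lemma adjugate_eq_trace_sub (x : Matrix (Fin 2) (Fin 2) ℂ) :
    x.adjugate = x.trace • (1 : Matrix (Fin 2) (Fin 2) ℂ) - x := by
  rw [Matrix.adjugate_fin_two, Matrix.trace_fin_two]
  ext i j
  fin_cases i <;> fin_cases j <;> simp

end matrix

variable {c : Config}

lemma det_xb (c : Config) (i j : Fin 4) : (xb c i - xb c j).det = (distSq c i j : ℂ) := by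
  rw [Matrix.det_fin_two, distSq]
  simp only [Matrix.sub_apply, xb, Fin.sum_univ_four, eta, sigmaTilde, sigma]
  simp
  ring_nf
  simp only [Complex.I_sq]
  ring

/-- The bodies of `x̃_{īj}⁻¹` for `j = 1`. -/
def zb (c : Config) (i : Fin 4) : Matrix (Fin 2) (Fin 2) ℂ := bodyM (XJ c i 0)

lemma bodyM_XJ_mul (hc : c ∈ nondegenerate) {i j : Fin 4} (h : i ≠ j) :
    bodyM (XJ c i j) * (xb c i - xb c j) = 1 ∧ (xb c i - xb c j) * bodyM (XJ c i j) = 1 := by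
  have := XJ_mul (isUnit_intervalSq hc h)
  rw [← bodyM_XI, ← bodyM_mul, ← bodyM_mul, this.1, this.2]
  exact ⟨map_one body.mapMatrix, map_one body.mapMatrix⟩

lemma zb_mul (hc : c ∈ nondegenerate) {i : Fin 4} (h : i ≠ 0) :
    zb c i * (xb c i - xb c 0) = 1 ∧ (xb c i - xb c 0) * zb c i = 1 := bodyM_XJ_mul hc h

lemma bodyM_XJ_zero (hc : c ∈ nondegenerate) {i : Fin 4} (h : i ≠ 0) :
    bodyM (XJ c 0 i) = -zb c i := by
  have h1 := (bodyM_XJ_mul hc h.symm).1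
  have h2 := (zb_mul hc h).2
  calc bodyM (XJ c 0 i) = bodyM (XJ c 0 i) * ((xb c i - xb c 0) * zb c i) := by rw [h2, mul_one]
    _ = -(bodyM (XJ c 0 i) * (xb c 0 - xb c i) * zb c i) := by noncomm_ring
    _ = _ := by rw [h1, one_mul]

/-- The body of the adjugate of `-X̃_{1(1)+}` or `-X̃_{1(2)-}`. -/
def Zb (c : Config) (n : Fin 2) : Matrix (Fin 2) (Fin 2) ℂ := zb c (pt n) - zb c 3

/-- The bodies of `X̃_{1(1)+}` and `X̃_{1(2)-}`. -/
def Xb (c : Config) (n : Fin 2) : Matrix (Fin 2) (Fin 2) ℂ := bodyM (evm c (XTilde n))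

lemma det_zb (hc : c ∈ nondegenerate) {i : Fin 4} (h : i ≠ 0) :
    (zb c i).det = (distSq c i 0 : ℂ)⁻¹ := by
  have := congrArg Matrix.det (zb_mul hc h).1
  rw [Matrix.det_mul, det_xb, Matrix.det_one] at this
  exact eq_inv_of_mul_eq_one_left this

lemma det_zb_sub (hc : c ∈ nondegenerate) {i j : Fin 4} (hi : i ≠ 0) (hj : j ≠ 0) :
    (zb c i - zb c j).det = distSq c i j / (distSq c i 0 * distSq c j 0) := by
  rw [← inverse_sub_inverse (zb_mul hc hi).1 (zb_mul hc hj).2, Matrix.det_mul, Matrix.det_mul,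
    det_zb hc hi, det_zb hc hj, sub_sub_sub_cancel_right, det_xb, distSq_comm c j i]
  rw [div_eq_mul_inv, mul_inv]; ring

lemma Zb_det (hc : c ∈ nondegenerate) (n : Fin 2) : (Zb c n).det ≠ 0 := by
  rw [Zb, det_zb_sub hc (pt_ne n).1 (by decide)]
  have h := fun i j (h : i ≠ j) => Complex.ofReal_ne_zero.2 (hc i j h)
  exact div_ne_zero (h _ _ (pt_ne n).2) (mul_ne_zero (h _ _ (pt_ne n).1) (h _ _ (by decide)))

lemma bodyM_adj2 (M : Matrix (Fin 2) (Fin 2) Grassmann) : bodyM (adj2 M) = (bodyM M).adjugate := by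
  rw [← adj2_eq_adjugate]
  ext α β
  fin_cases α <;> fin_cases β <;> simp [bodyM_apply, adj2]

lemma bodyM_neg (M : Matrix (Fin 2) (Fin 2) Grassmann) : bodyM (-M) = -bodyM M :=
  map_neg body.mapMatrix M

lemma Xb_eq (hc : c ∈ nondegenerate) (n : Fin 2) : Xb c n = -(Zb c n).adjugate := by
  have h : ∀ {i j : Fin 4}, i ≠ 0 → j ≠ 0 →
      bodyM (XJ c i 0 * XI c i j * XJ c 0 j) = zb c i - zb c j := by
    intro i j hi hj
    have e := inverse_sub_inverse (zb_mul hc hi).1 (zb_mul hc hj).2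
    rw [bodyM_mul, bodyM_mul, bodyM_XI, bodyM_XJ_zero hc hj, ← e]
    change zb c i * _ * _ = _
    noncomm_ring
  have key : ∀ {i j : Fin 4}, i ≠ 0 → j ≠ 0 →
      bodyM (evm c (intervalInv 0 j * toMat (interval i j) * intervalInv i 0)) =
        (zb c i - zb c j).adjugate := by
    intro i j hi hj
    rw [← h hi hj, ← adj2_chain, bodyM_adj2, adjugate_adjugate_fin_two]
  fin_cases n
  · change bodyM (evm c (-(intervalInv 0 3 * toMat (interval 1 3) * intervalInv 1 0))) = _
    rw [map_neg, bodyM_neg, key (by decide) (by decide)]; rfl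
  · change bodyM (evm c (intervalInv 0 2 * toMat (interval 3 2) * intervalInv 3 0)) = _
    rw [key (by decide) (by decide)]
    change (zb c 3 - zb c 2).adjugate = -(zb c 2 - zb c 3).adjugate
    rw [Matrix.adjugate_fin_two, Matrix.adjugate_fin_two]
    ext i j
    fin_cases i <;> fin_cases j <;> simp

/-- Data that diagonalize the bodies of the variables at the first point. -/
lemma exists_eigenbasis (hc : c ∈ regular) : ∃ (L : Matrix (Fin 2) (Fin 2) ℂ) (y : Fin 2 → ℂ),
    y 0 ≠ y 1 ∧ IsUnit L.det ∧ L * ((Xb c 0)⁻¹ * Xb c 1) = Matrix.diagonal y * L := by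
  have hn := hc.1
  have h0 := Zb_det hn 0
  have e0 : (Xb c 0)⁻¹ = -((Zb c 0).det⁻¹ • Zb c 0) := by
    refine Matrix.inv_eq_left_inv ?_
    rw [Xb_eq hn, neg_mul_neg, Matrix.smul_mul, Matrix.mul_adjugate, smul_smul, inv_mul_cancel₀ h0,
      one_smul]
  -- With `a = det Z₀`, `b = det Z₁` and `d = det (Z₀ - Z₁)` the discriminant is a nonzero multiple
  -- of `(a + b - d)² - 4ab`, which is symmetric in `a`, `b`, `d`. Inserting `det_zb_sub` makes it a
  -- nonzero multiple of the regularity polynomial.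
  refine exists_diagonalization fun h => hc.2 ?_
  have hK : (Xb c 0)⁻¹ * Xb c 1 = (Zb c 0).det⁻¹ • (Zb c 0 * (Zb c 1).adjugate) := by
    rw [e0, Xb_eq hn, neg_mul_neg, Matrix.smul_mul]
  rw [hK, Matrix.trace_smul, Matrix.det_smul, Matrix.det_mul, Matrix.det_adjugate,
    Fintype.card_fin, smul_eq_mul] at h
  have h1 : ((Zb c 0) * (Zb c 1).adjugate).trace ^ 2 - 4 * ((Zb c 0).det * (Zb c 1).det) = 0 := by
    field_simp at h
    linear_combination h
  have h2 := det_sub_fin_two (Zb c 0) (Zb c 1)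
  rw [show Zb c 0 - Zb c 1 = zb c 1 - zb c 2 by rw [Zb, Zb]; simp [pt]] at h2
  have h3 : ((Zb c 0) * (Zb c 1).adjugate).trace = (Zb c 0).det + (Zb c 1).det -
    (zb c 1 - zb c 2).det := by rw [h2]; ring
  rw [h3, det_zb_sub hn (by decide) (by decide),
    show (Zb c 0).det = _ from det_zb_sub hn (i := 1) (j := 3) (by decide) (by decide),
    show (Zb c 1).det = _ from det_zb_sub hn (i := 2) (j := 3) (by decide) (by decide),
    distSq_comm c 1 0, distSq_comm c 2 0, distSq_comm c 3 0] at h1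
  have n1 := Complex.ofReal_ne_zero.2 (hn 0 1 (by decide))
  have n2 := Complex.ofReal_ne_zero.2 (hn 0 2 (by decide))
  have n3 := Complex.ofReal_ne_zero.2 (hn 0 3 (by decide))
  field_simp at h1
  have h4 : (((distSq c 0 1 * distSq c 2 3) ^ 2 + (distSq c 0 2 * distSq c 1 3) ^ 2
      + (distSq c 0 3 * distSq c 1 2) ^ 2
      - 2 * (distSq c 0 1 * distSq c 2 3) * (distSq c 0 2 * distSq c 1 3)
      - 2 * (distSq c 0 2 * distSq c 1 3) * (distSq c 0 3 * distSq c 1 2)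
      - 2 * (distSq c 0 3 * distSq c 1 2) * (distSq c 0 1 * distSq c 2 3) : ℝ) : ℂ) = 0 := by
    push_cast
    linear_combination h1
  exact_mod_cast h4

/-- The stabilizer of the four points. -/
lemma exists_stabilizer (hn : c ∈ nondegenerate) {m' : Matrix (Fin 2) (Fin 2) ℂ}
    (h : m' * ((Xb c 0)⁻¹ * Xb c 1) = (Xb c 0)⁻¹ * Xb c 1 * m') :
    ∃ a m n k : Matrix (Fin 2) (Fin 2) ℂ, (∀ i, velocity c a m n k i = 0) ∧
      m + k * xb c 0 = m' ∧ (n + xb c 0 * k) * (Zb c 0)⁻¹ = -((Zb c 0)⁻¹ * m') := by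
  have h0 := Zb_det hn 0
  have hZ : Zb c 0 * (Zb c 0)⁻¹ = 1 := Matrix.mul_nonsing_inv _ (isUnit_iff_ne_zero.2 h0)
  have hZ' : (Zb c 0)⁻¹ * Zb c 0 = 1 := Matrix.nonsing_inv_mul _ (isUnit_iff_ne_zero.2 h0)
  have e0 : (Xb c 0)⁻¹ = -((Zb c 0).det⁻¹ • Zb c 0) := by
    refine Matrix.inv_eq_left_inv ?_
    rw [Xb_eq hn, neg_mul_neg, Matrix.smul_mul, Matrix.mul_adjugate, smul_smul, inv_mul_cancel₀ h0,
      one_smul]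
  have hK : ((Xb c 0)⁻¹ * Xb c 1).adjugate = Zb c 1 * (Zb c 0)⁻¹ := by
    rw [e0, Xb_eq hn, neg_mul_neg, Matrix.smul_mul, Matrix.adjugate_smul, Matrix.adjugate_mul_distrib,
      adjugate_adjugate_fin_two, Matrix.inv_def, Matrix.mul_smul, Ring.inverse_eq_inv]
    simp
  have hcomm : m' * (Zb c 1 * (Zb c 0)⁻¹) = Zb c 1 * (Zb c 0)⁻¹ * m' := by
    rw [← hK, adjugate_eq_trace_sub, mul_sub, sub_mul, h, Matrix.mul_smul, Matrix.smul_mul, mul_one,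
      one_mul]
  -- In the inverted coordinates `z_i = (x_i - x_0)⁻¹` a transformation fixing the point `0` acts
  -- affinely, and fixing the point `i` means `m' z_i + z_i n' + k = 0`. Fixing the difference `Z₀`
  -- dictates `n'`, fixing the point `3` dictates `k`, and then fixing `Z₁` amounts to the
  -- commutation hypothesis.
  set n' := -((Zb c 0)⁻¹ * m' * Zb c 0) with hn'
  set k := -(m' * zb c 3 + zb c 3 * n') with hk
  have z0 : m' * Zb c 0 + Zb c 0 * n' = 0 := by
    rw [hn', mul_neg, ← mul_assoc, ← mul_assoc, hZ, one_mul, add_neg_cancel]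
  have z1 : m' * Zb c 1 + Zb c 1 * n' = 0 := by
    have : Zb c 1 * n' = -(Zb c 1 * (Zb c 0)⁻¹ * m' * Zb c 0) := by rw [hn']; noncomm_ring
    rw [this, ← hcomm, mul_assoc m', mul_assoc (Zb c 1), hZ', mul_one, add_neg_cancel]
  have hz : ∀ i : Fin 4, i ≠ 0 → m' * zb c i + zb c i * n' + k = 0 := by
    intro i hi
    have e3 : m' * zb c 3 + zb c 3 * n' + k = 0 := by rw [hk]; abel
    fin_cases i
    · exact absurd rfl hi
    · change m' * zb c 1 + zb c 1 * n' + k = 0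
      have : m' * (zb c 1 - zb c 3) + (zb c 1 - zb c 3) * n' = 0 := z0
      rw [show m' * zb c 1 + zb c 1 * n' + k = m' * (zb c 1 - zb c 3) + (zb c 1 - zb c 3) * n' +
        (m' * zb c 3 + zb c 3 * n' + k) by noncomm_ring, this, e3, add_zero]
    · change m' * zb c 2 + zb c 2 * n' + k = 0
      have : m' * (zb c 2 - zb c 3) + (zb c 2 - zb c 3) * n' = 0 := z1
      rw [show m' * zb c 2 + zb c 2 * n' + k = m' * (zb c 2 - zb c 3) + (zb c 2 - zb c 3) * n' +
        (m' * zb c 3 + zb c 3 * n' + k) by noncomm_ring, this, e3, add_zero]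
    · exact e3
  -- The matrices `m'` and `n'` are the linear parts relative to the point `0`; returning to the
  -- original origin gives the shifts by `k`. The translation is the one that keeps the point `0` at
  -- rest.
  refine ⟨-(xb c 0 * (m' - k * xb c 0) + (n' - xb c 0 * k) * xb c 0 + xb c 0 * k * xb c 0),
    m' - k * xb c 0, n' - xb c 0 * k, k, fun i => ?_, by abel, ?_⟩
  · have e : velocity c (-(xb c 0 * (m' - k * xb c 0) + (n' - xb c 0 * k) * xb c 0 +
        xb c 0 * k * xb c 0)) (m' - k * xb c 0) (n' - xb c 0 * k) k i =
        (xb c i - xb c 0) * m' + n' * (xb c i - xb c 0) +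
          (xb c i - xb c 0) * k * (xb c i - xb c 0) := by
      rw [velocity]; noncomm_ring
    rw [e]
    rcases eq_or_ne i 0 with rfl | hi
    · rw [sub_self]; simp
    · obtain ⟨h1, h2⟩ := zb_mul hn hi
      set w := xb c i - xb c 0
      have : w * m' + n' * w + w * k * w = w * (m' * zb c i + zb c i * n' + k) * w := by
        have e1 : w * (m' * zb c i + zb c i * n' + k) * w =
          w * m' * (zb c i * w) + w * zb c i * n' * w + w * k * w := by noncomm_ring
        rw [e1, h1, h2, mul_one, one_mul]
      rw [this, hz i hi, mul_zero, zero_mul]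
  · rw [sub_add_cancel, hn', neg_mul, mul_assoc _ (Zb c 0), hZ, mul_one]

/-! ## Adapted odd coordinates -/

section combination
variable {E : Type*} [AddCommGroup E] [Module ℂ E]

/-- The linear combinations of two vectors with coefficients in the rows of a matrix. -/
def comb (M : Matrix (Fin 2) (Fin 2) ℂ) (t : Fin 2 → E) (α : Fin 2) : E := ∑ β, M α β • t β

lemma comb_mul (M N : Matrix (Fin 2) (Fin 2) ℂ) (t : Fin 2 → E) :
    comb (M * N) t = comb M (comb N t) := by
  funext α
  simp only [comb, Matrix.mul_apply, Fin.sum_univ_two]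
  module

lemma comb_neg (M : Matrix (Fin 2) (Fin 2) ℂ) (t : Fin 2 → E) : comb (-M) t = -comb M t := by
  funext α
  simp [comb]

lemma comb_diagonal (y : Fin 2 → ℂ) (t : Fin 2 → E) (α : Fin 2) :
    comb (Matrix.diagonal y) t α = y α • t α := by
  fin_cases α <;> simp [comb]

lemma comb_one (t : Fin 2 → E) : comb 1 t = t := by
  funext α
  rw [← Matrix.diagonal_one, comb_diagonal, one_smul]

lemma comb_mem {S : Submodule ℂ E} (M : Matrix (Fin 2) (Fin 2) ℂ) {t : Fin 2 → E}
    (h : ∀ β, t β ∈ S) (α : Fin 2) : comb M t α ∈ S :=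
  S.sum_mem fun β _ => S.smul_mem _ (h β)

lemma mem_of_comb_mem {S : Submodule ℂ E} {M N : Matrix (Fin 2) (Fin 2) ℂ} (h : N * M = 1)
    {t : Fin 2 → E} (ht : ∀ α, comb M t α ∈ S) (α : Fin 2) : t α ∈ S := by
  have := comb_mem N ht α
  rwa [← comb_mul, h, comb_one] at this

lemma map_comb {F : Type*} [AddCommGroup F] [Module ℂ F] (f : E →ₗ[ℂ] F)
    (M : Matrix (Fin 2) (Fin 2) ℂ) (t : Fin 2 → E) (α : Fin 2) :
    f (comb M t α) = comb M (fun β => f (t β)) α := by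
  simp only [comb, map_sum, map_smul]

end combination

lemma sum_idx {E : Type*} [AddCommMonoid E] (f : Fin 16 → E) : ∑ k, f k =
    ∑ i : Fin 4, (∑ α : Fin 2, f (thetaIdx i α) + ∑ α : Fin 2, f (thetaBarIdx i α)) := by
  simp only [Fin.sum_univ_four, Fin.sum_univ_two]
  change _ = f 0 + f 1 + (f 8 + f 9) + (f 2 + f 3 + (f 10 + f 11)) +
    (f 4 + f 5 + (f 12 + f 13)) + (f 6 + f 7 + (f 14 + f 15))
  simp only [Fin.sum_univ_succ, Finset.univ_eq_empty, Finset.sum_empty, add_zero]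
  change f 0 + (f 1 + (f 2 + (f 3 + (f 4 + (f 5 + (f 6 + (f 7 + (f 8 + (f 9 + (f 10 + (f 11 +
    (f 12 + (f 13 + (f 14 + f 15)))))))))))))) = _
  abel

lemma exists_family {E : Type*} (f g : Fin 4 → Fin 2 → E) : ∃ w : Fin 16 → E,
    (∀ i α, w (thetaIdx i α) = f i α) ∧ ∀ i α, w (thetaBarIdx i α) = g i α := by
  refine ⟨fun k => if k.val < 8 then f (Fin.ofNat 4 (k.val / 2)) (Fin.ofNat 2 k.val)
    else g (Fin.ofNat 4 ((k.val - 8) / 2)) (Fin.ofNat 2 k.val), ?_, ?_⟩ <;>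
  · intro i α
    fin_cases i <;> fin_cases α <;> rfl

lemma exists_idx (k : Fin 16) : ∃ i α, k = thetaIdx i α ∨ k = thetaBarIdx i α := by
  revert k; decide

section substitution
variable {T : (Fin 16 → ℂ) →ₗ[ℂ] (Fin 16 → ℂ)}

lemma inv_map (x : Grassmann) : inv (ExteriorAlgebra.map T x) = ExteriorAlgebra.map T (inv x) := by
  have : inv.comp (ExteriorAlgebra.map T) = (ExteriorAlgebra.map T).comp inv := by
    refine ExteriorAlgebra.hom_ext ?_
    refine LinearMap.ext fun v => ?_
    change inv (ExteriorAlgebra.map T (ExteriorAlgebra.ι ℂ v)) =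
      ExteriorAlgebra.map T (inv (ExteriorAlgebra.ι ℂ v))
    rw [ExteriorAlgebra.map_apply_ι, show inv (ExteriorAlgebra.ι ℂ _) = _ from ι_od _,
      show inv (ExteriorAlgebra.ι ℂ _) = _ from ι_od _, map_neg, ExteriorAlgebra.map_apply_ι]
  exact DFunLike.congr_fun this x

lemma ι_eq_sum (v : Fin 16 → ℂ) : ExteriorAlgebra.ι ℂ v = ∑ k, v k • gen k := by
  simp only [gen, ← map_smul, ← map_sum]
  congr 1
  funext j
  simp [Finset.sum_apply, Pi.single_apply]

lemma linearMap_ext_of_mul {D D' : Grassmann →ₗ[ℂ] Grassmann} 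
    (h0 : D 1 = D' 1) (h1 : ∀ k, D (gen k) = D' (gen k))
    (hD : ∀ x y, D x = D' x → D y = D' y → D (x * y) = D' (x * y)) : D = D' := by
  refine LinearMap.ext fun x => ?_
  induction x using ExteriorAlgebra.induction with
  | algebraMap r => rw [Algebra.algebraMap_eq_smul_one, map_smul, map_smul, h0]
  | ι v => simp only [ι_eq_sum, map_sum, map_smul, h1]
  | mul a b ha hb => exact hD a b ha hb
  | add a b ha hb => rw [map_add, map_add, ha, hb]

/-- The chain rule for odd derivations. -/
lemma antiderivation_map {D : Grassmann →ₗ[ℂ] Grassmann}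
    (hD : ∀ x y, D (x * y) = D x * y + inv x * D y) {s : Fin 16 → ℂ}
    (hs : ∀ k, D (ExteriorAlgebra.map T (gen k)) = algebraMap ℂ Grassmann (s k)) (x : Grassmann) :
    D (ExteriorAlgebra.map T x) = ExteriorAlgebra.map T (∑ k, s k • ctr k x) := by
  have h1 : D 1 = 0 := by simpa using hD 1 1
  have : D ∘ₗ (ExteriorAlgebra.map T).toLinearMap =
      (ExteriorAlgebra.map T).toLinearMap ∘ₗ ∑ k, s k • ctr k := by
    refine linearMap_ext_of_mul ?_ (fun k => ?_) fun x y hx hy => ?_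
    · have h2 : ∀ k, ctr k 1 = 0 := fun k => by rw [← map_one (algebraMap ℂ Grassmann), ctr_algebraMap]
      simp [h1, h2]
    · simp only [LinearMap.comp_apply, AlgHom.toLinearMap_apply, hs, LinearMap.sum_apply,
        LinearMap.smul_apply]
      have : ∀ j, ctr j (gen k) = if k = j then 1 else 0 := fun j => ctr_ι j k
      simp only [this, smul_ite, smul_zero, Finset.sum_ite_eq, Finset.mem_univ, if_true, map_smul,
        map_one, Algebra.algebraMap_eq_smul_one]
    · simp only [LinearMap.comp_apply, AlgHom.toLinearMap_apply, LinearMap.sum_apply,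
        LinearMap.smul_apply] at hx hy ⊢
      rw [map_mul, hD, hx, hy, inv_map]
      simp only [contractLeft_mul, smul_add, Finset.sum_add_distrib, map_add, ← map_mul,
        Finset.sum_mul, Finset.mul_sum, smul_mul_assoc, mul_smul_comm]
  exact LinearMap.congr_fun this x

/-- The chain rule for even derivations. -/
lemma derivation_map {R : Grassmann →ₗ[ℂ] Grassmann}
    (hR : ∀ x y, R (x * y) = R x * y + x * R y) {r : Fin 16 → Grassmann} (hr : ∀ k, Od (r k))
    (hs : ∀ k, R (ExteriorAlgebra.map T (gen k)) = ExteriorAlgebra.map T (r k)) (x : Grassmann) :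
    R (ExteriorAlgebra.map T x) = ExteriorAlgebra.map T (∑ k, r k * ctr k x) := by
  have h1 : R 1 = 0 := by simpa using hR 1 1
  have : R ∘ₗ (ExteriorAlgebra.map T).toLinearMap =
      (ExteriorAlgebra.map T).toLinearMap ∘ₗ ∑ k, LinearMap.mulLeft ℂ (r k) ∘ₗ ctr k := by
    refine linearMap_ext_of_mul ?_ (fun k => ?_) fun x y hx hy => ?_
    · have h2 : ∀ k, ctr k 1 = 0 := fun k => by rw [← map_one (algebraMap ℂ Grassmann), ctr_algebraMap]
      simp [h1, h2]
    · simp only [LinearMap.comp_apply, AlgHom.toLinearMap_apply, hs, LinearMap.sum_apply,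
        LinearMap.mulLeft_apply]
      have : ∀ j, ctr j (gen k) = if k = j then 1 else 0 := fun j => ctr_ι j k
      simp only [this, mul_ite, mul_zero, Finset.sum_ite_eq, Finset.mem_univ, if_true, mul_one]
    · simp only [LinearMap.comp_apply, AlgHom.toLinearMap_apply, LinearMap.sum_apply,
        LinearMap.mulLeft_apply] at hx hy ⊢
      rw [map_mul, hR, hx, hy, ← map_mul, ← map_mul, ← map_add]
      simp only [od_ctr_mul (hr _), Finset.sum_add_distrib, Finset.sum_mul, Finset.mul_sum]
  exact LinearMap.congr_fun this x

end substitution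

lemma exists_ι {x : Grassmann} (h : x ∈ ⋀[ℂ]^1 (Fin 16 → ℂ)) : ∃ v, ExteriorAlgebra.ι ℂ v = x := by
  change x ∈ LinearMap.range (ExteriorAlgebra.ι ℂ) ^ 1 at h
  rwa [pow_one] at h

/-- The lowest order of an odd generator, as a contraction. -/
def Generator.contr (V : Generator) (c : Config) : Grassmann →ₗ[ℂ] Grassmann :=
  ∑ i : Fin 4, (∑ α : Fin 2, body (V.onTheta i α c) • ctr (thetaIdx i α)
    + ∑ β : Fin 2, body (V.onThetaBar i β c) • ctr (thetaBarIdx i β))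

lemma contr_apply (V : Generator) (c : Config) (x : Grassmann) : V.contr c x =
    ∑ i : Fin 4, (∑ α : Fin 2, body (V.onTheta i α c) • ctr (thetaIdx i α) x
    + ∑ β : Fin 2, body (V.onThetaBar i β c) • ctr (thetaBarIdx i β) x) := by
  simp [Generator.contr, LinearMap.sum_apply]

lemma contr_mul (V : Generator) (c : Config) (x y : Grassmann) :
    V.contr c (x * y) = V.contr c x * y + inv x * V.contr c y := by
  simp only [contr_apply, contractLeft_mul, smul_add, Finset.sum_add_distrib, add_mul, mul_add,
    Finset.sum_mul, Finset.mul_sum, smul_mul_assoc, mul_smul_comm]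
  abel

variable {c : Config}

lemma contr_theta (V : Generator) (i : Fin 4) (α : Fin 2) :
    V.contr c (gen (thetaIdx i α)) = algebraMap ℂ Grassmann (body (V.onTheta i α c)) := by
  have : ∀ j, ctr j (gen (thetaIdx i α)) = if thetaIdx i α = j then 1 else 0 := fun j => ctr_ι j _
  simp [contr_apply, this, thetaIdx_inj, thetaIdx_ne, ite_and, Algebra.algebraMap_eq_smul_one]

lemma contr_thetaBar (V : Generator) (i : Fin 4) (α : Fin 2) :
    V.contr c (gen (thetaBarIdx i α)) = algebraMap ℂ Grassmann (body (V.onThetaBar i α c)) := by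
  have : ∀ j, ctr j (gen (thetaBarIdx i α)) = if thetaBarIdx i α = j then 1 else 0 :=
    fun j => ctr_ι j _
  simp [contr_apply, this, thetaBarIdx_inj, thetaIdx_ne.symm, ite_and,
    Algebra.algebraMap_eq_smul_one]

/-- The lowest order of `Θ̃_i`. -/
def lin (c : Config) (i α : Fin 2) : Grassmann := prj 1 (ThetaTilde i α c)

/-- The lowest order of `Θ̃bar_j`. -/
def linBar (c : Config) (j α : Fin 2) : Grassmann := prj 1 (ThetaBarTilde j α c)

/-- `Θ̃` transforms homogeneously, so its variation has body zero. To lowest order the odd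
generators are translations of the odd coordinates, and the leading linear form is invariant under
them. -/
lemma contr_lin (hc : c ∈ nondegenerate) {V : Generator} (hV : V.isOdd = true) (i α : Fin 2) :
    V.contr c (lin c i α) = 0 := by
  have h := ThetaTilde_act hc V i α
  have h1 := prj_act_odd (k := 0) hV h.diff (Filter.Eventually.of_forall fun x =>
    (ThetaTilde_od i α x).mem_fil)
  rw [contr_apply, lin, ← zero_add 1, ← h1, h.eq, prj_zero, map_add, map_neg, map_sum, map_mul]
  have h2 : ∀ γ, body (ThetaTilde i γ c) = 0 := fun γ => mem_fil_one.1 (ThetaTilde_od i γ c).mem_fil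
  simp [h2]

lemma contr_linBar (hc : c ∈ nondegenerate) {V : Generator} (hV : V.isOdd = true) (i α : Fin 2) :
    V.contr c (linBar c i α) = 0 := by
  have h := ThetaBarTilde_act hc V i α
  have h1 := prj_act_odd (k := 0) hV h.diff (Filter.Eventually.of_forall fun x =>
    (ThetaBarTilde_od i α x).mem_fil)
  rw [contr_apply, linBar, ← zero_add 1, ← h1, h.eq, prj_zero, map_add, map_neg, map_sum, map_mul]
  have h2 : ∀ γ, body (ThetaBarTilde i γ c) = 0 :=
    fun γ => mem_fil_one.1 (ThetaBarTilde_od i γ c).mem_fil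
  have h3 : ∀ γ, body (V.sg (ThetaBarTilde i γ c)) = 0 := fun γ => by
    rw [sg_odd hV (ThetaBarTilde_od i γ c), map_neg, h2, neg_zero]
  simp [h2, h3]

lemma prj_one_mul_od {a x : Grassmann} (hx : Od x) : prj 1 (a * x) = body a • prj 1 x := by
  have := prj_mul_of_mem_fil (fil_zero a) hx.mem_fil
  rw [zero_add] at this
  rw [this, prj_zero, Algebra.smul_def]

lemma prj_one_od_mul {a x : Grassmann} (hx : Od x) : prj 1 (x * a) = body a • prj 1 x := by
  have := prj_mul_of_mem_fil hx.mem_fil (fil_zero a)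
  rw [add_zero] at this
  rw [this, prj_zero, ← Algebra.commutes, Algebra.smul_def]

lemma prj_gen (k : Fin 16) : prj 1 (gen k) = gen k := by
  rw [gen, prj_of_mem (ι_mem _), if_pos rfl]

lemma lin_eq (c : Config) (i α : Fin 2) : lin c i α = Complex.I •
    (comb (zb c 3) (fun β => gen (thetaBarIdx 3 β) - gen (thetaBarIdx 0 β)) α -
      comb (zb c (pt i)) (fun β => gen (thetaBarIdx (pt i) β) - gen (thetaBarIdx 0 β)) α) := by
  have h : ∀ i, prj 1 (av c i α) =
      comb (zb c i) (fun β => gen (thetaBarIdx i β) - gen (thetaBarIdx 0 β)) α := by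
    intro i
    rw [av, Matrix.mulVec, dotProduct, map_sum, comb]
    refine Finset.sum_congr rfl fun β _ => ?_
    refine (prj_one_mul_od (a := XJ c i 0 α β)
      ((thetaBar_od i β c).sub (thetaBar_od 0 β c))).trans ?_
    rw [map_sub]
    change body _ • (prj 1 (gen _) - prj 1 (gen _)) = _
    rw [prj_gen, prj_gen]; rfl
  rw [lin, ThetaTilde_apply, map_smul, map_sub, h, h]

lemma linBar_eq (hc : c ∈ nondegenerate) (j α : Fin 2) : linBar c j α = Complex.I •
    (comb (zb c (pt j)).transpose (fun β => gen (thetaIdx (pt j) β) - gen (thetaIdx 0 β)) α -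
      comb (zb c 3).transpose (fun β => gen (thetaIdx 3 β) - gen (thetaIdx 0 β)) α) := by
  have h : ∀ i : Fin 4, i ≠ 0 → prj 1 (bv c i α) =
      -comb (zb c i).transpose (fun β => gen (thetaIdx i β) - gen (thetaIdx 0 β)) α := by
    intro i hi
    rw [bv, Matrix.vecMul, dotProduct, map_sum, comb, ← Finset.sum_neg_distrib]
    refine Finset.sum_congr rfl fun β _ => ?_
    refine (prj_one_od_mul (a := XJ c 0 i β α) ((theta_od i β c).sub (theta_od 0 β c))).trans ?_
    rw [map_sub]
    change body _ • (prj 1 (gen _) - prj 1 (gen _)) = _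
    rw [prj_gen, prj_gen, ← bodyM_apply, bodyM_XJ_zero hc hi, Matrix.neg_apply, neg_smul]; rfl
  rw [linBar, ThetaBarTilde_apply, map_smul, map_sub, h _ (pt_ne j).1, h _ (by decide)]
  module

/-! ## Leading terms of invariants -/

section rotation
variable {c : Config}

lemma body_scale (V : Generator) (c : Config) : body (V.scale c) = 0 := by
  have h1 : ∀ i α, body (th c i α) = 0 := fun i α => body_theta i α c
  have h2 : ∀ i α, body (tb c i α) = 0 := fun i α => body_thetaBar i α c
  cases V <;> simp [Generator.scale, h1, h2]

lemma prj_act_lin (hc : c ∈ nondegenerate) (V : Generator) (i α : Fin 2) :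
    prj 1 (V.act (ThetaTilde i α) c) = -comb (bodyM (V.right 0 c)) (lin c i) α := by
  rw [(ThetaTilde_act hc V i α).eq, map_add, map_neg, map_sum,
    prj_one_od_mul (ThetaTilde_od i α c), body_scale, zero_smul, add_zero, comb]
  exact congrArg _ (Finset.sum_congr rfl fun γ _ => prj_one_mul_od (ThetaTilde_od i γ c))

lemma prj_act_linBar (hc : c ∈ nondegenerate) {V : Generator} (hV : V.isOdd = false) (j α : Fin 2) :
    prj 1 (V.act (ThetaBarTilde j α) c) =
      -comb (bodyM (V.left 0 c)).transpose (linBar c j) α := by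
  rw [(ThetaBarTilde_act hc V j α).eq, map_add, map_neg, map_sum,
    prj_one_mul_od (ThetaBarTilde_od j α c), Generator.scale', if_neg (by simp [hV]), map_neg,
    body_scale, neg_zero, zero_smul, add_zero, comb]
  refine congrArg _ (Finset.sum_congr rfl fun γ _ => ?_)
  rw [sg_even hV]
  exact prj_one_od_mul (ThetaBarTilde_od j γ c)

lemma comb_add {E : Type*} [AddCommGroup E] [Module ℂ E] (M N : Matrix (Fin 2) (Fin 2) ℂ)
    (t : Fin 2 → E) (α : Fin 2) : comb (M + N) t α = comb M t α + comb N t α := by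
  simp only [comb, Matrix.add_apply, add_smul, Finset.sum_add_distrib]

lemma comb_zero {E : Type*} [AddCommGroup E] [Module ℂ E] (t : Fin 2 → E) (α : Fin 2) :
    comb 0 t α = 0 := by
  simp [comb]

lemma bodyM_zero : bodyM 0 = 0 := map_zero body.mapMatrix

variable {a m n k : Matrix (Fin 2) (Fin 2) ℂ}

lemma rotSum_lin (hc : c ∈ nondegenerate) (h0 : ∀ i, velocity c a m n k i = 0) (i α : Fin 2) :
    rotSum c a m n k (lin c i α) = -comb (m + k * xb c 0) (lin c i) α := by
  rw [lin, ← prj_act_stabilizer (ThetaTilde_act hc (.P 0) i α).diff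
    (Filter.Eventually.of_forall fun x => (ThetaTilde_od i α x).mem_fil) h0]
  simp only [sumEven, prj_act_lin hc, Generator.right, bodyM_zero, comb_zero, bodyM_mul, bodyM_const,
    bodyM_XP, comb_add]
  abel

lemma rotSum_linBar (hc : c ∈ nondegenerate) (h0 : ∀ i, velocity c a m n k i = 0) (j α : Fin 2) :
    rotSum c a m n k (linBar c j α) = -comb (n + xb c 0 * k).transpose (linBar c j) α := by
  rw [linBar, ← prj_act_stabilizer (ThetaBarTilde_act hc (.P 0) j α).diff
    (Filter.Eventually.of_forall fun x => (ThetaBarTilde_od j α x).mem_fil) h0]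
  simp only [sumEven]
  rw [prj_act_linBar hc rfl, prj_act_linBar hc rfl, prj_act_linBar hc rfl, prj_act_linBar hc rfl]
  simp only [Generator.left, bodyM_zero, Matrix.transpose_zero, comb_zero, bodyM_mul, bodyM_const,
    bodyM_XM, comb_add, Matrix.transpose_add]
  abel

lemma rotSum_gen_od (l : Fin 16) : Od (rotSum c a m n k (gen l)) := by
  have h : ∀ V : Generator, Od (V.rot c (gen l)) := by
    intro V
    have h1 : ∀ (x : Grassmann) j, Od (prj 1 x * ctr j (gen l)) := by
      intro x j
      rw [show ctr j (gen l) = _ from ctr_ι j l]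
      split
      · rw [mul_one]; exact prj_od x
      · rw [mul_zero]; exact od_zero
    rw [rot_apply]
    exact Od.sum fun i _ => (Od.sum fun α _ => h1 _ _).add (Od.sum fun α _ => h1 _ _)
  simp only [rotSum, sumEven, LinearMap.add_apply]
  exact (((h _).add (h _)).add (h _)).add (h _)

end rotation

/-- Odd coordinates that diagonalize the variables at the first point to lowest order. -/
structure Frame (c : Config) where
  /-- The substitution of the odd coordinates. -/
  T : (Fin 16 → ℂ) →ₗ[ℂ] (Fin 16 → ℂ)
  /-- The eigenvectors. -/
  L : Matrix (Fin 2) (Fin 2) ℂ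
  /-- The eigenvalues. -/
  y : Fin 2 → ℂ
  hy : y 0 ≠ y 1
  hL : L * L⁻¹ = 1
  hL' : L⁻¹ * L = 1
  hK : L * ((Xb c 0)⁻¹ * Xb c 1) = Matrix.diagonal y * L
  /-- The dual eigenvectors. -/
  M : Matrix (Fin 2) (Fin 2) ℂ
  hM : M = -((body (rootX c))⁻¹ • (Xb c 0 * L⁻¹))
  map_thetaBar : ∀ i σ, ExteriorAlgebra.map T (gen (thetaBarIdx (pt i) σ)) = comb L (lin c i) σ
  map_theta : ∀ j σ, ExteriorAlgebra.map T (gen (thetaIdx (pt j) σ)) =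
    comb M.transpose (linBar c j) σ
  map_inactive : ∀ k ∉ active, ExteriorAlgebra.map T (gen k) = gen k

/-- The odd coordinates of the points `1` and `2` are replaced by the leading forms of `Θ̃` and
`Θ̃bar` in the eigenbasis, while those of the points `0` and `3` are kept. -/
lemma exists_frame {c : Config} (hc : c ∈ regular) : Nonempty (Frame c) := by
  obtain ⟨L, y, hy, hL, hK⟩ := exists_eigenbasis hc
  set M := -((body (rootX c))⁻¹ • (Xb c 0 * L⁻¹)) with hM
  obtain ⟨w, hw, hw'⟩ := exists_family
    (![fun σ => gen (thetaIdx 0 σ), comb M.transpose (linBar c 0),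
      comb M.transpose (linBar c 1), fun σ => gen (thetaIdx 3 σ)])
    (![fun σ => gen (thetaBarIdx 0 σ), comb L (lin c 0), comb L (lin c 1),
      fun σ => gen (thetaBarIdx 3 σ)])
  have mem : ∀ {N : Matrix (Fin 2) (Fin 2) ℂ} {t : Fin 2 → Grassmann} {σ : Fin 2},
      (∀ β, t β ∈ ⋀[ℂ]^1 (Fin 16 → ℂ)) → comb N t σ ∈ ⋀[ℂ]^1 (Fin 16 → ℂ) :=
    fun h => comb_mem _ h _
  have hex : ∀ k, ∃ v, ExteriorAlgebra.ι ℂ v = w k := by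
    intro k
    refine exists_ι ?_
    obtain ⟨i, α, rfl | rfl⟩ := exists_idx k
    · rw [hw]
      fin_cases i
      exacts [ι_mem _, mem fun β => prj_mem _ _, mem fun β => prj_mem _ _, ι_mem _]
    · rw [hw']
      fin_cases i
      exacts [ι_mem _, mem fun β => prj_mem _ _, mem fun β => prj_mem _ _, ι_mem _]
  choose v hv using hex
  have hT : ∀ k, ExteriorAlgebra.map ((Pi.basisFun ℂ (Fin 16)).constr ℂ v) (gen k) = w k := by
    intro k
    rw [gen, ExteriorAlgebra.map_apply_ι, ← hv, ← Pi.basisFun_apply, Module.Basis.constr_basis]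
  refine ⟨⟨(Pi.basisFun ℂ (Fin 16)).constr ℂ v, L, y, hy, Matrix.mul_nonsing_inv _ hL,
    Matrix.nonsing_inv_mul _ hL, hK, M, hM, fun i σ => ?_, fun j σ => ?_, fun k hk => ?_⟩⟩
  · rw [hT, hw']; fin_cases i <;> rfl
  · rw [hT, hw]; fin_cases j <;> rfl
  · rw [hT]
    have h : ∀ k ∉ active, ∃ α, k = thetaIdx 0 α ∨ k = thetaIdx 3 α ∨ k = thetaBarIdx 0 α ∨
      k = thetaBarIdx 3 α := by decide +kernel
    obtain ⟨α, rfl | rfl | rfl | rfl⟩ := h k hk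
    · rw [hw]; rfl
    · rw [hw]; rfl
    · rw [hw']; rfl
    · rw [hw']; rfl

namespace Frame
variable {c : Config} (D : Frame c)

/-- The substitution of the odd coordinates in the Grassmann algebra. -/
def A : Grassmann →ₐ[ℂ] Grassmann := ExteriorAlgebra.map D.T

lemma det_X (hc : c ∈ nondegenerate) : Xb c 0 * (Xb c 0)⁻¹ = 1 := by
  refine Matrix.mul_nonsing_inv _ (isUnit_iff_ne_zero.2 ?_)
  rw [Xb_eq hc, Matrix.det_neg, Matrix.det_adjugate]
  simp [Zb_det hc 0]

lemma M_mul (hc : c ∈ nondegenerate) :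
    D.M * -(body (rootX c) • (D.L * (Xb c 0)⁻¹)) = 1 := by
  have h0 : body (rootX c) ≠ 0 := isUnit_iff_body.1 (rootX_unit hc)
  rw [D.hM, neg_mul_neg, Matrix.smul_mul, Matrix.mul_smul, smul_smul, inv_mul_cancel₀ h0, one_smul,
    mul_assoc, ← mul_assoc _ D.L, D.hL', one_mul, det_X hc]

/-- The forms in the image and the coordinates of the points `0` and `3` determine the coordinates
of the points `1` and `2`, because `L`, `M` and the inverse intervals are invertible. Since the
range is closed under products, generators suffice; injectivity follows by dimension. -/
lemma surjective (hc : c ∈ nondegenerate) : Function.Surjective D.A := by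
  set S := LinearMap.range D.A.toLinearMap with hS
  have hA : ∀ x, D.A x ∈ S := fun x => ⟨x, rfl⟩
  have h0 : ∀ k ∉ active, gen k ∈ S := fun k hk => by rw [← D.map_inactive k hk]; exact hA _
  have hlin : ∀ i α, lin c i α ∈ S := fun i => mem_of_comb_mem D.hL' fun σ => by
    rw [← D.map_thetaBar]; exact hA _
  have hlinBar : ∀ j α, linBar c j α ∈ S := fun j => by
    refine mem_of_comb_mem (M := D.M.transpose) (N := _) (by
      rw [← Matrix.transpose_mul, D.M_mul hc]; exact Matrix.transpose_one) fun σ => ?_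
    rw [← D.map_theta]; exact hA _
  have hi : ∀ {x : Grassmann}, Complex.I • x ∈ S → x ∈ S := fun h => by
    simpa [smul_smul] using S.smul_mem (-Complex.I) h
  have hbar : ∀ i β, gen (thetaBarIdx (pt i) β) ∈ S := by
    intro i β
    have h3 : ∀ β, gen (thetaBarIdx 3 β) - gen (thetaBarIdx 0 β) ∈ S := fun β =>
      S.sub_mem (h0 _ (by revert β; decide +kernel)) (h0 _ (by revert β; decide +kernel))
    have h4 : ∀ β, gen (thetaBarIdx (pt i) β) - gen (thetaBarIdx 0 β) ∈ S :=
      mem_of_comb_mem (zb_mul hc (pt_ne i).1).2 fun α => by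
        have h5 := hi (lin_eq c i α ▸ hlin i α)
        have h6 := S.sub_mem (comb_mem (zb c 3) h3 α) h5
        rwa [sub_sub_cancel] at h6
    have := S.add_mem (h4 β) (h0 (thetaBarIdx 0 β) (by revert β; decide +kernel))
    rwa [sub_add_cancel] at this
  have hth : ∀ i β, gen (thetaIdx (pt i) β) ∈ S := by
    intro i β
    have h3 : ∀ β, gen (thetaIdx 3 β) - gen (thetaIdx 0 β) ∈ S := fun β =>
      S.sub_mem (h0 _ (by revert β; decide +kernel)) (h0 _ (by revert β; decide +kernel))
    have h4 : ∀ β, gen (thetaIdx (pt i) β) - gen (thetaIdx 0 β) ∈ S :=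
      mem_of_comb_mem (M := (zb c (pt i)).transpose) (N := (xb c (pt i) - xb c 0).transpose) (by
        rw [← Matrix.transpose_mul, (zb_mul hc (pt_ne i).1).1]; exact Matrix.transpose_one)
        fun α => by
        have h5 := hi (linBar_eq hc i α ▸ hlinBar i α)
        have h6 := S.add_mem h5 (comb_mem (zb c 3).transpose h3 α)
        rwa [sub_add_cancel] at h6
    have := S.add_mem (h4 β) (h0 (thetaIdx 0 β) (by revert β; decide +kernel))
    rwa [sub_add_cancel] at this
  have hgen : ∀ k, gen k ∈ S := by
    intro k
    by_cases hk : k ∈ active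
    · simp only [active, Finset.mem_union, Finset.mem_image, Finset.mem_univ, true_and] at hk
      rcases hk with ⟨t, rfl⟩ | ⟨t, rfl⟩
      · exact hth _ _
      · exact hbar _ _
    · exact h0 k hk
  intro x
  change x ∈ S
  induction x using ExteriorAlgebra.induction with
  | algebraMap r => exact ⟨algebraMap ℂ Grassmann r, AlgHom.commutes _ _⟩
  | ι v => rw [ι_eq_sum]; exact S.sum_mem fun k _ => S.smul_mem _ (hgen k)
  | mul a b ha hb =>
    obtain ⟨a', rfl⟩ := ha
    obtain ⟨b', rfl⟩ := hb
    exact ⟨a' * b', map_mul D.A _ _⟩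
  | add a b ha hb => exact S.add_mem ha hb

lemma injective (hc : c ∈ nondegenerate) : Function.Injective D.A :=
  (LinearMap.injective_iff_surjective (f := D.A.toLinearMap)).2 (D.surjective hc)

end Frame

/-! ### Leading terms of the nilpotent invariants in the frame -/

/-- The lowest order of the invariants `I_{nij}`. -/
def leadNilp (c : Config) (t : Fin 2 × Fin 2 × Fin 2) : Grassmann :=
  prj 2 (nilp t.1 t.2.1 t.2.2 c)

lemma leadNilp_eq {c : Config} (hc : c ∈ nondegenerate) (n i j : Fin 2) : leadNilp c (n, i, j) =
    ∑ β, ∑ α, (-((body (rootX c))⁻¹ * Xb c n β α)) • (linBar c j β * lin c i α) := by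
  have h1 : ∀ β α, ThetaBarTilde j β c * XTilde n β α c ∈ Fil 1 := fun β α =>
    mul_mem_fil_right (ThetaBarTilde_od j β c).mem_fil _
  have h2 : ∀ β α, prj 2 (ThetaBarTilde j β c * XTilde n β α c * ThetaTilde i α c *
      sinv rootX c) = ((body (rootX c))⁻¹ * Xb c n β α) • (linBar c j β * lin c i α) := by
    intro β α
    have e1 := prj_mul_of_mem_fil (mul_mem_fil (h1 β α) (ThetaTilde_od i α c).mem_fil)
      (fil_zero (sinv rootX c))
    have e2 := prj_mul_of_mem_fil (h1 β α) (ThetaTilde_od i α c).mem_fil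
    rw [prj_one_od_mul (ThetaBarTilde_od j β c)] at e2
    norm_num at e1 e2
    rw [e1, e2, prj_zero, body_sinv (rootX_unit hc), ← Algebra.commutes, ← Algebra.smul_def, mul_smul]
    rfl
  simp only [leadNilp, nilp, Pi.neg_apply, Pi.mul_apply, Finset.sum_apply, Finset.sum_mul, map_neg,
    map_sum, h2, neg_smul, Finset.sum_neg_distrib]

namespace Frame
variable {c : Config} (D : Frame c)

/-- This is the purpose of `M`: it diagonalizes the two bilinear forms `-X_n / R` simultaneously,
the first to the identity and the second to the eigenvalues of `X₀⁻¹ X₁`. -/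
lemma M_mul_diagonal (hc : c ∈ nondegenerate) (n : Fin 2) :
    -((body (rootX c))⁻¹ • Xb c n) =
      D.M * Matrix.diagonal (fun σ => if n = 0 then 1 else D.y σ) * D.L := by
  fin_cases n
  · simp only [Fin.zero_eta, if_true, Matrix.diagonal_one, mul_one]
    rw [D.hM, neg_mul, Matrix.smul_mul, mul_assoc, D.hL', mul_one]
  · have : (fun σ => if (⟨1, by omega⟩ : Fin 2) = 0 then 1 else D.y σ) = D.y := by
      funext σ; rw [if_neg (by decide)]
    change _ = D.M * Matrix.diagonal (fun σ => if (⟨1, by omega⟩ : Fin 2) = 0 then 1 else D.y σ) * D.L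
    rw [this, mul_assoc, ← D.hK, D.hM, neg_mul, Matrix.smul_mul, mul_assoc, ← mul_assoc D.L⁻¹,
      D.hL', one_mul, ← mul_assoc, det_X hc, one_mul]
    rfl

lemma map_leadGen (hc : c ∈ nondegenerate) (t : Fin 2 × Fin 2 × Fin 2) :
    D.A (leadGen D.y t) = leadNilp c t := by
  obtain ⟨n, i, j⟩ := t
  rw [leadNilp_eq hc, leadGen]
  have h : ∀ β α, -((body (rootX c))⁻¹ * Xb c n β α) =
      ∑ σ, D.M β σ * (if n = 0 then 1 else D.y σ) * D.L σ α := fun β α => by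
    have := congrFun (congrFun (D.M_mul_diagonal hc n) β) α
    rw [Matrix.mul_apply] at this
    simp only [Matrix.mul_diagonal] at this
    exact this
  have e1 : ∀ σ, D.A (gen (thetaIdx (pt j) σ)) = _ := D.map_theta j
  have e2 : ∀ σ, D.A (gen (thetaBarIdx (pt i) σ)) = _ := D.map_thetaBar i
  simp only [h, map_add, map_smul, map_mul, e1, e2, comb, Fin.sum_univ_two, Matrix.transpose_apply,
    add_mul, mul_add, smul_mul_assoc, mul_smul_comm]
  module

lemma map_monProd_leadGen (hc : c ∈ nondegenerate) (e : Exponent) :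
    D.A (monProd (leadGen D.y) e) = monProd (leadNilp c) e := by
  rw [map_monProd]
  exact congrArg (monProd · e) (funext (D.map_leadGen hc))

/-- In adapted coordinates the odd generators differentiate only with respect to the coordinates of
the points `0` and `3`. There `Q`, `Qbar`, `S`, `Sbar` give eight equations for eight derivatives,
which are independent because `x_3 - x_0` is invertible. -/
lemma ctr_eq_zero (hc : c ∈ nondegenerate) {x : Grassmann}
    (h : ∀ V : Generator, V.isOdd = true → V.contr c (D.A x) = 0) :
    ∀ k ∉ active, ctr k x = 0 := by
  -- The chain rule transports the contraction through the substitution; `contr_lin` and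
  -- `contr_linBar` remove the coordinates of the points `1` and `2`.
  have key : ∀ V : Generator, V.isOdd = true →
      (∑ α, body (V.onTheta 0 α c) • ctr (thetaIdx 0 α) x +
        ∑ α, body (V.onThetaBar 0 α c) • ctr (thetaBarIdx 0 α) x) +
      (∑ α, body (V.onTheta 3 α c) • ctr (thetaIdx 3 α) x +
        ∑ α, body (V.onThetaBar 3 α c) • ctr (thetaBarIdx 3 α) x) = 0 := by
    intro V hV
    obtain ⟨s, hs, hs'⟩ := exists_family
      (![fun α => body (V.onTheta 0 α c), 0, 0, fun α => body (V.onTheta 3 α c)])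
      (![fun α => body (V.onThetaBar 0 α c), 0, 0, fun α => body (V.onThetaBar 3 α c)])
    have hl : ∀ (N : Matrix (Fin 2) (Fin 2) ℂ) i α, V.contr c (comb N (lin c i) α) = 0 := by
      intro N i α
      rw [map_comb]; simp only [contr_lin hc hV, comb, smul_zero, Finset.sum_const_zero]
    have hl' : ∀ (N : Matrix (Fin 2) (Fin 2) ℂ) i α, V.contr c (comb N (linBar c i) α) = 0 := by
      intro N i α
      rw [map_comb]; simp only [contr_linBar hc hV, comb, smul_zero, Finset.sum_const_zero]
    have h1 := antiderivation_map (T := D.T) (contr_mul V c) (s := s) (fun k => ?_) x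
    · have h2 := D.injective hc ((h1.symm.trans (h V hV)).trans (map_zero D.A).symm)
      rw [sum_idx] at h2
      simp only [hs, hs', Fin.sum_univ_four] at h2
      simpa using h2
    · obtain ⟨i, α, rfl | rfl⟩ := exists_idx k
      · rw [hs]
        fin_cases i
        · refine (congrArg _ (D.map_inactive _ (by revert α; decide +kernel))).trans (contr_theta V 0 α)
        · refine (congrArg _ (D.map_theta 0 α)).trans ((hl' _ _ _).trans (map_zero _).symm)
        · refine (congrArg _ (D.map_theta 1 α)).trans ((hl' _ _ _).trans (map_zero _).symm)
        · refine (congrArg _ (D.map_inactive _ (by revert α; decide +kernel))).trans (contr_theta V 3 α)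
      · rw [hs']
        fin_cases i
        · refine (congrArg _ (D.map_inactive _ (by revert α; decide +kernel))).trans
            (contr_thetaBar V 0 α)
        · refine (congrArg _ (D.map_thetaBar 0 α)).trans ((hl _ _ _).trans (map_zero _).symm)
        · refine (congrArg _ (D.map_thetaBar 1 α)).trans ((hl _ _ _).trans (map_zero _).symm)
        · refine (congrArg _ (D.map_inactive _ (by revert α; decide +kernel))).trans
            (contr_thetaBar V 3 α)
  have bth : ∀ i α, body (theta i α c) = 0 := fun i α => body_theta i α c
  have bbar : ∀ i α, body (thetaBar i α c) = 0 := fun i α => body_thetaBar i α c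
  have hxp : ∀ i β α, body (toMatTilde (xPlus i) β α c) = xb c i β α := fun i β α => by
    rw [← bodyM_XP]; rfl
  have hxm : ∀ i β α, body (toMatTilde (xMinus i) β α c) = xb c i β α := fun i β α => by
    rw [← bodyM_XM]; rfl
  have q : ∀ γ, ctr (thetaIdx 0 γ) x + ctr (thetaIdx 3 γ) x = 0 := fun γ => by
    have := key (.Q γ) rfl
    simp only [Generator.onTheta, Generator.onThetaBar, single_eval, Pi.zero_apply, map_zero,
      zero_smul, Finset.sum_const_zero, add_zero] at this
    fin_cases γ <;> simpa using this
  have qb : ∀ γ, ctr (thetaBarIdx 0 γ) x + ctr (thetaBarIdx 3 γ) x = 0 := fun γ => by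
    have := key (.Qbar γ) rfl
    simp only [Generator.onTheta, Generator.onThetaBar, single_eval, Pi.zero_apply, map_zero,
      zero_smul, Finset.sum_const_zero, zero_add] at this
    fin_cases γ <;> simpa using this
  -- `Q` gives the plain sum of the two derivatives and `Sbar` the sum weighted with `x_0` and
  -- `x_3`. Their combination is `x_3 - x_0` applied to the derivatives at the point `3`.
  have t3 : ∀ γ, ctr (thetaIdx 3 γ) x = 0 := by
    have : ∀ γ, ctr (thetaIdx 3 γ) x ∈ (⊥ : Submodule ℂ Grassmann) :=
      mem_of_comb_mem (zb_mul hc (i := 3) (by decide)).1 fun γ => by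
        have h1 := key (.Sbar γ) rfl
        simp only [Generator.onTheta, Generator.onThetaBar, Pi.smul_apply, Pi.mul_apply, map_smul,
          map_mul, bbar, hxp, mul_zero, smul_zero, zero_smul, Finset.sum_const_zero,
          add_zero, Fin.sum_univ_two] at h1
        rw [Submodule.mem_bot, comb, Fin.sum_univ_two]
        simp only [Matrix.sub_apply]
        linear_combination (norm := module) h1 - xb c 0 γ 0 • q 0 - xb c 0 γ 1 • q 1
    exact fun γ => (Submodule.mem_bot ℂ).1 (this γ)
  have tb3 : ∀ γ, ctr (thetaBarIdx 3 γ) x = 0 := by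
    have : ∀ γ, ctr (thetaBarIdx 3 γ) x ∈ (⊥ : Submodule ℂ Grassmann) :=
      mem_of_comb_mem (M := (xb c 3 - xb c 0).transpose) (N := (zb c 3).transpose)
        (by rw [← Matrix.transpose_mul, (zb_mul hc (i := 3) (by decide)).2]
            exact Matrix.transpose_one) fun γ => by
        have h1 := key (.S γ) rfl
        simp only [Generator.onTheta, Generator.onThetaBar, Pi.smul_apply, Pi.mul_apply, map_smul,
          map_mul, bth, hxm, mul_zero, smul_zero, zero_smul, Finset.sum_const_zero,
          zero_add, Fin.sum_univ_two] at h1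
        rw [Submodule.mem_bot, comb, Fin.sum_univ_two]
        simp only [Matrix.sub_apply, Matrix.transpose_apply]
        linear_combination (norm := module) h1 - xb c 0 0 γ • qb 0 - xb c 0 1 γ • qb 1
    exact fun γ => (Submodule.mem_bot ℂ).1 (this γ)
  have h : ∀ k ∉ active, ∃ α, k = thetaIdx 0 α ∨ k = thetaIdx 3 α ∨ k = thetaBarIdx 0 α ∨
    k = thetaBarIdx 3 α := by decide +kernel
  intro k hk
  obtain ⟨α, rfl | rfl | rfl | rfl⟩ := h k hk
  · simpa [t3] using q α
  · exact t3 α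
  · simpa [tb3] using qb α
  · exact tb3 α

/-- In adapted coordinates a generator of the stabilizer multiplies the active `θ` with spinor index
`σ` by `d σ` and the active `θbar` by `-d σ`. On an element independent of the other coordinates it
therefore acts as a difference of counting operators. -/
lemma rotSum_map (hc : c ∈ nondegenerate) {a m n k : Matrix (Fin 2) (Fin 2) ℂ} {d : Fin 2 → ℂ}
    (h0 : ∀ i, velocity c a m n k i = 0) (h1 : D.L * (m + k * xb c 0) = Matrix.diagonal d * D.L)
    (h2 : (n + xb c 0 * k) * D.M = -(D.M * Matrix.diagonal d)) {x : Grassmann}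
    (hx : ∀ k ∉ active, ctr k x = 0) : rotSum c a m n k (D.A x) = D.A (∑ σ, d σ •
      (∑ j, num (thetaIdx (pt j) σ) x - ∑ i, num (thetaBarIdx (pt i) σ) x)) := by
  -- The rotation of the coordinates of the points `0` and `3` need not be known: any odd preimage
  -- serves, because the corresponding derivatives of `x` vanish.
  choose q hq using fun l => D.surjective hc (rotSum c a m n k (gen l))
  obtain ⟨r, hr, hr'⟩ := exists_family
    (![fun α => q (thetaIdx 0 α), fun α => d α • gen (thetaIdx 1 α),
      fun α => d α • gen (thetaIdx 2 α), fun α => q (thetaIdx 3 α)])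
    (![fun α => q (thetaBarIdx 0 α), fun α => -d α • gen (thetaBarIdx 1 α),
      fun α => -d α • gen (thetaBarIdx 2 α), fun α => q (thetaBarIdx 3 α)])
  have hq' : ∀ l, Od (q l) := fun l => D.injective hc <| by
    rw [map_neg, hq]
    refine (inv_map (T := D.T) (q l)).symm.trans ?_
    rw [show ExteriorAlgebra.map D.T (q l) = _ from hq l]
    exact rotSum_gen_od l
  have e1 : ∀ i α, rotSum c a m n k (comb D.L (lin c i) α) = -d α • comb D.L (lin c i) α := by
    intro i α
    rw [map_comb, show (fun β => rotSum c a m n k (lin c i β)) = comb (-(m + k * xb c 0)) (lin c i)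
      from funext fun β => by rw [comb_neg, rotSum_lin hc h0]; rfl, ← comb_mul, mul_neg, h1,
      comb_neg, Pi.neg_apply, comb_mul, comb_diagonal, neg_smul]
  have e2 : ∀ j α, rotSum c a m n k (comb D.M.transpose (linBar c j) α) =
      d α • comb D.M.transpose (linBar c j) α := by
    intro j α
    rw [map_comb, show (fun β => rotSum c a m n k (linBar c j β)) =
      comb (-(n + xb c 0 * k).transpose) (linBar c j)
      from funext fun β => by rw [comb_neg, rotSum_linBar hc h0]; rfl, ← comb_mul, mul_neg,
      ← Matrix.transpose_mul, h2, Matrix.transpose_neg, neg_neg, Matrix.transpose_mul,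
      Matrix.diagonal_transpose, comb_mul, comb_diagonal]
  have h := derivation_map (T := D.T) (rotSum_mul c a m n k) (r := r) (fun l => ?_) (fun l => ?_) x
  · refine h.trans (congrArg D.A ?_)
    rw [sum_idx]
    have hin : ∀ α, ctr (thetaIdx 0 α) x = 0 ∧ ctr (thetaIdx 3 α) x = 0 ∧
        ctr (thetaBarIdx 0 α) x = 0 ∧ ctr (thetaBarIdx 3 α) x = 0 := fun α =>
      ⟨hx _ (by revert α; decide +kernel), hx _ (by revert α; decide +kernel),
        hx _ (by revert α; decide +kernel), hx _ (by revert α; decide +kernel)⟩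
    simp only [hr, hr', Fin.sum_univ_four, Fin.sum_univ_two, (hin _).1, (hin _).2.1, (hin _).2.2.1,
      (hin _).2.2.2, mul_zero, add_zero, zero_add]
    simp only [Matrix.cons_val_one, Matrix.cons_val_two, Matrix.cons_val_zero, Matrix.tail_cons,
      Matrix.head_cons, smul_mul_assoc, neg_smul, num, pt, smul_sub, smul_add]
    abel_nf
    simp only [smul_mul_assoc]
    abel
  · obtain ⟨i, α, rfl | rfl⟩ := exists_idx l
    · rw [hr]
      fin_cases i
      exacts [hq' _, (gen_od _).smul _, (gen_od _).smul _, hq' _]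
    · rw [hr']
      fin_cases i
      exacts [hq' _, (gen_od _).smul _, (gen_od _).smul _, hq' _]
  · have hs : ∀ (a : ℂ) k, ExteriorAlgebra.map D.T (a • gen k) = a • ExteriorAlgebra.map D.T (gen k) :=
      fun a k => map_smul _ _ _
    obtain ⟨i, α, rfl | rfl⟩ := exists_idx l
    · rw [hr]
      fin_cases i
      · exact (congrArg _ (D.map_inactive _ (by revert α; decide +kernel))).trans (hq _).symm
      · refine (congrArg _ (D.map_theta 0 α)).trans ((e2 0 α).trans ?_)
        rw [← D.map_theta 0 α]; exact (hs _ _).symm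
      · refine (congrArg _ (D.map_theta 1 α)).trans ((e2 1 α).trans ?_)
        rw [← D.map_theta 1 α]; exact (hs _ _).symm
      · exact (congrArg _ (D.map_inactive _ (by revert α; decide +kernel))).trans (hq _).symm
    · rw [hr']
      fin_cases i
      · exact (congrArg _ (D.map_inactive _ (by revert α; decide +kernel))).trans (hq _).symm
      · refine (congrArg _ (D.map_thetaBar 0 α)).trans ((e1 0 α).trans ?_)
        rw [← D.map_thetaBar 0 α]; exact (hs _ _).symm
      · refine (congrArg _ (D.map_thetaBar 1 α)).trans ((e1 1 α).trans ?_)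
        rw [← D.map_thetaBar 1 α]; exact (hs _ _).symm
      · exact (congrArg _ (D.map_inactive _ (by revert α; decide +kernel))).trans (hq _).symm

/-- A matrix that is diagonal in the eigenbasis commutes with `X₀⁻¹ X₁`, so `exists_stabilizer`
applies. The inverse of `Z₀` is proportional to `X₀`, which turns its second condition into a
statement about `M`. -/
lemma exists_diagonal_stabilizer (hc : c ∈ nondegenerate) (d : Fin 2 → ℂ) :
    ∃ a m n k : Matrix (Fin 2) (Fin 2) ℂ, (∀ i, velocity c a m n k i = 0) ∧
      D.L * (m + k * xb c 0) = Matrix.diagonal d * D.L ∧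
      (n + xb c 0 * k) * D.M = -(D.M * Matrix.diagonal d) := by
  have hK : (Xb c 0)⁻¹ * Xb c 1 = D.L⁻¹ * Matrix.diagonal D.y * D.L := by
    rw [mul_assoc, ← D.hK, ← mul_assoc, D.hL', one_mul]
  have hcomm : D.L⁻¹ * Matrix.diagonal d * D.L * ((Xb c 0)⁻¹ * Xb c 1) =
      (Xb c 0)⁻¹ * Xb c 1 * (D.L⁻¹ * Matrix.diagonal d * D.L) := by
    have : ∀ u v : Fin 2 → ℂ, D.L⁻¹ * Matrix.diagonal u * D.L * (D.L⁻¹ * Matrix.diagonal v * D.L) =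
        D.L⁻¹ * (Matrix.diagonal u * Matrix.diagonal v) * D.L := by
      intro u v
      rw [show D.L⁻¹ * Matrix.diagonal u * D.L * (D.L⁻¹ * Matrix.diagonal v * D.L) =
        D.L⁻¹ * Matrix.diagonal u * (D.L * D.L⁻¹) * Matrix.diagonal v * D.L by noncomm_ring, D.hL]
      noncomm_ring
    rw [hK, this, this, Matrix.diagonal_mul_diagonal, Matrix.diagonal_mul_diagonal]
    simp only [mul_comm]
  obtain ⟨a, m, n, k, h0, h1, h2⟩ := exists_stabilizer hc hcomm
  refine ⟨a, m, n, k, h0, ?_, ?_⟩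
  · rw [h1, ← mul_assoc, ← mul_assoc, D.hL, one_mul]
  · have hX : Xb c 0 = -((Zb c 0).det • (Zb c 0)⁻¹) := by
      rw [Xb_eq hc, Matrix.inv_def, smul_smul, Ring.inverse_eq_inv', mul_inv_cancel₀ (Zb_det hc 0),
        one_smul]
    have e : ∀ z : Matrix (Fin 2) (Fin 2) ℂ, z * D.M =
        ((body (rootX c))⁻¹ * (Zb c 0).det) • (z * (Zb c 0)⁻¹ * D.L⁻¹) := by
      intro z
      rw [D.hM, hX, neg_mul, smul_neg, neg_neg, Matrix.smul_mul, smul_smul, Matrix.mul_smul, mul_assoc]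
    have e' := e 1
    rw [one_mul, one_mul] at e'
    rw [e, h2, e', Matrix.smul_mul, ← smul_neg]
    congr 1
    rw [neg_mul, ← mul_assoc, ← mul_assoc, mul_assoc _ D.L, D.hL, mul_one]

end Frame

section span
variable {c : Config}

/-- The odd generators leave only active coordinates and the torus, with arbitrary weights `d`,
leaves only balanced monomials. These are combinations of the leading terms of the chosen monomials.
-/
lemma prj_mem_span (hc : c ∈ regular) {G : SuperFun} {k : ℕ} (hG : ∀ V, HasAct V c G 0)
    (h : ∀ᶠ x in nhds c, G x ∈ Fil k) : prj k (G c) ∈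
      Submodule.span ℂ (Set.range fun e : chosen => monProd (leadNilp c) (e : Exponent)) := by
  obtain ⟨D⟩ := exists_frame hc
  obtain ⟨x, hx⟩ := D.surjective hc.1 (prj k (G c))
  have h1 := D.ctr_eq_zero hc.1 (x := x) fun V hV => by
    rw [hx, contr_apply, lead_odd hV (hG V) h]
  have h2 : ∀ d : Fin 2 → ℂ, ∑ σ, d σ •
      (∑ j, num (thetaIdx (pt j) σ) x - ∑ i, num (thetaBarIdx (pt i) σ) x) = 0 := by
    intro d
    obtain ⟨a, m, n, l, e0, e1, e2⟩ := D.exists_diagonal_stabilizer hc.1 d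
    have e3 := D.rotSum_map hc.1 e0 e1 e2 h1
    rw [hx, ← prj_act_stabilizer (hG (.P 0)).diff h e0] at e3
    refine D.injective hc.1 (e3.symm.trans ?_)
    simp only [sumEven, (hG _).eq, map_zero, add_zero]
  have h3 : x ∈ Submodule.span ℂ (Set.range fun p => listProd (word p)) := by
    refine mem_span_word h1 fun σ => sub_eq_zero.1 ?_
    have := h2 (Pi.single σ 1)
    simpa [Pi.single_apply] using this
  have h4 : Submodule.span ℂ (Set.range fun p => listProd (word p)) ≤
      Submodule.span ℂ (Set.range fun e : chosen => monProd (leadGen D.y) (e : Exponent)) := by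
    rw [Submodule.span_le]
    rintro _ ⟨p, rfl⟩
    exact word_mem_span D.hy p
  have h5 := Submodule.mem_map_of_mem (f := D.A.toLinearMap) (h4 h3)
  rw [Submodule.map_span, ← Set.range_comp] at h5
  rw [← hx]
  have e : (D.A.toLinearMap ∘ fun e : chosen => monProd (leadGen D.y) (e : Exponent)) =
      fun e : chosen => monProd (leadNilp c) (e : Exponent) :=
    funext fun e => D.map_monProd_leadGen hc.1 e
  rwa [e] at h5

lemma linearIndependent_leadNilp (hc : c ∈ regular) :
    LinearIndependent ℂ fun e : chosen => monProd (leadNilp c) (e : Exponent) := by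
  obtain ⟨D⟩ := exists_frame hc
  have := (linearIndependent_lead D.hy).map' D.A.toLinearMap
    (LinearMap.ker_eq_bot.2 (D.injective hc.1))
  have e : (D.A.toLinearMap ∘ fun e : chosen => monProd (leadGen D.y) (e : Exponent)) =
      fun e : chosen => monProd (leadNilp c) (e : Exponent) :=
    funext fun e => D.map_monProd_leadGen hc.1 e
  rwa [e] at this

end span

/-! ## The differential of the cross ratios -/

/-- The Minkowski product of real vectors. -/
def mink (v w : Fin 4 → ℝ) : ℝ := v 0 * w 0 - v 1 * w 1 - v 2 * w 2 - v 3 * w 3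

lemma distSq_eq (c : Config) (i j : Fin 4) : distSq c i j = mink (c i - c j) (c i - c j) := by
  simp only [distSq, mink, Pi.sub_apply]; ring

lemma hasDerivAt_distSq (c ξ : Config) (i j : Fin 4) :
    HasDerivAt (fun t : ℝ => distSq (c + t • ξ) i j) (2 * mink (c i - c j) (ξ i - ξ j)) 0 := by
  have h : ∀ i μ : Fin 4, HasDerivAt (fun t : ℝ => (c + t • ξ) i μ) (ξ i μ) 0 := fun i μ => by
    have := ((hasDerivAt_id (0 : ℝ)).mul_const (ξ i μ)).const_add (c i μ)
    simpa using this
  have := (((((h i 0).sub (h j 0)).pow 2).sub (((h i 1).sub (h j 1)).pow 2)).sub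
    (((h i 2).sub (h j 2)).pow 2)).sub (((h i 3).sub (h j 3)).pow 2)
  refine this.congr_deriv ?_
  simp [mink]
  ring

/-- Only the point `2` moves, so each cross ratio is a constant times the ratio of two varying
squared distances. -/
lemma hasDerivAt_crossBody {c : Config} (hc : c ∈ nondegenerate) (v : Fin 4 → ℝ) :
    HasDerivAt (fun t : ℝ => crossBody (c + t • (Pi.single (2 : Fin 4) v : Config)))
      (distSq c 0 3 / distSq c 0 1 * ((2 * mink (c 2 - c 1) v * distSq c 2 3 -
        distSq c 2 1 * (2 * mink (c 2 - c 3) v)) / distSq c 2 3 ^ 2),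
      distSq c 0 3 / distSq c 1 3 * ((2 * mink (c 2 - c 1) v * distSq c 2 0 -
        distSq c 2 1 * (2 * mink (c 2 - c 0) v)) / distSq c 2 0 ^ 2)) 0 := by
  set ξ : Config := Pi.single (2 : Fin 4) v with hξ
  have e : (fun t : ℝ => crossBody (c + t • ξ)) =ᶠ[nhds 0] fun t =>
      (distSq (c + t • ξ) 0 3 * distSq (c + t • ξ) 2 1 /
        (distSq (c + t • ξ) 0 1 * distSq (c + t • ξ) 2 3),
      distSq (c + t • ξ) 0 3 * distSq (c + t • ξ) 2 1 /
        (distSq (c + t • ξ) 2 0 * distSq (c + t • ξ) 1 3)) := by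
    have hcont : Continuous fun t : ℝ => c + t • ξ := by fun_prop
    have : ∀ᶠ t in nhds (0 : ℝ), c + t • ξ ∈ nondegenerate :=
      hcont.continuousAt.eventually (isOpen_nondegenerate.mem_nhds (by simpa using hc))
    filter_upwards [this] with t ht
    rw [crossBody_eq ht, distSq_comm _ 1 2, distSq_comm _ 0 2]
  refine HasDerivAt.congr_of_eventuallyEq ?_ e
  have d0 : ∀ i j : Fin 4, i ≠ 2 → j ≠ 2 → ∀ t : ℝ, distSq (c + t • ξ) i j = distSq c i j := by
    intro i j hi hj t
    simp [distSq, hξ, hi, hj]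
  have d1 : ∀ j : Fin 4, j ≠ 2 →
      HasDerivAt (fun t : ℝ => distSq (c + t • ξ) 2 j) (2 * mink (c 2 - c j) v) 0 := by
    intro j hj
    have := hasDerivAt_distSq c ξ 2 j
    rwa [hξ, Pi.single_eq_same, Pi.single_eq_of_ne hj, sub_zero] at this
  have hd := fun i j (h : i ≠ j) => hc i j h
  have z : ∀ i j : Fin 4, distSq (c + (0 : ℝ) • ξ) i j = distSq c i j := fun i j => by simp
  simp only [d0 0 3 (by decide) (by decide), d0 0 1 (by decide) (by decide),
    d0 1 3 (by decide) (by decide)]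
  have k1 := ((d1 1 (by decide)).div (d1 3 (by decide)) (by rw [z]; exact hd _ _ (by decide))).const_mul
    (distSq c 0 3 / distSq c 0 1)
  have k2 := ((d1 1 (by decide)).div (d1 0 (by decide)) (by rw [z]; exact hd _ _ (by decide))).const_mul
    (distSq c 0 3 / distSq c 1 3)
  simp only [z] at k1 k2
  refine (k1.prodMk k2).congr_of_eventuallyEq (Filter.Eventually.of_forall fun t => ?_)
  refine Prod.ext ?_ ?_
  · simp only [Pi.div_apply]
    rw [div_mul_div_comm]
  · simp only [Pi.div_apply]
    rw [div_mul_div_comm, mul_comm (distSq c 1 3)]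

lemma mink_lin (x v w : Fin 4 → ℝ) (a b : ℝ) :
    mink x (a • v - b • w) = a * mink x v - b * mink x w := by
  simp only [mink, Pi.sub_apply, Pi.smul_apply, smul_eq_mul]; ring

lemma mink_comm (v w : Fin 4 → ℝ) : mink v w = mink w v := by
  simp only [mink]; ring

lemma mink_sub_sub (u v w : Fin 4 → ℝ) : mink (v - w) (v - w) =
    mink (u - v) (u - v) + mink (u - w) (u - w) - 2 * mink (u - v) (u - w) := by
  simp only [mink, Pi.sub_apply]; ring

/-- A Jacobian determinant of the two cross ratios, up to constant factors. With `p, q, r` the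
squared distances of the point `2` from the others and `a, b, e` the mutual products of the
difference vectors, it is the negative of the regularity polynomial divided by `q³ r³`. -/
lemma gram_ne_zero {p q r a b e : ℝ} (hp : p ≠ 0) (hq : q ≠ 0) (hr : r ≠ 0)
    (h : ((p + r - 2 * b) * q) ^ 2 + (r * (p + q - 2 * a)) ^ 2 + ((q + r - 2 * e) * p) ^ 2 -
      2 * ((p + r - 2 * b) * q) * (r * (p + q - 2 * a)) -
      2 * (r * (p + q - 2 * a)) * ((q + r - 2 * e) * p) -
      2 * ((q + r - 2 * e) * p) * ((p + r - 2 * b) * q) ≠ 0) :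
    (2 * (p⁻¹ * p - q⁻¹ * a) * q - p * (2 * (p⁻¹ * a - q⁻¹ * q))) / q ^ 2 *
      ((2 * (p⁻¹ * p - r⁻¹ * b) * r - p * (2 * (p⁻¹ * b - r⁻¹ * r))) / r ^ 2) -
    (2 * (p⁻¹ * p - r⁻¹ * b) * q - p * (2 * (p⁻¹ * a - r⁻¹ * e))) / q ^ 2 *
      ((2 * (p⁻¹ * p - q⁻¹ * a) * r - p * (2 * (p⁻¹ * b - q⁻¹ * e))) / r ^ 2) ≠ 0 := by
  have e : (2 * (p⁻¹ * p - q⁻¹ * a) * q - p * (2 * (p⁻¹ * a - q⁻¹ * q))) / q ^ 2 *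
      ((2 * (p⁻¹ * p - r⁻¹ * b) * r - p * (2 * (p⁻¹ * b - r⁻¹ * r))) / r ^ 2) -
    (2 * (p⁻¹ * p - r⁻¹ * b) * q - p * (2 * (p⁻¹ * a - r⁻¹ * e))) / q ^ 2 *
      ((2 * (p⁻¹ * p - q⁻¹ * a) * r - p * (2 * (p⁻¹ * b - q⁻¹ * e))) / r ^ 2) =
    -(((p + r - 2 * b) * q) ^ 2 + (r * (p + q - 2 * a)) ^ 2 + ((q + r - 2 * e) * p) ^ 2 -
      2 * ((p + r - 2 * b) * q) * (r * (p + q - 2 * a)) -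
      2 * (r * (p + q - 2 * a)) * ((q + r - 2 * e) * p) -
      2 * ((q + r - 2 * e) * p) * ((p + r - 2 * b) * q)) / (q ^ 3 * r ^ 3) := by
    field_simp
    ring
  rw [e]
  exact div_ne_zero (neg_ne_zero.2 h) (mul_ne_zero (pow_ne_zero _ hq) (pow_ne_zero _ hr))

lemma exists_combination {s t x y z w : ℝ} (s0 : s ≠ 0) (t0 : t ≠ 0) {u v : ℝ × ℝ}
    (hu : u = (s * x, t * y)) (hv : v = (s * z, t * w)) (hd : x * w - z * y ≠ 0) (m : ℝ × ℝ) :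
    ∃ a b : ℝ, a • u + b • v = m := by
  obtain ⟨e, he⟩ : ∃ e, e = x * w - z * y := ⟨_, rfl⟩
  rw [← he] at hd
  obtain ⟨m, n⟩ := m
  refine ⟨(m / s * w - z * (n / t)) / e, (x * (n / t) - m / s * y) / e, ?_⟩
  subst hu hv
  ext
  · simp only [Prod.fst_add, Prod.smul_fst, smul_eq_mul]
    field_simp
    rw [he]; ring
  · simp only [Prod.snd_add, Prod.smul_snd, smul_eq_mul]
    field_simp
    rw [he]; ring

lemma range_fderiv_crossBody {c : Config} (hc : c ∈ regular) :
    (fderiv ℝ crossBody c).range = ⊤ := by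
  have hd : HasFDerivAt crossBody (fderiv ℝ crossBody c) c :=
    ((crossBody_smooth hc.1).differentiableAt (by simp)).hasFDerivAt
  have hv : ∀ v : Fin 4 → ℝ, fderiv ℝ crossBody c (Pi.single (2 : Fin 4) v : Config) = _ :=
    fun v => (hd.hasLineDerivAt (Pi.single (2 : Fin 4) v : Config)).unique (hasDerivAt_crossBody hc.1 v)
  have hn := hc.1
  set A := c 2 - c 1 with hA
  set B := c 2 - c 3 with hB
  set C := c 2 - c 0 with hC
  have hp : distSq c 2 1 = mink A A := distSq_eq c 2 1
  have hq : distSq c 2 3 = mink B B := distSq_eq c 2 3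
  have hr : distSq c 2 0 = mink C C := distSq_eq c 2 0
  have h13 : distSq c 1 3 = mink A A + mink B B - 2 * mink A B := by
    rw [distSq_comm, distSq_eq, ← mink_comm B A, add_comm (mink A A)]
    have := mink_sub_sub (c 2) (c 3) (c 1)
    exact this
  have h01 : distSq c 0 1 = mink A A + mink C C - 2 * mink A C := by
    rw [distSq_comm, distSq_eq]; exact mink_sub_sub (c 2) (c 1) (c 0)
  have h03 : distSq c 0 3 = mink B B + mink C C - 2 * mink B C := by
    rw [distSq_comm, distSq_eq]; exact mink_sub_sub (c 2) (c 3) (c 0)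
  have p0 : mink A A ≠ 0 := hp ▸ hn 2 1 (by decide)
  have q0 : mink B B ≠ 0 := hq ▸ hn 2 3 (by decide)
  have r0 : mink C C ≠ 0 := hr ▸ hn 2 0 (by decide)
  have hreg := hc.2
  rw [distSq_comm c 0 2, distSq_comm c 1 2, hr, hp, hq, h13, h01, h03] at hreg
  have g := gram_ne_zero p0 q0 r0 hreg
  -- The two directions are half the Minkowski gradients, with respect to the point `2`, of the
  -- logarithms of the cross ratios. The determinant to be tested is therefore a multiple of the
  -- Gram determinant of these gradients.
  have e1 := hv ((mink A A)⁻¹ • A - (mink B B)⁻¹ • B)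
  have e2 := hv ((mink A A)⁻¹ • A - (mink C C)⁻¹ • C)
  simp only [mink_lin, hp, hq, hr] at e1 e2
  rw [mink_comm B A, mink_comm C A] at e1 e2
  rw [mink_comm C B] at e1
  set ξ : Config := Pi.single (2 : Fin 4) ((mink A A)⁻¹ • A - (mink B B)⁻¹ • B)
  set ζ : Config := Pi.single (2 : Fin 4) ((mink A A)⁻¹ • A - (mink C C)⁻¹ • C)
  set s := distSq c 0 3 / distSq c 0 1 with hs
  set t := distSq c 0 3 / distSq c 1 3 with ht
  have s0 : s ≠ 0 := div_ne_zero (hn 0 3 (by decide)) (hn 0 1 (by decide))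
  have t0 : t ≠ 0 := div_ne_zero (hn 0 3 (by decide)) (hn 1 3 (by decide))
  rw [LinearMap.range_eq_top]
  intro m
  obtain ⟨a, b, hab⟩ := exists_combination s0 t0 e1 e2 g m
  exact ⟨a • ξ + b • ζ, by rw [map_add, map_smul, map_smul]; exact hab⟩

/-! ### The vectors tangent to the orbits -/

/-- The complex-linear extension of the differential of a function. -/
def extD (h : Config → ℂ) (c : Config) : (Fin 4 → Fin 4 → ℂ) →ₗ[ℂ] ℂ :=
  ∑ i : Fin 4, ∑ μ : Fin 4, fderiv ℝ h c (Pi.single i (Pi.single μ 1)) •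
    (LinearMap.proj μ ∘ₗ LinearMap.proj i : (Fin 4 → Fin 4 → ℂ) →ₗ[ℂ] ℂ)

lemma extD_apply (h : Config → ℂ) (c : Config) (v : Fin 4 → Fin 4 → ℂ) : extD h c v =
    ∑ i : Fin 4, ∑ μ : Fin 4, fderiv ℝ h c (Pi.single i (Pi.single μ 1)) * v i μ := by
  simp [extD, LinearMap.sum_apply]

lemma extD_ofReal (h : Config → ℂ) (c ξ : Config) :
    extD h c (fun i μ => (ξ i μ : ℂ)) = fderiv ℝ h c ξ := by
  have e : ξ = ∑ i : Fin 4, ∑ μ : Fin 4, ξ i μ • (Pi.single i (Pi.single μ 1) : Config) := by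
    funext j ν
    simp [Finset.sum_apply, Pi.single_apply, ite_apply, Finset.sum_ite_eq]
  conv_rhs => rw [e]
  rw [extD_apply]
  simp only [map_sum, map_smul, Complex.real_smul, mul_comm]

lemma body_act_scalarFun {h : Config → ℂ} {c : Config} (hh : ContDiffAt ℝ ∞ h c) (V : Generator) :
    body (V.act (scalarFun h) c) = extD h c (fun i μ => body (V.coefX i μ c)) := by
  rw [(hasAct_scalarFun hh V).eq, extD_apply]
  simp only [map_sum, map_smul, smul_eq_mul]

lemma vecOf_eq_zero {M : Matrix (Fin 2) (Fin 2) ℂ} (h : vecOf M = 0) : M = 0 := by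
  have h0 := congrFun h 0
  have h1 := congrFun h 1
  have h2 := congrFun h 2
  have h3 := congrFun h 3
  simp [vecOf, sigma, Fin.sum_univ_two] at h0 h1 h2 h3
  ext i j
  fin_cases i <;> fin_cases j <;> simp only [Fin.mk_zero, Fin.mk_one, Matrix.zero_apply]
  · linear_combination h0 + h3
  · linear_combination h1 - Complex.I * h2 + (M 0 1 - M 1 0) / 2 * Complex.I_sq
  · linear_combination h1 + Complex.I * h2 - (M 0 1 - M 1 0) / 2 * Complex.I_sq
  · linear_combination h0 - h3

/-- The velocities of the points under the even generators. -/
def velocityMap (c : Config) : (Matrix (Fin 2) (Fin 2) ℂ × Matrix (Fin 2) (Fin 2) ℂ ×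
    Matrix (Fin 2) (Fin 2) ℂ × Matrix (Fin 2) (Fin 2) ℂ) →ₗ[ℂ] (Fin 4 → Fin 4 → ℂ) where
  toFun p := fun i μ => vecOf (velocity c p.1 p.2.1 p.2.2.1 p.2.2.2 i) μ
  map_add' p q := by
    funext i μ
    have : velocity c (p + q).1 (p + q).2.1 (p + q).2.2.1 (p + q).2.2.2 i =
      velocity c p.1 p.2.1 p.2.2.1 p.2.2.2 i + velocity c q.1 q.2.1 q.2.2.1 q.2.2.2 i := by
      simp only [velocity, Prod.fst_add, Prod.snd_add]; noncomm_ring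
    rw [this, vecOf_add]; rfl
  map_smul' a p := by
    funext i μ
    have : velocity c (a • p).1 (a • p).2.1 (a • p).2.2.1 (a • p).2.2.2 i =
      a • velocity c p.1 p.2.1 p.2.2.1 p.2.2.2 i := by
      simp only [velocity, Prod.smul_fst, Prod.smul_snd, smul_add, Matrix.mul_smul, Matrix.smul_mul]
    rw [this]
    simp only [vecOf, Matrix.smul_apply, Pi.smul_apply, smul_eq_mul, Finset.mul_sum, RingHom.id_apply]
    refine Finset.sum_congr rfl fun α _ => Finset.sum_congr rfl fun β _ => ?_
    ring

lemma extD_velocityMap {h : Config → ℂ} {c : Config} (hh : ContDiffAt ℝ ∞ h c)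
    (h0 : ∀ V : Generator, V.isOdd = false → body (V.act (scalarFun h) c) = 0) (p) :
    extD h c (velocityMap c p) = 0 := by
  have e : velocityMap c p = sumEven p.1 p.2.1 p.2.2.1 p.2.2.2
      (fun V => fun i μ => body (V.coefX i μ c)) := by
    funext i μ
    exact (sumEven_coefX c p.1 p.2.1 p.2.2.1 p.2.2.2 i μ).symm
  rw [e]
  simp only [sumEven, map_add, ← body_act_scalarFun hh]
  rw [h0 _ rfl, h0 _ rfl, h0 _ rfl, h0 _ rfl]
  ring

/-- A generator that fixes the four points is determined by `m' = m + k x_0`. This matrix commutes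
with `K`, hence is diagonal in the eigenbasis, and its two diagonal entries give an injective map to
`Fin 2 → ℂ`. -/
lemma finrank_ker_velocityMap {c : Config} (hc : c ∈ regular) :
    Module.finrank ℂ (LinearMap.ker (velocityMap c)) ≤ 2 := by
  obtain ⟨L, y, hy, hL, hK⟩ := exists_eigenbasis hc
  have hL1 := Matrix.mul_nonsing_inv _ hL
  have hL2 := Matrix.nonsing_inv_mul _ hL
  have hn := hc.1
  have h0 := Zb_det hn 0
  have hZ : Zb c 0 * (Zb c 0)⁻¹ = 1 := Matrix.mul_nonsing_inv _ (isUnit_iff_ne_zero.2 h0)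
  have hZ' : (Zb c 0)⁻¹ * Zb c 0 = 1 := Matrix.nonsing_inv_mul _ (isUnit_iff_ne_zero.2 h0)
  set K := (Xb c 0)⁻¹ * Xb c 1 with hKd
  have e0 : (Xb c 0)⁻¹ = -((Zb c 0).det⁻¹ • Zb c 0) := by
    refine Matrix.inv_eq_left_inv ?_
    rw [Xb_eq hn, neg_mul_neg, Matrix.smul_mul, Matrix.mul_adjugate, smul_smul, inv_mul_cancel₀ h0,
      one_smul]
  have hN : K = (Zb c 1 * (Zb c 0)⁻¹).adjugate := by
    rw [hKd, e0, Xb_eq hn, neg_mul_neg, Matrix.smul_mul, Matrix.adjugate_mul_distrib, Matrix.inv_def,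
      Matrix.adjugate_smul, adjugate_adjugate_fin_two, Ring.inverse_eq_inv']
    simp
  let φ : LinearMap.ker (velocityMap c) →ₗ[ℂ] (Fin 2 → ℂ) :=
    { toFun := fun p => fun σ => (L * (p.1.2.1 + p.1.2.2.2 * xb c 0) * L⁻¹) σ σ
      map_add' := fun p q => by
        funext σ
        have : L * ((p + q).1.2.1 + (p + q).1.2.2.2 * xb c 0) * L⁻¹ =
            L * (p.1.2.1 + p.1.2.2.2 * xb c 0) * L⁻¹ + L * (q.1.2.1 + q.1.2.2.2 * xb c 0) * L⁻¹ := by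
          change L * ((p.1.2.1 + q.1.2.1) + (p.1.2.2.2 + q.1.2.2.2) * xb c 0) * L⁻¹ = _
          noncomm_ring
        rw [this]; rfl
      map_smul' := fun a p => by
        funext σ
        have : L * ((a • p).1.2.1 + (a • p).1.2.2.2 * xb c 0) * L⁻¹ =
            a • (L * (p.1.2.1 + p.1.2.2.2 * xb c 0) * L⁻¹) := by
          change L * (a • p.1.2.1 + (a • p.1.2.2.2) * xb c 0) * L⁻¹ = _
          rw [Matrix.smul_mul, ← smul_add, Matrix.mul_smul, Matrix.smul_mul]
        rw [this]; rfl }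
  have hφ : Function.Injective φ := by
    rw [← LinearMap.ker_eq_bot, LinearMap.ker_eq_bot']
    rintro ⟨⟨a, m, n, k⟩, hp⟩ hφ0
    have hv : ∀ i, velocity c a m n k i = 0 := fun i =>
      vecOf_eq_zero (funext fun μ => congrFun (congrFun (LinearMap.mem_ker.1 hp) i) μ)
    have hd : ∀ σ, (L * (m + k * xb c 0) * L⁻¹) σ σ = 0 := fun σ => congrFun hφ0 σ
    set m' := m + k * xb c 0 with hm'
    set n' := n + xb c 0 * k with hn'
    -- The velocity relative to the point `0`, multiplied on both sides by `z_i = (x_i - x_0)⁻¹`, is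
    -- affine in `z_i`.
    have h1 : ∀ i : Fin 4, i ≠ 0 → m' * zb c i + zb c i * n' + k = 0 := by
      intro i hi
      have e1 : (xb c i - xb c 0) * m' + n' * (xb c i - xb c 0) +
          (xb c i - xb c 0) * k * (xb c i - xb c 0) = 0 := by
        have := congrArg₂ (· - ·) (hv i) (hv 0)
        simp only [velocity, sub_zero] at this
        rw [← this, hm', hn']; noncomm_ring
      have e2 : m' * zb c i + zb c i * n' + k = zb c i * ((xb c i - xb c 0) * m' +
          n' * (xb c i - xb c 0) + (xb c i - xb c 0) * k * (xb c i - xb c 0)) * zb c i := by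
        obtain ⟨f1, f2⟩ := zb_mul hn hi
        rw [show zb c i * ((xb c i - xb c 0) * m' + n' * (xb c i - xb c 0) +
          (xb c i - xb c 0) * k * (xb c i - xb c 0)) * zb c i =
          (zb c i * (xb c i - xb c 0)) * m' * zb c i + zb c i * n' * ((xb c i - xb c 0) * zb c i) +
          (zb c i * (xb c i - xb c 0)) * k * ((xb c i - xb c 0) * zb c i) by noncomm_ring, f1, f2]
        simp
      rw [e2, e1]; simp
    have h2 : ∀ j, m' * Zb c j + Zb c j * n' = 0 := fun j => by
      rw [Zb, show m' * (zb c (pt j) - zb c 3) + (zb c (pt j) - zb c 3) * n' =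
        (m' * zb c (pt j) + zb c (pt j) * n' + k) - (m' * zb c 3 + zb c 3 * n' + k) by noncomm_ring,
        h1 _ (pt_ne j).1, h1 _ (by decide), sub_zero]
    have h3 : n' = -((Zb c 0)⁻¹ * m' * Zb c 0) := by
      have := congrArg ((Zb c 0)⁻¹ * ·) (h2 0)
      simp only [mul_add, mul_zero, ← mul_assoc, hZ', one_mul] at this
      exact eq_neg_of_add_eq_zero_right this
    have h4 : m' * (Zb c 1 * (Zb c 0)⁻¹) = Zb c 1 * (Zb c 0)⁻¹ * m' := by
      have := congrArg (· * (Zb c 0)⁻¹) (h2 1)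
      simp only [h3, zero_mul] at this
      rw [← sub_eq_zero, ← this, show (m' * Zb c 1 + Zb c 1 * -((Zb c 0)⁻¹ * m' * Zb c 0)) *
        (Zb c 0)⁻¹ = m' * (Zb c 1 * (Zb c 0)⁻¹) - Zb c 1 * (Zb c 0)⁻¹ * m' *
          (Zb c 0 * (Zb c 0)⁻¹) by noncomm_ring, hZ, mul_one]
    have h5 : m' * K = K * m' := by
      rw [hN, adjugate_eq_trace_sub, mul_sub, sub_mul, h4, Matrix.mul_smul, Matrix.smul_mul, mul_one,
        one_mul]
    have h6 : L * m' * L⁻¹ * Matrix.diagonal y = Matrix.diagonal y * (L * m' * L⁻¹) := by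
      have f : Matrix.diagonal y = L * K * L⁻¹ := by rw [hK, mul_assoc, hL1, mul_one]
      rw [f, show L * m' * L⁻¹ * (L * K * L⁻¹) = L * m' * (L⁻¹ * L) * K * L⁻¹ by noncomm_ring,
        show L * K * L⁻¹ * (L * m' * L⁻¹) = L * K * (L⁻¹ * L) * m' * L⁻¹ by noncomm_ring, hL2,
        mul_one, mul_one, mul_assoc L m' K, h5, ← mul_assoc L K m']
    have h7 : L * m' * L⁻¹ = 0 := by
      ext i j
      by_cases hij : i = j
      · rw [← hij]; exact hd i
      · have := congrFun (congrFun h6 i) j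
        rw [Matrix.mul_diagonal, Matrix.diagonal_mul] at this
        have hne : y j - y i ≠ 0 := by
          fin_cases i <;> fin_cases j
          · exact absurd rfl hij
          · exact sub_ne_zero.2 hy.symm
          · exact sub_ne_zero.2 hy
          · exact absurd rfl hij
        rw [Matrix.zero_apply]
        exact (mul_eq_zero.1 (show (y j - y i) * (L * m' * L⁻¹) i j = 0 by
          linear_combination this)).resolve_left hne
    have h8 : m' = 0 := by
      calc m' = L⁻¹ * L * m' * (L⁻¹ * L) := by rw [hL2, one_mul, mul_one]
        _ = L⁻¹ * (L * m' * L⁻¹) * L := by noncomm_ring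
        _ = 0 := by rw [h7]; simp
    have h9 : n' = 0 := by rw [h3, h8]; simp
    have h10 : k = 0 := by simpa [h8, h9] using h1 3 (by decide)
    have h11 : m = 0 := by rw [hm', h10, zero_mul, add_zero] at h8; exact h8
    have h12 : n = 0 := by rw [hn', h10, mul_zero, add_zero] at h9; exact h9
    have h13 : a = 0 := by simpa [velocity, h10, h11, h12] using hv 0
    subst h10 h11 h12 h13
    rfl
  simpa using LinearMap.finrank_le_finrank_of_injective hφ

/-- Even generators preserve `Fil 1`, so the variation of the nilpotent part of an invariant has
body zero; that of the body then vanishes as well to lowest order. -/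
lemma extD_crossI {c : Config} (hc : c ∈ nondegenerate) {k : Fin 6} (hk : k = 0 ∨ k = 1) (p) :
    extD (fun c => body (crossI k c)) c (velocityMap c p) = 0 := by
  have hs : ContDiffAt ℝ ∞ (fun c => body (crossI k c)) c := by
    have h := crossBody_smooth hc
    have hev : ∀ᶠ c' in nhds c, c' ∈ nondegenerate := isOpen_nondegenerate.mem_nhds hc
    rcases hk with rfl | rfl
    · exact (Complex.ofRealCLM.contDiff.contDiffAt.comp c h.fst).congr_of_eventuallyEq
        (hev.mono fun c' hc' => (body_crossI hc').1)
    · exact (Complex.ofRealCLM.contDiff.contDiffAt.comp c h.snd).congr_of_eventuallyEq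
        (hev.mono fun c' hc' => (body_crossI hc').2)
  refine extD_velocityMap hs (fun V hV => ?_) p
  have h1 : HasAct V c (crossNil k) (-crossAct V c k) := by
    rcases hk with rfl | rfl
    exacts [(hasAct_crossNil hc V).1, (hasAct_crossNil hc V).2]
  have h2 := act_mem_fil (k := 1) hV h1.diff (Filter.eventually_of_mem
    (isOpen_nondegenerate.mem_nhds hc) fun c' hc' => fil_mono (by norm_num) (crossNil_mem_fil hc' k))
  rw [h1.eq, mem_fil_one, map_neg, neg_eq_zero] at h2
  exact h2

/-- A function that is invariant to lowest order is stationary where the cross ratios are. -/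
lemma fderiv_eq_zero_of_invariant {c : Config} (hc : c ∈ regular) {h : Config → ℂ}
    (hh : ContDiffAt ℝ ∞ h c)
    (h0 : ∀ V : Generator, V.isOdd = false → body (V.act (scalarFun h) c) = 0) {ξ : Config}
    (hξ : fderiv ℝ crossBody c ξ = 0) : fderiv ℝ h c ξ = 0 := by
  have hn := hc.1
  set u : Config → ℂ := fun c => body (crossI 0 c)
  set v : Config → ℂ := fun c => body (crossI 1 c)
  have hd : HasFDerivAt crossBody (fderiv ℝ crossBody c) c :=
    ((crossBody_smooth hn).differentiableAt (by simp)).hasFDerivAt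
  have hev : ∀ᶠ c' in nhds c, c' ∈ nondegenerate := isOpen_nondegenerate.mem_nhds hn
  have hu : ∀ ζ, fderiv ℝ u c ζ = ((fderiv ℝ crossBody c ζ).1 : ℂ) := fun ζ => by
    have := (Complex.ofRealCLM.hasFDerivAt.comp c hd.fst).congr_of_eventuallyEq
      (f₁ := u) (hev.mono fun c' hc' => (body_crossI hc').1)
    rw [this.fderiv]; rfl
  have hv : ∀ ζ, fderiv ℝ v c ζ = ((fderiv ℝ crossBody c ζ).2 : ℂ) := fun ζ => by
    have := (Complex.ofRealCLM.hasFDerivAt.comp c hd.snd).congr_of_eventuallyEq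
      (f₁ := v) (hev.mono fun c' hc' => (body_crossI hc').2)
    rw [this.fderiv]; rfl
  have hsurj := LinearMap.range_eq_top.1 (range_fderiv_crossBody hc)
  obtain ⟨ζ, hζ⟩ := hsurj (1, 0)
  obtain ⟨τ, hτ⟩ := hsurj (0, 1)
  replace hζ : fderiv ℝ crossBody c ζ = (1, 0) := hζ
  replace hτ : fderiv ℝ crossBody c τ = (0, 1) := hτ
  have hli : LinearIndependent ℂ ![extD u c, extD v c] := by
    rw [LinearIndependent.pair_iff]
    intro a b hab
    have e : ∀ η : Config, a * (fderiv ℝ crossBody c η).1 + b * (fderiv ℝ crossBody c η).2 = 0 := by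
      intro η
      have : _ = (0 : ℂ) := LinearMap.congr_fun hab (fun i μ => (η i μ : ℂ))
      simpa only [LinearMap.add_apply, LinearMap.smul_apply, extD_ofReal, smul_eq_mul, hu, hv] using this
    constructor
    · simpa [hζ] using e ζ
    · simpa [hτ] using e τ
  set p := LinearMap.range (velocityMap c) with hp
  have mem : ∀ {g : Config → ℂ}, (∀ q, extD g c (velocityMap c q) = 0) →
      extD g c ∈ p.dualAnnihilator := by
    intro g hg
    rw [Submodule.mem_dualAnnihilator]
    rintro _ ⟨q, rfl⟩
    exact hg q
  -- Both the space of parameters and the space of velocities have dimension 16, so the annihilator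
  -- of the range has the dimension of the kernel.
  have hfin : Module.finrank ℂ p.dualAnnihilator ≤ 2 := by
    have h1 := Subspace.finrank_add_finrank_dualAnnihilator_eq p
    have h2 := LinearMap.finrank_range_add_finrank_ker (velocityMap c)
    have h3 := finrank_ker_velocityMap hc
    have e1 : Module.finrank ℂ (Fin 4 → Fin 4 → ℂ) = 16 := by
      simp [Module.finrank_pi_fintype]
    have e2 : Module.finrank ℂ (Matrix (Fin 2) (Fin 2) ℂ × Matrix (Fin 2) (Fin 2) ℂ ×
        Matrix (Fin 2) (Fin 2) ℂ × Matrix (Fin 2) (Fin 2) ℂ) = 16 := by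
      simp [Module.finrank_prod, Module.finrank_matrix]
    rw [e1] at h1
    rw [e2] at h2
    rw [← hp] at h2
    omega
  -- The differentials of the two cross ratios are independent elements of an at most
  -- two-dimensional space, hence span it; in particular they span the differential of `h`.
  have hspan : Submodule.span ℂ (Set.range ![extD u c, extD v c]) = p.dualAnnihilator := by
    refine Submodule.eq_of_le_of_finrank_le ?_ ?_
    · rw [Submodule.span_le]
      rintro _ ⟨i, rfl⟩
      fin_cases i
      · exact mem (extD_crossI hn (Or.inl rfl))
      · exact mem (extD_crossI hn (Or.inr rfl))
    · rw [finrank_span_eq_card hli]; simpa using hfin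
  have hm := mem (extD_velocityMap hh h0)
  rw [← hspan, Matrix.range_cons, Matrix.range_cons, Matrix.range_empty, Set.union_empty,
    Set.singleton_union, Submodule.mem_span_pair] at hm
  obtain ⟨a, b, hab⟩ := hm
  rw [← extD_ofReal, ← hab]
  simp [extD_ofReal, hu, hv, hξ]

/-! ## Functions with the symmetries of a submersion -/

/-- A smooth map whose derivative vanishes on the kernel of the derivative of a submersion factors
locally through the submersion. -/
lemma exists_factor_of_ker_le {X Y E : Type*} [NormedAddCommGroup X] [NormedSpace ℝ X]
    [FiniteDimensional ℝ X] [NormedAddCommGroup Y] [NormedSpace ℝ Y] [CompleteSpace Y]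
    [NormedAddCommGroup E] [NormedSpace ℝ E] {φ : X → Y} {h : X → E} {p : X} {U : Set X}
    (hU : IsOpen U) (hp : p ∈ U) (hφ : ContDiffOn ℝ ∞ φ U) (hh : ContDiffOn ℝ ∞ h U)
    (hs : (fderiv ℝ φ p).range = ⊤)
    (hk : ∀ c ∈ U, ∀ ξ, fderiv ℝ φ c ξ = 0 → fderiv ℝ h c ξ = 0) :
    ∃ V : Set X, IsOpen V ∧ p ∈ V ∧ V ⊆ U ∧ ∃ W : Set Y, IsOpen W ∧ Set.MapsTo φ V W ∧
      ∃ f : Y → E, ContDiffOn ℝ ∞ f W ∧ Set.EqOn h (f ∘ φ) V := by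
  have : CompleteSpace X := FiniteDimensional.complete ℝ X
  obtain ⟨π, hπ⟩ := Submodule.ClosedComplemented.of_finiteDimensional (𝕜 := ℝ) (fderiv ℝ φ p).ker
  have hπr : π.range = ⊤ := LinearMap.range_eq_top.2 fun x => ⟨x, hπ x⟩
  -- Together with a projection to the kernel of its derivative, the submersion gives local
  -- coordinates in which it is the first projection.
  let A : X ≃L[ℝ] Y × (fderiv ℝ φ p).ker := (fderiv ℝ φ p).equivProdOfSurjectiveOfIsCompl π hs hπr
    (LinearMap.isCompl_of_proj hπ)
  let F : X → Y × (fderiv ℝ φ p).ker := fun c => (φ c, π c)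
  have hF : ContDiffOn ℝ ∞ F U := hφ.prodMk π.contDiff.contDiffOn
  have hFat : ∀ c ∈ U, ContDiffAt ℝ ∞ F c := fun c hc => hF.contDiffAt (hU.mem_nhds hc)
  have hφat : ∀ c ∈ U, HasFDerivAt φ (fderiv ℝ φ c) c := fun c hc =>
    ((hφ.contDiffAt (hU.mem_nhds hc)).differentiableAt (by simp)).hasFDerivAt
  have hFd : ∀ c ∈ U, fderiv ℝ F c = (fderiv ℝ φ c).prod π := fun c hc =>
    ((hφat c hc).prodMk π.hasFDerivAt).fderiv
  have hA : (A : X →L[ℝ] Y × (fderiv ℝ φ p).ker) = fderiv ℝ F p := by rw [hFd p hp]; rfl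
  have hst : HasStrictFDerivAt F (A : X →L[ℝ] Y × (fderiv ℝ φ p).ker) p := by
    rw [hA]; exact (hFat p hp).hasStrictFDerivAt (by simp)
  let e := hst.toOpenPartialHomeomorph F
  have hpe : p ∈ e.source := hst.mem_toOpenPartialHomeomorph_source
  have hN : ∀ᶠ c in nhds p, c ∈ e.source ∩ U ∧
      fderiv ℝ F c ∈ Set.range ((↑) : (X ≃L[ℝ] Y × (fderiv ℝ φ p).ker) → _) := by
    refine Filter.Eventually.and ((e.open_source.inter hU).mem_nhds ⟨hpe, hp⟩) ?_
    have hc : ContinuousAt (fderiv ℝ F) p :=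
      (hF.continuousOn_fderiv_of_isOpen hU (by simp)).continuousAt (hU.mem_nhds hp)
    exact hc.preimage_mem_nhds (hA ▸ A.nhds)
  obtain ⟨O, hO, hOo, hpO⟩ := eventually_nhds_iff.1 hN
  have hOs : O ⊆ e.source := fun c hc => (hO c hc).1.1
  have himg : e '' O ∈ nhds (φ p, π p) :=
    (e.isOpen_image_of_subset_source hOo hOs).mem_nhds ⟨p, hpO, rfl⟩
  obtain ⟨r, hr, hball⟩ := Metric.mem_nhds_iff.1 himg
  -- In a product of balls every fibre of the submersion is a ball, hence preconnected, so that a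
  -- function with vanishing derivative along the fibre is constant on it.
  rw [← ball_prod_same] at hball
  have hinv : ∀ z ∈ Metric.ball (φ p) r ×ˢ Metric.ball (π p) r, z ∈ e.target ∧ e.symm z ∈ O ∧
      F (e.symm z) = z := by
    intro z hz
    obtain ⟨c, hc, rfl⟩ := hball hz
    rw [e.left_inv (hOs hc)]
    exact ⟨e.map_source (hOs hc), hc, rfl⟩
  have hsym : ∀ z ∈ Metric.ball (φ p) r ×ˢ Metric.ball (π p) r, ∃ D : X ≃L[ℝ] Y × (fderiv ℝ φ p).ker,
      (D : X →L[ℝ] Y × (fderiv ℝ φ p).ker) = fderiv ℝ F (e.symm z) ∧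
      HasFDerivAt e.symm (D.symm : Y × (fderiv ℝ φ p).ker →L[ℝ] X) z ∧
      ContDiffAt ℝ ∞ e.symm z := by
    intro z hz
    obtain ⟨h1, h2, -⟩ := hinv z hz
    obtain ⟨D, hD⟩ := (hO _ h2).2
    have hd : HasFDerivAt e (D : X →L[ℝ] Y × (fderiv ℝ φ p).ker) (e.symm z) := by
      rw [hD]; exact ((hFat _ (hO _ h2).1.2).differentiableAt (by simp)).hasFDerivAt
    exact ⟨D, hD, e.hasFDerivAt_symm h1 hd, e.contDiffAt_symm h1 hd (hFat _ (hO _ h2).1.2)⟩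
  have hhat : ∀ c ∈ O, ContDiffAt ℝ ∞ h c := fun c hc => hh.contDiffAt (hU.mem_nhds (hO c hc).1.2)
  have hconst : ∀ y ∈ Metric.ball (φ p) r, ∀ t ∈ Metric.ball (π p) r,
      h (e.symm (y, t)) = h (e.symm (y, π p)) := by
    intro y hy t ht
    have hder : ∀ t ∈ Metric.ball (π p) r, HasFDerivAt (fun t => h (e.symm (y, t)))
        (0 : (fderiv ℝ φ p).ker →L[ℝ] E) t := by
      intro t ht
      obtain ⟨D, hD, hd, -⟩ := hsym (y, t) ⟨hy, ht⟩
      have h2 := (hinv (y, t) ⟨hy, ht⟩).2.1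
      have hc := (((hhat _ h2).differentiableAt (by simp)).hasFDerivAt.comp (y, t) hd).comp t
        (hasFDerivAt_prodMk_right y t)
      refine hc.congr_fderiv (ContinuousLinearMap.ext fun τ => ?_)
      refine hk _ (hO _ h2).1.2 _ ?_
      have h3 : fderiv ℝ F (e.symm (y, t)) (D.symm (0, τ)) = (0, τ) := by
        rw [← hD]; exact D.apply_symm_apply _
      rw [hFd _ (hO _ h2).1.2] at h3
      exact congrArg Prod.fst h3
    refine Metric.isOpen_ball.is_const_of_fderiv_eq_zero (𝕜 := ℝ)
      (convex_ball _ _).isPreconnected (f := fun t => h (e.symm (y, t)))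
      (fun t ht => (hder t ht).differentiableAt.differentiableWithinAt)
      (fun t ht => (hder t ht).fderiv) ht (Metric.mem_ball_self hr)
  have hFc : ContinuousOn F O := hF.continuousOn.mono fun c hc => (hO c hc).1.2
  refine ⟨O ∩ F ⁻¹' (Metric.ball (φ p) r ×ˢ Metric.ball (π p) r),
    hFc.isOpen_inter_preimage hOo (Metric.isOpen_ball.prod Metric.isOpen_ball),
    ⟨hpO, Metric.mem_ball_self hr, Metric.mem_ball_self hr⟩, fun c hc => (hO c hc.1).1.2,
    Metric.ball (φ p) r, Metric.isOpen_ball, fun c hc => hc.2.1,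
    fun y => h (e.symm (y, π p)), fun y hy => ?_, fun c hc => ?_⟩
  · have hz : (y, π p) ∈ Metric.ball (φ p) r ×ˢ Metric.ball (π p) r :=
      ⟨hy, Metric.mem_ball_self hr⟩
    obtain ⟨-, -, -, h1⟩ := hsym _ hz
    exact (((hhat _ (hinv _ hz).2.1).comp (y, π p) h1).comp y
      (contDiffAt_id.prodMk contDiffAt_const)).contDiffWithinAt
  · have h1 := hconst (φ c) hc.2.1 (π c) hc.2.2
    have h2 : e.symm (φ c, π c) = c := e.left_inv (hOs hc.1)
    rw [h2] at h1
    exact h1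

lemma isOpen_image_crossBody {V : Set Config} (hV : IsOpen V) (h : V ⊆ regular) :
    IsOpen (crossBody '' V) := by
  rw [isOpen_iff_mem_nhds]
  rintro _ ⟨c, hc, rfl⟩
  rw [← ((crossBody_smooth (h hc).1).hasStrictFDerivAt (by simp)).map_nhds_eq_of_surj
    (range_fderiv_crossBody (h hc))]
  exact Filter.image_mem_map (hV.mem_nhds hc)

/-! ## Smooth coefficients of leading terms -/

/-- The coefficients with respect to smooth vectors that are linearly independent at a point are
smooth near that point. -/
lemma exists_smooth_coeff {X G ι : Type*} [NormedAddCommGroup X] [NormedSpace ℝ X]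
    [NormedAddCommGroup G] [NormedSpace ℝ G] [NormedSpace ℂ G] [IsScalarTower ℝ ℂ G]
    [FiniteDimensional ℝ G]
    [Fintype ι] {v : ι → X → G} {x : X → G} {p : X} {U : Set X} (hU : IsOpen U) (hp : p ∈ U)
    (hv : ∀ i, ContDiffOn ℝ ∞ (v i) U) (hx : ContDiffOn ℝ ∞ x U)
    (hi : LinearIndependent ℂ fun i => v i p)
    (hs : ∀ c ∈ U, x c ∈ Submodule.span ℂ (Set.range fun i => v i c)) :
    ∃ V : Set X, IsOpen V ∧ p ∈ V ∧ V ⊆ U ∧ ∃ h : X → ι → ℂ, ContDiffOn ℝ ∞ h V ∧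
      ∀ c ∈ V, x c = ∑ i, h c i • v i c := by
  let M : X → (ι → ℂ) →ₗ[ℂ] G := fun c => Fintype.linearCombination ℂ fun i => v i c
  obtain ⟨L, hL⟩ := (M p).exists_leftInverse_of_injective
    (LinearMap.ker_eq_bot.2 hi.fintypeLinearCombination_injective)
  let L' : G →L[ℝ] (ι → ℂ) := (L.restrictScalars ℝ).toContinuousLinearMap
  -- `L` is a left inverse of the combination map at `p` only. Its composition with the combination
  -- map at nearby points is close to the identity, hence invertible, and its inverse depends
  -- smoothly on the point.
  let Q : X → (ι → ℂ) →L[ℝ] (ι → ℂ) := fun c =>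
    ((L ∘ₗ M c).restrictScalars ℝ).toContinuousLinearMap
  have hQ : ContDiffOn ℝ ∞ Q U := contDiffOn_clm_apply.2 fun y => by
    have h1 : ContDiffOn ℝ ∞ (fun c => ∑ i, y i • v i c) U :=
      ContDiffOn.sum fun i _ => contDiffOn_const.smul (hv i)
    exact L'.contDiff.comp_contDiffOn h1
  have hQp : Q p = ((ContinuousLinearEquiv.refl ℝ (ι → ℂ) :
      (ι → ℂ) ≃L[ℝ] (ι → ℂ)) : (ι → ℂ) →L[ℝ] (ι → ℂ)) :=
    ContinuousLinearMap.ext fun y => LinearMap.congr_fun hL y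
  have hN : ∀ᶠ c in nhds p, c ∈ U ∧
      Q c ∈ Set.range ((↑) : ((ι → ℂ) ≃L[ℝ] (ι → ℂ)) → (ι → ℂ) →L[ℝ] (ι → ℂ)) :=
    Filter.Eventually.and (hU.mem_nhds hp)
      ((hQ.continuousOn.continuousAt (hU.mem_nhds hp)).preimage_mem_nhds
        (hQp ▸ (ContinuousLinearEquiv.refl ℝ (ι → ℂ)).nhds))
  obtain ⟨V, hV, hVo, hpV⟩ := eventually_nhds_iff.1 hN
  refine ⟨V, hVo, hpV, fun c hc => (hV c hc).1, fun c => (Q c).inverse (L' (x c)),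
    fun c hc => ?_, fun c hc => ?_⟩
  · obtain ⟨hcU, e, he⟩ := hV c hc
    have h1 : ContDiffAt ℝ ∞ (fun c => (Q c).inverse) c :=
      (he ▸ contDiffAt_map_inverse e :
        ContDiffAt ℝ ∞ ContinuousLinearMap.inverse (Q c)).comp c (hQ.contDiffAt (hU.mem_nhds hcU))
    exact (h1.clm_apply (L'.contDiff.contDiffAt.comp c
      (hx.contDiffAt (hU.mem_nhds hcU)))).contDiffWithinAt
  · obtain ⟨hcU, e, he⟩ := hV c hc
    obtain ⟨a, ha⟩ := (Submodule.mem_span_range_iff_exists_fun ℂ).1 (hs c hcU)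
    have h1 : L' (x c) = e a := by
      have : L' (x c) = Q c a := by
        change L (x c) = L (M c a)
        rw [← ha]; rfl
      rw [this, ← he]; rfl
    have h2 : (Q c).inverse (L' (x c)) = a := by
      rw [h1, ← he, ContinuousLinearMap.inverse_equiv]
      exact e.symm_apply_apply a
    simp only [h2, ha]

/-! ## Monomials and their leading terms -/

section monomials
variable {c : Config} {k : ℕ}

lemma degree_eq (e : Exponent) : degree e = e (0, 0, 0) + e (0, 0, 1) + e (0, 1, 0) + e (0, 1, 1) +
    e (1, 0, 0) + e (1, 0, 1) + e (1, 1, 0) + e (1, 1, 1) := by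
  simp only [degree, Fintype.sum_prod_type, Fin.sum_univ_two]
  ring

lemma monProd_mem_fil_and_prj {v : Fin 2 × Fin 2 × Fin 2 → Grassmann} (hv : ∀ t, v t ∈ Fil k)
    (e : Exponent) : monProd v e ∈ Fil (degree e * k) ∧
      prj (degree e * k) (monProd v e) = monProd (fun t => prj k (v t)) e := by
  have hp := fun t => pow_mem_fil (hv t) (e t)
  have hq := fun t => prj_pow_of_mem_fil (hv t) (e t)
  rw [degree_eq]
  simp only [add_mul]
  have step : ∀ {m n : ℕ} {x y x' y' : Grassmann}, (x ∈ Fil m ∧ prj m x = x') →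
      (y ∈ Fil n ∧ prj n y = y') → x * y ∈ Fil (m + n) ∧ prj (m + n) (x * y) = x' * y' := by
    rintro m n x y _ _ ⟨h1, rfl⟩ ⟨h2, rfl⟩
    exact ⟨mul_mem_fil h1 h2, prj_mul_of_mem_fil h1 h2⟩
  exact step (step (step (step (step (step (step ⟨hp _, hq _⟩ ⟨hp _, hq _⟩) ⟨hp _, hq _⟩)
    ⟨hp _, hq _⟩) ⟨hp _, hq _⟩) ⟨hp _, hq _⟩) ⟨hp _, hq _⟩) ⟨hp _, hq _⟩

lemma nilp_mem_fil (hc : c ∈ nondegenerate) (t : Fin 2 × Fin 2 × Fin 2) :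
    nilp t.1 t.2.1 t.2.2 c ∈ Fil 2 :=
  (nilp_wt hc (.L 0) t.1 t.2.1 t.2.2).ev.body_zero_mem_fil (body_nilp _ _ _ _)

lemma monomial_mem_fil (hc : c ∈ nondegenerate) (e : Exponent) :
    monomial e c ∈ Fil (degree e * 2) :=
  (monProd_mem_fil_and_prj (nilp_mem_fil hc) e).1

lemma prj_monomial (hc : c ∈ nondegenerate) (e : Exponent) :
    prj (degree e * 2) (monomial e c) = monProd (leadNilp c) e :=
  (monProd_mem_fil_and_prj (nilp_mem_fil hc) e).2

lemma prj_monProd_leadNilp (hc : c ∈ nondegenerate) (e : Exponent) (k : ℕ) :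
    prj k (monProd (leadNilp c) e) = if degree e * 2 = k then monProd (leadNilp c) e else 0 := by
  rw [← prj_monomial hc, prj_prj]

lemma hasAct_monomial (hc : c ∈ nondegenerate) (V : Generator) (e : Exponent) :
    HasAct V c (monomial e) 0 := by
  have h := fun t : Fin 2 × Fin 2 × Fin 2 =>
    ((nilp_wt hc V t.1 t.2.1 t.2.2).act_zero).pow_zero_of (e t)
  have step : ∀ {F G : SuperFun}, HasAct V c F 0 → HasAct V c G 0 → HasAct V c (F * G) 0 :=
    fun hF hG => (hF.mul hG).cast (by rw [zero_mul, mul_zero, add_zero])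
  exact step (step (step (step (step (step (step (h (0, 0, 0)) (h (0, 0, 1))) (h (0, 1, 0)))
    (h (0, 1, 1))) (h (1, 0, 0))) (h (1, 0, 1))) (h (1, 1, 0))) (h (1, 1, 1))

lemma hasAct_combination (hc : c ∈ nondegenerate) {W : Set (ℝ × ℝ)} (hW : IsOpen W)
    (hcW : crossBody c ∈ W) {T : Finset Exponent} {f : Exponent → ℝ × ℝ → ℂ}
    (hf : ∀ e ∈ T, ContDiffOn ℝ ∞ (f e) W) (V : Generator) :
    HasAct V c (∑ e ∈ T, ofCrossRatios (f e) * monomial e) 0 := by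
  refine (HasAct.sum (d := fun _ => 0) fun e he =>
    ((hasAct_ofCrossRatios hc hW (hf e he) hcW V).mul (hasAct_monomial hc V e)).cast ?_).cast
    Finset.sum_const_zero
  rw [zero_mul, mul_zero, add_zero]

end monomials

/-! ## Invariants as combinations of the chosen monomials -/

section combinations
variable {c p : Config} {k : ℕ}

lemma prj_mul_monomial (hc : c ∈ nondegenerate) (a : Grassmann) (e : Exponent) :
    prj (degree e * 2) (a * monomial e c) = body a • monProd (leadNilp c) e := by
  have := prj_mul_of_mem_fil (fil_zero a) (monomial_mem_fil hc e)
  rwa [zero_add, prj_monomial hc, prj_zero, ← Algebra.smul_def] at this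

lemma body_ofCrossRatios (hc : c ∈ nondegenerate) {W : Set (ℝ × ℝ)} (hW : IsOpen W)
    (hcW : crossBody c ∈ W) {f : ℝ × ℝ → ℂ} (hf : ContDiffOn ℝ ∞ f W) :
    body (ofCrossRatios f c) = f (crossBody c) := by
  have := mem_fil_one.1 (ofCrossRatios_sub_mem_fil hc hW hf hcW)
  rwa [map_sub, body_algebraMap, sub_eq_zero] at this

/-- The chosen monomials of degree `k` in the odd coordinates. -/
def chosenOf (k : ℕ) : Finset Exponent := chosen.filter fun e => degree e * 2 = k

lemma linearIndependent_chosenOf (hc : c ∈ regular) (k : ℕ) :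
    LinearIndependent ℂ fun e : chosenOf k => monProd (leadNilp c) (e : Exponent) :=
  (linearIndependent_leadNilp hc).comp
    (fun e : chosenOf k => (⟨e, (Finset.mem_filter.1 e.2).1⟩ : chosen))
    fun _ _ h => Subtype.ext (congrArg (fun e : chosen => (e : Exponent)) h)

lemma prj_mem_span_chosenOf (hc : c ∈ regular) {G : SuperFun} (hG : ∀ V, HasAct V c G 0)
    (h : ∀ᶠ x in nhds c, G x ∈ Fil k) : prj k (G c) ∈
      Submodule.span ℂ (Set.range fun e : chosenOf k => monProd (leadNilp c) (e : Exponent)) := by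
  have h1 : Submodule.span ℂ (Set.range fun e : chosen => monProd (leadNilp c) (e : Exponent)) ≤
      (Submodule.span ℂ (Set.range fun e : chosenOf k =>
        monProd (leadNilp c) (e : Exponent))).comap (prj k) := by
    refine Submodule.span_le.2 ?_
    rintro _ ⟨e, rfl⟩
    change prj k (monProd (leadNilp c) (e : Exponent)) ∈ Submodule.span ℂ
      (Set.range fun e : chosenOf k => monProd (leadNilp c) (e : Exponent))
    rw [prj_monProd_leadNilp hc.1]
    split_ifs with hk
    · exact Submodule.subset_span ⟨⟨e, Finset.mem_filter.2 ⟨e.2, hk⟩⟩, rfl⟩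
    · exact Submodule.zero_mem _
  have h2 := h1 (prj_mem_span hc hG h)
  rwa [Submodule.mem_comap, prj_prj, if_pos rfl] at h2

lemma prj_sum_mul_monomial (hc : c ∈ nondegenerate) (a : Exponent → Grassmann) :
    prj k (∑ e ∈ chosenOf k, a e * monomial e c) =
      ∑ e : chosenOf k, body (a e) • monProd (leadNilp c) (e : Exponent) := by
  rw [map_sum, Finset.sum_coe_sort (chosenOf k) fun e => body (a e) • monProd (leadNilp c) e]
  refine Finset.sum_congr rfl fun e he => ?_
  rw [← (Finset.mem_filter.1 he).2, prj_mul_monomial hc]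

lemma sum_mul_monomial_mem_fil (hc : c ∈ nondegenerate) (a : Exponent → Grassmann) :
    ∑ e ∈ chosenOf k, a e * monomial e c ∈ Fil k :=
  Submodule.sum_mem _ fun e he =>
    (Finset.mem_filter.1 he).2 ▸ mul_mem_fil_left _ (monomial_mem_fil hc e)

/-- The leading coefficients of an invariant are functions of the cross ratios. -/
lemma exists_leading_combination {U : Set Config} (hU : IsOpen U) (hp : p ∈ U) (hr : U ⊆ regular)
    {G : SuperFun} (hG : ∀ c ∈ U, ∀ V, HasAct V c G 0) (hk : ∀ c ∈ U, G c ∈ Fil k) :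
    ∃ V : Set Config, IsOpen V ∧ p ∈ V ∧ V ⊆ U ∧ ∃ W : Set (ℝ × ℝ), IsOpen W ∧
      Set.MapsTo crossBody V W ∧ ∃ f : Exponent → ℝ × ℝ → ℂ,
      (∀ e ∈ chosenOf k, ContDiffOn ℝ ∞ (f e) W) ∧
      ∀ c ∈ V, G c - ∑ e ∈ chosenOf k, ofCrossRatios (f e) c * monomial e c ∈ Fil (k + 1) := by
  have hev : ∀ {O : Set Config}, IsOpen O → ∀ {P : Config → Prop}, (∀ c ∈ O, P c) → ∀ c ∈ O,
      ∀ᶠ x in nhds c, P x := fun hO _ h c hc => Filter.mem_of_superset (hO.mem_nhds hc) h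
  obtain ⟨V, hV, hpV, hVU, h, hh, hsum⟩ := exists_smooth_coeff (ι := chosenOf k)
    (v := fun e c => monProd (leadNilp c) (e : Exponent)) (x := fun c => prj k (G c)) hU hp
    (fun e c hc => ((prjReal (degree e.1 * 2)).contDiff.contDiffAt.comp c
      (hasAct_monomial (hr hc).1 (.L 0) e).smooth).contDiffWithinAt.congr_of_eventuallyEq
        (Filter.eventually_of_mem self_mem_nhdsWithin fun x hx => (prj_monomial (hr hx).1 _).symm)
        (prj_monomial (hr hc).1 _).symm)
    (fun c hc => ((prjReal k).contDiff.contDiffAt.comp c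
      (hG c hc (.L 0)).smooth).contDiffWithinAt)
    (linearIndependent_chosenOf (hr hp) k)
    (fun c hc => prj_mem_span_chosenOf (hr hc) (hG c hc) (hev hU hk c hc))
  have hhc : ∀ c ∈ V, ∀ e, ContDiffAt ℝ ∞ (fun c => h c e) c := fun c hc e =>
    contDiffAt_pi.1 (hh.contDiffAt (hV.mem_nhds hc)) e
  let H : Exponent → Config → ℂ := fun e c => if he : e ∈ chosenOf k then h c ⟨e, he⟩ else 0
  have hH : ∀ e : chosenOf k, H e = fun c => h c e := fun e => funext fun c => dif_pos e.2
  -- Here the coefficients are still arbitrary smooth functions of the configuration; subtracting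
  -- the combination already removes the component of order `k`.
  have hrest : ∀ c ∈ V,
      (G - ∑ e ∈ chosenOf k, scalarFun (H e) * monomial e) c ∈ Fil (k + 1) := fun c hc => by
    have hn := (hr (hVU hc)).1
    have e1 : (∑ e ∈ chosenOf k, scalarFun (H e) * monomial e) c =
      ∑ e ∈ chosenOf k, scalarFun (H e) c * monomial e c := Finset.sum_apply _ _ _
    rw [Pi.sub_apply, e1]
    refine fil_succ.2 ⟨Submodule.sub_mem _ (hk c (hVU hc))
      (sum_mul_monomial_mem_fil hn fun e => scalarFun (H e) c), ?_⟩
    rw [map_sub, prj_sum_mul_monomial hn fun e => scalarFun (H e) c, hsum c hc, sub_eq_zero]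
    exact Finset.sum_congr rfl fun e _ => by rw [hH, scalarFun, body_algebraMap]
  -- An even generator keeps the remainder in `Fil (k + 1)` and annihilates both `G` and the
  -- monomials. So the varied coefficients, multiplied by the leading terms, sum to zero in order
  -- `k`, and independence makes each of their bodies vanish.
  have hinv : ∀ c ∈ V, ∀ V : Generator, V.isOdd = false → ∀ e : chosenOf k,
      body (V.act (scalarFun fun c => h c e) c) = 0 := by
    intro c hc T hT
    have hn := (hr (hVU hc)).1
    have hs : ∀ e ∈ chosenOf k, HasAct T c (scalarFun (H e) * monomial e)
        (T.act (scalarFun (H e)) c * monomial e c) := fun e he => by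
      have h1 := hasAct_scalarFun (by rw [hH ⟨e, he⟩]; exact hhc c hc _ :
        ContDiffAt ℝ ∞ (H (⟨e, he⟩ : chosenOf k)) c) T
      refine ((h1.cast h1.eq.symm).mul_ev (hasAct_monomial hn T e) (ev_algebraMap _)).cast ?_
      rw [mul_zero, add_zero]
    have h2 := (hG c (hVU hc) T).sub (HasAct.sum hs)
    have h3 := act_mem_fil hT h2.diff (hev hV hrest c hc)
    rw [h2.eq, zero_sub, Submodule.neg_mem_iff] at h3
    have h4 := (fil_succ.1 h3).2
    rw [prj_sum_mul_monomial hn fun e => T.act (scalarFun (H e)) c] at h4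
    intro e
    rw [← hH]
    exact Fintype.linearIndependent_iff.1 (linearIndependent_chosenOf (hr (hVU hc)) k) _ h4 e
  -- All coefficients are factored through the cross ratios at once, as one map with values in the
  -- tuples indexed by the monomials.
  obtain ⟨V', hV', hpV', hVV', W, hW, hm, f, hf, heq⟩ := exists_factor_of_ker_le hV hpV
    (fun c hc => (crossBody_smooth (hr (hVU hc)).1).contDiffWithinAt) hh
    (range_fderiv_crossBody (hr hp)) fun c hc ξ hξ => by
      have hd := ((hh.contDiffAt (hV.mem_nhds hc)).differentiableAt (by simp)).hasFDerivAt
      refine funext fun e => ?_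
      have h1 := (hasFDerivAt_pi'.1 hd e).fderiv
      have h2 := fderiv_eq_zero_of_invariant (hr (hVU hc)) (hhc c hc e)
        (fun T hT => hinv c hc T hT e) hξ
      rw [h1] at h2
      exact h2
  refine ⟨V', hV', hpV', hVV'.trans hVU, W, hW, hm,
    fun e y => if he : e ∈ chosenOf k then f y ⟨e, he⟩ else 0, fun e he => ?_, fun c hc => ?_⟩
  · simp only [he, dif_pos]
    exact contDiffOn_pi.1 hf _
  · have hn := (hr (hVU (hVV' hc))).1
    refine fil_succ.2 ⟨Submodule.sub_mem _ (hk c (hVU (hVV' hc)))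
      (sum_mul_monomial_mem_fil hn fun e => ofCrossRatios _ c), ?_⟩
    rw [map_sub, prj_sum_mul_monomial hn fun e => ofCrossRatios _ c, hsum c (hVV' hc), sub_eq_zero]
    refine Finset.sum_congr rfl fun e _ => ?_
    rw [heq hc]
    simp only [e.2, dif_pos]
    rw [body_ofCrossRatios hn hW (hm hc) (contDiffOn_pi.1 hf e)]
    rfl

/-- The number `j` bounds the degrees that are left, since nothing survives beyond degree 16.
Subtracting the combination of order `k` leaves an invariant of order `k + 1` on a smaller
neighbourhood, to which the induction hypothesis applies. -/
lemma isCombinationNear_of_mem_fil (j : ℕ) : ∀ k, 17 ≤ k + j → ∀ {U : Set Config}, IsOpen U →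
    p ∈ U → U ⊆ regular → ∀ {G : SuperFun}, (∀ c ∈ U, ∀ V, HasAct V c G 0) →
    (∀ c ∈ U, G c ∈ Fil k) → IsCombinationNear G (chosen.filter fun e => k ≤ degree e * 2) p := by
  induction j with
  | zero =>
    intro k hj U hU hp hr G hG hk
    refine ⟨U, hU, hp, Set.univ, isOpen_univ, Set.mapsTo_univ _ _, fun _ _ => 0, fun _ _ => contDiffOn_const,
      fun c hc => ?_⟩
    rw [eq_zero_of_mem_fil (by omega) (hk c hc), Finset.sum_apply]
    refine (Finset.sum_eq_zero fun e _ => ?_).symm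
    exact (congrArg (· * monomial e c)
      (ofCrossRatios_eq_zero (Filter.Eventually.of_forall fun _ => rfl))).trans (zero_mul _)
  | succ j ih =>
    intro k hj U hU hp hr G hG hk
    obtain ⟨V, hV, hpV, hVU, W, hW, hm, f, hf, hrest⟩ := exists_leading_combination hU hp hr hG hk
    obtain ⟨V', hV', hpV', W', hW', hm', f', hf', heq⟩ := ih (k + 1) (by omega) hV hpV
      (hVU.trans hr) (G := G - ∑ e ∈ chosenOf k, ofCrossRatios (f e) * monomial e)
      (fun c hc T => ((hG c (hVU hc) T).sub (hasAct_combination (hr (hVU hc)).1 hW (hm hc) hf T)).cast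
        (sub_zero _))
      (fun c hc => by
        rw [Pi.sub_apply, Finset.sum_apply]
        exact hrest c hc)
    -- The monomials of the current order take the new coefficients and those of higher order the
    -- coefficients of the remainder, so no coefficient is used twice.
    refine ⟨V ∩ V', hV.inter hV', ⟨hpV, hpV'⟩, W ∩ W', hW.inter hW',
      fun c hc => ⟨hm hc.1, hm' hc.2⟩, fun e => if degree e * 2 = k then f e else f' e,
      fun e he => ?_, fun c hc => ?_⟩
    · rw [Finset.mem_filter] at he
      by_cases h : degree e * 2 = k
      · simp only [h, if_true]
        exact (hf e (Finset.mem_filter.2 ⟨he.1, h⟩)).mono Set.inter_subset_left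
      · simp only [h, if_false]
        exact (hf' e (Finset.mem_filter.2 ⟨he.1, by omega⟩)).mono Set.inter_subset_right
    · have h1 := heq hc.2
      rw [Pi.sub_apply, sub_eq_iff_eq_add] at h1
      rw [h1, ← Pi.add_apply, chosenOf, Finset.sum_filter, Finset.sum_filter, Finset.sum_filter,
        ← Finset.sum_add_distrib]
      refine congrFun (Finset.sum_congr rfl fun e _ => ?_) c
      beta_reduce
      by_cases h : degree e * 2 = k
      · rw [if_neg (by omega), if_pos h, if_pos (by omega), if_pos h, zero_add]
      · rw [if_neg h, if_neg h, add_zero]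
        by_cases h' : k + 1 ≤ degree e * 2
        · rw [if_pos h', if_pos (by omega)]
        · rw [if_neg h', if_neg (by omega)]

lemma isInvariantOn_iff_combination {F : SuperFun} {U : Set Config} (hU : IsOpen U)
    (hr : U ⊆ regular) : IsInvariantOn F U ↔ ∀ p ∈ U, IsCombinationNear F chosen p := by
  rw [isInvariantOn_iff hU]
  constructor
  · intro h p hp
    have := isCombinationNear_of_mem_fil 17 0 le_rfl hU hp hr h fun c _ => fil_zero _
    rwa [Finset.filter_true_of_mem fun e _ => Nat.zero_le _] at this
  · intro h p hp T
    obtain ⟨V, hV, hpV, W, hW, hm, f, hf, heq⟩ := h p hp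
    exact (hasAct_combination (hr hp).1 hW (hm hpV) hf T).congr
      (Filter.eventuallyEq_of_mem (hV.mem_nhds hpV) heq).symm

/-! ## Independence and minimality -/

/-- Induction on the degree: once the coefficients of lower degree are gone, the component of order
`k` involves only the bodies of the coefficients of that order, in front of independent leading
terms. -/
lemma eqOn_zero_of_combination_eq_zero {V : Set Config} {W : Set (ℝ × ℝ)}
    {f : Exponent → ℝ × ℝ → ℂ} (hV : IsOpen V) (hr : V ⊆ regular) (hW : IsOpen W)
    (hm : Set.MapsTo crossBody V W) (hf : ∀ e ∈ chosen, ContDiffOn ℝ ∞ (f e) W)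
    (h : Set.EqOn (∑ e ∈ chosen, ofCrossRatios (f e) * monomial e) 0 V) :
    ∀ e ∈ chosen, Set.EqOn (f e) 0 (crossBody '' V) := by
  have key : ∀ k, ∀ e ∈ chosen, degree e * 2 = k → Set.EqOn (f e) 0 (crossBody '' V) := by
    intro k
    induction k using Nat.strong_induction_on with
    | _ k ih =>
      rintro e he hek _ ⟨c, hc, rfl⟩
      have hn := (hr hc).1
      have h1 : ∑ e ∈ chosen, ofCrossRatios (f e) c * monomial e c = 0 :=
        (Finset.sum_apply c _ _).symm.trans (h hc)
      have h2 : prj k (∑ e ∈ chosen, ofCrossRatios (f e) c * monomial e c) =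
          prj k (∑ e ∈ chosenOf k, ofCrossRatios (f e) c * monomial e c) := by
        rw [map_sum, map_sum, chosenOf, Finset.sum_filter]
        refine Finset.sum_congr rfl fun e he => ?_
        split_ifs with hd
        · rfl
        · rcases lt_or_gt_of_ne hd with hd | hd
          -- Vanishing at one point would not suffice, because the Taylor expansion involves all
          -- derivatives. The coefficient vanishes on the image of `V`, which is open by
          -- `isOpen_image_crossBody`.
          · rw [ofCrossRatios_eq_zero (Filter.eventuallyEq_of_mem
              ((isOpen_image_crossBody hV hr).mem_nhds ⟨c, hc, rfl⟩) (ih _ hd e he rfl)),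
              zero_mul, map_zero]
          · exact mem_fil.1 (mul_mem_fil_left _ (monomial_mem_fil hn e)) k hd
      rw [h1, map_zero, prj_sum_mul_monomial hn fun e => ofCrossRatios (f e) c] at h2
      have h3 := Fintype.linearIndependent_iff.1 (linearIndependent_chosenOf (hr hc) k) _ h2.symm
        ⟨e, Finset.mem_filter.2 ⟨he, hek⟩⟩
      rwa [body_ofCrossRatios hn hW (hm hc) (hf e he)] at h3
  exact fun e he => key _ e he rfl

/-- The chosen monomials are expanded in those of `T`, and these again in the chosen ones. By
independence the composition is the identity at `p`, so an identity matrix factors through a space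
of dimension `T.card`. -/
lemma card_le_of_combinations (hp : p ∈ regular) {T : Finset Exponent}
    (h : ∀ e ∈ chosen, IsCombinationNear (monomial e) T p) : chosen.card ≤ T.card := by
  have hmon : ∀ e, IsInvariantOn (monomial e) regular := fun e =>
    (isInvariantOn_iff isOpen_regular).2 fun c hc V => hasAct_monomial hc.1 V e
  have hT : ∀ t : T, IsCombinationNear (monomial t) chosen p := fun t =>
    (isInvariantOn_iff_combination isOpen_regular subset_rfl).1 (hmon t) p hp
  choose V hV hpV W hW hm g hg heq using fun e : chosen => h e e.2
  choose V' hV' hpV' W' hW' hm' f hf heq' using hT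
  set O := (⋂ e, V e) ∩ (⋂ t, V' t) ∩ regular with hO
  set Y := (⋂ e, W e) ∩ ⋂ t, W' t with hY
  have hOo : IsOpen O := ((isOpen_iInter_of_finite hV).inter (isOpen_iInter_of_finite hV')).inter
    isOpen_regular
  have hYo : IsOpen Y := (isOpen_iInter_of_finite hW).inter (isOpen_iInter_of_finite hW')
  have hOY : Set.MapsTo crossBody O Y := fun c hc =>
    ⟨Set.mem_iInter.2 fun e => hm e (Set.mem_iInter.1 hc.1.1 e),
      Set.mem_iInter.2 fun t => hm' t (Set.mem_iInter.1 hc.1.2 t)⟩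
  have hpO : p ∈ O := ⟨⟨Set.mem_iInter.2 hpV, Set.mem_iInter.2 hpV'⟩, hp⟩
  have hgY : ∀ e (t : T), ContDiffOn ℝ ∞ (g e t) Y := fun e t =>
    (hg e t t.2).mono fun y hy => Set.mem_iInter.1 hy.1 e
  have hfY : ∀ (t : T), ∀ e ∈ chosen, ContDiffOn ℝ ∞ (f t e) Y := fun t e he =>
    (hf t e he).mono fun y hy => Set.mem_iInter.1 hy.2 t
  have hmul : ∀ e, ∀ e' ∈ chosen, ∀ t : T, ContDiffOn ℝ ∞ (g e t * f t e') Y := fun e e' he' t =>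
    (hgY e t).mul (hfY t e' he')
  have hsum : ∀ e, ∀ e' ∈ chosen, ContDiffOn ℝ ∞ (∑ t : T, g e t * f t e') Y := fun e e' he' => by
    have := ContDiffOn.sum (s := Finset.univ) fun t _ => hmul e e' he' t
    exact this.congr fun y _ => Finset.sum_apply _ _ _
  let δ : Exponent → Exponent → ℝ × ℝ → ℂ := fun e e' _ => if e = e' then 1 else 0
  have hδ : ∀ e e', ContDiffOn ℝ ∞ (δ e e') Y := fun e e' => contDiffOn_const
  -- Composing the expansions writes each chosen monomial as a combination of chosen monomials. Its
  -- difference from the trivial expression of the monomial, with coefficients `δ`, is a vanishing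
  -- combination with smooth coefficients, so independence applies.
  have key : ∀ e e' : chosen, ∑ t : T, g e t (crossBody p) * f t e' (crossBody p) =
      if (e : Exponent) = e' then 1 else 0 := by
    intro e e'
    have h0 := eqOn_zero_of_combination_eq_zero hOo (fun c hc => hc.2) hYo hOY
      (f := fun e' => (∑ t : T, g e t * f t e') + (-1 : ℂ) • δ e e')
      (fun e' he' => (hsum e e' he').add (smooth_smul (hδ e e') _)) (fun c hc => ?_) e' e'.2
      ⟨p, hpO, rfl⟩
    · have h1 : (∑ t : T, g e t * f t e') (crossBody p) + (-1 : ℂ) * δ e e' (crossBody p) = 0 := h0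
      rw [Finset.sum_apply, neg_one_mul, add_neg_eq_zero] at h1
      exact h1
    · have hn := hc.2.1
      have h1 : monomial e c = ∑ t : T, ofCrossRatios (g e t) c * monomial t c := by
        have := heq e (Set.mem_iInter.1 hc.1.1 e)
        rw [Finset.sum_apply] at this
        rw [this]
        exact (Finset.sum_coe_sort T fun t => ofCrossRatios (g e t) c * monomial t c).symm
      have h2 : ∀ t : T, monomial t c = ∑ e' ∈ chosen, ofCrossRatios (f t e') c * monomial e' c :=
        fun t => (heq' t (Set.mem_iInter.1 hc.1.2 t)).trans (Finset.sum_apply _ _ _)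
      have h3 : ∑ e' ∈ chosen, ofCrossRatios (δ e e') c * monomial e' c = monomial e c := by
        rw [Finset.sum_eq_single_of_mem (e : Exponent) e.2]
        · rw [show δ e e = fun _ => (1 : ℂ) from funext fun _ => if_pos rfl, ofCrossRatios_const,
            map_one, one_mul]
        · intro b _ hb
          rw [show δ e b = fun _ => (0 : ℂ) from funext fun _ => if_neg (Ne.symm hb),
            ofCrossRatios_const, map_zero, zero_mul]
      have h4 : ∑ e' ∈ chosen, ofCrossRatios (∑ t : T, g e t * f t e') c * monomial e' c =
          monomial e c := by
        rw [h1]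
        simp only [h2, Finset.mul_sum]
        rw [Finset.sum_comm]
        refine Finset.sum_congr rfl fun e' he' => ?_
        rw [ofCrossRatios_sum hYo _ (fun t _ => hmul e e' he' t) (hOY hc), Finset.sum_mul]
        refine Finset.sum_congr rfl fun t _ => ?_
        rw [ofCrossRatios_mul hn hYo (hgY e t) (hfY t e' he') (hOY hc), mul_assoc]
      rw [Finset.sum_apply, Pi.zero_apply, ← sub_eq_zero.2 (h4.trans h3.symm),
        ← Finset.sum_sub_distrib]
      refine Finset.sum_congr rfl fun e' he' => ?_
      rw [Pi.mul_apply, ofCrossRatios_add hYo (hsum e e' he') (smooth_smul (hδ e e') _) (hOY hc),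
        ofCrossRatios_smul hYo (hδ e e') _ (hOY hc), neg_one_smul, ← sub_eq_add_neg, sub_mul]
  let A : Matrix chosen T ℂ := Matrix.of fun e t => g e t (crossBody p)
  let B : Matrix T chosen ℂ := Matrix.of fun t e => f t e (crossBody p)
  have hAB : A * B = 1 := by
    ext e e'
    rw [Matrix.mul_apply, Matrix.one_apply]
    exact (key e e').trans (by simp only [Subtype.ext_iff])
  have h1 := (Matrix.rank_mul_le_left A B).trans (Matrix.rank_le_card_width A)
  rwa [hAB, Matrix.rank_one, Fintype.card_coe, Fintype.card_coe] at h1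

lemma chosen_card_le (hp : p ∈ regular) {T : Finset Exponent}
    (h : ∀ (F : SuperFun) (U : Set Config), IsOpen U → p ∈ U → U ⊆ regular →
      IsInvariantOn F U → IsCombinationNear F T p) : 36 ≤ T.card := by
  rw [← chosen_card.1]
  exact card_le_of_combinations hp fun e _ => h _ regular isOpen_regular hp subset_rfl
    ((isInvariantOn_iff isOpen_regular).2 fun c hc V => hasAct_monomial hc.1 V e)

end combinations

end FourPoint

end

theorem mainTheorem2 :
    -- the variables involved are superconformal invariants, and the `I_{nij}` are nilpotent
    (∀ k : Fin 6, IsInvariantOn (crossI k) nondegenerate) ∧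
    IsInvariantOn J₁ nondegenerate ∧
    (∀ k : Fin 2, IsInvariantOn (J k) nondegenerate) ∧
    (∀ m n : Fin 2, IsInvariantOn (hatDot m n) nondegenerate) ∧
    (∀ n i j : Fin 2, IsInvariantOn (nilp n i j) nondegenerate ∧
      ∀ c ∈ nondegenerate, IsNilpotent (nilp n i j c)) ∧
    -- up to inversion there are six cross ratios, and four of them are expressed by the other two
    (∀ r s t u : Fin 4, [r, s, t, u].Nodup → ∃ k : Fin 6,
      Set.EqOn (crossRatio r s t u) (crossI k) nondegenerate ∨
      Set.EqOn (crossRatio r s t u) (sinv (crossI k)) nondegenerate) ∧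
    Set.EqOn (crossI 2) (sinv J₁ * J 0 * crossI 1) nondegenerate ∧
    Set.EqOn (crossI 3) (J₁ * crossI 0 * sinv (crossI 1)) nondegenerate ∧
    Set.EqOn (crossI 4) (J₁ * J 1 * crossI 0) nondegenerate ∧
    Set.EqOn (crossI 5) (J₁ * sinv (J 0) * J 1 * crossI 0 * sinv (crossI 1)) nondegenerate ∧
    -- relations between the nilpotent invariants
    Set.EqOn (hatDot 0 0) (unipotentSqrt (J 0)) nondegenerate ∧
    Set.EqOn (hatDot 0 0)
      (1 - (2 * Complex.I) • nilp 0 0 0 + (6 : ℂ) • nilp 0 0 0 ^ 2) nondegenerate ∧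
    (∀ j k : Fin 2, Set.EqOn (nilp 0 j k * nilp 1 j k)
      (hatDot 0 1 * sinv (hatDot 0 0) * (nilp 0 j k * nilp 0 j k)) nondegenerate) ∧
    (∀ j k m n : Fin 2, j = m ∨ k = n → Set.EqOn (nilp 1 j k * nilp 1 m n)
      (hatDot 1 1 * sinv (hatDot 0 0) * (nilp 0 j k * nilp 0 m n)) nondegenerate) ∧
    Set.EqOn (nilp 1 0 0 * nilp 0 0 1)
      ((2 : ℂ) • (hatDot 0 1 * sinv (hatDot 0 0) * (nilp 0 0 0 * nilp 0 0 1))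
        - nilp 0 0 0 * nilp 1 0 1) nondegenerate ∧
    Set.EqOn (nilp 1 0 0 * nilp 0 1 0)
      ((2 : ℂ) • (hatDot 0 1 * sinv (hatDot 0 0) * (nilp 0 0 0 * nilp 0 1 0))
        - nilp 0 0 0 * nilp 1 1 0) nondegenerate ∧
    Set.EqOn (nilp 0 0 1 * nilp 1 1 1)
      ((2 : ℂ) • (hatDot 0 1 * sinv (hatDot 0 0) * (nilp 0 0 1 * nilp 0 1 1))
        - nilp 1 0 1 * nilp 0 1 1) nondegenerate ∧
    Set.EqOn (nilp 0 1 0 * nilp 1 1 1)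
      ((2 : ℂ) • (hatDot 0 1 * sinv (hatDot 0 0) * (nilp 0 1 0 * nilp 0 1 1))
        - nilp 1 1 0 * nilp 0 1 1) nondegenerate ∧
    Set.EqOn (nilp 0 1 0 * nilp 1 0 1)
      (-(nilp 0 0 1 * nilp 1 1 0) - nilp 0 0 0 * nilp 1 1 1 - nilp 0 1 1 * nilp 1 0 0
        + (2 : ℂ) • (hatDot 0 1 * sinv (hatDot 0 0) *
          (nilp 0 0 0 * nilp 0 1 1 + nilp 0 0 1 * nilp 0 1 0))) nondegenerate ∧
    Set.EqOn (nilp 1 0 0 * nilp 1 1 1)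
      (-(nilp 1 0 1 * nilp 1 1 0)
        + hatDot 1 1 * sinv (hatDot 0 0) *
          (nilp 0 0 0 * nilp 0 1 1 + nilp 0 0 1 * nilp 0 1 0)) nondegenerate ∧
    -- the invariants of lowest order `(θ θbar)²` are expressed by the `I_{nij}`
    (∀ i j : Fin 2, Set.EqOn (nilp 0 i j ^ 2)
      ((1 / 4 : ℂ) • (hatDot 0 0 * parkInv i j i j)) nondegenerate) ∧
    (∀ i : Fin 2, Set.EqOn (nilp 0 i i * nilp 0 0 1)
      ((1 / 4 : ℂ) • (hatDot 0 0 * parkInv i i 0 1)) nondegenerate) ∧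
    (∀ i : Fin 2, Set.EqOn (nilp 0 i i * nilp 0 1 0)
      ((1 / 4 : ℂ) • (hatDot 0 0 * parkInv i i 1 0)) nondegenerate) ∧
    Set.EqOn (nilp 0 0 0 * nilp 0 1 1 + nilp 0 0 1 * nilp 0 1 0)
      ((1 / 2 : ℂ) • (hatDot 0 0 * parkInv 0 0 1 1)) nondegenerate ∧
    Set.EqOn (nilp 0 0 0 * nilp 0 1 1 + nilp 0 0 1 * nilp 0 1 0)
      ((1 / 2 : ℂ) • (hatDot 0 0 * parkInv 0 1 1 0)) nondegenerate ∧
    -- the number of chosen monomials, in total and by degree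
    chosen.card = 36 ∧ (chosen.filter fun e => 1 < degree e).card = 27 ∧
    (∀ d : Fin 5, (chosen.filter fun e => degree e = d).card = ![1, 8, 18, 8, 1] d) ∧
    -- the invariants are exactly the local combinations of the chosen monomials
    (∀ (F : SuperFun) (U : Set Config), IsOpen U → U ⊆ regular →
      (IsInvariantOn F U ↔ ∀ p ∈ U, IsCombinationNear F chosen p)) ∧
    -- the two cross ratios are independent
    (∀ V : Set Config, IsOpen V → V ⊆ regular → IsOpen (crossBody '' V)) ∧
    -- the chosen monomials are linearly independent over the functions of the cross ratios
    (∀ (V : Set Config) (W : Set (ℝ × ℝ)) (f : Exponent → ℝ × ℝ → ℂ),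
      IsOpen V → V ⊆ regular → IsOpen W → Set.MapsTo crossBody V W →
      (∀ e ∈ chosen, ContDiffOn ℝ ∞ (f e) W) →
      Set.EqOn (∑ e ∈ chosen, ofCrossRatios (f e) * monomial e) 0 V →
      ∀ e ∈ chosen, Set.EqOn (f e) 0 (crossBody '' V)) ∧
    -- no smaller set of monomials suffices
    (∀ p ∈ regular, ∀ T : Finset Exponent,
      (∀ (F : SuperFun) (U : Set Config), IsOpen U → p ∈ U → U ⊆ regular →
        IsInvariantOn F U → IsCombinationNear F T p) → 36 ≤ T.card) := by
  have wt : ∀ F : SuperFun, (∀ c ∈ nondegenerate, ∀ V, HasWt V c F 0) →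
      IsInvariantOn F nondegenerate := fun F h =>
    (isInvariantOn_iff isOpen_nondegenerate).2 fun c hc V => (h c hc V).act_zero
  refine ⟨fun k => wt _ fun c hc V => crossI_wt hc V k, wt _ fun c hc V => J₁_wt hc V,
    fun k => wt _ fun c hc V => J_wt hc V k, fun m n => wt _ fun c hc V => hatDot_wt hc V m n,
    fun n i j => ⟨wt _ fun c hc V => nilp_wt hc V n i j,
      fun c _ => isNilpotent_of_body (body_nilp n i j c)⟩,
    exists_crossI,
    fun c hc => (crossI_relations hc).1, fun c hc => (crossI_relations hc).2.1,
    fun c hc => (crossI_relations hc).2.2.1, fun c hc => (crossI_relations hc).2.2.2,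
    fun c hc => hatDot_zero hc, fun c hc => hatDot_zero_eq hc,
    fun j k c hc => nilp_same hc j k, fun j k m n h c hc => nilp_adjacent hc j k m n h,
    fun c hc => nilp_mixed_left hc 0 0 1, fun c hc => nilp_mixed_right hc 0 0 1,
    fun c hc => nilp_mixed_right' hc 0 1 1, fun c hc => nilp_mixed_left' hc 1 0 1,
    fun c hc => nilp_cross₁ hc, fun c hc => nilp_cross₂ hc,
    fun i j c hc => ?_, fun i c hc => ?_, fun i c hc => ?_,
    fun c hc => (nilp_parkInv_cross hc).1, fun c hc => (nilp_parkInv_cross hc).2,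
    chosen_card.1, chosen_card.2.1, chosen_card.2.2,
    fun F U hU hr => isInvariantOn_iff_combination hU hr, fun V hV hr => isOpen_image_crossBody hV hr,
    fun V W f hV hr hW hm hf h => eqOn_zero_of_combination_eq_zero hV hr hW hm hf h,
    fun p hp T h => chosen_card_le hp h⟩
  · rw [pow_two]; exact nilp_parkInv_left hc i j j
  · fin_cases i
    · exact nilp_parkInv_left hc 0 0 1
    · exact nilp_parkInv_right hc 1 1 0
  · fin_cases i
    · exact nilp_parkInv_right hc 0 0 1
    · exact nilp_parkInv_left hc 1 1 0
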